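/- **Conventions.** Let $G$ be a compact Lie group with Lie algebra $\mathfrak g$, equipped with an $\mathrm{Ad}$-invariant (positive definite) inner product, denoted by a dot and used to identify $\mathfrak g^*\cong\mathfrak g$; let $(e_a)$ be an orthonormal basis, $f_{abc}=e_a\cdot[e_b,e_c]$, and let $\phi=\frac1{12}f_{abc}\,e_a\wedge e_b\wedge e_c\in\wedge^3\mathfrak g$ (summation convention). For a $G$-manifold $M$ and $\xi\in\mathfrak g$ put $\xi_M(m)=\frac{d}{dt}|_{t=0}\exp(-t\xi).m$, and extend $\xi\mapsto\xi_M$ to $\wedge^\bullet\mathfrak g$; for $\alpha:M\to\wedge^\bullet\mathfrak g$ put $\alpha_M(m)=(\alpha(m))_M(m)$. Let $\xi^L,\xi^R$ be the left- and right-invariant vector fields on $G$, and let $\mathcal D$ be the $\mathfrak g$-valued operator $(\mathcal Df)_a=\frac12(e_a^L+e_a^R)f$. A *Hamiltonian quasi-Poisson $G$-manifold* is a triple $(M,P,\Phi)$ of a $G$-manifold $M$, a $G$-invariant bivector field $P$ with Schouten bracket $[P,P]=\phi_M$, and a smooth map $\Phi:M\to G$, equivariant for the conjugation action on $G$, such that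 $P^\sharp(d(\Phi^*f))=(\Phi^*(\mathcal Df))_M$ for all $f\in C^\infty(G,\mathbb R)$, where $P^\sharp(a)(b)=P(a,b)$. For a closed subgroup $H\subset G$, Hamiltonian quasi-Poisson $H$-manifolds are defined with the restriction of the inner product to $\mathfrak h=\mathrm{Lie}(H)$. Let $g\in G$, let $H=G_g$ be its stabilizer under conjugation, and let $U$ be a slice at $g$: an open, conjugation-invariant neighbourhood of $g$ in $H$ such that the natural map $G\times_HU\to G$, $[k,u]\mapsto kuk^{-1}$, is a diffeomorphism onto its image. For $u\in U$ the operator $\mathrm{Ad}_u-1$ is invertible on $\mathfrak h^\perp$; put $$r(u)=\tfrac12 r_{ab}(u)\,e_a\wedge e_b\in\wedge^2\mathfrak h^\perp,\qquad r_{ab}(u)=-\frac12\Big(\frac{\mathrm{Ad}_u+1}{\mathrm{Ad}_u-1}\Big|_{\mathfrak h^\perp}\Big)_{ab},$$ where $A_{ab}=e_a\cdot Ae_b$ and the operator is extended by zero to $\mathfrak h$. **Theorem.** 1. Let $(M,P,\Phi)$ be a Hamiltonian quasi-Poisson $G$-manifold. Then the cross-section $Y=\Phi^{-1}(U)$ is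 an embedded, $H$-invariant submanifold of $M$; along $Y$ there is a decomposition $P|_Y=P_Y+P_Y^\perp$ with $P_Y$ a bivector field on $Y$ and $P_Y^\perp$ the bivector generated by a smooth map $Y\to\wedge^2\mathfrak h^\perp$, namely by $-\Phi_Y^*r$, where $\Phi_Y=\Phi|_Y$; and $(Y,P_Y,\Phi_Y)$ with $P_Y=P|_Y-P_Y^\perp$ is a Hamiltonian quasi-Poisson $H$-manifold. 2. Conversely, let $(Y,P_Y,\Phi_Y)$ be a Hamiltonian quasi-Poisson $H$-manifold with $\Phi_Y(Y)\subset U$. Then on the associated bundle $G\times_HY$ (with its quotient manifold structure, and $Y$ embedded by $y\mapsto[1,y]$) there are a unique equivariant map $\Phi:G\times_HY\to G$ that restricts to $\Phi_Y$ on $Y$ and a unique $G$-invariant bivector field $P$ whose restriction to $Y$ is $P_Y-(\Phi_Y^*r)_{G\times_HY}$, and $(G\times_HY,P,\Phi)$ is a Hamiltonian quasi-Poisson $G$-manifold. -/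

import Mathlib

open scoped Manifold ContDiff

noncomputable section

namespace QuasiPoisson

section Bivector

variable {F : Type*} [NormedAddCommGroup F] [NormedSpace ℝ F]
  {M : Type*} [TopologicalSpace M] [ChartedSpace F M]

/-- The cotangent space of `M` at `m`. -/
abbrev Cotangent (F : Type*) [NormedAddCommGroup F] [NormedSpace ℝ F]
    {M : Type*} [TopologicalSpace M] [ChartedSpace F M] (m : M) : Type _ :=
  TangentSpace 𝓘(ℝ, F) m →L[ℝ] ℝ

/-- The differential `df` at `m`, as a covector. -/
def dAt (f : M → ℝ) (m : M) : Cotangent F m := mfderiv 𝓘(ℝ, F) 𝓘(ℝ, ℝ) f m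

/-- Smooth real functions on `M`. -/
def SmoothFun (F : Type*) [NormedAddCommGroup F] [NormedSpace ℝ F]
    {M : Type*} [TopologicalSpace M] [ChartedSpace F M] (f : M → ℝ) : Prop :=
  ContMDiff 𝓘(ℝ, F) 𝓘(ℝ, ℝ) ∞ f

variable (F M) in
/-- A smooth bivector field on a (finite-dimensional, Hausdorff) manifold. An element of
`Λ² T_m M` is the alternating bilinear form that it defines on `T_m^* M`, with the convention
`(X ∧ Y)(α, β) = α(X) β(Y) - α(Y) β(X)`. -/
@[ext]
structure BivectorField where
  val : ∀ m : M, Cotangent F m →ₗ[ℝ] Cotangent F m →ₗ[ℝ] ℝ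
  alt : ∀ (m : M) (α : Cotangent F m), val m α α = 0
  smooth : ∀ f h : M → ℝ, SmoothFun F f → SmoothFun F h →
    SmoothFun F (fun m => val m (dAt f m) (dAt h m))

/-- The bracket `{f, h} = P(df, dh)`. -/
def BivectorField.bracket (P : BivectorField F M) (f h : M → ℝ) : M → ℝ :=
  fun m => P.val m (dAt f m) (dAt h m)

/-- The value `[P, P](df₁, df₂, df₃)` of the Schouten bracket. The sign and the factor are those
of the graded Lie bracket of multivector fields that extends the Lie derivative `[X, ·]` and
satisfies `[α, β ∧ γ] = [α, β] ∧ γ + (-1)^{(|α|-1)|β|} β ∧ [α, γ]` and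
`[α, β] = -(-1)^{(|α|-1)(|β|-1)} [β, α]`: thus `[X ∧ Y, X ∧ Y] = 2 [X, Y] ∧ X ∧ Y`, where trivectors
are evaluated on covectors by determinants. -/
def BivectorField.schoutenSelf (P : BivectorField F M) (f₁ f₂ f₃ : M → ℝ) (m : M) : ℝ :=
  2 * (P.bracket f₁ (P.bracket f₂ f₃) m + P.bracket f₂ (P.bracket f₃ f₁) m
    + P.bracket f₃ (P.bracket f₁ f₂) m)

/-- The bivector field `P` is invariant under the action of `G`. -/
def BivectorField.IsInvariant (P : BivectorField F M) (G : Type*) [Group G] [MulAction G M] :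
    Prop :=
  ∀ (k : G) (m : M) (α β : Cotangent F (k • m)),
    P.val (k • m) α β =
      P.val m (α.comp (mfderiv 𝓘(ℝ, F) 𝓘(ℝ, F) (fun x : M => k • x) m))
        (β.comp (mfderiv 𝓘(ℝ, F) 𝓘(ℝ, F) (fun x : M => k • x) m))

end Bivector

section Group

variable {E : Type*} [NormedAddCommGroup E] [NormedSpace ℝ E]
  {G : Type*} [TopologicalSpace G] [ChartedSpace E G] [Group G]

/-- The adjoint action `Ad_k` on the Lie algebra. -/
def Ad (E : Type*) [NormedAddCommGroup E] [NormedSpace ℝ E]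
    {G : Type*} [TopologicalSpace G] [ChartedSpace E G] [Group G] (k : G) :
    GroupLieAlgebra 𝓘(ℝ, E) G →L[ℝ] GroupLieAlgebra 𝓘(ℝ, E) G :=
  mfderiv 𝓘(ℝ, E) 𝓘(ℝ, E) (fun x : G => k * x * k⁻¹) 1

/-- `ξ ↦ ξ^L(k)`, the value at `k` of the left-invariant vector field of `ξ`. -/
def leftInv (k : G) : GroupLieAlgebra 𝓘(ℝ, E) G →L[ℝ] TangentSpace 𝓘(ℝ, E) k :=
  mfderiv 𝓘(ℝ, E) 𝓘(ℝ, E) (fun x : G => k * x) 1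

/-- `ξ ↦ ξ^R(k)`, the value at `k` of the right-invariant vector field of `ξ`. -/
def rightInv (k : G) : GroupLieAlgebra 𝓘(ℝ, E) G →L[ℝ] TangentSpace 𝓘(ℝ, E) k :=
  mfderiv 𝓘(ℝ, E) 𝓘(ℝ, E) (fun x : G => x * k) 1

/-- `ξ ↦ ξ_M(m) = d/dt|_{t=0} exp(-tξ).m`, the infinitesimal action. -/
def infAct (E : Type*) [NormedAddCommGroup E] [NormedSpace ℝ E]
    (G : Type*) [TopologicalSpace G] [ChartedSpace E G] [Group G]
    {F : Type*} [NormedAddCommGroup F] [NormedSpace ℝ F]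
    {M : Type*} [TopologicalSpace M] [ChartedSpace F M] [MulAction G M] (m : M) :
    GroupLieAlgebra 𝓘(ℝ, E) G →L[ℝ] TangentSpace 𝓘(ℝ, F) m :=
  -(mfderiv 𝓘(ℝ, E) 𝓘(ℝ, F) (fun k : G => k • m) 1)

variable (E G) in
/-- An invariant (positive definite) inner product on the Lie algebra of `G`. -/
structure InvariantInnerProduct where
  form : LinearMap.BilinForm ℝ (GroupLieAlgebra 𝓘(ℝ, E) G)
  symm : ∀ ξ η, form ξ η = form η ξ
  posDef : ∀ ξ, ξ ≠ 0 → 0 < form ξ ξ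
  invariant : ∀ (k : G) (ξ η), form (Ad E k ξ) (Ad E k η) = form ξ η

namespace InvariantInnerProduct

variable (B : InvariantInnerProduct E G)

theorem nondegenerate : B.form.Nondegenerate := by
  have key : ∀ ξ, (∀ η, B.form ξ η = 0) → ξ = 0 := fun ξ h => by
    by_contra hξ
    exact (B.posDef ξ hξ).ne' (h ξ)
  exact ⟨fun ξ h => key ξ h, fun ξ h => key ξ fun η => by rw [B.symm]; exact h η⟩

variable [FiniteDimensional ℝ E]

/-- The identification `𝔤^* ≅ 𝔤` given by the inner product. -/
def sharp : Module.Dual ℝ (GroupLieAlgebra 𝓘(ℝ, E) G) →ₗ[ℝ] GroupLieAlgebra 𝓘(ℝ, E) G :=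
  haveI : FiniteDimensional ℝ (GroupLieAlgebra 𝓘(ℝ, E) G) := ‹FiniteDimensional ℝ E›
  (B.form.toDual B.nondegenerate).symm.toLinearMap

/-- The `𝔤`-valued differential operator `𝒟`; its components in an orthonormal basis `(e_a)` are
`(𝒟f)_a = (1/2) (e_a^L + e_a^R) f`. -/
def diffOp (f : G → ℝ) (k : G) : GroupLieAlgebra 𝓘(ℝ, E) G :=
  B.sharp ((1 / 2 : ℝ) • ((dAt f k).comp (leftInv (E := E) k)
    + (dAt f k).comp (rightInv (E := E) k)).toLinearMap)

/-- The Cartan 3-tensor `φ = (1/12) f_{abc} e_a ∧ e_b ∧ e_c`, `f_{abc} = e_a · [e_b, e_c]`, as a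
function on `𝔤 ≅ 𝔤^*`. -/
def cartan (ξ η ζ : GroupLieAlgebra 𝓘(ℝ, E) G) : ℝ := (1 / 2 : ℝ) * B.form ξ ⁅η, ζ⁆

variable {F : Type*} [NormedAddCommGroup F] [NormedSpace ℝ F]
  {M : Type*} [TopologicalSpace M] [ChartedSpace F M] [MulAction G M]

/-- The element of `𝔤` with components `α((e_a)_M(m))` in an orthonormal basis `(e_a)`, that is,
the image of the covector `α` under the transpose `T_m^* M → 𝔤^* ≅ 𝔤` of the infinitesimal
action. -/
def pull (m : M) (α : Cotangent F m) : GroupLieAlgebra 𝓘(ℝ, E) G :=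
  B.sharp (α.comp (infAct E G m)).toLinearMap

/-- The value on the covectors `α, β` of the bivector at `m` generated by `s ∈ Λ²𝔤`. Elements of
`Λ²𝔤` are regarded as bilinear forms on `𝔤 ≅ 𝔤^*`: to `(1/2) s_{ab} e_a ∧ e_b` corresponds
the form with matrix `s_{ab}`. -/
def generated (s : LinearMap.BilinForm ℝ (GroupLieAlgebra 𝓘(ℝ, E) G)) (m : M)
    (α β : Cotangent F m) : ℝ :=
  s (B.pull m α) (B.pull m β)

/-- `M` is a smooth `G`-manifold (Hausdorff, second countable), and `(M, P, Φ)` is a Hamiltonian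
quasi-Poisson `G`-manifold. -/
structure IsHamiltonian (P : BivectorField F M) (Φ : M → G) : Prop where
  isManifold : IsManifold 𝓘(ℝ, F) ∞ M
  t2 : T2Space M
  secondCountable : SecondCountableTopology M
  smooth_action : ContMDiffSMul 𝓘(ℝ, E) 𝓘(ℝ, F) ∞ G M
  invariant : P.IsInvariant G
  /-- `[P, P] = φ_M`. -/
  schouten : ∀ f₁ f₂ f₃ : M → ℝ, SmoothFun F f₁ → SmoothFun F f₂ → SmoothFun F f₃ → ∀ m : M,
    P.schoutenSelf f₁ f₂ f₃ m =
      B.cartan (B.pull (F := F) m (dAt f₁ m)) (B.pull (F := F) m (dAt f₂ m))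
        (B.pull (F := F) m (dAt f₃ m))
  smooth_moment : ContMDiff 𝓘(ℝ, F) 𝓘(ℝ, E) ∞ Φ
  equivariant : ∀ (k : G) (m : M), Φ (k • m) = k * Φ m * k⁻¹
  /-- `P^♯(d(Φ^* f)) = (Φ^*(𝒟f))_M`, where `P^♯(a)(b) = P(a, b)`. -/
  moment : ∀ f : G → ℝ, SmoothFun E f → ∀ (m : M) (β : Cotangent F m),
    P.val m (dAt (fun x => f (Φ x)) m) β = β (infAct E G m (B.diffOp f (Φ m)))

/-- Along the map `i : Y → M`, the bivector field `P` is the sum of the push-forward of the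
bivector field `Q` on `Y` and of the bivector generated by `s : Y → Λ²𝔤`. -/
def SplitsAlong {F' : Type*} [NormedAddCommGroup F'] [NormedSpace ℝ F']
    {Y : Type*} [TopologicalSpace Y] [ChartedSpace F' Y]
    (P : BivectorField F M) (i : Y → M) (Q : BivectorField F' Y)
    (s : Y → LinearMap.BilinForm ℝ (GroupLieAlgebra 𝓘(ℝ, E) G)) : Prop :=
  ∀ (y : Y) (α β : Cotangent F (i y)),
    P.val (i y) α β =
      Q.val y (α.comp (mfderiv 𝓘(ℝ, F') 𝓘(ℝ, F) i y)) (β.comp (mfderiv 𝓘(ℝ, F') 𝓘(ℝ, F) i y))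
        + B.generated (s y) (i y) α β

end InvariantInnerProduct

end Group

section Subgroup

variable {E : Type*} [NormedAddCommGroup E] [NormedSpace ℝ E]
  {G : Type*} [TopologicalSpace G] [ChartedSpace E G] [Group G]
  {E' : Type*} [NormedAddCommGroup E'] [NormedSpace ℝ E']
  {H : Subgroup G} [ChartedSpace E' H]

variable (E E' H) in
/-- The manifold structure on `H` (compatible with the subspace topology) makes it an embedded Lie
subgroup of `G`. -/
structure IsLieSubgroup : Prop where
  lieGroup : LieGroup 𝓘(ℝ, E') ∞ H
  embedding : Manifold.IsSmoothEmbedding 𝓘(ℝ, E') 𝓘(ℝ, E) ∞ (Subtype.val : H → G)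

variable (E E' H) in
/-- The inclusion `𝔥 → 𝔤` of Lie algebras. -/
def lieIncl : GroupLieAlgebra 𝓘(ℝ, E') H →L[ℝ] GroupLieAlgebra 𝓘(ℝ, E) G :=
  mfderiv 𝓘(ℝ, E') 𝓘(ℝ, E) (Subtype.val : H → G) 1

theorem lieIncl_injective (hH : IsLieSubgroup E E' H) :
    Function.Injective (lieIncl E E' H) := by
  have hi := hH.embedding.isImmersion.isImmersionAt (1 : H)
  have hm : IsManifold 𝓘(ℝ, E') ∞ H := hH.lieGroup.toIsManifold
  set f : H → G := Subtype.val
  set φ := hi.domChart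
  set ψ := hi.codChart
  have hfm : MDifferentiableAt 𝓘(ℝ, E') 𝓘(ℝ, E) f 1 :=
    hi.contMDiffAt.mdifferentiableAt (by simp)
  have hψ : MDifferentiableAt 𝓘(ℝ, E) 𝓘(ℝ, E) ψ (f 1) :=
    (contMDiffAt_of_mem_maximalAtlas hi.codChart_mem_maximalAtlas
      hi.mem_codChart_source).mdifferentiableAt (by simp)
  have hφs : ContMDiffAt 𝓘(ℝ, E') 𝓘(ℝ, E') ∞ φ.symm (φ 1) :=
    contMDiffAt_symm_of_mem_maximalAtlas hi.domChart_mem_maximalAtlas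
      (φ.map_source hi.mem_domChart_source)
  let p : E → E' := fun x => (hi.equiv.symm x).1
  have hp : ∀ x, MDifferentiableAt 𝓘(ℝ, E) 𝓘(ℝ, E') p x := fun x => by
    apply DifferentiableAt.mdifferentiableAt
    fun_prop
  have hloc : ∀ x ∈ φ.source, p (ψ (f x)) = φ x := fun x hx => by
    have ht : φ x ∈ (φ.extend 𝓘(ℝ, E')).target := by simpa using φ.map_source hx
    have hw := hi.writtenInCharts ht
    have hw' : ψ (f (φ.symm (φ x))) = hi.equiv (φ x, 0) := by simpa using hw
    rw [φ.left_inv hx] at hw'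
    simp [p, hw']
  have h1 : p (ψ (f 1)) = φ 1 := hloc 1 hi.mem_domChart_source
  let q : G → H := fun x => φ.symm (p (ψ x))
  have hq : MDifferentiableAt 𝓘(ℝ, E) 𝓘(ℝ, E') q (f 1) := by
    have h2 : MDifferentiableAt 𝓘(ℝ, E) 𝓘(ℝ, E') (fun x => p (ψ x)) (f 1) :=
      (hp _).comp (f 1) hψ
    have h3 : MDifferentiableAt 𝓘(ℝ, E') 𝓘(ℝ, E') φ.symm (p (ψ (f 1))) := by
      rw [h1]
      exact hφs.mdifferentiableAt (by simp)
    exact h3.comp (f 1) h2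
  have hqf : q ∘ f =ᶠ[nhds 1] id := by
    filter_upwards [φ.open_source.mem_nhds hi.mem_domChart_source] with x hx
    simp only [Function.comp_apply, q, hloc x hx, id]
    exact φ.left_inv hx
  have hid : HasMFDerivAt 𝓘(ℝ, E') 𝓘(ℝ, E') (q ∘ f) 1
      ((mfderiv 𝓘(ℝ, E) 𝓘(ℝ, E') q (f 1)).comp (mfderiv 𝓘(ℝ, E') 𝓘(ℝ, E) f 1)) :=
    hq.hasMFDerivAt.comp 1 hfm.hasMFDerivAt
  have hid' := (hasMFDerivAt_id (I := 𝓘(ℝ, E')) (1 : H)).congr_of_eventuallyEq hqf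
  have heq := hasMFDerivAt_unique hid hid'
  intro ξ η h
  have e1 := DFunLike.congr_fun heq ξ
  have e2 := DFunLike.congr_fun heq η
  have h' : mfderiv 𝓘(ℝ, E') 𝓘(ℝ, E) f 1 ξ = mfderiv 𝓘(ℝ, E') 𝓘(ℝ, E) f 1 η := h
  have e3 : (mfderiv 𝓘(ℝ, E) 𝓘(ℝ, E') q (f 1)) (mfderiv 𝓘(ℝ, E') 𝓘(ℝ, E) f 1 ξ) =
      (mfderiv 𝓘(ℝ, E) 𝓘(ℝ, E') q (f 1)) (mfderiv 𝓘(ℝ, E') 𝓘(ℝ, E) f 1 η) := by rw [h']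
  exact e1.symm.trans (e3.trans e2)

theorem lieIncl_Ad [LieGroup 𝓘(ℝ, E) ∞ G] (hH : IsLieSubgroup E E' H) (h : H)
    (ξ : GroupLieAlgebra 𝓘(ℝ, E') H) :
    lieIncl E E' H (Ad E' h ξ) = Ad E (h : G) (lieIncl E E' H ξ) := by
  have := hH.lieGroup
  have hf : ∀ x, MDifferentiableAt 𝓘(ℝ, E') 𝓘(ℝ, E) (Subtype.val : H → G) x := fun x =>
    hH.embedding.contMDiff.contMDiffAt.mdifferentiableAt (by simp)
  have hc : MDifferentiableAt 𝓘(ℝ, E') 𝓘(ℝ, E') (fun x : H => h * x * h⁻¹) 1 :=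
    ((contMDiff_mul_right (I := 𝓘(ℝ, E')) (n := ∞)).comp
      (contMDiff_mul_left (I := 𝓘(ℝ, E')) (n := ∞))).contMDiffAt.mdifferentiableAt (by simp)
  have hc' : MDifferentiableAt 𝓘(ℝ, E) 𝓘(ℝ, E) (fun x : G => (h : G) * x * (h : G)⁻¹) 1 :=
    ((contMDiff_mul_right (I := 𝓘(ℝ, E)) (n := ∞)).comp
      (contMDiff_mul_left (I := 𝓘(ℝ, E)) (n := ∞))).contMDiffAt.mdifferentiableAt (by simp)
  have h1 := mfderiv_comp (1 : H) (hf (h * 1 * h⁻¹)) hc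
  have h2 := mfderiv_comp (1 : H) (g := fun x : G => (h : G) * x * (h : G)⁻¹) hc' (hf 1)
  have e : (Subtype.val : H → G) ∘ (fun x : H => h * x * h⁻¹) =
      (fun x : G => (h : G) * x * (h : G)⁻¹) ∘ (Subtype.val : H → G) := by
    ext x; simp
  rw [e, h2] at h1
  have h3 : ∀ x : H, x = 1 → ((mfderiv 𝓘(ℝ, E') 𝓘(ℝ, E) (Subtype.val : H → G) x : E' →L[ℝ] E)) =
      mfderiv 𝓘(ℝ, E') 𝓘(ℝ, E) (Subtype.val : H → G) 1 := by
    rintro _ rfl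
    rfl
  have h4 := DFunLike.congr_fun h1 ξ
  have h5 := DFunLike.congr_fun (h3 (h * 1 * h⁻¹) (by simp))
    (mfderiv 𝓘(ℝ, E') 𝓘(ℝ, E') (fun x : H => h * x * h⁻¹) 1 ξ)
  exact (h4.trans h5).symm

namespace InvariantInnerProduct

variable [LieGroup 𝓘(ℝ, E) ∞ G] (B : InvariantInnerProduct E G) (hH : IsLieSubgroup E E' H)

/-- The restriction of the inner product to the Lie algebra of `H`. -/
def restrict : InvariantInnerProduct E' H where
  form := B.form.compl₁₂ (lieIncl E E' H).toLinearMap (lieIncl E E' H).toLinearMap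
  symm ξ η := B.symm _ _
  posDef ξ hξ := B.posDef _ (fun h => hξ (lieIncl_injective hH (by rw [map_zero]; exact h)))
  invariant h ξ η := by
    have := B.invariant (h : G) (lieIncl E E' H ξ) (lieIncl E E' H η)
    rw [← lieIncl_Ad hH, ← lieIncl_Ad hH] at this
    exact this

variable [FiniteDimensional ℝ E']

/-- The orthogonal projection of `𝔤` onto `𝔥`. -/
def projSub : Module.End ℝ (GroupLieAlgebra 𝓘(ℝ, E) G) :=
  (lieIncl E E' H).toLinearMap ∘ₗ (B.restrict hH).sharp ∘ₗ
    (B.form.compl₁₂ LinearMap.id (lieIncl E E' H).toLinearMap)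

/-- The orthogonal projection of `𝔤` onto `𝔥^⊥`. -/
def projPerp : Module.End ℝ (GroupLieAlgebra 𝓘(ℝ, E) G) := 1 - B.projSub hH

/-- The operator `-(1/2) (Ad_u + 1)/(Ad_u - 1)` on `𝔥^⊥`, extended by zero to `𝔤`, for `u ∈ H` such
that `Ad_u - 1` is invertible on `𝔥^⊥`. The operator that is inverted is `Ad_u - 1` on `𝔥^⊥` and
the identity on `𝔥`. -/
def rOp (u : H) : Module.End ℝ (GroupLieAlgebra 𝓘(ℝ, E) G) :=
  let A : Module.End ℝ (GroupLieAlgebra 𝓘(ℝ, E) G) := (Ad E (u : G)).toLinearMap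
  (-(1 / 2) : ℝ) • ((A + 1) * Ring.inverse ((A - 1) * B.projPerp hH + B.projSub hH)
    * B.projPerp hH)

/-- `r(u) = (1/2) r_{ab}(u) e_a ∧ e_b` in `Λ² 𝔥^⊥`, where
`r_{ab}(u) = -(1/2) ((Ad_u + 1)/(Ad_u - 1)|𝔥^⊥)_{ab}`. -/
def rMatrix (u : H) : LinearMap.BilinForm ℝ (GroupLieAlgebra 𝓘(ℝ, E) G) :=
  B.form.compl₁₂ LinearMap.id (B.rOp hH u)

/-- `s` is a smooth map from `Y` to `Λ² 𝔥^⊥`. -/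
structure IsPerpSection (E' : Type*) [NormedAddCommGroup E'] [NormedSpace ℝ E']
    (H : Subgroup G) [ChartedSpace E' H] (F : Type*) [NormedAddCommGroup F] [NormedSpace ℝ F]
    {Y : Type*} [TopologicalSpace Y] [ChartedSpace F Y]
    (s : Y → LinearMap.BilinForm ℝ (GroupLieAlgebra 𝓘(ℝ, E) G)) : Prop where
  alt : ∀ y ξ, s y ξ ξ = 0
  perp : ∀ y (ζ : GroupLieAlgebra 𝓘(ℝ, E') H) (η : GroupLieAlgebra 𝓘(ℝ, E) G),
    s y (lieIncl E E' H ζ) η = 0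
  smooth : ∀ ξ η, SmoothFun F (fun y => s y ξ η)

end InvariantInnerProduct

end Subgroup

section Associated

variable {G : Type*} [Group G]

/-- `(k, y) ∼ (k h⁻¹, h y)`. -/
def assocSetoid (H : Subgroup G) (Y : Type*) [MulAction H Y] : Setoid (G × Y) where
  r p q := ∃ h : H, q = (p.1 * (h : G)⁻¹, h • p.2)
  iseqv :=
    { refl := fun p => ⟨1, by simp⟩
      symm := by
        rintro p q ⟨h, rfl⟩
        exact ⟨h⁻¹, by simp⟩
      trans := by
        rintro p q s ⟨h, rfl⟩ ⟨h', rfl⟩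
        exact ⟨h' * h, by simp [mul_assoc, mul_smul]⟩ }

/-- The associated bundle `G ×_H Y`. -/
def AssocBundle (H : Subgroup G) (Y : Type*) [MulAction H Y] : Type _ :=
  Quotient (assocSetoid H Y)

namespace AssocBundle

variable {H : Subgroup G} {Y : Type*} [MulAction H Y]

/-- The quotient map `G × Y → G ×_H Y`. -/
def mk (p : G × Y) : AssocBundle H Y := Quotient.mk (assocSetoid H Y) p

instance [TopologicalSpace G] [TopologicalSpace Y] : TopologicalSpace (AssocBundle H Y) :=
  inferInstanceAs (TopologicalSpace (Quotient (assocSetoid H Y)))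

/-- `G` acts by `k.[k', y] = [k k', y]`. -/
instance : MulAction G (AssocBundle H Y) where
  smul k := Quotient.map (fun p => (k * p.1, p.2)) (by
    rintro p q ⟨h, rfl⟩
    exact ⟨h, by simp [mul_assoc]⟩)
  one_smul := by
    rintro ⟨p⟩
    exact congrArg (Quotient.mk (assocSetoid H Y)) (by simp)
  mul_smul := by
    rintro k k' ⟨p⟩
    exact congrArg (Quotient.mk (assocSetoid H Y)) (by simp [mul_assoc])

/-- A smooth structure on `G ×_H Y` is the quotient structure: the projection from `G × Y` is a
submersion. -/
structure IsQuotientManifold (E : Type*) [NormedAddCommGroup E] [NormedSpace ℝ E]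
    [TopologicalSpace G] [ChartedSpace E G]
    (F : Type*) [NormedAddCommGroup F] [NormedSpace ℝ F] [TopologicalSpace Y] [ChartedSpace F Y]
    (F' : Type*) [NormedAddCommGroup F'] [NormedSpace ℝ F'] [ChartedSpace F' (AssocBundle H Y)] :
    Prop where
  isManifold : IsManifold 𝓘(ℝ, F') ∞ (AssocBundle H Y)
  submersion : Manifold.IsSubmersion (𝓘(ℝ, E).prod 𝓘(ℝ, F)) 𝓘(ℝ, F') ∞
    (mk : G × Y → AssocBundle H Y)

end AssocBundle

end Associated

section Slice

variable {G : Type*} [TopologicalSpace G] [Group G] {H : Subgroup G}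

/-- The conjugation action of `H` on an invariant open subset of `H`. -/
@[reducible]
def conjAction (U : TopologicalSpace.Opens H) (hU : ∀ h u : H, u ∈ U → h * u * h⁻¹ ∈ U) :
    MulAction H U where
  smul h u := ⟨h * (u : H) * h⁻¹, hU h u u.2⟩
  one_smul u := Subtype.ext (by change 1 * (u : H) * 1⁻¹ = u; simp)
  mul_smul h h' u := Subtype.ext (by
    change h * h' * (u : H) * (h * h')⁻¹ = h * (h' * (u : H) * h'⁻¹) * h⁻¹
    simp [mul_assoc])

/-- The natural map `G ×_H U → G`, `[k, u] ↦ k u k⁻¹`. -/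
def sliceMap (U : TopologicalSpace.Opens H) (hU : ∀ h u : H, u ∈ U → h * u * h⁻¹ ∈ U) :
    letI := conjAction U hU
    AssocBundle H U → G :=
  letI := conjAction U hU
  Quotient.lift (fun p : G × U => p.1 * ((p.2 : H) : G) * p.1⁻¹) (by
    rintro p q ⟨h, rfl⟩
    change _ = p.1 * (h : G)⁻¹ * ((h * (p.2 : H) * h⁻¹ : H) : G) * (p.1 * (h : G)⁻¹)⁻¹
    simp [mul_assoc])

/-- The open subset `U` of `H = G_g` is a slice at `g` for the conjugation action: an
`H`-invariant neighbourhood of `g` such that `G ×_H U → G` is a diffeomorphism onto its (open)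
image. -/
structure IsSlice (E : Type*) [NormedAddCommGroup E] [NormedSpace ℝ E] [ChartedSpace E G]
    (E' : Type*) [NormedAddCommGroup E'] [NormedSpace ℝ E'] [ChartedSpace E' H]
    (g : G) (U : TopologicalSpace.Opens H) : Prop where
  mem : ∃ u ∈ U, (u : G) = g
  invariant : ∀ h u : H, u ∈ U → h * u * h⁻¹ ∈ U
  diffeo : letI := conjAction U invariant
    ∃ (n : ℕ) (_ : ChartedSpace (EuclideanSpace ℝ (Fin n)) (AssocBundle H U)),
      AssocBundle.IsQuotientManifold (H := H) (Y := U) E E' (EuclideanSpace ℝ (Fin n)) ∧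
      IsLocalDiffeomorph 𝓘(ℝ, EuclideanSpace ℝ (Fin n)) 𝓘(ℝ, E) ∞ (sliceMap U invariant) ∧
      Function.Injective (sliceMap U invariant)

/-- The cross-section `Y = Φ⁻¹(U)`. -/
def crossSection {M : Type*} (Φ : M → G) (U : TopologicalSpace.Opens H) : Set M :=
  Φ ⁻¹' (Subtype.val '' (U : Set H))

end Slice

end QuasiPoisson

end

noncomputable section

open scoped Topology
open Set Filter

/-! At `u ∈ U` put `A = Ad_u`, and let `l` be the left-trivialized gradient at `u` of a function `f`
on `G`. Along the orbits the covector `d(Φ^*f)` is represented by `(1 - A) l` (`pl_comp_moment`),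
while `𝒟f = ½ (1 + A) l` (`dop_eq`). For `l ∈ 𝔥^⊥` the operator that takes the first to the second
is the r-matrix (`rM_eq_of`). The moment map condition thus prescribes `P` on covectors pulled back
from `G`, and transversally to the cross-section it prescribes `-r`. The operator is skew because
`A` is orthogonal (`bf_rM_skew`). It exists because the slice map is a local diffeomorphism: then
`(A⁻¹ - 1)𝔤 + 𝔥 = 𝔤`, and a vector of `𝔥^⊥` fixed by `A` is orthogonal to both summands
(`IsSlice.regular`).

The geometry rests on a map `σ : V → G` through `1` and tangent to `𝔥^⊥`, for which `(v, h) ↦ σ(v)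
h` is an open embedding (`exists_isTransversal`). By regularity `(v, u) ↦ σ(v) u σ(v)⁻¹` is a local
diffeomorphism, and `v` composed with `Φ` is a submersion whose zero set is the cross-section
(`IsSlice.exists_submersion`). Also `(v, y) ↦ σ(v) y` is a local diffeomorphism `V × Y → M`, so `T_y
M` is the direct sum of `T_y Y` and the orbit directions of `𝔥^⊥`. The same coordinates trivialize
`G ×_H Y`. Both halves of the theorem therefore work with one structure, `IsCross`, together with
this local product.

Restriction. A covector that vanishes on `T_y Y` is some `d(Φ^*f)` with `l ∈ 𝔥^⊥`
(`exists_dR_moment_eq`), so on it `P` is given by `-r`. On covectors that vanish on the directions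
of `𝔥^⊥`, `P` defines `P_Y`. Since `r` vanishes on `𝔥`, the two pieces add up to `P`
(`exists_splitting`). The moment conditions of `P` and `P_Y` have the same defect (`moment_defect`).
For the Schouten bracket, functions on `Y` are extended to be constant along the transversal
(`exists_extension`). On such functions the brackets of `P` and `P_Y` agree along `Y`, and `φ`
reduces to the tensor of `𝔥` because `𝔥 → 𝔤` is a Lie algebra homomorphism (`schoutenSelf_eq`,
`IsCross.cartan_eq`).

Induction. The bivector `P_Y - r` along `Y` is `H`-equivariant, hence moves along the orbits to an
invariant bivector field, which is smooth because `G × Y → G ×_H Y` is a submersion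
(`exists_bivectorField`). By invariance everything can be checked along `Y`. The moment condition
follows from `moment_defect`. The moment condition and invariance alone imply `[P, P] = φ_M` when
one argument is pulled back from `G` (`schoutenSelf_moment`). Since `[P, P]` is tensorial
(`schoutenSelf_eq_of_dR`), each argument may then be replaced by any function with the same
differential along `Y`, in particular by one constant along the transversal, and the identity on `Y`
applies (`schouten_incl`). -/

namespace QuasiPoisson

set_option linter.unusedSectionVars false

/-! ### Derivatives of maps between manifolds, as linear maps of the model spaces -/

section Deriv

variable {E₁ : Type*} [NormedAddCommGroup E₁] [NormedSpace ℝ E₁]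
  {H₁ : Type*} [TopologicalSpace H₁] {I₁ : ModelWithCorners ℝ E₁ H₁}
  {M₁ : Type*} [TopologicalSpace M₁] [ChartedSpace H₁ M₁]
  {E₂ : Type*} [NormedAddCommGroup E₂] [NormedSpace ℝ E₂]
  {H₂ : Type*} [TopologicalSpace H₂] {I₂ : ModelWithCorners ℝ E₂ H₂}
  {M₂ : Type*} [TopologicalSpace M₂] [ChartedSpace H₂ M₂]
  {E₃ : Type*} [NormedAddCommGroup E₃] [NormedSpace ℝ E₃]
  {H₃ : Type*} [TopologicalSpace H₃] {I₃ : ModelWithCorners ℝ E₃ H₃}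
  {M₃ : Type*} [TopologicalSpace M₃] [ChartedSpace H₃ M₃]
  {E₄ : Type*} [NormedAddCommGroup E₄] [NormedSpace ℝ E₄]
  {H₄ : Type*} [TopologicalSpace H₄] {I₄ : ModelWithCorners ℝ E₄ H₄}
  {M₄ : Type*} [TopologicalSpace M₄] [ChartedSpace H₄ M₄]

/-- The derivative of a map between manifolds as a map of model vector spaces. -/
def md (I₁ : ModelWithCorners ℝ E₁ H₁) (I₂ : ModelWithCorners ℝ E₂ H₂) (f : M₁ → M₂) (x : M₁) :
    E₁ →L[ℝ] E₂ := mfderiv I₁ I₂ f x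

theorem md_comp {g : M₂ → M₃} {f : M₁ → M₂} {x : M₁} (hg : MDifferentiableAt I₂ I₃ g (f x))
    (hf : MDifferentiableAt I₁ I₂ f x) :
    md I₁ I₃ (fun y => g (f y)) x = (md I₂ I₃ g (f x)).comp (md I₁ I₂ f x) :=
  mfderiv_comp x hg hf

theorem md_comp_of_eq {g : M₂ → M₃} {f : M₁ → M₂} {x : M₁} {y : M₂}
    (hg : MDifferentiableAt I₂ I₃ g y) (hf : MDifferentiableAt I₁ I₂ f x) (h : f x = y) :
    md I₁ I₃ (fun y => g (f y)) x = (md I₂ I₃ g y).comp (md I₁ I₂ f x) := by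
  subst h; exact md_comp hg hf

theorem md_congr {f g : M₁ → M₂} {x : M₁} (h : f =ᶠ[𝓝 x] g) : md I₁ I₂ f x = md I₁ I₂ g x :=
  h.mfderiv_eq

theorem md_id (x : M₁) : md I₁ I₁ (fun y => y) x = ContinuousLinearMap.id ℝ E₁ := mfderiv_id

theorem md_const (c : M₂) (x : M₁) : md I₁ I₂ (fun _ => c) x = 0 := mfderiv_const

theorem md_prod_apply {f : M₁ × M₂ → M₃} {x : M₁} {y : M₂}
    (hf : MDifferentiableAt (I₁.prod I₂) I₃ f (x, y)) (v : E₁) (w : E₂) :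
    md (I₁.prod I₂) I₃ f (x, y) (v, w) =
      md I₁ I₃ (fun z => f (z, y)) x v + md I₂ I₃ (fun z => f (x, z)) y w :=
  mfderiv_prod_eq_add_apply (v := ((v, w) : E₁ × E₂)) hf

theorem md_prodMk {f : M₁ → M₂} {g : M₁ → M₃} {x : M₁} (hf : MDifferentiableAt I₁ I₂ f x)
    (hg : MDifferentiableAt I₁ I₃ g x) :
    md I₁ (I₂.prod I₃) (fun y => (f y, g y)) x = (md I₁ I₂ f x).prod (md I₁ I₃ g x) :=
  mfderiv_prodMk hf hg

theorem md_eq_fderiv {f : E₁ → E₂} {x : E₁} : md 𝓘(ℝ, E₁) 𝓘(ℝ, E₂) f x = fderiv ℝ f x :=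
  mfderiv_eq_fderiv

/-- The derivative of a two-variable map along two curves. -/
theorem md_comp₂ {f : M₂ × M₃ → M₄} {g : M₁ → M₂} {h : M₁ → M₃} {x : M₁}
    (hf : MDifferentiableAt (I₂.prod I₃) I₄ f (g x, h x))
    (hg : MDifferentiableAt I₁ I₂ g x) (hh : MDifferentiableAt I₁ I₃ h x) (v : E₁) :
    md I₁ I₄ (fun z => f (g z, h z)) x v =
      md I₂ I₄ (fun z => f (z, h x)) (g x) (md I₁ I₂ g x v) +
      md I₃ I₄ (fun z => f (g x, z)) (h x) (md I₁ I₃ h x v) := by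
  rw [md_comp (g := f) (f := fun z => (g z, h z)) hf (hg.prodMk hh), md_prodMk hg hh]
  exact md_prod_apply hf _ _

theorem md_eq_fderiv_extChartAt [I₁.Boundaryless] {f : M₁ → E₂} {x : M₁}
    (hf : MDifferentiableAt I₁ 𝓘(ℝ, E₂) f x) :
    md I₁ 𝓘(ℝ, E₂) f x = fderiv ℝ (fun z => f ((extChartAt I₁ x).symm z)) (extChartAt I₁ x x) := by
  have := hf.mfderiv
  refine this.trans ?_
  rw [I₁.range_eq_univ, fderivWithin_univ]
  rfl

theorem contMDiffAt_extChartAt_symm [I₁.Boundaryless] [IsManifold I₁ ∞ M₁] (x : M₁) :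
    ContMDiffAt 𝓘(ℝ, E₁) I₁ ∞ (extChartAt I₁ x).symm (extChartAt I₁ x x) :=
  (contMDiffOn_extChartAt_symm x).contMDiffAt (extChartAt_target_mem_nhds x)

theorem tendsto_extChartAt_symm [I₁.Boundaryless] [IsManifold I₁ ∞ M₁] (x : M₁) :
    Tendsto (extChartAt I₁ x).symm (𝓝 (extChartAt I₁ x x)) (𝓝 x) := by
  have := (contMDiffAt_extChartAt_symm (I₁ := I₁) x).continuousAt
  rwa [ContinuousAt, extChartAt_to_inv x] at this

/-- The tangent space at `x` is identified with the model space by the preferred chart at `x`, so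
this chart has the identity as derivative at `x` itself. At other points of its domain this fails in
general, which is why `frame` is needed later. -/
theorem md_extChartAt_self [I₁.Boundaryless] [IsManifold I₁ ∞ M₁] (x : M₁) :
    md I₁ 𝓘(ℝ, E₁) (extChartAt I₁ x) x = ContinuousLinearMap.id ℝ E₁ := by
  rw [md_eq_fderiv_extChartAt
    ((contMDiffAt_extChartAt (n := ∞)).mdifferentiableAt (by simp))]
  have : (fun z => extChartAt I₁ x ((extChartAt I₁ x).symm z)) =ᶠ[𝓝 (extChartAt I₁ x x)] id := by
    filter_upwards [extChartAt_target_mem_nhds x] with z hz using (extChartAt I₁ x).right_inv hz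
  rw [this.fderiv_eq, fderiv_id]

theorem md_extChartAt_symm_self [I₁.Boundaryless] [IsManifold I₁ ∞ M₁] (x : M₁) :
    md 𝓘(ℝ, E₁) I₁ (extChartAt I₁ x).symm (extChartAt I₁ x x) = ContinuousLinearMap.id ℝ E₁ := by
  have h1 := md_comp_of_eq (g := extChartAt I₁ x) (f := (extChartAt I₁ x).symm)
    (x := extChartAt I₁ x x) (y := x) (I₂ := I₁) (I₃ := 𝓘(ℝ, E₁)) (I₁ := 𝓘(ℝ, E₁))
    ((contMDiffAt_extChartAt (n := ∞)).mdifferentiableAt (by simp))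
    ((contMDiffAt_extChartAt_symm x).mdifferentiableAt (by simp)) (extChartAt_to_inv x)
  rw [md_extChartAt_self, ContinuousLinearMap.id_comp] at h1
  rw [← h1]
  have : (fun z => extChartAt I₁ x ((extChartAt I₁ x).symm z)) =ᶠ[𝓝 (extChartAt I₁ x x)]
      fun z => z := by
    filter_upwards [extChartAt_target_mem_nhds x] with z hz using (extChartAt I₁ x).right_inv hz
  rw [md_congr this, md_id]

/-- Symmetry of mixed partial derivatives in vector spaces. -/
theorem fderiv_fderiv_comm {f : E₁ × E₂ → E₃} {a : E₁} {b : E₂} (hf : ContDiffAt ℝ 2 f (a, b))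
    (v : E₁) (w : E₂) :
    fderiv ℝ (fun x => fderiv ℝ (fun y => f (x, y)) b w) a v =
      fderiv ℝ (fun y => fderiv ℝ (fun x => f (x, y)) a v) b w := by
  have hdf : ∀ᶠ p in 𝓝 (a, b), DifferentiableAt ℝ f p := by
    filter_upwards [hf.eventually (by simp)] with p hp using hp.differentiableAt (by simp)
  have hd2 : DifferentiableAt ℝ (fderiv ℝ f) (a, b) :=
    (hf.fderiv_right (m := 1) (by norm_num)).differentiableAt (by simp)
  have hsymm := hf.isSymmSndFDerivAt (by simp)
  have e1 : (fun x => fderiv ℝ (fun y => f (x, y)) b w) =ᶠ[𝓝 a] fun x => fderiv ℝ f (x, b)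
      (0, w) := by
    have : Tendsto (fun x : E₁ => (x, b)) (𝓝 a) (𝓝 (a, b)) :=
      (Continuous.prodMk_left b).tendsto a
    filter_upwards [this.eventually hdf] with x hx
    have := HasFDerivAt.comp (g := f) b hx.hasFDerivAt (hasFDerivAt_prodMk_right x b)
    rw [show fderiv ℝ (fun y => f (x, y)) b = _ from this.fderiv]
    simp
  have e2 : (fun y => fderiv ℝ (fun x => f (x, y)) a v) =ᶠ[𝓝 b] fun y => fderiv ℝ f (a, y)
      (v, 0) := by
    have : Tendsto (fun y : E₂ => (a, y)) (𝓝 b) (𝓝 (a, b)) :=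
      (Continuous.prodMk_right a).tendsto b
    filter_upwards [this.eventually hdf] with y hy
    have := HasFDerivAt.comp (g := f) a hy.hasFDerivAt (hasFDerivAt_prodMk_left (𝕜 := ℝ) a y)
    rw [show fderiv ℝ (fun x => f (x, y)) a = _ from this.fderiv]
    simp
  rw [e1.fderiv_eq, e2.fderiv_eq]
  have h1 := (HasFDerivAt.comp (g := fderiv ℝ f) a hd2.hasFDerivAt
      (hasFDerivAt_prodMk_left (𝕜 := ℝ) a b)).clm_apply
    (hasFDerivAt_const ((0, w) : E₁ × E₂) a)
  have h2 := (HasFDerivAt.comp (g := fderiv ℝ f) b hd2.hasFDerivAt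
      (hasFDerivAt_prodMk_right a b)).clm_apply
    (hasFDerivAt_const ((v, 0) : E₁ × E₂) b)
  rw [show fderiv ℝ (fun x => fderiv ℝ f (x, b) (0, w)) a = _ from h1.fderiv,
    show fderiv ℝ (fun y => fderiv ℝ f (a, y) (v, 0)) b = _ from h2.fderiv]
  simpa using hsymm (v, 0) (0, w)

theorem eventually_mdifferentiableAt [IsManifold I₁ ∞ M₁] [IsManifold I₂ ∞ M₂] {f : M₁ → M₂}
    {x : M₁} (hf : ContMDiffAt I₁ I₂ ∞ f x) : ∀ᶠ y in 𝓝 x, MDifferentiableAt I₁ I₂ f y := by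
  have : IsManifold I₁ 1 M₁ := .of_le (n := ∞) (by simp)
  have : IsManifold I₂ 1 M₂ := .of_le (n := ∞) (by simp)
  filter_upwards [(contMDiffAt_iff_contMDiffAt_nhds (by simp)).mp
    (hf.of_le (m := 1) (by simp))] with y hy
  exact hy.mdifferentiableAt (by simp)

/-- Partial derivatives of a smooth map are smooth. -/
theorem contMDiffAt_md [IsManifold I₁ ∞ M₁] [IsManifold I₂ ∞ M₂] [I₂.Boundaryless]
    {f : M₁ → M₂ → E₃} {a : M₁} {b : M₂}
    (hf : ContMDiffAt (I₁.prod I₂) 𝓘(ℝ, E₃) ∞ (fun p : M₁ × M₂ => f p.1 p.2) (a, b)) :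
    ContMDiffAt I₁ 𝓘(ℝ, E₂ →L[ℝ] E₃) ∞ (fun x => md I₂ 𝓘(ℝ, E₃) (f x) b) a := by
  -- With the second variable read in the chart at `b`, the derivative is taken between vector
  -- spaces, where the tangent coordinate changes in `ContMDiffAt.mfderiv` are trivial.
  have hg : ContMDiffAt (I₁.prod 𝓘(ℝ, E₂)) 𝓘(ℝ, E₃) ∞
      (Function.uncurry fun (x : M₁) (z : E₂) => f x ((extChartAt I₂ b).symm z))
      (a, extChartAt I₂ b b) := by
    refine ContMDiffAt.comp_of_eq (g := fun p : M₁ × M₂ => f p.1 p.2)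
      (f := fun p : M₁ × E₂ => (p.1, (extChartAt I₂ b).symm p.2)) (y := (a, b)) hf ?_ (by simp)
    exact contMDiffAt_fst.prodMk
      ((contMDiffAt_extChartAt_symm b).comp_of_eq contMDiffAt_snd rfl)
  have := ContMDiffAt.mfderiv (m := ∞) (I := 𝓘(ℝ, E₂)) (I' := 𝓘(ℝ, E₃))
    (fun (x : M₁) (z : E₂) => f x ((extChartAt I₂ b).symm z)) (fun _ : M₁ => extChartAt I₂ b b)
    hg contMDiffAt_const (by simp)
  have h2 := (congrArg (fun φ => ContMDiffAt I₁ 𝓘(ℝ, E₂ →L[ℝ] E₃) ∞ φ a)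
    (inTangentCoordinates_model_space _ _ _ _)).mp this
  refine h2.congr_of_eventuallyEq ?_
  have h3 : ∀ᶠ x in 𝓝 a, MDifferentiableAt I₂ 𝓘(ℝ, E₃) (f x) b := by
    have h4 := eventually_mdifferentiableAt hf
    have : Tendsto (fun x : M₁ => (x, b)) (𝓝 a) (𝓝 (a, b)) :=
      (Continuous.prodMk_left b).tendsto a
    filter_upwards [this.eventually h4] with x hx
    exact MDifferentiableAt.comp (g := fun p : M₁ × M₂ => f p.1 p.2) (f := fun y => (x, y)) b
      hx (mdifferentiableAt_const.prodMk mdifferentiableAt_id)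
  filter_upwards [h3] with x hx
  exact (md_eq_fderiv_extChartAt hx).trans mfderiv_eq_fderiv.symm

/-- Symmetry of mixed partial derivatives on manifolds. -/
theorem md_md_comm [IsManifold I₁ ∞ M₁] [IsManifold I₂ ∞ M₂] [I₁.Boundaryless] [I₂.Boundaryless]
    {f : M₁ × M₂ → E₃} {a : M₁} {b : M₂}
    (hf : ContMDiffAt (I₁.prod I₂) 𝓘(ℝ, E₃) ∞ f (a, b)) (v : E₁) (w : E₂) :
    md I₁ 𝓘(ℝ, E₃) (fun x => md I₂ 𝓘(ℝ, E₃) (fun y => f (x, y)) b w) a v =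
      md I₂ 𝓘(ℝ, E₃) (fun y => md I₁ 𝓘(ℝ, E₃) (fun x => f (x, y)) a v) b w := by
  have hf' : ContMDiffAt (I₂.prod I₁) 𝓘(ℝ, E₃) ∞ (fun p : M₂ × M₁ => f (p.2, p.1)) (b, a) :=
    hf.comp_of_eq (contMDiffAt_snd.prodMk contMDiffAt_fst) rfl
  have hev : ∀ᶠ p in 𝓝 (a, b), MDifferentiableAt (I₁.prod I₂) 𝓘(ℝ, E₃) f p :=
    eventually_mdifferentiableAt hf
  have h1 : MDifferentiableAt I₁ 𝓘(ℝ, E₃) (fun x => md I₂ 𝓘(ℝ, E₃) (fun y => f (x, y)) b w) a := by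
    have := contMDiffAt_md (f := fun x y => f (x, y)) hf
    exact (this.clm_apply contMDiffAt_const).mdifferentiableAt (by simp)
  have h2 : MDifferentiableAt I₂ 𝓘(ℝ, E₃) (fun y => md I₁ 𝓘(ℝ, E₃) (fun x => f (x, y)) a v) b := by
    have := contMDiffAt_md (f := fun y x => f (x, y)) hf'
    exact (this.clm_apply contMDiffAt_const).mdifferentiableAt (by simp)
  rw [md_eq_fderiv_extChartAt h1, md_eq_fderiv_extChartAt h2]
  have hg : ContMDiffAt 𝓘(ℝ, E₁ × E₂) 𝓘(ℝ, E₃) ∞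
      (fun p : E₁ × E₂ => f ((extChartAt I₁ a).symm p.1, (extChartAt I₂ b).symm p.2))
      (extChartAt I₁ a a, extChartAt I₂ b b) := by
    refine ContMDiffAt.comp_of_eq (g := f)
      (f := fun p : E₁ × E₂ => ((extChartAt I₁ a).symm p.1, (extChartAt I₂ b).symm p.2))
      (y := (a, b)) hf ?_ (by simp)
    exact ((contMDiffAt_extChartAt_symm a).comp_of_eq contDiff_fst.contMDiff.contMDiffAt rfl).prodMk
      ((contMDiffAt_extChartAt_symm b).comp_of_eq contDiff_snd.contMDiff.contMDiffAt rfl)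
  have hg' := (contMDiffAt_iff_contDiffAt.mp hg).of_le (m := 2) ENat.LEInfty.out
  have := fderiv_fderiv_comm hg' v w
  refine Eq.trans ?_ (this.trans ?_)
  · refine congrArg (fun φ : E₁ →L[ℝ] E₃ => φ v) (Filter.EventuallyEq.fderiv_eq ?_)
    have ht : Tendsto (fun z => ((extChartAt I₁ a).symm z, b)) (𝓝 (extChartAt I₁ a a)) (𝓝 (a, b)) :=
      (tendsto_extChartAt_symm a).prodMk_nhds tendsto_const_nhds
    filter_upwards [ht.eventually hev] with z hz
    have : MDifferentiableAt I₂ 𝓘(ℝ, E₃) (fun y => f ((extChartAt I₁ a).symm z, y)) b :=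
      MDifferentiableAt.comp (g := f) (f := fun y => ((extChartAt I₁ a).symm z, y)) b
        hz (mdifferentiableAt_const.prodMk mdifferentiableAt_id)
    rw [md_eq_fderiv_extChartAt this]
  · refine congrArg (fun φ : E₂ →L[ℝ] E₃ => φ w) (Filter.EventuallyEq.fderiv_eq ?_)
    have ht : Tendsto (fun z => (a, (extChartAt I₂ b).symm z)) (𝓝 (extChartAt I₂ b b)) (𝓝 (a, b)) :=
      tendsto_const_nhds.prodMk_nhds (tendsto_extChartAt_symm b)
    filter_upwards [ht.eventually hev] with z hz
    have : MDifferentiableAt I₁ 𝓘(ℝ, E₃) (fun x => f (x, (extChartAt I₂ b).symm z)) a :=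
      MDifferentiableAt.comp (g := f) (f := fun x => (x, (extChartAt I₂ b).symm z)) a
        hz (mdifferentiableAt_id.prodMk mdifferentiableAt_const)
    rw [md_eq_fderiv_extChartAt this]

end Deriv

/-! ### Inverse function theorem, partial diffeomorphisms, sections of submersions -/

section LocalDiffeo

variable {E₁ : Type*} [NormedAddCommGroup E₁] [NormedSpace ℝ E₁]
  {H₁ : Type*} [TopologicalSpace H₁] {I₁ : ModelWithCorners ℝ E₁ H₁}
  {M₁ : Type*} [TopologicalSpace M₁] [ChartedSpace H₁ M₁]
  {E₂ : Type*} [NormedAddCommGroup E₂] [NormedSpace ℝ E₂]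
  {H₂ : Type*} [TopologicalSpace H₂] {I₂ : ModelWithCorners ℝ E₂ H₂}
  {M₂ : Type*} [TopologicalSpace M₂] [ChartedSpace H₂ M₂]
  {E₃ : Type*} [NormedAddCommGroup E₃] [NormedSpace ℝ E₃]
  {H₃ : Type*} [TopologicalSpace H₃] {I₃ : ModelWithCorners ℝ E₃ H₃}
  {M₃ : Type*} [TopologicalSpace M₃] [ChartedSpace H₃ M₃]

variable (I₁) in
/-- The extended chart at `x` as a partial diffeomorphism. -/
def chartDiffeo [I₁.Boundaryless] [IsManifold I₁ ∞ M₁] (x : M₁) :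
    PartialDiffeomorph I₁ 𝓘(ℝ, E₁) M₁ E₁ ∞ where
  toPartialEquiv := extChartAt I₁ x
  open_source := isOpen_extChartAt_source x
  open_target := isOpen_extChartAt_target x
  contMDiffOn_toFun := by
    have := contMDiffOn_extChartAt (I := I₁) (n := ∞) (x := x)
    rwa [← extChartAt_source I₁ x] at this
  contMDiffOn_invFun := contMDiffOn_extChartAt_symm x

/-- The inverse function theorem in vector spaces. -/
theorem isLocalDiffeomorphAt_of_fderiv [CompleteSpace E₁] [CompleteSpace E₂] {g : E₁ → E₂}
    {s : Set E₁} (hs : IsOpen s) {x : E₁} (hx : x ∈ s) (hg : ContDiffOn ℝ ∞ g s)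
    (hb : Function.Bijective (fderiv ℝ g x)) :
    IsLocalDiffeomorphAt 𝓘(ℝ, E₁) 𝓘(ℝ, E₂) ∞ g x := by
  have hgx : ContDiffAt ℝ ∞ g x := hg.contDiffAt (hs.mem_nhds hx)
  let g' : E₁ ≃L[ℝ] E₂ := ContinuousLinearEquiv.ofBijective (fderiv ℝ g x)
    (LinearMap.ker_eq_bot.mpr hb.1) (LinearMap.range_eq_top.mpr hb.2)
  have hg' : HasFDerivAt g (g' : E₁ →L[ℝ] E₂) x := by
    have := (hgx.differentiableAt (by simp)).hasFDerivAt
    exact this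
  let e := hgx.toOpenPartialHomeomorph g hg' (by simp)
  -- Invertible operators are open, so the derivative is invertible on a whole neighbourhood.
  -- Restricting to it makes the inverse smooth on all of the target and not only at `g x`.
  have hopen : IsOpen (s ∩ fderiv ℝ g ⁻¹' range ((↑) : (E₁ ≃L[ℝ] E₂) → E₁ →L[ℝ] E₂)) :=
    (hg.continuousOn_fderiv_of_isOpen hs (by simp)).isOpen_inter_preimage hs
      ContinuousLinearEquiv.isOpen
  set O := s ∩ fderiv ℝ g ⁻¹' range ((↑) : (E₁ ≃L[ℝ] E₂) → E₁ →L[ℝ] E₂)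
  let e' := e.restrOpen O hopen
  refine ⟨⟨e'.toPartialEquiv, e'.open_source, e'.open_target, ?_, ?_⟩, ?_, ?_⟩
  · exact contMDiffOn_iff_contDiffOn.mpr (hg.mono fun z hz => by
      rw [OpenPartialHomeomorph.restrOpen_source] at hz; exact hz.2.1)
  · refine contMDiffOn_iff_contDiffOn.mpr fun z hz => ContDiffAt.contDiffWithinAt ?_
    have hz' := e'.map_target hz
    rw [OpenPartialHomeomorph.restrOpen_source] at hz'
    obtain ⟨L, hL⟩ := hz'.2.2
    have hd : ContDiffAt ℝ ∞ g (e'.symm z) := hg.contDiffAt (hs.mem_nhds hz'.2.1)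
    refine e'.contDiffAt_symm (f₀' := L) hz ?_ hd
    rw [hL]
    exact (hd.differentiableAt (by simp)).hasFDerivAt
  · change x ∈ e'.source
    rw [OpenPartialHomeomorph.restrOpen_source]
    exact ⟨hgx.mem_toOpenPartialHomeomorph_source hg' (by simp), hx, g', rfl⟩
  · intro z _
    rfl

/-- The inverse function theorem on manifolds. -/
theorem isLocalDiffeomorphAt_of_md [CompleteSpace E₁] [CompleteSpace E₂]
    [I₁.Boundaryless] [IsManifold I₁ ∞ M₁] [I₂.Boundaryless] [IsManifold I₂ ∞ M₂] {f : M₁ → M₂}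
    {s : Set M₁} (hs : IsOpen s) {x : M₁} (hx : x ∈ s) (hf : ContMDiffOn I₁ I₂ ∞ f s)
    (hb : Function.Bijective (md I₁ I₂ f x)) :
    IsLocalDiffeomorphAt I₁ I₂ ∞ f x := by
  let φ := extChartAt I₁ x
  let ψ := extChartAt I₂ (f x)
  let s' := s ∩ f ⁻¹' ψ.source
  have hs' : IsOpen s' := hf.continuousOn.isOpen_inter_preimage hs (isOpen_extChartAt_source _)
  let O := φ.target ∩ φ.symm ⁻¹' s'
  have hO : IsOpen O := (contMDiffOn_extChartAt_symm (n := ∞) x).continuousOn.isOpen_inter_preimage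
    (isOpen_extChartAt_target x) hs'
  have hxO : φ x ∈ O := ⟨mem_extChartAt_target x, by
    change φ.symm (φ x) ∈ s'
    rw [extChartAt_to_inv x]
    exact ⟨hx, mem_extChartAt_source (f x)⟩⟩
  have hfx := hf.contMDiffAt (hs.mem_nhds hx)
  have hg : ContDiffOn ℝ ∞ (fun z => ψ (f (φ.symm z))) O := by
    rw [← contMDiffOn_iff_contDiffOn]
    have h1 : ContMDiffOn 𝓘(ℝ, E₁) I₁ ∞ φ.symm O :=
      (contMDiffOn_extChartAt_symm x).mono inter_subset_left
    have h2 : ContMDiffOn 𝓘(ℝ, E₁) I₂ ∞ (fun z => f (φ.symm z)) O :=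
      hf.comp h1 fun z hz => hz.2.1
    refine ContMDiffOn.comp (t := ψ.source) (g := ψ) ?_ h2 fun z hz => hz.2.2
    have := contMDiffOn_extChartAt (I := I₂) (n := ∞) (x := f x)
    rwa [← extChartAt_source I₂ (f x)] at this
  have hder : fderiv ℝ (fun z => ψ (f (φ.symm z))) (φ x) = md I₁ I₂ f x := by
    have hψ : MDifferentiableAt I₂ 𝓘(ℝ, E₂) ψ (f x) :=
      (contMDiffAt_extChartAt (n := ∞)).mdifferentiableAt (by simp)
    have hfd := hfx.mdifferentiableAt (n := ∞) (by simp)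
    have h1 := md_comp (g := ψ) (f := f) (x := x) hψ hfd
    rw [show md I₂ 𝓘(ℝ, E₂) ψ (f x) = _ from md_extChartAt_self (f x),
      ContinuousLinearMap.id_comp] at h1
    rw [← h1]
    exact (md_eq_fderiv_extChartAt (f := fun y => ψ (f y)) (hψ.comp x hfd)).symm
  have hloc := isLocalDiffeomorphAt_of_fderiv hO hxO hg (by rwa [hder])
  obtain ⟨Φ, hΦx, hΦ⟩ := hloc
  let Φ' : PartialDiffeomorph 𝓘(ℝ, E₁) 𝓘(ℝ, E₂) E₁ E₂ ∞ :=
    { toPartialEquiv := (Φ.toOpenPartialHomeomorph.restrOpen O hO).toPartialEquiv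
      open_source := (Φ.toOpenPartialHomeomorph.restrOpen O hO).open_source
      open_target := (Φ.toOpenPartialHomeomorph.restrOpen O hO).open_target
      contMDiffOn_toFun := Φ.contMDiffOn_toFun.mono fun z hz => by
        rw [OpenPartialHomeomorph.restrOpen_source] at hz; exact hz.1
      contMDiffOn_invFun := Φ.contMDiffOn_invFun.mono fun z hz =>
        hz.1 }
  have hΦ's : ∀ z, z ∈ Φ'.source ↔ z ∈ Φ.source ∧ z ∈ O := fun z => by
    change z ∈ (Φ.toOpenPartialHomeomorph.restrOpen O hO).source ↔ _
    rw [OpenPartialHomeomorph.restrOpen_source]; rfl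
  let T := ((chartDiffeo I₁ x).trans Φ').trans (chartDiffeo I₂ (f x)).symm
  have hTs : ∀ y, y ∈ T.source ↔ (y ∈ φ.source ∧ φ y ∈ Φ'.source) ∧ Φ (φ y) ∈ ψ.target := by
    intro y
    rfl
  refine ⟨T, ?_, ?_⟩
  · rw [hTs, hΦ's]
    refine ⟨⟨mem_extChartAt_source x, hΦx, hxO⟩, ?_⟩
    rw [← hΦ hΦx]
    change ψ (f (φ.symm (φ x))) ∈ ψ.target
    rw [extChartAt_to_inv x]
    exact mem_extChartAt_target (f x)
  · intro y hy
    rw [hTs, hΦ's] at hy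
    obtain ⟨⟨h1, h2, h3⟩, h4⟩ := hy
    change f y = ψ.symm (Φ (φ y))
    rw [← hΦ h2]
    change f y = ψ.symm (ψ (f (φ.symm (φ y))))
    have h5 := h3.2.2
    rw [φ.left_inv h1] at h5 ⊢
    rw [ψ.left_inv h5]

theorem md_bijective_of_isLocalDiffeomorphAt {f : M₁ → M₂} {x : M₁}
    (hf : IsLocalDiffeomorphAt I₁ I₂ ∞ f x) : Function.Bijective (md I₁ I₂ f x) := by
  have := (hf.mfderivToContinuousLinearEquiv (by simp)).bijective
  exact this

/-- An injective local diffeomorphism is a partial diffeomorphism. -/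
theorem exists_partialDiffeomorph_of_injOn [Nonempty M₁] {f : M₁ → M₂} {s : Set M₁} (hs : IsOpen s)
    (hf : ∀ x ∈ s, IsLocalDiffeomorphAt I₁ I₂ ∞ f x) (hinj : InjOn f s) :
    ∃ e : PartialDiffeomorph I₁ I₂ M₁ M₂ ∞, e.source = s ∧ e.toFun = f := by
  -- Near `f x` the global inverse on `f '' s` coincides with the inverse of any partial
  -- diffeomorphism representing `f` at `x`, by injectivity on `s`.
  have key : ∀ x ∈ s, f '' s ∈ 𝓝 (f x) ∧
      ContMDiffAt I₂ I₁ ∞ (hinj.toPartialEquiv f s).symm (f x) := by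
    intro x hx
    obtain ⟨Φ, hΦx, hΦ⟩ := hf x hx
    have hev : ∀ᶠ z in 𝓝 (f x), z ∈ Φ.target ∧ Φ.symm z ∈ s := by
      have hfx : f x ∈ Φ.target := by rw [hΦ hΦx]; exact Φ.map_source hΦx
      refine Filter.Eventually.and (Φ.open_target.mem_nhds hfx) ?_
      have hc : ContinuousAt Φ.symm (f x) :=
        Φ.contMDiffOn_invFun.continuousOn.continuousAt (Φ.open_target.mem_nhds hfx)
      refine hc.preimage_mem_nhds (hs.mem_nhds ?_)
      rw [hΦ hΦx]
      change Φ.toPartialEquiv.symm (Φ.toPartialEquiv x) ∈ s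
      rwa [Φ.left_inv hΦx]
    have hfs : ∀ z, z ∈ Φ.target → f (Φ.symm z) = z := fun z hz =>
      (hΦ (Φ.map_target hz)).trans (Φ.right_inv hz)
    refine ⟨?_, ?_⟩
    · filter_upwards [hev] with z hz using ⟨Φ.symm z, hz.2, hfs z hz.1⟩
    · have hfx : f x ∈ Φ.target := by rw [hΦ hΦx]; exact Φ.map_source hΦx
      have hsm : ContMDiffAt I₂ I₁ ∞ Φ.symm (f x) :=
        Φ.contMDiffOn_invFun.contMDiffAt (Φ.open_target.mem_nhds hfx)
      refine hsm.congr_of_eventuallyEq ?_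
      filter_upwards [hev] with z hz
      have h1 : (hinj.toPartialEquiv f s).symm (f (Φ.symm z)) = Φ.symm z :=
        (hinj.toPartialEquiv f s).left_inv hz.2
      rwa [hfs z hz.1] at h1
  refine ⟨⟨hinj.toPartialEquiv f s, hs, ?_, ?_, ?_⟩, rfl, rfl⟩
  · refine isOpen_iff_mem_nhds.mpr ?_
    rintro _ ⟨x, hx, rfl⟩
    exact (key x hx).1
  · exact fun x hx => (hf x hx).contMDiffAt.contMDiffWithinAt
  · rintro _ ⟨x, hx, rfl⟩
    exact (key x hx).2.contMDiffWithinAt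

/-- A submersion has local sections. -/
theorem exists_section_of_isSubmersionAt [I₁.Boundaryless] [IsManifold I₁ ∞ M₁] [I₂.Boundaryless]
    [IsManifold I₂ ∞ M₂] {f : M₁ → M₂}
    {x : M₁} (hf : Manifold.IsSubmersionAt I₁ I₂ ∞ f x) :
    ∃ s : M₂ → M₁, ContMDiffAt I₂ I₁ ∞ s (f x) ∧ s (f x) = x ∧ ∀ᶠ z in 𝓝 (f x), f (s z) = z := by
  obtain ⟨C, _, _, h⟩ := hf
  let φ := h.domChart.extend I₁
  let ψ := h.codChart.extend I₂
  have hx : x ∈ h.domChart.source := h.mem_domChart_source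
  have hfx : f x ∈ h.codChart.source := h.mem_codChart_source
  have hw : ∀ z ∈ φ.target, ψ (f (φ.symm z)) = (h.equiv z).1 := fun z hz => h.writtenInCharts hz
  have hxφ : x ∈ φ.source := by simpa [φ] using hx
  have hφx : φ.symm (φ x) = x := φ.left_inv hxφ
  have h0 : ψ (f x) = (h.equiv (φ x)).1 := by
    have := hw (φ x) (φ.map_source hxφ)
    rwa [hφx] at this
  -- In submersion charts `f` is the first projection; the section is `w ↦ (w, c)`, with the fibre
  -- coordinate of `x` held fixed.
  let c := (h.equiv (φ x)).2
  let t : M₂ → E₁ := fun z => h.equiv.symm (ψ z, c)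
  have ht0 : t (f x) = φ x := by simp [t, h0, c]
  have hψs : ContMDiffAt I₂ 𝓘(ℝ, E₂) ∞ ψ (f x) :=
    (I₂.contMDiff (n := ∞)).contMDiffAt.comp (f x)
      (contMDiffAt_of_mem_maximalAtlas h.codChart_mem_maximalAtlas hfx)
  have ht : ContMDiffAt I₂ 𝓘(ℝ, E₁) ∞ t (f x) := by
    have h1 : ContDiff ℝ ∞ (fun w : E₂ => h.equiv.symm (w, c)) :=
      h.equiv.symm.contDiff.comp (contDiff_id.prodMk contDiff_const)
    exact h1.contMDiff.contMDiffAt.comp (f x) hψs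
  have htarget : φ.target ∈ 𝓝 (φ x) := by
    exact (h.domChart.isOpen_extend_target (I := I₁)).mem_nhds (φ.map_source hxφ)
  have hφs : ContMDiffAt 𝓘(ℝ, E₁) I₁ ∞ φ.symm (φ x) :=
    (contMDiffOn_extend_symm h.domChart_mem_maximalAtlas).contMDiffAt (by
      rw [← h.domChart.extend_target']; exact htarget)
  refine ⟨fun z => φ.symm (t z), ?_, by simp only [ht0, hφx], ?_⟩
  · exact ContMDiffAt.comp_of_eq hφs ht ht0
  · have e1 : ∀ᶠ z in 𝓝 (f x), t z ∈ φ.target := by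
      refine ht.continuousAt.preimage_mem_nhds ?_
      rwa [ht0]
    have e2 : ∀ᶠ z in 𝓝 (f x), z ∈ h.codChart.source := h.codChart.open_source.mem_nhds hfx
    filter_upwards [e1, e2] with z h1 h2
    have h3 := hw (t z) h1
    have h4 : f (φ.symm (t z)) ∈ h.codChart.source :=
      h.source_subset_preimage_source (by simpa [φ] using φ.map_target h1)
    have h5 : ψ (f (φ.symm (t z))) = ψ z := by rw [h3]; simp [t]
    exact ψ.injOn (by simpa [ψ] using h4) (by simpa [ψ] using h2) h5

/-- The derivative of a local section through `x` is a right inverse. -/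
theorem md_surjective_of_isSubmersionAt [I₁.Boundaryless] [IsManifold I₁ ∞ M₁] [I₂.Boundaryless]
    [IsManifold I₂ ∞ M₂] {f : M₁ → M₂} {x : M₁} (hf : Manifold.IsSubmersionAt I₁ I₂ ∞ f x) :
    Function.Surjective (md I₁ I₂ f x) := by
  obtain ⟨s, hs, hsx, hfs⟩ := exists_section_of_isSubmersionAt hf
  have hfd : MDifferentiableAt I₁ I₂ f x := by
    obtain ⟨C, _, _, h⟩ := hf
    exact h.contMDiffAt.mdifferentiableAt (by simp)
  have h1 := md_comp_of_eq (g := f) (f := s) hfd (hs.mdifferentiableAt (by simp)) hsx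
  rw [md_congr (g := fun z => z) hfs, md_id] at h1
  intro w
  exact ⟨md I₂ I₁ s (f x) w, (DFunLike.congr_fun h1 w).symm⟩

end LocalDiffeo

/-! ### Global functions with prescribed germ or differential -/

section Bump

variable {E : Type*} [NormedAddCommGroup E] [NormedSpace ℝ E] [FiniteDimensional ℝ E]
  {M : Type*} [TopologicalSpace M] [ChartedSpace E M] [IsManifold 𝓘(ℝ, E) ∞ M] [T2Space M]

/-- A smooth function on a neighbourhood of a point agrees near this point with a global one. -/
theorem exists_smoothFun_eventuallyEq {f : M → ℝ} {s : Set M} (hs : IsOpen s) {x : M} (hx : x ∈ s)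
    (hf : ContMDiffOn 𝓘(ℝ, E) 𝓘(ℝ, ℝ) ∞ f s) : ∃ F : M → ℝ, SmoothFun E F ∧ F =ᶠ[𝓝 x] f := by
  obtain ⟨χ, -, hχ⟩ := (SmoothBumpFunction.nhds_basis_tsupport (I := 𝓘(ℝ, E)) x).mem_iff.mp
    (hs.mem_nhds hx)
  refine ⟨fun y => χ y • f y, contMDiff_of_tsupport fun y hy => ?_, ?_⟩
  · have hy' : y ∈ s := hχ (tsupport_smul_subset_left _ _ hy)
    exact χ.contMDiff.contMDiffAt.smul (hf.contMDiffAt (hs.mem_nhds hy'))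
  · filter_upwards [χ.eventuallyEq_one] with y hy
    simp [hy]

/-- Every covector is the differential of a smooth function. -/
theorem exists_smoothFun_md_eq (x : M) (α : E →L[ℝ] ℝ) :
    ∃ F : M → ℝ, SmoothFun E F ∧ md 𝓘(ℝ, E) 𝓘(ℝ, ℝ) F x = α := by
  have hc : ContMDiffOn 𝓘(ℝ, E) 𝓘(ℝ, E) ∞ (extChartAt 𝓘(ℝ, E) x) (chartAt E x).source :=
    contMDiffOn_extChartAt
  obtain ⟨F, hF, hFx⟩ := exists_smoothFun_eventuallyEq (f := fun y => α (extChartAt 𝓘(ℝ, E) x y))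
    (chartAt E x).open_source (mem_chart_source E x)
    (α.contDiff.contMDiff.comp_contMDiffOn hc)
  refine ⟨F, hF, ?_⟩
  rw [md_congr hFx, md_comp (g := α) α.differentiableAt.mdifferentiableAt
    ((contMDiffAt_extChartAt (n := ∞)).mdifferentiableAt (by simp)), md_extChartAt_self,
        md_eq_fderiv]
  simp

end Bump

/-! ### Lie bracket of vector fields as a commutator of derivations -/

section LieBracket

variable {E : Type*} [NormedAddCommGroup E] [NormedSpace ℝ E] [CompleteSpace E]
  {M : Type*} [TopologicalSpace M] [ChartedSpace E M] [IsManifold 𝓘(ℝ, E) ∞ M]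

/-- The Lie bracket of vector fields acts on functions as the commutator. -/
theorem md_mlieBracket {V W : ∀ x : M, TangentSpace 𝓘(ℝ, E) x} {x : M}
    (hV : MDifferentiableAt 𝓘(ℝ, E) 𝓘(ℝ, E).tangent (fun y => (V y : TangentBundle 𝓘(ℝ, E) M)) x)
    (hW : MDifferentiableAt 𝓘(ℝ, E) 𝓘(ℝ, E).tangent (fun y => (W y : TangentBundle 𝓘(ℝ, E) M)) x)
    {f : M → ℝ} (hf : ContMDiff 𝓘(ℝ, E) 𝓘(ℝ, ℝ) ∞ f) :
    md 𝓘(ℝ, E) 𝓘(ℝ, ℝ) f x (VectorField.mlieBracket 𝓘(ℝ, E) V W x) =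
      md 𝓘(ℝ, E) 𝓘(ℝ, ℝ) (fun y => md 𝓘(ℝ, E) 𝓘(ℝ, ℝ) f y (W y)) x (V x) -
      md 𝓘(ℝ, E) 𝓘(ℝ, ℝ) (fun y => md 𝓘(ℝ, E) 𝓘(ℝ, ℝ) f y (V y)) x (W x) := by
  have : IsManifold 𝓘(ℝ, E) 2 M := .of_le (n := ∞) ENat.LEInfty.out
  have : IsManifold 𝓘(ℝ, E) 1 M := .of_le (n := ∞) ENat.LEInfty.out
  let φ := extChartAt 𝓘(ℝ, E) x
  -- Vector fields pulled back to the chart at `x`. The bracket on the manifold is that of these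
  -- fields, so the identity becomes the one in a vector space, which is symmetry of the second
  -- derivative of `f` in the chart.
  let t : (∀ x : M, TangentSpace 𝓘(ℝ, E) x) → E → E := fun V =>
    VectorField.mpullbackWithin 𝓘(ℝ, E) 𝓘(ℝ, E) φ.symm V (range 𝓘(ℝ, E))
  have hdiff : ∀ V : ∀ x : M, TangentSpace 𝓘(ℝ, E) x,
      MDifferentiableAt 𝓘(ℝ, E) 𝓘(ℝ, E).tangent (fun y => (V y : TangentBundle 𝓘(ℝ, E) M)) x →
      DifferentiableAt ℝ (t V) (φ x) := fun V hV => by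
    have h1 : MDifferentiableWithinAt 𝓘(ℝ, E) 𝓘(ℝ, E).tangent
      (fun y => (V y : TangentBundle 𝓘(ℝ, E) M)) univ x := hV.mdifferentiableWithinAt
    have h2 : DifferentiableWithinAt ℝ (t V) (φ.symm ⁻¹' univ ∩ range 𝓘(ℝ, E)) (φ x) :=
      h1.differentiableWithinAt_mpullbackWithin_vectorField
    exact h2.differentiableAt (by simp)
  have hfφ : ContDiffAt ℝ ∞ (fun z => f (φ.symm z)) (φ x) :=
    contMDiffAt_iff_contDiffAt.mp (hf.contMDiffAt.comp (φ x) (contMDiffAt_extChartAt_symm x))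
  have key : ∀ V : ∀ x : M, TangentSpace 𝓘(ℝ, E) x, ∀ z ∈ φ.target,
      fderiv ℝ (fun z => f (φ.symm z)) z (t V z) = md 𝓘(ℝ, E) 𝓘(ℝ, ℝ) f (φ.symm z)
          (V (φ.symm z)) := by
    intro V z hz
    have hinv : (mfderivWithin 𝓘(ℝ, E) 𝓘(ℝ, E) φ.symm (range 𝓘(ℝ, E)) z).IsInvertible :=
      isInvertible_mfderivWithin_extChartAt_symm hz
    have h1 : mfderivWithin 𝓘(ℝ, E) 𝓘(ℝ, E) φ.symm (range 𝓘(ℝ, E)) z (t V z) = V (φ.symm z) := by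
      obtain ⟨L, hL⟩ := hinv
      change mfderivWithin 𝓘(ℝ, E) 𝓘(ℝ, E) φ.symm (range 𝓘(ℝ, E)) z
        ((mfderivWithin 𝓘(ℝ, E) 𝓘(ℝ, E) φ.symm (range 𝓘(ℝ, E)) z).inverse (V (φ.symm z))) = _
      rw [← hL, ContinuousLinearMap.inverse_equiv]
      exact L.apply_symm_apply _
    have h2 : mfderivWithin 𝓘(ℝ, E) 𝓘(ℝ, E) φ.symm (range 𝓘(ℝ, E)) z =
        mfderiv 𝓘(ℝ, E) 𝓘(ℝ, E) φ.symm z := by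
      rw [ModelWithCorners.range_eq_univ, mfderivWithin_univ]
    have hs : MDifferentiableAt 𝓘(ℝ, E) 𝓘(ℝ, E) φ.symm z :=
      ((contMDiffOn_extChartAt_symm (n := ∞) x).contMDiffAt
        ((isOpen_extChartAt_target x).mem_nhds hz)).mdifferentiableAt (by simp)
    have h3 := md_comp (g := f) (f := φ.symm) (x := z)
      (hf.contMDiffAt.mdifferentiableAt (by simp)) hs
    rw [md_eq_fderiv] at h3
    rw [h3]
    refine congrArg (md 𝓘(ℝ, E) 𝓘(ℝ, ℝ) f (φ.symm z)) ?_
    exact (DFunLike.congr_fun h2 (t V z)).symm.trans h1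
  have ht0 : ∀ V : ∀ x : M, TangentSpace 𝓘(ℝ, E) x, t V (φ x) = V x := fun V => by
    have h2 : mfderivWithin 𝓘(ℝ, E) 𝓘(ℝ, E) φ.symm (range 𝓘(ℝ, E)) (φ x) =
        mfderiv 𝓘(ℝ, E) 𝓘(ℝ, E) φ.symm (φ x) := by
      rw [ModelWithCorners.range_eq_univ, mfderivWithin_univ]
    let L : E →L[ℝ] E := mfderivWithin 𝓘(ℝ, E) 𝓘(ℝ, E) φ.symm (range 𝓘(ℝ, E)) (φ x)
    have h3 : L = ContinuousLinearMap.id ℝ E := h2.trans (md_extChartAt_symm_self x)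
    have h4 : t V (φ x) = L.inverse (V (φ.symm (φ x)) : E) := rfl
    rw [h4, h3, ContinuousLinearMap.inverse_id]
    change (V (φ.symm (φ x)) : E) = V x
    rw [extChartAt_to_inv x]
  have hbr : (VectorField.mlieBracket 𝓘(ℝ, E) V W x : E) =
      VectorField.lieBracket ℝ (t V) (t W) (φ x) := by
    have h4 : (VectorField.mlieBracket 𝓘(ℝ, E) V W x : E) = ContinuousLinearMap.inverse
      (md 𝓘(ℝ, E) 𝓘(ℝ, E) φ x) (VectorField.lieBracketWithin ℝ (t V) (t W)
        (φ.symm ⁻¹' univ ∩ range 𝓘(ℝ, E)) (φ x)) := rfl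
    rw [h4, md_extChartAt_self, ContinuousLinearMap.inverse_id, preimage_univ,
      ModelWithCorners.range_eq_univ, univ_inter, VectorField.lieBracketWithin_univ]
    rfl
  have hmain := VectorField.fderiv_apply_lieBracket (V := t V) (W := t W) hfφ
    (by simp; exact ENat.LEInfty.out) (hdiff W hW) (hdiff V hV)
  have houter : ∀ V : ∀ x : M, TangentSpace 𝓘(ℝ, E) x,
      MDifferentiableAt 𝓘(ℝ, E) 𝓘(ℝ, E).tangent (fun y => (V y : TangentBundle 𝓘(ℝ, E) M)) x →
      md 𝓘(ℝ, E) 𝓘(ℝ, ℝ) (fun y => md 𝓘(ℝ, E) 𝓘(ℝ, ℝ) f y (V y)) x =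
        fderiv ℝ (fun z => fderiv ℝ (fun z => f (φ.symm z)) z (t V z)) (φ x) := fun V hV => by
    have hd : DifferentiableAt ℝ (fun z => fderiv ℝ (fun z => f (φ.symm z)) z (t V z)) (φ x) :=
      ((hfφ.fderiv_right (m := 1) (by norm_cast)).differentiableAt (by simp)).clm_apply (hdiff V hV)
    have he : (fun y => md 𝓘(ℝ, E) 𝓘(ℝ, ℝ) f y (V y)) =ᶠ[𝓝 x]
        fun y => (fun z => fderiv ℝ (fun z => f (φ.symm z)) z (t V z)) (φ y) := by
      filter_upwards [extChartAt_source_mem_nhds (I := 𝓘(ℝ, E)) x] with y hy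
      rw [key V (φ y) (φ.map_source hy), φ.left_inv hy]
    rw [md_congr he, md_comp (g := fun z => fderiv ℝ (fun z => f (φ.symm z)) z (t V z)) (f := φ)
      hd.mdifferentiableAt ((contMDiffAt_extChartAt (n := ∞)).mdifferentiableAt (by simp)),
      md_extChartAt_self, md_eq_fderiv]
    rfl
  rw [houter V hV, houter W hW]
  rw [ht0, ht0] at hmain
  have hfin : md 𝓘(ℝ, E) 𝓘(ℝ, ℝ) f x (VectorField.mlieBracket 𝓘(ℝ, E) V W x) =
      fderiv ℝ (fun z => f (φ.symm z)) (φ x) (VectorField.lieBracket ℝ (t V) (t W) (φ x)) := by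
    rw [md_eq_fderiv_extChartAt (hf.contMDiffAt.mdifferentiableAt (by simp))]
    exact congrArg _ hbr
  exact hfin.trans hmain

end LieBracket

/-! ### Differentials of real functions -/

section Differential

variable {E : Type*} [NormedAddCommGroup E] [NormedSpace ℝ E]
  {M : Type*} [TopologicalSpace M] [ChartedSpace E M]
  {F : Type*} [NormedAddCommGroup F] [NormedSpace ℝ F]
  {N : Type*} [TopologicalSpace N] [ChartedSpace F N]

variable (E) in
/-- The differential of a real function, as a functional on the model space. -/
def dR (f : M → ℝ) (x : M) : E →L[ℝ] ℝ := md 𝓘(ℝ, E) 𝓘(ℝ, ℝ) f x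

theorem dR_comp {f : N → ℝ} {g : M → N} {x : M} {y : N}
    (hf : MDifferentiableAt 𝓘(ℝ, F) 𝓘(ℝ, ℝ) f y)
    (hg : MDifferentiableAt 𝓘(ℝ, E) 𝓘(ℝ, F) g x) (h : g x = y) :
    dR E (fun z => f (g z)) x = (dR F f y).comp (md 𝓘(ℝ, E) 𝓘(ℝ, F) g x) :=
  md_comp_of_eq hf hg h

theorem dR_comp_apply {f : N → ℝ} {g : M → N} {x : M} {y : N}
    (hf : MDifferentiableAt 𝓘(ℝ, F) 𝓘(ℝ, ℝ) f y)
    (hg : MDifferentiableAt 𝓘(ℝ, E) 𝓘(ℝ, F) g x) (h : g x = y) (v : E) :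
    dR E (fun z => f (g z)) x v = dR F f y (md 𝓘(ℝ, E) 𝓘(ℝ, F) g x v) := by
  rw [dR_comp hf hg h]; rfl

theorem dR_congr {f g : M → ℝ} {x : M} (h : f =ᶠ[𝓝 x] g) : dR E f x = dR E g x := md_congr h

theorem SmoothFun.mdiff {f : M → ℝ} (hf : SmoothFun E f) (x : M) :
    MDifferentiableAt 𝓘(ℝ, E) 𝓘(ℝ, ℝ) f x :=
  ContMDiffAt.mdifferentiableAt (hf x) (by simp)

theorem _root_.ContMDiff.mdiff {f : M → N} (hf : ContMDiff 𝓘(ℝ, E) 𝓘(ℝ, F) ∞ f) (x : M) :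
    MDifferentiableAt 𝓘(ℝ, E) 𝓘(ℝ, F) f x :=
  ContMDiffAt.mdifferentiableAt (hf x) (by simp)

theorem dR_add {f g : M → ℝ} {x : M} (hf : MDifferentiableAt 𝓘(ℝ, E) 𝓘(ℝ, ℝ) f x)
    (hg : MDifferentiableAt 𝓘(ℝ, E) 𝓘(ℝ, ℝ) g x) :
    dR E (fun y => f y + g y) x = dR E f x + dR E g x :=
  mfderiv_add hf hg

theorem dR_sub {f g : M → ℝ} {x : M} (hf : MDifferentiableAt 𝓘(ℝ, E) 𝓘(ℝ, ℝ) f x)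
    (hg : MDifferentiableAt 𝓘(ℝ, E) 𝓘(ℝ, ℝ) g x) :
    dR E (fun y => f y - g y) x = dR E f x - dR E g x :=
  mfderiv_sub hf hg

theorem dR_mul {f g : M → ℝ} {x : M} (hf : MDifferentiableAt 𝓘(ℝ, E) 𝓘(ℝ, ℝ) f x)
    (hg : MDifferentiableAt 𝓘(ℝ, E) 𝓘(ℝ, ℝ) g x) :
    dR E (fun y => f y * g y) x = f x • dR E g x + g x • dR E f x :=
  (hf.hasMFDerivAt.mul hg.hasMFDerivAt).mfderiv

theorem dR_const_smul {f : M → ℝ} {x : M} (c : ℝ) (hf : MDifferentiableAt 𝓘(ℝ, E) 𝓘(ℝ, ℝ) f x) :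
    dR E (fun y => c * f y) x = c • dR E f x :=
  const_smul_mfderiv hf c

end Differential

/-! ### Translations, adjoint action and infinitesimal actions -/

section Group

variable {E : Type*} [NormedAddCommGroup E] [NormedSpace ℝ E]
  {G : Type*} [TopologicalSpace G] [ChartedSpace E G] [Group G]
  {F : Type*} [NormedAddCommGroup F] [NormedSpace ℝ F]
  {M : Type*} [TopologicalSpace M] [ChartedSpace F M] [MulAction G M]

variable (E) in
/-- The adjoint action on the model space. -/
def adMap (k : G) : E →L[ℝ] E := md 𝓘(ℝ, E) 𝓘(ℝ, E) (fun x : G => k * x * k⁻¹) 1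

variable (E) in
/-- Left translation to `k` on the model space. -/
def leftMap (k : G) : E →L[ℝ] E := md 𝓘(ℝ, E) 𝓘(ℝ, E) (fun x : G => k * x) 1

variable (E) in
/-- Right translation to `k` on the model space. -/
def rightMap (k : G) : E →L[ℝ] E := md 𝓘(ℝ, E) 𝓘(ℝ, E) (fun x : G => x * k) 1

variable (E G F) in
/-- The derivative of the orbit map at the identity, on the model spaces. -/
def actMap (m : M) : E →L[ℝ] F := md 𝓘(ℝ, E) 𝓘(ℝ, F) (fun k : G => k • m) 1

variable (E G) in
/-- The Lie bracket on the model space. -/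
def lieBr (a b : E) : E :=
  Bracket.bracket (L := GroupLieAlgebra 𝓘(ℝ, E) G) (M := GroupLieAlgebra 𝓘(ℝ, E) G) a b

theorem adMap_one : adMap E (1 : G) = ContinuousLinearMap.id ℝ E := by
  rw [adMap, ← md_id (I₁ := 𝓘(ℝ, E)) (1 : G)]
  simp

theorem leftMap_one : leftMap E (1 : G) = ContinuousLinearMap.id ℝ E := by
  rw [leftMap, ← md_id (I₁ := 𝓘(ℝ, E)) (1 : G)]
  simp

/-- Derivatives along orbits become derivatives at `1 ∈ G` of a function that is smooth on `G × M`.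
Their smoothness in `m`, and the exchange with other derivatives, then follow from `contMDiffAt_md`
and `md_md_comm`. The vector field `ξ_M` is the negative of `actMap`. -/
theorem dR_actMap [ContMDiffSMul 𝓘(ℝ, E) 𝓘(ℝ, F) ∞ G M] {f : M → ℝ} (hf : SmoothFun F f) (m : M)
    (ξ : E) : dR F f m (actMap E G F m ξ) = dR E (fun k : G => f (k • m)) 1 ξ :=
  have hact : ContMDiff 𝓘(ℝ, E) 𝓘(ℝ, F) ∞ (fun k : G => k • m) :=
    contMDiff_id.smul contMDiff_const
  (dR_comp_apply (hf.mdiff _) (hact.mdiff _) (by simp) ξ).symm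

section

variable [LieGroup 𝓘(ℝ, E) ∞ G]

theorem contMDiff_mulLeft (k : G) : ContMDiff 𝓘(ℝ, E) 𝓘(ℝ, E) ∞ (fun x : G => k * x) :=
  contMDiff_mul_left

theorem contMDiff_mulRight (k : G) : ContMDiff 𝓘(ℝ, E) 𝓘(ℝ, E) ∞ (fun x : G => x * k) :=
  contMDiff_mul_right

theorem contMDiff_conj (k : G) : ContMDiff 𝓘(ℝ, E) 𝓘(ℝ, E) ∞ (fun x : G => k * x * k⁻¹) :=
  (contMDiff_mulRight k⁻¹).comp (contMDiff_mulLeft k)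

theorem contMDiff_mul₂ :
    ContMDiff (𝓘(ℝ, E).prod 𝓘(ℝ, E)) 𝓘(ℝ, E) ∞ (fun p : G × G => p.1 * p.2) :=
  contMDiff_mul 𝓘(ℝ, E) ∞

theorem adMap_mul (k l : G) : adMap E (k * l) = (adMap E k).comp (adMap E l) := by
  have h := md_comp_of_eq (g := fun x : G => k * x * k⁻¹) (f := fun x : G => l * x * l⁻¹)
    (x := 1) (y := 1) ((contMDiff_conj (E := E) k).mdiff _) ((contMDiff_conj (E := E) l).mdiff _)
        (by simp)
  refine Eq.trans ?_ h
  exact congrArg (fun f : G → G => md 𝓘(ℝ, E) 𝓘(ℝ, E) f 1) (by ext x; simp [mul_assoc])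

theorem adMap_inv_apply (k : G) (ξ : E) : adMap E k⁻¹ (adMap E k ξ) = ξ := by
  have := adMap_mul (E := E) k⁻¹ k
  rw [inv_mul_cancel, adMap_one] at this
  exact (DFunLike.congr_fun this ξ).symm

theorem adMap_apply_inv (k : G) (ξ : E) : adMap E k (adMap E k⁻¹ ξ) = ξ := by
  have := adMap_inv_apply k⁻¹ ξ
  rwa [inv_inv] at this

/-- From `x k = k (k⁻¹ x k)`. It allows everything to be written in the left trivialization, where
`Ad` is the only operator that remains. -/
theorem rightMap_eq (k : G) (ξ : E) : rightMap E k ξ = leftMap E k (adMap E k⁻¹ ξ) := by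
  have h := md_comp_of_eq (g := fun x : G => k * x) (f := fun x : G => k⁻¹ * x * k⁻¹⁻¹)
    (x := 1) (y := 1) ((contMDiff_mulLeft (E := E) k).mdiff _)
        ((contMDiff_conj (E := E) k⁻¹).mdiff _) (by simp)
  refine Eq.trans ?_ (DFunLike.congr_fun h ξ)
  exact congrArg (fun f : G → G => md 𝓘(ℝ, E) 𝓘(ℝ, E) f 1 ξ) (by ext x; simp [mul_assoc])

theorem md_mul_leftMap (k l : G) (ξ : E) :
    md 𝓘(ℝ, E) 𝓘(ℝ, E) (fun x : G => k * x) l (leftMap E l ξ) = leftMap E (k * l) ξ := by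
  have h := md_comp_of_eq (g := fun x : G => k * x) (f := fun x : G => l * x)
    (x := 1) (y := l) ((contMDiff_mulLeft (E := E) k).mdiff _)
        ((contMDiff_mulLeft (E := E) l).mdiff _) (by simp)
  refine Eq.trans (DFunLike.congr_fun h ξ).symm ?_
  exact congrArg (fun f : G → G => md 𝓘(ℝ, E) 𝓘(ℝ, E) f 1 ξ) (by ext x; simp [mul_assoc])

theorem leftMap_bijective (k : G) : Function.Bijective (leftMap E k) := by
  have h := md_comp_of_eq (g := fun x : G => k * x) (f := fun x : G => k⁻¹ * x)
    (x := k) (y := 1) ((contMDiff_mulLeft (E := E) k).mdiff _)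
        ((contMDiff_mulLeft (E := E) k⁻¹).mdiff _) (by simp)
  have h' : ∀ w : E, w = leftMap E k (md 𝓘(ℝ, E) 𝓘(ℝ, E) (fun x : G => k⁻¹ * x) k w) := fun w => by
    refine Eq.trans ?_ (DFunLike.congr_fun h w)
    simp only [mul_inv_cancel_left]
    rw [md_id]; rfl
  refine ⟨fun a b hab => ?_, fun w => ⟨_, (h' w).symm⟩⟩
  have := congrArg (md 𝓘(ℝ, E) 𝓘(ℝ, E) (fun x : G => k⁻¹ * x) k) hab
  rw [md_mul_leftMap, md_mul_leftMap, inv_mul_cancel, leftMap_one] at this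
  exact this

/-- The derivative of `k ↦ k u k⁻¹` at the identity. -/
theorem md_conj_orbit (u : G) (ξ : E) :
    md 𝓘(ℝ, E) 𝓘(ℝ, E) (fun k : G => k * u * k⁻¹) 1 ξ = rightMap E u ξ - leftMap E u ξ := by
  have hinv : ContMDiff 𝓘(ℝ, E) 𝓘(ℝ, E) ∞ (fun k : G => k⁻¹) := contMDiff_inv 𝓘(ℝ, E) ∞
  have hc : ContMDiff 𝓘(ℝ, E) 𝓘(ℝ, E) ∞ (fun k : G => k * u * k⁻¹) :=
    (contMDiff_mulRight u).mul hinv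
  -- Differentiating the product `(k u k⁻¹) k = k u` avoids the derivative of inversion.
  have h := md_comp₂ (f := fun p : G × G => p.1 * p.2) (g := fun k : G => k * u * k⁻¹)
    (h := fun k : G => k) (x := 1) (I₁ := 𝓘(ℝ, E)) (I₄ := 𝓘(ℝ, E))
    (contMDiff_mul₂.contMDiffAt.mdifferentiableAt (by simp))
    (hc.mdiff 1) mdifferentiableAt_id ξ
  have e1 : (fun k : G => (k * u * k⁻¹, k).1 * (k * u * k⁻¹, k).2) = fun k => k * u := by
    ext k; simp
  rw [e1] at h
  have e2 : md 𝓘(ℝ, E) 𝓘(ℝ, E) (fun z : G => z * 1) (1 * u * 1⁻¹)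
      = ContinuousLinearMap.id ℝ E := by
    rw [← md_id (I₁ := 𝓘(ℝ, E)) (1 * u * 1⁻¹ : G)]; simp
  have e3 : (fun z : G => 1 * u * 1⁻¹ * z) = fun z => u * z := by ext z; simp
  change rightMap E u ξ = md 𝓘(ℝ, E) 𝓘(ℝ, E) (fun z : G => z * 1) (1 * u * 1⁻¹)
    (md 𝓘(ℝ, E) 𝓘(ℝ, E) (fun k : G => k * u * k⁻¹) 1 ξ) +
    md 𝓘(ℝ, E) 𝓘(ℝ, E) (fun z : G => 1 * u * 1⁻¹ * z) 1 (md 𝓘(ℝ, E) 𝓘(ℝ, E) (fun k : G => k) 1 ξ)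
        at h
  rw [e2, e3, md_id] at h
  rw [h]
  change _ = _ + leftMap E u ξ - leftMap E u ξ
  simp

theorem md_equivariant_actMap [ContMDiffSMul 𝓘(ℝ, E) 𝓘(ℝ, F) ∞ G M] {Φ : M → G}
    (hΦ : ContMDiff 𝓘(ℝ, F) 𝓘(ℝ, E) ∞ Φ) (heq : ∀ (k : G) (m : M), Φ (k • m) = k * Φ m * k⁻¹)
    (m : M) (ξ : E) :
    md 𝓘(ℝ, F) 𝓘(ℝ, E) Φ m (actMap E G F m ξ) = rightMap E (Φ m) ξ - leftMap E (Φ m) ξ := by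
  have hact : ContMDiff 𝓘(ℝ, E) 𝓘(ℝ, F) ∞ (fun k : G => k • m) :=
    contMDiff_id.smul contMDiff_const
  have h := md_comp_of_eq (g := Φ) (f := fun k : G => k • m) (x := 1) (y := m) (hΦ.mdiff _)
    (hact.mdiff _) (by simp)
  refine Eq.trans (DFunLike.congr_fun h ξ).symm ?_
  simp only [heq]
  exact md_conj_orbit (Φ m) ξ

/-- `Ad_k` intertwines the infinitesimal action. -/
theorem md_smul_actMap [ContMDiffSMul 𝓘(ℝ, E) 𝓘(ℝ, F) ∞ G M] (k : G) (m : M) (ξ : E) :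
    md 𝓘(ℝ, F) 𝓘(ℝ, F) (fun x : M => k • x) m (actMap E G F m ξ) =
      actMap E G F (k • m) (adMap E k ξ) := by
  have hact : ∀ m : M, ContMDiff 𝓘(ℝ, E) 𝓘(ℝ, F) ∞ (fun k : G => k • m) := fun m =>
    contMDiff_id.smul contMDiff_const
  have hk : ContMDiff 𝓘(ℝ, F) 𝓘(ℝ, F) ∞ (fun x : M => k • x) :=
    ContMDiffSMul.contMDiff_const_smul (I := 𝓘(ℝ, E)) k
  have h := md_comp_of_eq (g := fun x : M => k • x) (f := fun k : G => k • m) (x := 1) (y := m)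
    (hk.mdiff _) ((hact m).mdiff _) (by simp)
  have h' := md_comp_of_eq (g := fun l : G => l • k • m) (f := fun x : G => k * x * k⁻¹)
    (x := 1) (y := 1) ((hact (k • m)).mdiff _) ((contMDiff_conj (E := E) k).mdiff _) (by simp)
  refine (DFunLike.congr_fun h ξ).symm.trans (Eq.trans ?_ (DFunLike.congr_fun h' ξ))
  exact congrArg (fun f : G → M => md 𝓘(ℝ, E) 𝓘(ℝ, F) f 1 ξ) (by ext x; simp [smul_smul])

theorem dR_leftMap {f : G → ℝ} (hf : SmoothFun E f) (k : G) (ξ : E) :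
    dR E f k (leftMap E k ξ) = dR E (fun x => f (k * x)) 1 ξ :=
  (dR_comp_apply (hf.mdiff _) ((contMDiff_mulLeft (E := E) k).mdiff _) (by simp) ξ).symm

theorem dR_rightMap {f : G → ℝ} (hf : SmoothFun E f) (k : G) (ξ : E) :
    dR E f k (rightMap E k ξ) = dR E (fun x => f (x * k)) 1 ξ :=
  (dR_comp_apply (hf.mdiff _) ((contMDiff_mulRight (E := E) k).mdiff _) (by simp) ξ).symm

theorem smoothFun_dR_actMap [IsManifold 𝓘(ℝ, F) ∞ M] [ContMDiffSMul 𝓘(ℝ, E) 𝓘(ℝ, F) ∞ G M]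
    {f : M → ℝ} (hf : SmoothFun F f) (ξ : E) :
    SmoothFun F (fun m => dR F f m (actMap E G F m ξ)) := by
  intro m
  simp only [dR_actMap hf]
  have h1 : ContMDiff (𝓘(ℝ, F).prod 𝓘(ℝ, E)) 𝓘(ℝ, ℝ) ∞ (fun p : M × G => f (p.2 • p.1)) :=
    ContMDiff.comp (g := f) hf (contMDiff_snd.smul contMDiff_fst)
  exact (contMDiffAt_md (f := fun (m : M) (k : G) => f (k • m)) (b := (1 : G))
      h1.contMDiffAt).clm_apply
    contMDiffAt_const

theorem smoothFun_dR_leftMap {f : G → ℝ} (hf : SmoothFun E f) (ξ : E) :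
    SmoothFun E (fun k => dR E f k (leftMap E k ξ)) := by
  intro m
  simp only [dR_leftMap hf]
  have h1 : ContMDiff (𝓘(ℝ, E).prod 𝓘(ℝ, E)) 𝓘(ℝ, ℝ) ∞ (fun p : G × G => f (p.1 * p.2)) :=
    ContMDiff.comp (g := f) hf contMDiff_mul₂
  exact (contMDiffAt_md (f := fun (m : G) (k : G) => f (m * k)) (b := (1 : G))
      h1.contMDiffAt).clm_apply
    contMDiffAt_const

theorem smoothFun_dR_rightMap {f : G → ℝ} (hf : SmoothFun E f) (ξ : E) :
    SmoothFun E (fun k => dR E f k (rightMap E k ξ)) := by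
  intro m
  simp only [dR_rightMap hf]
  have h1 : ContMDiff (𝓘(ℝ, E).prod 𝓘(ℝ, E)) 𝓘(ℝ, ℝ) ∞ (fun p : G × G => f (p.2 * p.1)) :=
    ContMDiff.comp (g := f) hf (contMDiff_snd.mul contMDiff_fst)
  exact (contMDiffAt_md (f := fun (m : G) (k : G) => f (k * m)) (b := (1 : G))
      h1.contMDiffAt).clm_apply
    contMDiffAt_const

/-- The adjoint action is smooth. -/
theorem contMDiff_adMap : ContMDiff 𝓘(ℝ, E) 𝓘(ℝ, E →L[ℝ] E) ∞ (fun k : G => adMap E k) := by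
  intro k
  have h1 : ContMDiff (𝓘(ℝ, E).prod 𝓘(ℝ, E)) 𝓘(ℝ, E) ∞ (fun p : G × G => p.1 * p.2 * p.1⁻¹) :=
    (contMDiff_fst.mul contMDiff_snd).mul contMDiff_fst.inv
  have hc : ContMDiffAt 𝓘(ℝ, E) 𝓘(ℝ, E) ∞ (extChartAt 𝓘(ℝ, E) (1 : G)) 1 := contMDiffAt_extChartAt
  -- Every conjugation fixes `1`, so composing with the chart at `1`, whose derivative there is the
  -- identity, changes no derivative and gives a family with values in a vector space.
  have h2 := contMDiffAt_md (f := fun (k x : G) => extChartAt 𝓘(ℝ, E) (1 : G) (k * x * k⁻¹))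
    (a := k) (b := (1 : G)) (I₁ := 𝓘(ℝ, E)) (I₂ := 𝓘(ℝ, E))
    (ContMDiffAt.comp_of_eq (g := extChartAt 𝓘(ℝ, E) (1 : G)) hc h1.contMDiffAt (by simp))
  refine h2.congr_of_eventuallyEq (.of_forall fun l => ?_)
  have := md_comp_of_eq (g := extChartAt 𝓘(ℝ, E) (1 : G)) (f := fun x : G => l * x * l⁻¹)
    (hc.mdifferentiableAt (by simp)) ((contMDiff_conj (E := E) l).mdiff 1) (by simp)
  rw [md_extChartAt_self, ContinuousLinearMap.id_comp] at this
  exact this.symm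

variable [CompleteSpace E]

/-- The bracket of the Lie algebra is by definition the value at `1` of the bracket of
left-invariant vector fields, and these act on functions by commutators. -/
theorem dR_lieBr {f : G → ℝ} (hf : SmoothFun E f) (a b : E) :
    dR E f 1 (lieBr E G a b) = dR E (fun x => dR E f x (leftMap E x b)) 1 a -
      dR E (fun x => dR E f x (leftMap E x a)) 1 b := by
  have : LieGroup 𝓘(ℝ, E) (minSmoothness ℝ 3) G := by
    rw [minSmoothness_of_isRCLikeNormedField]; infer_instance
  have h := md_mlieBracket (mdifferentiableAt_mulInvariantVectorField (I := 𝓘(ℝ, E)) (G := G)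
      (g := 1) a)
    (mdifferentiableAt_mulInvariantVectorField (I := 𝓘(ℝ, E)) (G := G) (g := 1) b) hf
  have e : ∀ a : E, (mulInvariantVectorField (I := 𝓘(ℝ, E)) (G := G) a 1 : E) = a := fun a => by
    have := DFunLike.congr_fun (leftMap_one (E := E) (G := G)) a
    exact this
  refine h.trans ?_
  exact congrArg₂ (fun (v w : E) => dR E (fun x => dR E f x (leftMap E x b)) 1 v -
      dR E (fun x => dR E f x (leftMap E x a)) 1 w) (e a) (e b)

end

end Group

/-! ### Commutators of the operators that make up `𝒟` -/

section Commutator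

variable {E : Type*} [NormedAddCommGroup E] [NormedSpace ℝ E]
  {G : Type*} [TopologicalSpace G] [ChartedSpace E G] [Group G] [LieGroup 𝓘(ℝ, E) ∞ G]

variable (E) in
/-- The derivative of `f` along `(ξ^L + ξ^R) / 2`. -/
def symDeriv (f : G → ℝ) (ξ : E) (k : G) : ℝ :=
  (1 / 2 : ℝ) * (dR E f k (leftMap E k ξ) + dR E f k (rightMap E k ξ))

theorem smoothFun_symDeriv {f : G → ℝ} (hf : SmoothFun E f) (ξ : E) :
    SmoothFun E (symDeriv E f ξ) :=
  contMDiff_const.mul ((smoothFun_dR_leftMap hf ξ).add (smoothFun_dR_rightMap hf ξ))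

/-- The commutator of the operators `(ξ^L + ξ^R) / 2`. -/
theorem symDeriv_comm [CompleteSpace E] {f : G → ℝ} (hf : SmoothFun E f) (a b : E) (k : G) :
    symDeriv E (symDeriv E f b) a k - symDeriv E (symDeriv E f a) b k =
      (1 / 4 : ℝ) * (dR E f k (leftMap E k (lieBr E G a b))
        - dR E f k (rightMap E k (lieBr E G a b))) := by
  have hfl : SmoothFun E (fun x => f (k * x)) := ContMDiff.comp (g := f) hf (contMDiff_mulLeft k)
  have hfr : SmoothFun E (fun x => f (x * k)) := ContMDiff.comp (g := f) hf (contMDiff_mulRight k)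
  have hL := smoothFun_dR_leftMap hf
  have hR := smoothFun_dR_rightMap hf
  have hLL : ∀ a b : E, dR E (fun x => dR E f x (leftMap E x b)) k (leftMap E k a) =
      dR E (fun x => dR E (fun x => f (k * x)) x (leftMap E x b)) 1 a := fun a b => by
    rw [dR_leftMap (hL b)]
    simp only [dR_leftMap hf, dR_leftMap hfl, mul_assoc]
  -- Mixed derivatives of `f(y x k)`: exchanging them turns right-invariant derivatives at `k` into
  -- left-invariant ones of `x ↦ f(x k)` at `1` with `a` and `b` swapped. Hence right-invariant
  -- fields bracket with the opposite sign.
  have hRR : ∀ a b : E, dR E (fun x => dR E f x (rightMap E x b)) k (rightMap E k a) =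
      dR E (fun x => dR E (fun x => f (x * k)) x (leftMap E x a)) 1 b := fun a b => by
    rw [dR_rightMap (hR b)]
    simp only [dR_rightMap hf, dR_leftMap hfr]
    have h1 : ContMDiff (𝓘(ℝ, E).prod 𝓘(ℝ, E)) 𝓘(ℝ, ℝ) ∞ (fun p : G × G => f (p.2 * (p.1 * k))) :=
      ContMDiff.comp (g := f) hf (contMDiff_snd.mul (contMDiff_fst.mul contMDiff_const))
    have h2 := md_md_comm (a := (1 : G)) (b := (1 : G)) h1.contMDiffAt a b
    simp only [mul_assoc]
    exact h2
  -- Left- and right-invariant fields commute, both orders being mixed derivatives of `f(y k x)`;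
  -- the cross terms of the commutator cancel.
  have hLR : ∀ a b : E, dR E (fun x => dR E f x (rightMap E x b)) k (leftMap E k a) =
      dR E (fun x => dR E f x (leftMap E x a)) k (rightMap E k b) := fun a b => by
    rw [dR_leftMap (hR b), dR_rightMap (hL a)]
    simp only [dR_rightMap hf, dR_leftMap hf]
    have h1 : ContMDiff (𝓘(ℝ, E).prod 𝓘(ℝ, E)) 𝓘(ℝ, ℝ) ∞ (fun p : G × G => f (p.2 * (k * p.1))) :=
      ContMDiff.comp (g := f) hf (contMDiff_snd.mul (contMDiff_const.mul contMDiff_fst))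
    have h2 := md_md_comm (a := (1 : G)) (b := (1 : G)) h1.contMDiffAt a b
    simp only [mul_assoc]
    exact h2
  have hexp : ∀ a b : E, symDeriv E (symDeriv E f b) a k = (1 / 4 : ℝ) *
      (dR E (fun x => dR E f x (leftMap E x b)) k (leftMap E k a) +
       dR E (fun x => dR E f x (rightMap E x b)) k (leftMap E k a) +
       dR E (fun x => dR E f x (leftMap E x b)) k (rightMap E k a) +
       dR E (fun x => dR E f x (rightMap E x b)) k (rightMap E k a)) := fun a b => by
    have h1 : dR E (symDeriv E f b) k = (1 / 2 : ℝ) • (dR E (fun x => dR E f x (leftMap E x b)) k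
        + dR E (fun x => dR E f x (rightMap E x b)) k) := by
      rw [← dR_add ((hL b).mdiff k) ((hR b).mdiff k), ← dR_const_smul]
      · rfl
      · exact ((hL b).add (hR b)).mdiff k
    rw [symDeriv, h1]
    simp only [smul_add, add_apply, smul_apply,
      smul_eq_mul]
    ring
  have e1 := dR_lieBr hfl a b
  have e2 := dR_lieBr hfr a b
  rw [dR_leftMap hf, dR_rightMap hf, e1, e2, hexp, hexp, hLL, hLL, hRR, hRR, hLR a b, hLR b a]
  ring

end Commutator

/-! ### The Lie subalgebra of a Lie subgroup -/

section Subgroup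

variable {E : Type*} [NormedAddCommGroup E] [NormedSpace ℝ E]
  {G : Type*} [TopologicalSpace G] [ChartedSpace E G] [Group G]
  {E' : Type*} [NormedAddCommGroup E'] [NormedSpace ℝ E']
  {H : Subgroup G} [ChartedSpace E' H]

variable (E E' H) in
def inclMap : E' →L[ℝ] E := md 𝓘(ℝ, E') 𝓘(ℝ, E) (Subtype.val : H → G) 1

theorem inclMap_injective (hH : IsLieSubgroup E E' H) : Function.Injective (inclMap E E' H) :=
  lieIncl_injective hH

variable [LieGroup 𝓘(ℝ, E) ∞ G]

theorem inclMap_adMap (hH : IsLieSubgroup E E' H) (h : H) (ξ : E') :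
    inclMap E E' H (adMap E' h ξ) = adMap E (h : G) (inclMap E E' H ξ) :=
  lieIncl_Ad hH h ξ

theorem md_val_leftMap (hH : IsLieSubgroup E E' H) (u : H) (ξ : E') :
    md 𝓘(ℝ, E') 𝓘(ℝ, E) (Subtype.val : H → G) u (leftMap E' u ξ) =
      leftMap E (u : G) (inclMap E E' H ξ) := by
  have := hH.lieGroup
  have hv : ContMDiff 𝓘(ℝ, E') 𝓘(ℝ, E) ∞ (Subtype.val : H → G) := hH.embedding.contMDiff
  have h1 := md_comp_of_eq (g := (Subtype.val : H → G)) (f := fun x : H => u * x) (x := 1) (y := u)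
    (hv.mdiff u) ((contMDiff_mulLeft (E := E') u).mdiff 1) (by simp)
  have h2 := md_comp_of_eq (g := fun x : G => (u : G) * x) (f := (Subtype.val : H → G))
    (x := 1) (y := 1) ((contMDiff_mulLeft (E := E) (u : G)).mdiff 1) (hv.mdiff 1) (by simp)
  exact (DFunLike.congr_fun h1 ξ).symm.trans (DFunLike.congr_fun h2 ξ)

/-- The inclusion of a Lie subgroup induces a homomorphism of Lie algebras. -/
theorem inclMap_lieBr [FiniteDimensional ℝ E] [FiniteDimensional ℝ E'] [T2Space G]
    (hH : IsLieSubgroup E E' H) (a b : E') :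
    inclMap E E' H (lieBr E' H a b) = lieBr E G (inclMap E E' H a) (inclMap E E' H b) := by
  have := hH.lieGroup
  have hv : ContMDiff 𝓘(ℝ, E') 𝓘(ℝ, E) ∞ (Subtype.val : H → G) := hH.embedding.contMDiff
  have := FiniteDimensional.complete ℝ E
  have := FiniteDimensional.complete ℝ E'
  -- Left-invariant fields on `H` are related by the inclusion to those on `G`, so the two vectors
  -- agree on every function on `G`; differentials of functions separate tangent vectors.
  have key : ∀ f : G → ℝ, SmoothFun E f → dR E f 1 (inclMap E E' H (lieBr E' H a b)) =
      dR E f 1 (lieBr E G (inclMap E E' H a) (inclMap E E' H b)) := by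
    intro f hf
    have hfv : SmoothFun E' (fun x : H => f x) := ContMDiff.comp (g := f) hf hv
    have h1 : ∀ c : E', (fun x : H => dR E' (fun x : H => f x) x (leftMap E' x c)) =
        fun x : H => (fun y : G => dR E f y (leftMap E y (inclMap E E' H c))) x := fun c => by
      ext x
      rw [dR_comp_apply (g := (Subtype.val : H → G)) (y := (x : G)) (hf.mdiff _) (hv.mdiff _) rfl,
        md_val_leftMap hH]
    have h2 : ∀ c d : E', dR E' (fun x : H => dR E' (fun x : H => f x) x (leftMap E' x c)) 1 d =
        dR E (fun y : G => dR E f y (leftMap E y (inclMap E E' H c))) 1 (inclMap E E' H d) :=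
      fun c d => by
        rw [h1]
        exact dR_comp_apply (g := (Subtype.val : H → G)) (y := (1 : G))
          ((smoothFun_dR_leftMap hf _).mdiff _) (hv.mdiff 1) rfl d
    rw [dR_lieBr hf, ← h2, ← h2, ← dR_lieBr hfv]
    exact (dR_comp_apply (g := (Subtype.val : H → G)) (y := (1 : G)) (hf.mdiff _) (hv.mdiff 1)
      rfl _).symm
  by_contra hne
  obtain ⟨α, hα⟩ := SeparatingDual.exists_separating_of_ne (R := ℝ) hne
  obtain ⟨f, hf, hfα⟩ := exists_smoothFun_md_eq (1 : G) α
  have := key f hf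
  rw [show dR E f 1 = α from hfα] at this
  exact hα this

end Subgroup

/-! ### The inner product, gradients, and transposes of infinitesimal actions -/

section InnerProduct

variable {E : Type*} [NormedAddCommGroup E] [NormedSpace ℝ E]
  {G : Type*} [TopologicalSpace G] [ChartedSpace E G] [Group G]

namespace InvariantInnerProduct

/-- The inner product on the model space. -/
def bf (B : InvariantInnerProduct E G) : LinearMap.BilinForm ℝ E := B.form

theorem bf_symm (B : InvariantInnerProduct E G) (ξ η : E) : B.bf ξ η = B.bf η ξ := B.symm ξ η

theorem bf_adMap (B : InvariantInnerProduct E G) (k : G) (ξ η : E) :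
    B.bf (adMap E k ξ) (adMap E k η) = B.bf ξ η := B.invariant k ξ η

theorem eq_zero_of_bf_self (B : InvariantInnerProduct E G) {ξ : E} (h : B.bf ξ ξ = 0) : ξ = 0 := by
  by_contra hξ
  exact (B.posDef ξ hξ).ne' h

theorem eq_of_bf (B : InvariantInnerProduct E G) {ξ η : E} (h : ∀ ζ, B.bf ξ ζ = B.bf η ζ) :
    ξ = η := by
  rw [← sub_eq_zero]
  apply B.eq_zero_of_bf_self
  rw [map_sub B.bf, LinearMap.sub_apply, h, sub_self]

variable [FiniteDimensional ℝ E]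

/-- The identification `𝔤^* ≅ 𝔤` on the model space. -/
def sh (B : InvariantInnerProduct E G) (φ : E →L[ℝ] ℝ) : E := B.sharp φ.toLinearMap

theorem bf_sh (B : InvariantInnerProduct E G) (φ : E →L[ℝ] ℝ) (ξ : E) : B.bf (B.sh φ) ξ = φ ξ := by
  have : FiniteDimensional ℝ (GroupLieAlgebra 𝓘(ℝ, E) G) := ‹FiniteDimensional ℝ E›
  exact LinearMap.BilinForm.apply_toDual_symm_apply (B := B.form) (hB := B.nondegenerate)
    φ.toLinearMap ξ

theorem sh_add (B : InvariantInnerProduct E G) (φ ψ : E →L[ℝ] ℝ) :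
    B.sh (φ + ψ) = B.sh φ + B.sh ψ :=
  B.eq_of_bf fun ζ => by simp [bf_sh]

theorem sh_smul (B : InvariantInnerProduct E G) (c : ℝ) (φ : E →L[ℝ] ℝ) :
    B.sh (c • φ) = c • B.sh φ :=
  B.eq_of_bf fun ζ => by simp [bf_sh]

/-- The operator `𝒟` with values in the model space. -/
def dop (B : InvariantInnerProduct E G) (f : G → ℝ) (k : G) : E := B.diffOp f k

theorem bf_dop (B : InvariantInnerProduct E G) (f : G → ℝ) (k : G) (ξ : E) :
    B.bf (B.dop f k) ξ = symDeriv E f ξ k := by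
  have := B.bf_sh ((1 / 2 : ℝ) • ((dR E f k).comp (leftMap E k) + (dR E f k).comp (rightMap E k))) ξ
  rw [symDeriv]
  exact this

variable {F : Type*} [NormedAddCommGroup F] [NormedSpace ℝ F]
  {M : Type*} [TopologicalSpace M] [ChartedSpace F M] [MulAction G M]

/-- The transpose of the infinitesimal action, on the model spaces. -/
def pl (B : InvariantInnerProduct E G) (m : M) (α : F →L[ℝ] ℝ) : E :=
  B.sh (-(α.comp (actMap E G F m)))

theorem pull_eq_pl (B : InvariantInnerProduct E G) (m : M) (α : F →L[ℝ] ℝ) :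
    B.pull (F := F) m α = B.pl m α := by
  have : α.comp (-(actMap E G F m)) = -(α.comp (actMap E G F m)) := by ext; simp
  exact congrArg B.sh this

/-- The sign comes from `ξ_M` being the derivative of `exp(-tξ)`. -/
theorem bf_pl (B : InvariantInnerProduct E G) (m : M) (α : F →L[ℝ] ℝ) (ξ : E) :
    B.bf (B.pl m α) ξ = -α (actMap E G F m ξ) := by
  rw [pl, bf_sh]
  simp

theorem pl_add (B : InvariantInnerProduct E G) (m : M) (α β : F →L[ℝ] ℝ) :
    B.pl m (α + β) = B.pl m α + B.pl m β :=
  B.eq_of_bf fun ζ => by simp [bf_pl]; ring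

theorem pl_smul (B : InvariantInnerProduct E G) (m : M) (c : ℝ) (α : F →L[ℝ] ℝ) :
    B.pl m (c • α) = c • B.pl m α :=
  B.eq_of_bf fun ζ => by simp [bf_pl]

variable [LieGroup 𝓘(ℝ, E) ∞ G]

theorem pl_smul_point [ContMDiffSMul 𝓘(ℝ, E) 𝓘(ℝ, F) ∞ G M] (B : InvariantInnerProduct E G)
    (k : G) (m : M) (α : F →L[ℝ] ℝ) :
    B.pl (k • m) α =
      adMap E k (B.pl m (α.comp (md 𝓘(ℝ, F) 𝓘(ℝ, F) (fun x : M => k • x) m))) :=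
  B.eq_of_bf fun ζ => by
    rw [bf_pl]
    obtain ⟨ζ, rfl⟩ : ∃ ζ', adMap E k ζ' = ζ := ⟨adMap E k⁻¹ ζ, adMap_apply_inv k ζ⟩
    rw [bf_adMap, bf_pl, ← md_smul_actMap]
    rfl

/-- The operator `𝒟` in terms of the left-trivialized differential. -/
theorem dop_eq (B : InvariantInnerProduct E G) (f : G → ℝ) (k : G) :
    B.dop f k = (1 / 2 : ℝ) • (B.sh ((dR E f k).comp (leftMap E k)) +
      adMap E k (B.sh ((dR E f k).comp (leftMap E k)))) :=
  B.eq_of_bf fun ζ => by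
    rw [bf_dop]
    obtain ⟨ζ, rfl⟩ : ∃ ζ', adMap E k ζ' = ζ := ⟨adMap E k⁻¹ ζ, adMap_apply_inv k ζ⟩
    rw [symDeriv, rightMap_eq, adMap_inv_apply]
    simp [bf_sh, bf_adMap]
    ring

/-- By equivariance `dΦ` maps an orbit direction `ξ` to `ξ^R - ξ^L`; transposing gives `(1 - Ad_u)
l` with `l` the left-trivialized gradient. Compared with `½ (1 + Ad_u) l` for `𝒟f` in `dop_eq`, this
is where the Cayley transform of `Ad_u` enters the moment map condition. -/
theorem pl_comp_moment [ContMDiffSMul 𝓘(ℝ, E) 𝓘(ℝ, F) ∞ G M] (B : InvariantInnerProduct E G)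
    {Φ : M → G} (hΦ : ContMDiff 𝓘(ℝ, F) 𝓘(ℝ, E) ∞ Φ)
    (heq : ∀ (k : G) (m : M), Φ (k • m) = k * Φ m * k⁻¹) {f : G → ℝ} (hf : SmoothFun E f) (m : M) :
    B.pl m (dR F (fun x => f (Φ x)) m) = B.sh ((dR E f (Φ m)).comp (leftMap E (Φ m))) -
      adMap E (Φ m) (B.sh ((dR E f (Φ m)).comp (leftMap E (Φ m)))) :=
  B.eq_of_bf fun ζ => by
    obtain ⟨ζ, rfl⟩ : ∃ ζ', adMap E (Φ m) ζ' = ζ := ⟨adMap E (Φ m)⁻¹ ζ, adMap_apply_inv _ ζ⟩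
    rw [bf_pl, dR_comp_apply (hf.mdiff _) (hΦ.mdiff _) rfl, md_equivariant_actMap hΦ heq,
      rightMap_eq, adMap_inv_apply]
    simp [bf_sh, bf_adMap]

end InvariantInnerProduct

end InnerProduct

/-! ### Orthogonal projections and the r-matrix -/

section Projections

variable {E : Type*} [NormedAddCommGroup E] [NormedSpace ℝ E]
  {G : Type*} [TopologicalSpace G] [ChartedSpace E G] [Group G]
  {E' : Type*} [NormedAddCommGroup E'] [NormedSpace ℝ E']
  {H : Subgroup G} [ChartedSpace E' H] [LieGroup 𝓘(ℝ, E) ∞ G]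

namespace InvariantInnerProduct

theorem bf_restrict (B : InvariantInnerProduct E G) (hH : IsLieSubgroup E E' H) (ξ η : E') :
    (B.restrict hH).bf ξ η = B.bf (inclMap E E' H ξ) (inclMap E E' H η) := rfl

theorem perp_adMap (B : InvariantInnerProduct E G) (hH : IsLieSubgroup E E' H) {ξ : E}
    (hξ : ∀ ζ, B.bf ξ (inclMap E E' H ζ) = 0) (h : H) (ζ : E') :
    B.bf (adMap E (h : G) ξ) (inclMap E E' H ζ) = 0 := by
  have := hH.lieGroup
  rw [← adMap_apply_inv h ζ, inclMap_adMap hH, bf_adMap, hξ]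

variable [FiniteDimensional ℝ E']

def pS (B : InvariantInnerProduct E G) (hH : IsLieSubgroup E E' H) : Module.End ℝ E := B.projSub hH

/-- The orthogonal projection to `𝔥^⊥` on the model space. -/
def pP (B : InvariantInnerProduct E G) (hH : IsLieSubgroup E E' H) : Module.End ℝ E := B.projPerp hH

variable (B : InvariantInnerProduct E G) (hH : IsLieSubgroup E E' H)

theorem pS_mem (ξ : E) : ∃ ζ, B.pS hH ξ = inclMap E E' H ζ := ⟨_, rfl⟩

theorem pP_apply (ξ : E) : B.pP hH ξ = ξ - B.pS hH ξ := rfl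

theorem bf_pS (ξ : E) (ζ : E') :
    B.bf (B.pS hH ξ) (inclMap E E' H ζ) = B.bf ξ (inclMap E E' H ζ) :=
  (B.restrict hH).bf_sh ((B.bf ξ ∘ₗ (inclMap E E' H).toLinearMap).toContinuousLinearMap) ζ

theorem bf_pP (ξ : E) (ζ : E') : B.bf (B.pP hH ξ) (inclMap E E' H ζ) = 0 := by
  rw [pP_apply, map_sub, LinearMap.sub_apply, bf_pS, sub_self]

/-- The inner product is definite on `𝔥`, so an element of `𝔥` is determined by its products with
`𝔥`. -/
theorem pS_eq_of (ξ : E) (ζ : E') (h : ∀ ζ', B.bf (ξ - inclMap E E' H ζ) (inclMap E E' H ζ') = 0) :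
    B.pS hH ξ = inclMap E E' H ζ := by
  obtain ⟨ζ₀, h₀⟩ := B.pS_mem hH ξ
  rw [h₀, ← sub_eq_zero, ← map_sub]
  apply B.eq_zero_of_bf_self
  have h1 := h (ζ₀ - ζ)
  have h2 := B.bf_pS hH ξ (ζ₀ - ζ)
  rw [h₀] at h2
  rw [map_sub B.bf, LinearMap.sub_apply, ← h2] at h1
  rwa [map_sub (inclMap E E' H) ζ₀ ζ, map_sub B.bf, LinearMap.sub_apply, ← map_sub (inclMap E E' H)]

theorem pS_inclMap (ζ : E') : B.pS hH (inclMap E E' H ζ) = inclMap E E' H ζ :=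
  B.pS_eq_of hH _ _ fun ζ' => by simp

theorem pS_of_perp {ξ : E} (h : ∀ ζ, B.bf ξ (inclMap E E' H ζ) = 0) : B.pS hH ξ = 0 := by
  rw [B.pS_eq_of hH ξ 0 fun ζ' => by simpa using h ζ', map_zero]

theorem pP_of_perp {ξ : E} (h : ∀ ζ, B.bf ξ (inclMap E E' H ζ) = 0) : B.pP hH ξ = ξ := by
  rw [pP_apply, pS_of_perp B hH h, sub_zero]

theorem pP_inclMap (ζ : E') : B.pP hH (inclMap E E' H ζ) = 0 := by
  rw [pP_apply, pS_inclMap, sub_self]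

theorem pS_add_pP (ξ : E) : B.pS hH ξ + B.pP hH ξ = ξ := by
  rw [pP_apply, add_sub_cancel]

theorem bf_perp_left {ξ : E} (h : ∀ ζ, B.bf ξ (inclMap E E' H ζ) = 0) (η : E) :
    B.bf ξ η = B.bf ξ (B.pP hH η) := by
  obtain ⟨ζ, hζ⟩ := B.pS_mem hH η
  conv_lhs => rw [← B.pS_add_pP hH η, map_add, hζ, h, zero_add]

theorem pS_adMap (h : H) (ξ : E) : B.pS hH (adMap E (h : G) ξ) = adMap E (h : G) (B.pS hH ξ) := by
  conv_lhs => rw [← B.pS_add_pP hH ξ]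
  obtain ⟨ζ, hζ⟩ := B.pS_mem hH ξ
  rw [map_add, map_add, hζ, ← inclMap_adMap hH, pS_inclMap,
    B.pS_of_perp hH (B.perp_adMap hH (B.bf_pP hH ξ) h), add_zero]

theorem pP_adMap (h : H) (ξ : E) : B.pP hH (adMap E (h : G) ξ) = adMap E (h : G) (B.pP hH ξ) := by
  rw [pP_apply, pS_adMap, pP_apply, map_sub]

/-- The operator that is inverted in the definition of the r-matrix. -/
def invOp (u : H) : Module.End ℝ E :=
  ((adMap E (u : G)).toLinearMap - 1) * B.pP hH + B.pS hH

theorem invOp_apply (u : H) (ξ : E) :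
    B.invOp hH u ξ = adMap E (u : G) (B.pP hH ξ) - B.pP hH ξ + B.pS hH ξ := rfl

/-- `Ad_u - 1` is injective on `𝔥^⊥`. -/
def Regular (_ : IsLieSubgroup E E' H) (u : H) : Prop :=
  ∀ ξ : E, (∀ ζ, B.bf ξ (inclMap E E' H ζ) = 0) → adMap E (u : G) ξ = ξ → ξ = 0

/-- `Ad_u` commutes with the projections because `u ∈ H`. Projecting to `𝔥` therefore separates the
summands: the component in `𝔥` vanishes, and the one in `𝔥^⊥` is fixed by `Ad_u`. -/
theorem invOp_injective {u : H} (hu : B.Regular hH u) : Function.Injective (B.invOp hH u) := by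
  rw [injective_iff_map_eq_zero]
  intro ξ hξ
  rw [invOp_apply] at hξ
  have h1 := congrArg (B.pS hH) hξ
  have h2 : B.pS hH (B.pP hH ξ) = 0 := B.pS_of_perp hH (B.bf_pP hH ξ)
  have h3 : B.pS hH (B.pS hH ξ) = B.pS hH ξ := by
    obtain ⟨ζ, hζ⟩ := B.pS_mem hH ξ
    rw [hζ, pS_inclMap]
  rw [map_add, map_sub, pS_adMap, h2, map_zero, h3, map_zero, sub_zero, zero_add] at h1
  rw [h1, add_zero, sub_eq_zero] at hξ
  rw [← B.pS_add_pP hH ξ, h1, zero_add, hu _ (B.bf_pP hH ξ) hξ]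

/-- The operator of the r-matrix on the model space. -/
def rM (u : H) : Module.End ℝ E := B.rOp hH u

theorem rM_apply (u : H) (ξ : E) :
    B.rM hH u ξ = (-(1 / 2) : ℝ) • (adMap E (u : G) (Ring.inverse (B.invOp hH u) (B.pP hH ξ))
      + Ring.inverse (B.invOp hH u) (B.pP hH ξ)) := rfl

theorem rM_inclMap (u : H) (ζ : E') : B.rM hH u (inclMap E E' H ζ) = 0 := by
  rw [rM_apply, pP_inclMap]
  simp

variable [FiniteDimensional ℝ E]

theorem invOp_isUnit {u : H} (hu : B.Regular hH u) : IsUnit (B.invOp hH u) :=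
  (Module.End.isUnit_iff _).2
    ⟨B.invOp_injective hH hu, LinearMap.injective_iff_surjective.1 (B.invOp_injective hH hu)⟩

theorem inverse_invOp_eq {u : H} (hu : B.Regular hH u) {ξ η : E} (h : B.invOp hH u ξ = η) :
    Ring.inverse (B.invOp hH u) η = ξ := by
  rw [← h]
  change (Ring.inverse (B.invOp hH u) * B.invOp hH u) ξ = ξ
  rw [Ring.inverse_mul_cancel _ (B.invOp_isUnit hH hu)]
  rfl

/-- The Cayley transform without an inverse: `-½ (A + 1)/(A - 1)` applied to `(1 - A) l` is `½ (A +
1) l`. With `exists_sub_adMap` supplying `l`, the algebraic properties of the r-matrix are computed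
from this formula and `Ring.inverse` is not unfolded again. -/
theorem rM_eq_of {u : H} (hu : B.Regular hH u) {ξ l : E} (hl : ∀ ζ, B.bf l (inclMap E E' H ζ) = 0)
    (h : B.pP hH ξ = l - adMap E (u : G) l) :
    B.rM hH u ξ = (1 / 2 : ℝ) • (adMap E (u : G) l + l) := by
  have h1 : B.invOp hH u (-l) = B.pP hH ξ := by
    rw [invOp_apply, map_neg, map_neg, map_neg, B.pP_of_perp hH hl, B.pS_of_perp hH hl, h]
    simp [sub_eq_add_neg, add_comm]
  rw [rM_apply, B.inverse_invOp_eq hH hu h1, map_neg, ← neg_add, smul_neg, neg_smul, neg_neg]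

/-- In finite dimension injectivity gives surjectivity of the operator; the preimage of a vector of
`𝔥^⊥` has no component in `𝔥`. -/
theorem exists_sub_adMap {u : H} (hu : B.Regular hH u) (ξ : E) :
    ∃ l : E, (∀ ζ, B.bf l (inclMap E E' H ζ) = 0) ∧ B.pP hH ξ = l - adMap E (u : G) l := by
  obtain ⟨η, hη⟩ := LinearMap.injective_iff_surjective.1 (B.invOp_injective hH hu) (B.pP hH ξ)
  have h0 : B.pS hH η = 0 := by
    have h1 := congrArg (B.pS hH) hη
    have h2 : ∀ ξ, B.pS hH (B.pP hH ξ) = 0 := fun ξ => B.pS_of_perp hH (B.bf_pP hH ξ)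
    have h3 : B.pS hH (B.pS hH η) = B.pS hH η := by
      obtain ⟨ζ, hζ⟩ := B.pS_mem hH η
      rw [hζ, pS_inclMap]
    rwa [invOp_apply, map_add, map_sub, pS_adMap, h2, h2, map_zero, h3, sub_zero, zero_add] at h1
  refine ⟨-B.pP hH η, fun ζ => ?_, ?_⟩
  · rw [map_neg, LinearMap.neg_apply, bf_pP, neg_zero]
  · rw [← hη, invOp_apply, h0, map_neg]
    simp [sub_eq_add_neg, add_comm]

/-- For orthogonal `A` the product of `(1 - A) l` with `(1 + A) m` is `l · Am - Al · m`, which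
changes sign when `l` and `m` are exchanged. -/
theorem bf_rM_skew {u : H} (hu : B.Regular hH u) (ξ η : E) :
    B.bf ξ (B.rM hH u η) = -B.bf (B.rM hH u ξ) η := by
  obtain ⟨l, hl, hξ⟩ := B.exists_sub_adMap hH hu ξ
  obtain ⟨m, hm, hη⟩ := B.exists_sub_adMap hH hu η
  have e : ∀ l : E, (∀ ζ, B.bf l (inclMap E E' H ζ) = 0) →
      ∀ ζ, B.bf ((1 / 2 : ℝ) • (adMap E (u : G) l + l)) (inclMap E E' H ζ) = 0 := fun l hl ζ => by
    simp [hl, B.perp_adMap hH hl]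
  rw [B.rM_eq_of hH hu hl hξ, B.rM_eq_of hH hu hm hη, bf_symm, B.bf_perp_left hH (e m hm),
    B.bf_perp_left hH (e l hl), hξ, hη]
  simp only [map_smul, map_add, map_sub, LinearMap.smul_apply, LinearMap.add_apply, smul_eq_mul,
    bf_adMap]
  rw [B.bf_symm m (adMap E (u : G) l), B.bf_symm (adMap E (u : G) m) l, B.bf_symm m l]
  ring

/-- If `l` solves the equation for `u`, then `Ad_h l` solves it for `h u h⁻¹`. -/
theorem rM_adMap {u : H} (hu : B.Regular hH u) (h : H) (hu' : B.Regular hH (h * u * h⁻¹)) (ξ : E) :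
    B.rM hH (h * u * h⁻¹) (adMap E (h : G) ξ) = adMap E (h : G) (B.rM hH u ξ) := by
  obtain ⟨l, hl, hξ⟩ := B.exists_sub_adMap hH hu ξ
  have h1 : adMap E ((h * u * h⁻¹ : H) : G) (adMap E (h : G) l) =
      adMap E (h : G) (adMap E (u : G) l) := by
    simp only [Subgroup.coe_mul, adMap_mul, Subgroup.coe_inv, ContinuousLinearMap.comp_apply,
      adMap_inv_apply]
  rw [B.rM_eq_of hH hu hl hξ, B.rM_eq_of hH hu' (l := adMap E (h : G) l) (B.perp_adMap hH hl h), h1,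
    map_smul, map_add]
  rw [pP_adMap, hξ, map_sub, h1]

/-- `Ad` is smooth, and inversion is smooth at the units of the Banach algebra of continuous
endomorphisms. The ring inverse is transported along the isomorphism `e` between linear and
continuous linear endomorphisms. -/
theorem contMDiffAt_rM {u : H} (hu : B.Regular hH u) (ξ : E) :
    ContMDiffAt 𝓘(ℝ, E') 𝓘(ℝ, E) ∞ (fun u : H => B.rM hH u ξ) u := by
  let e : Module.End ℝ E ≃ₐ[ℝ] (E →L[ℝ] E) := Module.End.toContinuousLinearMap E
  have hi : ∀ T : Module.End ℝ E, Ring.inverse (e T) = e (Ring.inverse T) := fun T => by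
    by_cases hT : IsUnit T
    · obtain ⟨T, rfl⟩ := hT
      have : e (T : Module.End ℝ E) = (Units.map (e : Module.End ℝ E →* _) T : (E →L[ℝ] E)ˣ) := rfl
      rw [this, Ring.inverse_unit, Ring.inverse_unit]
      rfl
    · rw [Ring.inverse_non_unit _ hT, Ring.inverse_non_unit _ (by simpa using hT), map_zero]
  have hA : ContMDiff 𝓘(ℝ, E') 𝓘(ℝ, E →L[ℝ] E) ∞ (fun u : H => adMap E (u : G)) :=
    contMDiff_adMap.comp hH.embedding.contMDiff
  have hT : ContMDiff 𝓘(ℝ, E') 𝓘(ℝ, E →L[ℝ] E) ∞ (fun u : H => e (B.invOp hH u)) := by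
    have : (fun u : H => e (B.invOp hH u)) = fun u : H =>
        (adMap E (u : G) - 1).comp (e (B.pP hH)) + e (B.pS hH) := rfl
    rw [this]
    exact ((hA.sub contMDiff_const).clm_comp contMDiff_const).add contMDiff_const
  have hR : ContMDiffAt 𝓘(ℝ, E') 𝓘(ℝ, E →L[ℝ] E) ∞ (fun u : H => Ring.inverse (e (B.invOp hH u)))
      u := by
    have hu' : IsUnit (e (B.invOp hH u)) := (B.invOp_isUnit hH hu).map e
    obtain ⟨T, hT'⟩ := hu'
    have := contDiffAt_ringInverse ℝ (n := ∞) T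
    rw [hT'] at this
    exact this.contMDiffAt.comp u hT.contMDiffAt
  have : (fun u : H => B.rM hH u ξ) = fun u : H => (-(1 / 2) : ℝ) •
      (adMap E (u : G) (Ring.inverse (e (B.invOp hH u)) (B.pP hH ξ))
        + Ring.inverse (e (B.invOp hH u)) (B.pP hH ξ)) := by
    funext u
    rw [hi, rM_apply]
    rfl
  rw [this]
  have h1 := hR.clm_apply (contMDiffAt_const (c := B.pP hH ξ))
  exact (contMDiffAt_const (I' := 𝓘(ℝ, ℝ)) (c := (-(1 / 2) : ℝ))).smul
    ((hA.contMDiffAt.clm_apply h1).add h1)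

end InvariantInnerProduct

end Projections

/-! ### Differentials of finite sums -/

section Sum

variable {F : Type*} [NormedAddCommGroup F] [NormedSpace ℝ F]
  {M : Type*} [TopologicalSpace M] [ChartedSpace F M]

theorem dR_sum {ι : Type*} [Fintype ι] {f : ι → M → ℝ} {x : M}
    (hf : ∀ i, MDifferentiableAt 𝓘(ℝ, F) 𝓘(ℝ, ℝ) (f i) x) :
    dR F (fun y => ∑ i, f i y) x = ∑ i, dR F (f i) x := by
  classical
  suffices h : ∀ t : Finset ι, MDifferentiableAt 𝓘(ℝ, F) 𝓘(ℝ, ℝ) (fun y => ∑ i ∈ t, f i y) x ∧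
      dR F (fun y => ∑ i ∈ t, f i y) x = ∑ i ∈ t, dR F (f i) x from (h Finset.univ).2
  intro t
  induction t using Finset.induction_on with
  | empty => exact ⟨by simpa using mdifferentiableAt_const, by simpa [dR] using md_const (0 : ℝ) x⟩
  | insert a t ha ih =>
    simp only [Finset.sum_insert ha]
    exact ⟨(hf a).add ih.1, by rw [dR_add (hf a) ih.1, ih.2]⟩

end Sum

/-! ### Coordinate vector fields and local coordinates -/

section Frame

variable {F : Type*} [NormedAddCommGroup F] [NormedSpace ℝ F]
  {M : Type*} [TopologicalSpace M] [ChartedSpace F M]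

variable (F) in
/-- The coordinate vector field in direction `w` of the chart at `m`. -/
def frame (m : M) (w : F) (y : M) : F :=
  md 𝓘(ℝ, F) 𝓘(ℝ, F) (extChartAt 𝓘(ℝ, F) m).symm (extChartAt 𝓘(ℝ, F) m y) w

theorem extChartAt_symm_apply {m y : M} (hy : y ∈ (chartAt F m).source) :
    (extChartAt 𝓘(ℝ, F) m).symm (extChartAt 𝓘(ℝ, F) m y) = y :=
  (extChartAt 𝓘(ℝ, F) m).left_inv (by simpa using hy)

variable [IsManifold 𝓘(ℝ, F) ∞ M]

theorem contMDiffAt_extChartAt_symm_of_mem {m y : M} (hy : y ∈ (chartAt F m).source) :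
    ContMDiffAt 𝓘(ℝ, F) 𝓘(ℝ, F) ∞ (extChartAt 𝓘(ℝ, F) m).symm (extChartAt 𝓘(ℝ, F) m y) :=
  (contMDiffOn_extChartAt_symm m).contMDiffAt
    (extChartAt_target_mem_nhds' (by simpa [mfld_simps] using (chartAt F m).map_source hy))

theorem dR_frame_eq {f : M → ℝ} {m y : M} (hy : y ∈ (chartAt F m).source)
    (hf : MDifferentiableAt 𝓘(ℝ, F) 𝓘(ℝ, ℝ) f y) (w : F) :
    dR F f y (frame F m w y) =
      fderiv ℝ (fun z => f ((extChartAt 𝓘(ℝ, F) m).symm z)) (extChartAt 𝓘(ℝ, F) m y) w := by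
  rw [frame, ← dR_comp_apply hf ((contMDiffAt_extChartAt_symm_of_mem hy).mdifferentiableAt
    (by simp)) (extChartAt_symm_apply hy), dR, md_eq_fderiv]

theorem frame_md_extChartAt {m y : M} (hy : y ∈ (chartAt F m).source) (v : F) :
    frame F m (md 𝓘(ℝ, F) 𝓘(ℝ, F) (extChartAt 𝓘(ℝ, F) m) y v) y = v := by
  have hc : MDifferentiableAt 𝓘(ℝ, F) 𝓘(ℝ, F) (extChartAt 𝓘(ℝ, F) m) y :=
    (contMDiffAt_extChartAt' (n := ∞) hy).mdifferentiableAt (by simp)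
  have h := md_comp ((contMDiffAt_extChartAt_symm_of_mem hy).mdifferentiableAt (by simp)) hc
  have h' : (fun z => (extChartAt 𝓘(ℝ, F) m).symm (extChartAt 𝓘(ℝ, F) m z)) =ᶠ[𝓝 y] fun z => z := by
    filter_upwards [(chartAt F m).open_source.mem_nhds hy] with z hz
    exact extChartAt_symm_apply hz
  rw [md_congr h', md_id] at h
  exact (DFunLike.congr_fun h v).symm

/-- Smoothness of the derivatives of a smooth family of functions along the coordinate fields. -/
theorem contMDiffAt_dR_frame {E : Type*} [NormedAddCommGroup E] [NormedSpace ℝ E]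
    {N : Type*} [TopologicalSpace N] [ChartedSpace E N] [IsManifold 𝓘(ℝ, E) ∞ N]
    {f : N → M → ℝ}
    (hf : ContMDiff (𝓘(ℝ, E).prod 𝓘(ℝ, F)) 𝓘(ℝ, ℝ) ∞ (fun p : N × M => f p.1 p.2))
    {m : M} (w : F) {p : N × M} (hp : p.2 ∈ (chartAt F m).source) :
    ContMDiffAt (𝓘(ℝ, E).prod 𝓘(ℝ, F)) 𝓘(ℝ, ℝ) ∞
      (fun p : N × M => dR F (f p.1) p.2 (frame F m w p.2)) p := by
  have hfn : ∀ n, SmoothFun F (f n) := fun n =>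
    ContMDiff.comp (g := fun p : N × M => f p.1 p.2) hf (contMDiff_const.prodMk contMDiff_id)
  -- The derivative at a moving point is written as the derivative at the fixed point `0` of the
  -- function translated in the chart, so that `contMDiffAt_md` applies.
  have h1 : ContMDiffAt ((𝓘(ℝ, E).prod 𝓘(ℝ, F)).prod 𝓘(ℝ, F)) 𝓘(ℝ, ℝ) ∞
      (fun q : (N × M) × F => f q.1.1 ((extChartAt 𝓘(ℝ, F) m).symm
        (extChartAt 𝓘(ℝ, F) m q.1.2 + q.2))) (p, 0) := by
    have a1 : ContMDiffAt ((𝓘(ℝ, E).prod 𝓘(ℝ, F)).prod 𝓘(ℝ, F)) 𝓘(ℝ, E) ∞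
      (fun q : (N × M) × F => q.1.1) (p, 0) := contMDiffAt_fst.fst
    have a2 : ContMDiffAt ((𝓘(ℝ, E).prod 𝓘(ℝ, F)).prod 𝓘(ℝ, F)) 𝓘(ℝ, F) ∞
      (fun q : (N × M) × F => q.1.2) (p, 0) := contMDiffAt_fst.snd
    suffices a3 : ContMDiffAt ((𝓘(ℝ, E).prod 𝓘(ℝ, F)).prod 𝓘(ℝ, F)) 𝓘(ℝ, F) ∞
      (fun q : (N × M) × F => (extChartAt 𝓘(ℝ, F) m).symm
        (extChartAt 𝓘(ℝ, F) m q.1.2 + q.2)) (p, 0) from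
      ContMDiffAt.comp (g := fun p : N × M => f p.1 p.2) _ hf.contMDiffAt (a1.prodMk a3)
    refine ContMDiffAt.comp_of_eq (contMDiffAt_extChartAt_symm_of_mem hp)
      (ContMDiffAt.add ?_ contMDiffAt_snd) (by simp)
    exact ContMDiffAt.comp (g := extChartAt 𝓘(ℝ, F) m) _ (contMDiffAt_extChartAt' (n := ∞) hp)
      a2
  have h2 := (contMDiffAt_md (f := fun (q : N × M) (z : F) => f q.1 ((extChartAt 𝓘(ℝ, F) m).symm
        (extChartAt 𝓘(ℝ, F) m q.2 + z))) h1).clm_apply (contMDiffAt_const (c := w))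
  refine h2.congr_of_eventuallyEq ?_
  filter_upwards [((chartAt F m).open_source.preimage continuous_snd).mem_nhds hp] with q hq
  rw [dR_frame_eq hq ((hfn q.1).mdiff _), md_eq_fderiv]
  have := fderiv_comp_add_left (𝕜 := ℝ) (f := fun z => f q.1 ((extChartAt 𝓘(ℝ, F) m).symm z))
    (x := 0) (extChartAt 𝓘(ℝ, F) m q.2)
  rw [this, add_zero]

/-- Coordinate vector fields commute. -/
theorem dR_frame_comm {f : M → ℝ} (hf : SmoothFun F f) (m : M) (v w : F) :
    dR F (fun y => dR F f y (frame F m v y)) m (frame F m w m) =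
      dR F (fun y => dR F f y (frame F m w y)) m (frame F m v m) := by
  have hm := mem_chart_source F m
  set c := extChartAt 𝓘(ℝ, F) m
  have hφ : ContDiffAt ℝ ∞ (fun z => f (c.symm z)) (c m) :=
    contMDiffAt_iff_contDiffAt.1
      (hf.contMDiffAt.comp (c m) (contMDiffAt_extChartAt_symm_of_mem hm))
  have hφ2 : DifferentiableAt ℝ (fderiv ℝ (fun z => f (c.symm z))) (c m) :=
    (hφ.fderiv_right (m := ∞) le_rfl).differentiableAt (by simp)
  have key : ∀ v w : F, dR F (fun y => dR F f y (frame F m v y)) m (frame F m w m) =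
      fderiv ℝ (fderiv ℝ (fun z => f (c.symm z))) (c m) w v := fun v w => by
    have hd : MDifferentiableAt 𝓘(ℝ, F) 𝓘(ℝ, ℝ) (fun y => dR F f y (frame F m v y)) m := by
      have h1 := contMDiffAt_dR_frame (N := F) (f := fun _ => f)
        (ContMDiff.comp (g := f) hf (contMDiff_snd (I := 𝓘(ℝ, F)))) (m := m) v (p := ((0 : F), m))
            hm
      exact (h1.comp m ((contMDiff_const (I' := 𝓘(ℝ, F)) (c := (0 : F))).prodMk
        contMDiff_id).contMDiffAt).mdifferentiableAt (by simp)
    rw [dR_frame_eq hm hd]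
    have h2 : (fun z => dR F f (c.symm z) (frame F m v (c.symm z))) =ᶠ[𝓝 (c m)]
        fun z => fderiv ℝ (fun z => f (c.symm z)) z v := by
      filter_upwards [extChartAt_target_mem_nhds (I := 𝓘(ℝ, F)) m] with z hz
      have hz' : c.symm z ∈ (chartAt F m).source := by
        simpa [c] using (extChartAt 𝓘(ℝ, F) m).map_target hz
      rw [dR_frame_eq hz' (hf.mdiff _)]
      simp only [c]
      rw [(extChartAt 𝓘(ℝ, F) m).right_inv hz]
    have h3 := h2.fderiv_eq (𝕜 := ℝ)
    refine Eq.trans (congrArg (fun φ : F →L[ℝ] ℝ => φ w) h3) ?_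
    rw [fderiv_clm_apply hφ2 (differentiableAt_const v)]
    simp
  rw [key, key]
  exact (hφ.isSymmSndFDerivAt (by simpa using ENat.LEInfty.out)) w v

variable [FiniteDimensional ℝ F]

/-- Global smooth functions that are coordinates near a given point. -/
theorem exists_coordinates [T2Space M] (m : M) :
    ∃ (x : Fin (Module.finrank ℝ F) → M → ℝ) (s : Set M), IsOpen s ∧ m ∈ s ∧
      s ⊆ (chartAt F m).source ∧ (∀ i, SmoothFun F (x i)) ∧
      ∀ y ∈ s, ∀ α : F →L[ℝ] ℝ,
        α = ∑ i, α (frame F m (Module.finBasis ℝ F i) y) • dR F (x i) y := by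
  set b := Module.finBasis ℝ F
  set c := extChartAt 𝓘(ℝ, F) m with hc
  have hcs : ContMDiffOn 𝓘(ℝ, F) 𝓘(ℝ, F) ∞ c (chartAt F m).source := contMDiffOn_extChartAt
  let co : Fin (Module.finrank ℝ F) → F →L[ℝ] ℝ := fun i => (b.coord i).toContinuousLinearMap
  choose x hx hxm using fun i => exists_smoothFun_eventuallyEq (f := fun y => co i (c y))
    (chartAt F m).open_source (mem_chart_source F m)
    ((co i).contDiff.contMDiff.comp_contMDiffOn hcs)
  have hev : ∀ᶠ y in 𝓝 m, (∀ i, x i =ᶠ[𝓝 y] fun y => co i (c y)) ∧ y ∈ (chartAt F m).source :=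
    ((eventually_all.2 fun i => (hxm i).eventuallyEq_nhds)).and (chart_source_mem_nhds F m)
  obtain ⟨s, hs, hso, hms⟩ := mem_nhds_iff.1 hev
  refine ⟨x, s, hso, hms, fun y hy => (hs hy).2, hx, fun y hy α => ?_⟩
  obtain ⟨h1, h2⟩ := hs hy
  have h3 : ∀ i, dR F (x i) y = (co i).comp (md 𝓘(ℝ, F) 𝓘(ℝ, F) c y) := fun i => by
    rw [dR_congr (h1 i), dR_comp (f := co i) (y := c y) (co i).differentiableAt.mdifferentiableAt
      ((hcs.contMDiffAt ((chartAt F m).open_source.mem_nhds h2)).mdifferentiableAt (by simp)) rfl]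
    congr 1
    rw [dR, md_eq_fderiv]
    simp
  ext v
  conv_lhs => rw [← frame_md_extChartAt h2 v]
  rw [← b.sum_repr (md 𝓘(ℝ, F) 𝓘(ℝ, F) (extChartAt 𝓘(ℝ, F) m) y v)]
  simp only [h3, frame, map_sum, map_smul, sum_apply, smul_apply, smul_eq_mul]
  refine Finset.sum_congr rfl fun i _ => ?_
  rw [mul_comm]
  rfl

end Frame

/-! ### Brackets of functions and tensoriality of `[P, P]` -/

section Tensoriality

variable {F : Type*} [NormedAddCommGroup F] [NormedSpace ℝ F]
  {M : Type*} [TopologicalSpace M] [ChartedSpace F M]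

namespace BivectorField

/-- The value of a bivector field on covectors in the model space. -/
def pv (P : BivectorField F M) (m : M) : (F →L[ℝ] ℝ) →ₗ[ℝ] (F →L[ℝ] ℝ) →ₗ[ℝ] ℝ := P.val m

theorem bracket_apply (P : BivectorField F M) (f h : M → ℝ) (m : M) :
    P.bracket f h m = P.pv m (dR F f m) (dR F h m) := rfl

theorem smoothFun_bracket (P : BivectorField F M) {f h : M → ℝ} (hf : SmoothFun F f)
    (hh : SmoothFun F h) : SmoothFun F (P.bracket f h) := P.smooth f h hf hh

theorem pv_self (P : BivectorField F M) (m : M) (α : F →L[ℝ] ℝ) : P.pv m α α = 0 := P.alt m α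

theorem pv_swap (P : BivectorField F M) (m : M) (α β : F →L[ℝ] ℝ) :
    P.pv m α β = -P.pv m β α := by
  have := P.pv_self m (α + β)
  simp only [map_add, LinearMap.add_apply, pv_self] at this
  linarith

theorem bracket_swap (P : BivectorField F M) (f h : M → ℝ) (m : M) :
    P.bracket f h m = -P.bracket h f m := P.pv_swap m _ _

theorem bracket_congr (P : BivectorField F M) {f f' h h' : M → ℝ} {m : M} (hf : f =ᶠ[𝓝 m] f')
    (hh : h =ᶠ[𝓝 m] h') : P.bracket f h m = P.bracket f' h' m := by
  rw [bracket_apply, bracket_apply, dR_congr hf, dR_congr hh]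

theorem schoutenSelf_cyclic (P : BivectorField F M) (f₁ f₂ f₃ : M → ℝ) (m : M) :
    P.schoutenSelf f₁ f₂ f₃ m = P.schoutenSelf f₂ f₃ f₁ m := by
  simp only [schoutenSelf]
  ring

theorem schoutenSelf_congr (P : BivectorField F M) {f₁ f₂ f₃ g₁ g₂ g₃ : M → ℝ} {m : M}
    (h₁ : f₁ =ᶠ[𝓝 m] g₁) (h₂ : f₂ =ᶠ[𝓝 m] g₂) (h₃ : f₃ =ᶠ[𝓝 m] g₃) :
    P.schoutenSelf f₁ f₂ f₃ m = P.schoutenSelf g₁ g₂ g₃ m := by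
  have key : ∀ {f f' h h' : M → ℝ}, f =ᶠ[𝓝 m] f' → h =ᶠ[𝓝 m] h' →
      P.bracket f h =ᶠ[𝓝 m] P.bracket f' h' := fun hf hh => by
    filter_upwards [hf.eventuallyEq_nhds, hh.eventuallyEq_nhds] with y h1 h2
    exact P.bracket_congr h1 h2
  rw [schoutenSelf, schoutenSelf, P.bracket_congr h₁ (key h₂ h₃), P.bracket_congr h₂ (key h₃ h₁),
    P.bracket_congr h₃ (key h₁ h₂)]

theorem schoutenSelf_sub (P : BivectorField F M) {f g f₂ f₃ : M → ℝ} (hf : SmoothFun F f)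
    (hg : SmoothFun F g) (h₂ : SmoothFun F f₂) (h₃ : SmoothFun F f₃) (m : M) :
    P.schoutenSelf (fun x => f x - g x) f₂ f₃ m =
      P.schoutenSelf f f₂ f₃ m - P.schoutenSelf g f₂ f₃ m := by
  have h1 : P.bracket f₃ (fun x => f x - g x) = fun x => P.bracket f₃ f x - P.bracket f₃ g x := by
    ext y
    rw [bracket_apply, dR_sub (hf.mdiff y) (hg.mdiff y), map_sub]
    rfl
  have h2 : P.bracket (fun x => f x - g x) f₂ = fun x => P.bracket f f₂ x - P.bracket g f₂ x := by
    ext y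
    rw [bracket_apply, dR_sub (hf.mdiff y) (hg.mdiff y), map_sub]
    rfl
  rw [schoutenSelf, h1, h2, P.bracket_apply _ _ m, P.bracket_apply f₂ _ m, P.bracket_apply f₃ _ m,
    dR_sub (hf.mdiff m) (hg.mdiff m), dR_sub ((P.smoothFun_bracket h₃ hf).mdiff m)
    ((P.smoothFun_bracket h₃ hg).mdiff m), dR_sub ((P.smoothFun_bracket hf h₂).mdiff m)
    ((P.smoothFun_bracket hg h₂).mdiff m)]
  simp only [map_sub, LinearMap.sub_apply, schoutenSelf]
  simp only [P.bracket_apply _ _ m]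
  ring

variable [IsManifold 𝓘(ℝ, F) ∞ M] [FiniteDimensional ℝ F] [T2Space M]

/-- The bracket of two smooth families of functions is smooth in the parameter and the point. -/
theorem contMDiff_pv (P : BivectorField F M) {E : Type*} [NormedAddCommGroup E] [NormedSpace ℝ E]
    {N : Type*} [TopologicalSpace N] [ChartedSpace E N] [IsManifold 𝓘(ℝ, E) ∞ N]
    {f h : N → M → ℝ}
    (hf : ContMDiff (𝓘(ℝ, E).prod 𝓘(ℝ, F)) 𝓘(ℝ, ℝ) ∞ (fun p : N × M => f p.1 p.2))
    (hh : ContMDiff (𝓘(ℝ, E).prod 𝓘(ℝ, F)) 𝓘(ℝ, ℝ) ∞ (fun p : N × M => h p.1 p.2)) :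
    ContMDiff (𝓘(ℝ, E).prod 𝓘(ℝ, F)) 𝓘(ℝ, ℝ) ∞
      (fun p : N × M => P.pv p.2 (dR F (f p.1) p.2) (dR F (h p.1) p.2)) := by
  rintro ⟨n, m⟩
  obtain ⟨x, s, hs, hms, hsc, hx, hex⟩ := exists_coordinates (F := F) m
  -- Smoothness of `P` is given only on pairs of fixed functions. Expanding both differentials in
  -- coordinates reduces the families to the fixed coefficients `{x_i, x_j}`.
  have h1 : (fun p : N × M => P.pv p.2 (dR F (f p.1) p.2) (dR F (h p.1) p.2)) =ᶠ[𝓝 (n, m)]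
      fun p => ∑ i, ∑ j, (dR F (f p.1) p.2 (frame F m (Module.finBasis ℝ F i) p.2) *
        (dR F (h p.1) p.2 (frame F m (Module.finBasis ℝ F j) p.2) *
          P.bracket (x i) (x j) p.2)) := by
    filter_upwards [(hs.preimage continuous_snd).mem_nhds (show (n, m).2 ∈ s from hms)] with p hp
    have key : ∀ α β : F →L[ℝ] ℝ, P.pv p.2 α β =
        ∑ i, ∑ j, α (frame F m (Module.finBasis ℝ F i) p.2) *
          (β (frame F m (Module.finBasis ℝ F j) p.2) * P.bracket (x i) (x j) p.2) := fun α β => by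
      conv_lhs => rw [hex _ hp α, hex _ hp β]
      simp only [map_sum, LinearMap.sum_apply, map_smul, LinearMap.smul_apply, smul_eq_mul,
        bracket_apply, Finset.mul_sum]
      rw [Finset.sum_comm]
      exact Finset.sum_congr rfl fun i _ => Finset.sum_congr rfl fun j _ => by ring
    exact key _ _
  refine ContMDiffAt.congr_of_eventuallyEq ?_ h1
  refine contMDiffAt_finsetSum fun i _ => contMDiffAt_finsetSum fun j _ => ?_
  exact (contMDiffAt_dR_frame hf _ (hsc hms)).mul ((contMDiffAt_dR_frame hh _ (hsc hms)).mul
    (ContMDiffAt.comp _ (P.smoothFun_bracket (hx i) (hx j)).contMDiffAt contMDiffAt_snd))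

/-- At a critical point of `f` only the derivatives of the components of `df` survive in `d{h, f}`.
So `{g, {h, f}}` is the Hessian of `f` on the Hamiltonian vectors of `g` and `h`, which is symmetric
by `dR_frame_comm`. -/
theorem bracket_bracket_comm (P : BivectorField F M) {f g h : M → ℝ} (hf : SmoothFun F f)
    (hg : SmoothFun F g) (hh : SmoothFun F h) {m : M} (h0 : dR F f m = 0) :
    P.bracket g (P.bracket h f) m = P.bracket h (P.bracket g f) m := by
  obtain ⟨x, s, hs, hms, hsc, hx, hex⟩ := exists_coordinates (F := F) m
  set b := Module.finBasis ℝ F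
  have hPx : ∀ y ∈ s, ∀ α β : F →L[ℝ] ℝ, P.pv y α β =
      ∑ i, β (frame F m (b i) y) * P.pv y α (dR F (x i) y) := fun y hy α β => by
    conv_lhs => rw [hex _ hy β]
    simp only [map_sum, map_smul, smul_eq_mul, b]
  have hd : ∀ i, ContMDiffAt 𝓘(ℝ, F) 𝓘(ℝ, ℝ) ∞ (fun y => dR F f y (frame F m (b i) y)) m := fun i =>
    ContMDiffAt.comp m (contMDiffAt_dR_frame (N := F) (f := fun _ => f)
        (ContMDiff.comp (g := f) hf contMDiff_snd)
      (m := m) (b i) (p := ((0 : F), m)) (mem_chart_source F m))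
      ((contMDiff_const (I' := 𝓘(ℝ, F)) (c := (0 : F))).prodMk contMDiff_id).contMDiffAt
  have key : ∀ {g h : M → ℝ}, SmoothFun F g → SmoothFun F h → P.bracket g (P.bracket h f) m =
      ∑ i, ∑ j, dR F (fun y => dR F f y (frame F m (b i) y)) m (frame F m (b j) m) *
        (P.bracket g (x j) m * P.bracket h (x i) m) := by
    intro g h hg hh
    have h1 : P.bracket h f =ᶠ[𝓝 m] fun y => ∑ i, dR F f y (frame F m (b i) y) *
        P.bracket h (x i) y := by
      filter_upwards [hs.mem_nhds hms] with y hy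
      exact hPx y hy _ _
    have h2 : dR F (P.bracket h f) m = ∑ i, P.bracket h (x i) m •
        dR F (fun y => dR F f y (frame F m (b i) y)) m := by
      rw [dR_congr h1]
      rw [dR_sum (f := fun i y => dR F f y (frame F m (b i) y) * P.bracket h (x i) y) fun i =>
          ((hd i).mdifferentiableAt (by simp)).mul
        ((P.smoothFun_bracket hh (hx i)).mdiff m)]
      refine Finset.sum_congr rfl fun i _ => ?_
      rw [dR_mul ((hd i).mdifferentiableAt (by simp)) ((P.smoothFun_bracket hh (hx i)).mdiff m), h0]
      simp
    rw [bracket_apply, h2, map_sum]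
    refine Finset.sum_congr rfl fun i _ => ?_
    rw [map_smul, hPx m hms, Finset.smul_sum]
    refine Finset.sum_congr rfl fun j _ => ?_
    rw [smul_eq_mul, bracket_apply, bracket_apply]
    ring
  rw [key hg hh, key hh hg, Finset.sum_comm]
  refine Finset.sum_congr rfl fun i _ => Finset.sum_congr rfl fun j _ => ?_
  rw [dR_frame_comm hf]
  ring

/-- `[P, P](df₁, df₂, df₃)` depends only on the differentials at the point. -/
theorem schoutenSelf_eq_of_dR (P : BivectorField F M) {f g f₂ f₃ : M → ℝ} (hf : SmoothFun F f)
    (hg : SmoothFun F g) (h₂ : SmoothFun F f₂) (h₃ : SmoothFun F f₃) {m : M}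
    (h : dR F f m = dR F g m) : P.schoutenSelf f f₂ f₃ m = P.schoutenSelf g f₂ f₃ m := by
  rw [← sub_eq_zero, ← P.schoutenSelf_sub hf hg h₂ h₃]
  have hs : SmoothFun F (fun x => f x - g x) := ContMDiff.sub hf hg
  have h0 : dR F (fun x => f x - g x) m = 0 := by
    rw [dR_sub (hf.mdiff m) (hg.mdiff m), h, sub_self]
  -- The difference of the two functions is critical at `m`: one term of the cyclic sum vanishes and
  -- the other two cancel.
  have h1 := P.bracket_bracket_comm hs h₂ h₃ h0
  have h2 : P.bracket (fun x => f x - g x) f₂ = fun x => -P.bracket f₂ (fun x => f x - g x) x := by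
    ext y
    exact P.bracket_swap _ _ _
  have h3 : P.bracket f₃ (P.bracket (fun x => f x - g x) f₂) m =
      -P.bracket f₃ (P.bracket f₂ (fun x => f x - g x)) m := by
    have : dR F (fun x => -P.bracket f₂ (fun x => f x - g x) x) m =
        -dR F (P.bracket f₂ (fun x => f x - g x)) m := mfderiv_neg
    rw [h2, bracket_apply, this, map_neg]
    rfl
  rw [schoutenSelf, h3, h1, bracket_apply, h0]
  simp

end BivectorField

end Tensoriality

/-! ### Invariant bivector fields and infinitesimal symmetries -/

section Invariance

variable {G : Type*} [Group G]
  {F : Type*} [NormedAddCommGroup F] [NormedSpace ℝ F]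
  {M : Type*} [TopologicalSpace M] [ChartedSpace F M] [MulAction G M]

theorem BivectorField.bracket_smul {P : BivectorField F M} (hP : P.IsInvariant G) {f h : M → ℝ}
    (hf : SmoothFun F f) (hh : SmoothFun F h) {k : G}
    (hk : ContMDiff 𝓘(ℝ, F) 𝓘(ℝ, F) ∞ (fun x : M => k • x)) (m : M) :
    P.bracket f h (k • m) =
      P.pv m (dR F (fun x => f (k • x)) m) (dR F (fun x => h (k • x)) m) := by
  rw [dR_comp (hf.mdiff _) (hk.mdiff m) rfl, dR_comp (hh.mdiff _) (hk.mdiff m) rfl]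
  exact hP k m _ _

variable {E : Type*} [NormedAddCommGroup E] [NormedSpace ℝ E]
  [TopologicalSpace G] [ChartedSpace E G] [LieGroup 𝓘(ℝ, E) ∞ G]
  [FiniteDimensional ℝ F] [IsManifold 𝓘(ℝ, F) ∞ M] [ContMDiffSMul 𝓘(ℝ, E) 𝓘(ℝ, F) ∞ G M]

/-- An invariant bracket is differentiated by the infinitesimal action. -/
theorem BivectorField.dR_bracket_actMap {P : BivectorField F M} (hP : P.IsInvariant G)
    {f h : M → ℝ} (hf : SmoothFun F f) (hh : SmoothFun F h) (m : M) (ξ : E) :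
    dR F (P.bracket f h) m (actMap E G F m ξ) =
      P.bracket (fun x => dR F f x (actMap E G F x ξ)) h m +
        P.bracket f (fun x => dR F h x (actMap E G F x ξ)) m := by
  -- By invariance the bracket at `k • m` is the fixed bilinear form `P` at `m` on two covectors
  -- that depend on `k`; the claim is the product rule for this expression at `k = 1`.
  rw [dR_actMap (P.smoothFun_bracket hf hh)]
  simp only [bracket_smul hP hf hh (ContMDiffSMul.contMDiff_const_smul (I := 𝓘(ℝ, E)) _)]
  have hs : ∀ {f : M → ℝ}, SmoothFun F f → ContMDiff (𝓘(ℝ, E).prod 𝓘(ℝ, F)) 𝓘(ℝ, ℝ) ∞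
      (fun p : G × M => f (p.1 • p.2)) := fun hf =>
    ContMDiff.comp (g := _) hf (contMDiff_fst.smul contMDiff_snd)
  have ha : ∀ {f : M → ℝ}, SmoothFun F f → ContMDiffAt 𝓘(ℝ, E) 𝓘(ℝ, F →L[ℝ] ℝ) ∞
      (fun k : G => dR F (fun x => f (k • x)) m) 1 := fun hf =>
    contMDiffAt_md (f := fun (k : G) (x : M) => _) (hs hf).contMDiffAt
  -- Symmetry of mixed derivatives of `f(k • x)` in `k` and `x`.
  have hd : ∀ {f : M → ℝ}, SmoothFun F f →
      md 𝓘(ℝ, E) 𝓘(ℝ, F →L[ℝ] ℝ) (fun k : G => dR F (fun x => f (k • x)) m) 1 ξ =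
        dR F (fun x => dR F f x (actMap E G F x ξ)) m := fun {f} hf => by
    ext w
    have h1 := md_md_comm (a := (1 : G)) (b := m) (hs hf).contMDiffAt ξ w
    simp only [dR_actMap hf]
    refine Eq.trans ?_ h1
    let ev : (F →L[ℝ] ℝ) →L[ℝ] ℝ := ContinuousLinearMap.apply ℝ ℝ w
    have h2 := md_comp_of_eq (g := ev) (I₃ := 𝓘(ℝ, ℝ)) (y := dR F (fun x => f ((1 : G) • x)) m)
      ev.differentiableAt.mdifferentiableAt ((ha hf).mdifferentiableAt (by simp)) rfl
    rw [md_eq_fderiv, ev.fderiv] at h2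
    exact (DFunLike.congr_fun h2 ξ).symm
  let Q : (F →L[ℝ] ℝ) →L[ℝ] (F →L[ℝ] ℝ) →L[ℝ] ℝ := (P.pv m).toContinuousBilinearMap
  have hQ : ContMDiff (𝓘(ℝ, F →L[ℝ] ℝ).prod 𝓘(ℝ, F →L[ℝ] ℝ)) 𝓘(ℝ, ℝ) ∞
      (fun p : (F →L[ℝ] ℝ) × (F →L[ℝ] ℝ) => Q p.1 p.2) :=
    (Q.contMDiff.comp contMDiff_fst).clm_apply contMDiff_snd
  have hmd := md_comp₂ (I₄ := 𝓘(ℝ, ℝ)) (f := fun p : (F →L[ℝ] ℝ) × (F →L[ℝ] ℝ) => Q p.1 p.2)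
    (x := (1 : G))
    (g := fun k : G => dR F (fun x => f (k • x)) m) (h := fun k : G => dR F (fun x => h (k • x)) m)
    (I₂ := 𝓘(ℝ, F →L[ℝ] ℝ)) (I₃ := 𝓘(ℝ, F →L[ℝ] ℝ))
    (hQ.contMDiffAt.mdifferentiableAt (by simp))
    ((ha hf).mdifferentiableAt (by simp)) ((ha hh).mdifferentiableAt (by simp)) ξ
  rw [hd hf, hd hh] at hmd
  simp only [one_smul] at hmd
  have e1 : md 𝓘(ℝ, F →L[ℝ] ℝ) 𝓘(ℝ, ℝ) (fun z => Q z (dR F h m)) (dR F f m) =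
      Q.flip (dR F h m) := by
    rw [md_eq_fderiv]
    exact (Q.flip (dR F h m)).fderiv
  have e2 : md 𝓘(ℝ, F →L[ℝ] ℝ) 𝓘(ℝ, ℝ) (fun z => Q (dR F f m) z) (dR F h m) =
      Q (dR F f m) := by
    rw [md_eq_fderiv]
    exact (Q (dR F f m)).fderiv
  refine Eq.trans hmd ?_
  rw [e1, e2]
  rfl

end Invariance

/-! ### The Schouten bracket on functions pulled back from `G` -/

section Moment

theorem InvariantInnerProduct.cartan_eq {E : Type*} [NormedAddCommGroup E] [NormedSpace ℝ E]
    {G : Type*} [TopologicalSpace G] [ChartedSpace E G] [Group G]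
    (B : InvariantInnerProduct E G) (ξ η ζ : E) :
    B.cartan ξ η ζ = (1 / 2 : ℝ) * B.bf ξ (lieBr E G η ζ) := rfl

variable {E : Type*} [NormedAddCommGroup E] [NormedSpace ℝ E] [FiniteDimensional ℝ E]
  {G : Type*} [TopologicalSpace G] [ChartedSpace E G] [Group G] [LieGroup 𝓘(ℝ, E) ∞ G]
  {F : Type*} [NormedAddCommGroup F] [NormedSpace ℝ F] [FiniteDimensional ℝ F]
  {M : Type*} [TopologicalSpace M] [ChartedSpace F M] [IsManifold 𝓘(ℝ, F) ∞ M] [MulAction G M]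
  [ContMDiffSMul 𝓘(ℝ, E) 𝓘(ℝ, F) ∞ G M]

theorem lieBr_eq_sum (a b : E) {ι : Type*} [Fintype ι] (θ : ι → E) (x y : ι → ℝ)
    (ha : a = ∑ i, x i • θ i) (hb : b = ∑ i, y i • θ i) :
    lieBr E G a b = ∑ i, ∑ j, (x i * y j) • lieBr E G (θ i) (θ j) := by
  have : LieGroup 𝓘(ℝ, E) (minSmoothness ℝ 3) G := .of_le (n := ∞) (by simpa using ENat.LEInfty.out)
  have := FiniteDimensional.complete ℝ E
  have h : ∀ (a b : GroupLieAlgebra 𝓘(ℝ, E) G) (θ : ι → GroupLieAlgebra 𝓘(ℝ, E) G)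
    (_ : a = ∑ i, x i • θ i) (_ : b = ∑ i, y i • θ i),
    ⁅a, b⁆ = ∑ i, ∑ j, (x i * y j) • ⁅θ i, θ j⁆ := by
    rintro _ _ θ rfl rfl
    simp only [sum_lie, lie_sum, smul_lie, lie_smul, Finset.smul_sum, smul_smul]
    rw [Finset.sum_comm]
    simp only [mul_comm]
  exact h a b θ ha hb

namespace InvariantInnerProduct

/-- For an invariant bivector field that satisfies the moment map condition, `[P, P] = φ_M` holds
when one of the functions is pulled back from `G`. -/
theorem schoutenSelf_moment (B : InvariantInnerProduct E G) {P : BivectorField F M}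
    (hP : P.IsInvariant G) {Φ : M → G} (hΦ : ContMDiff 𝓘(ℝ, F) 𝓘(ℝ, E) ∞ Φ)
    (heq : ∀ (k : G) (m : M), Φ (k • m) = k * Φ m * k⁻¹)
    (hmom : ∀ f : G → ℝ, SmoothFun E f → ∀ (m : M) (β : F →L[ℝ] ℝ),
      P.pv m (dR F (fun x => f (Φ x)) m) β = -β (actMap E G F m (B.dop f (Φ m))))
    {f : G → ℝ} (hf : SmoothFun E f) {F₂ F₃ : M → ℝ} (h₂ : SmoothFun F F₂) (h₃ : SmoothFun F F₃)
    (m : M) :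
    P.schoutenSelf (fun x => f (Φ x)) F₂ F₃ m =
      B.cartan (B.pl m (dR F (fun x => f (Φ x)) m)) (B.pl m (dR F F₂ m)) (B.pl m (dR F F₃ m)) := by
  have := FiniteDimensional.complete ℝ E
  set e := Module.finBasis ℝ E
  -- The basis `e` and its dual basis `θ` with respect to the inner product take the place of an
  -- orthonormal basis.
  let θ : Fin (Module.finrank ℝ E) → E := fun a => B.sh (e.coord a).toContinuousLinearMap
  have hθ : ∀ a x, B.bf x (θ a) = e.coord a x := fun a x => by
    rw [bf_symm, bf_sh]
    rfl
  have hsum : ∀ x : E, x = ∑ a, B.bf x (e a) • θ a := fun x => B.eq_of_bf fun ζ => by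
    conv_lhs => rw [← e.sum_repr ζ]
    simp only [map_sum, LinearMap.sum_apply, map_smul, LinearMap.smul_apply, smul_eq_mul, B.bf_symm
        (θ _), hθ]
    refine Finset.sum_congr rfl fun a _ => ?_
    rw [mul_comm]
    rfl
  -- `X a` differentiates along `(e_a)_M` and `D a` along `½ (θ_a^L + θ_a^R)`. The moment condition
  -- becomes `{Φ^*f, F'} = ∑ Φ^*(D_a f) X_a F'`.
  let X : Fin (Module.finrank ℝ E) → (M → ℝ) → M → ℝ := fun a F' m => -dR F F' m
      (actMap E G F m (e a))
  let D : Fin (Module.finrank ℝ E) → (G → ℝ) → G → ℝ := fun a f => symDeriv E f (θ a)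
  have hX : ∀ a {F' : M → ℝ}, SmoothFun F F' → SmoothFun F (X a F') := fun a F' hF' =>
    ContMDiff.neg (smoothFun_dR_actMap hF' (e a))
  have hD : ∀ a {f : G → ℝ}, SmoothFun E f → SmoothFun E (D a f) := fun a f hf =>
    smoothFun_symDeriv hf (θ a)
  have hc : ∀ {f : G → ℝ}, SmoothFun E f → SmoothFun F (fun x => f (Φ x)) := fun hf =>
    ContMDiff.comp (g := _) hf hΦ
  have hbr : ∀ {f : G → ℝ}, SmoothFun E f → ∀ F' : M → ℝ, P.bracket (fun x => f (Φ x)) F' =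
      fun m => ∑ a, D a f (Φ m) * X a F' m := fun {f} hf F' => by
    ext m
    rw [P.bracket_apply, hmom f hf]
    have h1 : (B.dop f (Φ m) : E) = ∑ a, D a f (Φ m) • e a := by
      conv_lhs => rw [← e.sum_repr (B.dop f (Φ m) : E)]
      refine Finset.sum_congr rfl fun a _ => ?_
      have h2 : e.coord a (B.dop f (Φ m)) = D a f (Φ m) := by
        rw [← hθ]
        exact B.bf_dop f (Φ m) (θ a)
      exact congrArg (· • e a) h2
    rw [h1]
    simp [X, Finset.sum_neg_distrib]
  have hinv : ∀ a {f h : M → ℝ}, SmoothFun F f → SmoothFun F h → X a (P.bracket f h) m =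
      P.bracket (X a f) h m + P.bracket f (X a h) m := fun a f h hf hh => by
    have hneg : ∀ f : M → ℝ, dR F (X a f) m = -dR F (fun x => dR F f x (actMap E G F x (e a))) m :=
      fun f => mfderiv_neg
    simp only [X, P.dR_bracket_actMap hP hf hh]
    rw [P.bracket_apply, P.bracket_apply, P.bracket_apply, P.bracket_apply]
    have h1 := hneg f
    have h2 := hneg h
    simp only [X] at h1 h2
    rw [h1, h2]
    simp only [map_neg, LinearMap.neg_apply]
    ring
  have hleib : ∀ (u w : Fin (Module.finrank ℝ E) → M → ℝ), (∀ a, SmoothFun F (u a)) →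
      (∀ a, SmoothFun F (w a)) → ∀ h : M → ℝ, P.bracket h (fun m => ∑ a, u a m * w a m) m =
        ∑ a, (u a m * P.bracket h (w a) m + w a m * P.bracket h (u a) m) :=
    fun u w hu hw h => by
      rw [P.bracket_apply, dR_sum (f := fun a m => u a m * w a m)
        fun a => ((hu a).mdiff m).mul ((hw a).mdiff m), map_sum]
      refine Finset.sum_congr rfl fun a _ => ?_
      rw [dR_mul ((hu a).mdiff m) ((hw a).mdiff m), map_add, map_smul, map_smul]
      rfl
  have hswap : P.bracket F₃ (fun x => f (Φ x)) = fun m => ∑ a, D a f (Φ m) * (fun m => -X a F₃ m)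
      m := by
    ext m
    rw [P.bracket_swap, hbr hf]
    simp [Finset.sum_neg_distrib]
  have hneg : ∀ a, P.bracket F₂ (fun m => -X a F₃ m) m = -P.bracket F₂ (X a F₃) m := fun a => by
    have : dR F (fun m => -X a F₃ m) m = -dR F (X a F₃) m := mfderiv_neg
    rw [P.bracket_apply, this, map_neg]
    rfl
  -- By the Leibniz rule, and because the `X a` are derivations of the bracket, all terms in which
  -- `X a` acts inside a bracket cancel; what is left are the commutators of the `D a`.
  have hJ : P.bracket (fun x => f (Φ x)) (P.bracket F₂ F₃) m
      + P.bracket F₂ (P.bracket F₃ (fun x => f (Φ x))) m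
      + P.bracket F₃ (P.bracket (fun x => f (Φ x)) F₂) m =
      ∑ a, ∑ b, (X a F₂ m * X b F₃ m) * (D a (D b f) (Φ m) - D b (D a f) (Φ m)) := by
    have h1 : P.bracket (fun x => f (Φ x)) (P.bracket F₂ F₃) m =
      ∑ a, D a f (Φ m) * (P.bracket (X a F₂) F₃ m + P.bracket F₂ (X a F₃) m) := by
      rw [hbr hf]
      exact Finset.sum_congr rfl fun a _ => by rw [hinv a h₂ h₃]
    rw [h1, hswap, hleib (fun a m => D a f (Φ m)) (fun a m => -X a F₃ m) (fun a => hc (hD a hf))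
      (fun a => (hX a h₃).neg), hbr hf F₂, hleib (fun a m => D a f (Φ m)) (fun a => X a F₂)
      (fun a => hc (hD a hf)) (fun a => hX a h₂)]
    simp only [hneg, P.bracket_swap F₂ (fun m => D _ f (Φ m)),
      P.bracket_swap F₃ (fun m => D _ f (Φ m)), hbr (hD _ hf), mul_sub, Finset.sum_sub_distrib,
      P.bracket_swap (X _ F₂) F₃]
    rw [Finset.sum_comm (f := fun a b => X a F₂ m * X b F₃ m * D a (D b f) (Φ m)),
      ← Finset.sum_sub_distrib, ← Finset.sum_add_distrib, ← Finset.sum_add_distrib]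
    refine Finset.sum_congr rfl fun a _ => ?_
    have e1 : ∑ b, X b F₂ m * X a F₃ m * D b (D a f) (Φ m) =
        X a F₃ m * ∑ b, D b (D a f) (Φ m) * X b F₂ m := by
      rw [Finset.mul_sum]
      exact Finset.sum_congr rfl fun b _ => by ring
    have e2 : ∑ b, X a F₂ m * X b F₃ m * D b (D a f) (Φ m) =
        X a F₂ m * ∑ b, D b (D a f) (Φ m) * X b F₃ m := by
      rw [Finset.mul_sum]
      exact Finset.sum_congr rfl fun b _ => by ring
    rw [e1, e2]
    ring
  have hXp : ∀ a (F' : M → ℝ), X a F' m = B.bf (B.pl m (dR F F' m)) (e a) := fun a F' => by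
    rw [bf_pl]
  have hlie := lieBr_eq_sum (G := G) _ _ θ _ _ (hsum (B.pl m (dR F F₂ m)))
    (hsum (B.pl m (dR F F₃ m)))
  rw [cartan_eq, hlie, BivectorField.schoutenSelf, hJ, B.pl_comp_moment hΦ heq hf]
  -- `symDeriv_comm` pairs `¼ (1 - Ad_u) l` with the bracket, and `(1 - Ad_u) l` is what
  -- `pl_comp_moment` gives for `d(Φ^*f)`. The factor `2 · ¼` is the `½` of the Cartan tensor.
  have hcomm : ∀ a b, D a (D b f) (Φ m) - D b (D a f) (Φ m) = (1 / 4 : ℝ) *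
      B.bf (B.sh ((dR E f (Φ m)).comp (leftMap E (Φ m))) -
        adMap E (Φ m) (B.sh ((dR E f (Φ m)).comp (leftMap E (Φ m))))) (lieBr E G (θ a) (θ b)) := by
    intro a b
    simp only [D]
    rw [symDeriv_comm hf, rightMap_eq]
    congr 1
    obtain ⟨ζ, hζ⟩ : ∃ ζ', adMap E (Φ m) ζ' = lieBr E G (θ a) (θ b) := ⟨_, adMap_apply_inv _ _⟩
    rw [← hζ, adMap_inv_apply]
    simp [bf_sh, bf_adMap]
  simp only [hcomm, hXp, map_sum, map_smul, smul_eq_mul, Finset.mul_sum]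
  refine Finset.sum_congr rfl fun a _ => Finset.sum_congr rfl fun b _ => ?_
  ring

end InvariantInnerProduct

end Moment

/-! ### Comparison of `M` and `Y` along a cross-section -/

section CrossSection

variable {E : Type*} [NormedAddCommGroup E] [NormedSpace ℝ E] [FiniteDimensional ℝ E]
  {G : Type*} [TopologicalSpace G] [ChartedSpace E G] [Group G] [LieGroup 𝓘(ℝ, E) ∞ G]
  {E' : Type*} [NormedAddCommGroup E'] [NormedSpace ℝ E'] [FiniteDimensional ℝ E']
  {H : Subgroup G} [ChartedSpace E' H]
  {F : Type*} [NormedAddCommGroup F] [NormedSpace ℝ F]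
  {M : Type*} [TopologicalSpace M] [ChartedSpace F M] [MulAction G M]
  {F' : Type*} [NormedAddCommGroup F'] [NormedSpace ℝ F']
  {Y : Type*} [TopologicalSpace Y] [ChartedSpace F' Y] [MulAction H Y]

namespace InvariantInnerProduct

/-- The gradient of a restriction is the orthogonal projection of the gradient, here in left
trivializations. -/
theorem inclMap_sh (B : InvariantInnerProduct E G) (hH : IsLieSubgroup E E' H) {f : G → ℝ}
    (hf : SmoothFun E f) (u : H) :
  inclMap E E' H ((B.restrict hH).sh ((dR E' (fun x : H => f x) u).comp (leftMap E' u))) =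
      B.pS hH (B.sh ((dR E f u).comp (leftMap E (u : G)))) := by
  have hv : ContMDiff 𝓘(ℝ, E') 𝓘(ℝ, E) ∞ (Subtype.val : H → G) := hH.embedding.contMDiff
  refine (B.pS_eq_of hH _ _ fun ζ => ?_).symm
  rw [map_sub, LinearMap.sub_apply, B.bf_sh, ← B.bf_restrict hH, InvariantInnerProduct.bf_sh,
    ContinuousLinearMap.comp_apply, ContinuousLinearMap.comp_apply,
    dR_comp_apply (g := (Subtype.val : H → G)) (hf.mdiff _) (hv.mdiff u) rfl, md_val_leftMap hH,
    sub_self]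

/-- `Ad_u` with `u ∈ H` commutes with the inclusion of `𝔥`, so `dop_eq` for `H` is the formula for
`G` applied to the projected gradient. -/
theorem inclMap_dop (B : InvariantInnerProduct E G) (hH : IsLieSubgroup E E' H) {f : G → ℝ}
    (hf : SmoothFun E f) (u : H) :
    inclMap E E' H ((B.restrict hH).dop (fun x : H => f x) u) =
      (1 / 2 : ℝ) • (B.pS hH (B.sh ((dR E f u).comp (leftMap E (u : G)))) +
        adMap E (u : G) (B.pS hH (B.sh ((dR E f u).comp (leftMap E (u : G)))))) := by
  have := hH.lieGroup
  rw [InvariantInnerProduct.dop_eq, map_smul, map_add, inclMap_adMap hH, B.inclMap_sh hH hf]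

end InvariantInnerProduct

/-- `i : Y → M` is an `H`-equivariant smooth map along which the `G`-equivariant map `Φ` restricts
to `ΦY : Y → H`, with regular values. -/
structure IsCross (B : InvariantInnerProduct E G) (hH : IsLieSubgroup E E' H) (F F' : Type*)
    [NormedAddCommGroup F] [NormedSpace ℝ F] [NormedAddCommGroup F'] [NormedSpace ℝ F']
    {M : Type*} [TopologicalSpace M] [ChartedSpace F M] [MulAction G M]
    {Y : Type*} [TopologicalSpace Y] [ChartedSpace F' Y] [MulAction H Y]
    (i : Y → M) (Φ : M → G) (ΦY : Y → H) : Prop where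
  smooth_incl : ContMDiff 𝓘(ℝ, F') 𝓘(ℝ, F) ∞ i
  smul : ∀ (h : H) (y : Y), i (h • y) = (h : G) • i y
  coe_moment : ∀ y, (ΦY y : G) = Φ (i y)
  regular : ∀ y, B.Regular hH (ΦY y)
  smooth_moment : ContMDiff 𝓘(ℝ, F) 𝓘(ℝ, E) ∞ Φ
  smooth_moment' : ContMDiff 𝓘(ℝ, F') 𝓘(ℝ, E') ∞ ΦY
  equivariant : ∀ (k : G) (m : M), Φ (k • m) = k * Φ m * k⁻¹

namespace IsCross

variable {B : InvariantInnerProduct E G} {hH : IsLieSubgroup E E' H} {i : Y → M} {Φ : M → G}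
  {ΦY : Y → H}

theorem md_comp_actMap (hc : IsCross B hH F F' i Φ ΦY) [ContMDiffSMul 𝓘(ℝ, E) 𝓘(ℝ, F) ∞ G M]
    [ContMDiffSMul 𝓘(ℝ, E') 𝓘(ℝ, F') ∞ H Y] (y : Y) (ζ : E') :
    md 𝓘(ℝ, F') 𝓘(ℝ, F) i y (actMap E' H F' y ζ) = actMap E G F (i y) (inclMap E E' H ζ) := by
  have ha : ContMDiff 𝓘(ℝ, E') 𝓘(ℝ, F') ∞ (fun h : H => h • y) := contMDiff_id.smul contMDiff_const
  have ha' : ContMDiff 𝓘(ℝ, E) 𝓘(ℝ, F) ∞ (fun k : G => k • i y) :=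
    contMDiff_id.smul contMDiff_const
  have hv : ContMDiff 𝓘(ℝ, E') 𝓘(ℝ, E) ∞ (Subtype.val : H → G) := hH.embedding.contMDiff
  have h1 := md_comp_of_eq (g := i) (f := fun h : H => h • y) (x := 1) (y := y)
    (hc.smooth_incl.mdiff y) (ha.mdiff 1) (one_smul _ _)
  have h2 := md_comp_of_eq (g := fun k : G => k • i y) (f := (Subtype.val : H → G)) (x := 1)
    (y := 1) (ha'.mdiff 1) (hv.mdiff 1) rfl
  have h3 : (fun h : H => i (h • y)) = fun h : H => (h : G) • i y := funext fun h => hc.smul h y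
  rw [h3] at h1
  exact (DFunLike.congr_fun h1 ζ).symm.trans (DFunLike.congr_fun h2 ζ)

theorem pS_pl (hc : IsCross B hH F F' i Φ ΦY) [ContMDiffSMul 𝓘(ℝ, E) 𝓘(ℝ, F) ∞ G M]
    [ContMDiffSMul 𝓘(ℝ, E') 𝓘(ℝ, F') ∞ H Y]
    (y : Y) (α : F →L[ℝ] ℝ) : B.pS hH (B.pl (i y) α) =
      inclMap E E' H ((B.restrict hH).pl y (α.comp (md 𝓘(ℝ, F') 𝓘(ℝ, F) i y))) :=
  B.pS_eq_of hH _ _ fun ζ => by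
    rw [map_sub, LinearMap.sub_apply, B.bf_pl, ← B.bf_restrict hH, InvariantInnerProduct.bf_pl,
      ContinuousLinearMap.comp_apply, hc.md_comp_actMap, sub_self]

theorem dR_comp_moment (hc : IsCross B hH F F' i Φ ΦY) {f : G → ℝ} (hf : SmoothFun E f) (y : Y) :
    (dR F (fun x => f (Φ x)) (i y)).comp (md 𝓘(ℝ, F') 𝓘(ℝ, F) i y) =
      dR F' (fun y => f (ΦY y : G)) y := by
  have : SmoothFun F (fun x => f (Φ x)) := ContMDiff.comp (g := f) hf hc.smooth_moment
  simp only [hc.coe_moment]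
  exact (dR_comp (f := fun x => f (Φ x)) (this.mdiff _) (hc.smooth_incl.mdiff y) rfl).symm

theorem splits_apply {P : BivectorField F M} {Q : BivectorField F' Y}
    (hs : B.SplitsAlong P i Q (fun y => -B.rMatrix hH (ΦY y))) (y : Y) (α β : F →L[ℝ] ℝ) :
    P.pv (i y) α β = Q.pv y (α.comp (md 𝓘(ℝ, F') 𝓘(ℝ, F) i y)) (β.comp (md 𝓘(ℝ, F') 𝓘(ℝ, F) i y))
      - B.bf (B.pl (i y) α) (B.rM hH (ΦY y) (B.pl (i y) β)) := by
  have h := hs y α β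
  have e : B.generated (-B.rMatrix hH (ΦY y)) (i y) α β =
      -(B.bf (B.pl (i y) α) (B.rM hH (ΦY y) (B.pl (i y) β))) :=
    congrArg₂ (fun ξ η : E => -(B.bf ξ (B.rM hH (ΦY y) η))) (B.pull_eq_pl (i y) α)
      (B.pull_eq_pl (i y) β)
  exact h.trans ((congrArg _ e).trans (sub_eq_add_neg _ _).symm)

/-- Along a cross-section, the moment map conditions on `M` and on `Y` are equivalent. -/
theorem moment_defect (hc : IsCross B hH F F' i Φ ΦY) [ContMDiffSMul 𝓘(ℝ, E) 𝓘(ℝ, F) ∞ G M]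
    [ContMDiffSMul 𝓘(ℝ, E') 𝓘(ℝ, F') ∞ H Y] {P : BivectorField F M} {Q : BivectorField F' Y}
    (hs : B.SplitsAlong P i Q (fun y => -B.rMatrix hH (ΦY y))) {f : G → ℝ} (hf : SmoothFun E f)
    (y : Y) (β : F →L[ℝ] ℝ) :
    P.pv (i y) (dR F (fun x => f (Φ x)) (i y)) β +
        β (actMap E G F (i y) (B.dop f (Φ (i y)))) =
      Q.pv y (dR F' (fun y => f (ΦY y : G)) y) (β.comp (md 𝓘(ℝ, F') 𝓘(ℝ, F) i y)) +
        β.comp (md 𝓘(ℝ, F') 𝓘(ℝ, F) i y)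
          (actMap E' H F' y ((B.restrict hH).dop (fun x : H => f x) (ΦY y))) := by
  have := hH.lieGroup
  set u := ΦY y with hu
  set l := B.sh ((dR E f (u : G)).comp (leftMap E (u : G))) with hl
  have hr := hc.regular y
  have hpv := splits_apply hs y (dR F (fun x => f (Φ x)) (i y)) β
  have hpl : B.pl (i y) (dR F (fun x => f (Φ x)) (i y)) = l - adMap E (u : G) l := by
    rw [B.pl_comp_moment hc.smooth_moment hc.equivariant hf, ← hc.coe_moment]
  have hrM : B.rM hH u (l - adMap E (u : G) l) =
      (1 / 2 : ℝ) • (adMap E (u : G) (B.pP hH l) + B.pP hH l) :=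
    B.rM_eq_of hH hr (B.bf_pP hH l) (by rw [map_sub, B.pP_adMap])
  -- `𝒟f` splits into the operator of `H` and `½ (1 + Ad_u)` of the part of `l` in `𝔥^⊥`. By `hrM`
  -- the latter is exactly the contribution of the r-matrix, so it cancels on the left-hand side.
  have hdop : B.dop f (u : G) = (1 / 2 : ℝ) • (adMap E (u : G) (B.pP hH l) + B.pP hH l) +
      inclMap E E' H ((B.restrict hH).dop (fun x : H => f x) u) := by
    rw [B.inclMap_dop hH hf, B.dop_eq, ← hl]
    conv_lhs => rw [← B.pS_add_pP hH l]
    rw [map_add]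
    module
  rw [hpv, hc.dR_comp_moment hf, hpl, B.bf_rM_skew hH hr, hrM, sub_neg_eq_add,
    B.bf_symm _ (B.pl (i y) β), ← hc.coe_moment, hdop, map_add, map_add,
        ContinuousLinearMap.comp_apply,
    hc.md_comp_actMap, B.bf_pl]
  ring

/-- If `ν` is the component in `𝔥^⊥`, then `ν · ν = B.pl (i y) α · ν`, which is `α` on the orbit
direction of `ν` up to sign and hence zero. -/
theorem pl_eq_inclMap (hc : IsCross B hH F F' i Φ ΦY) [ContMDiffSMul 𝓘(ℝ, E) 𝓘(ℝ, F) ∞ G M]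
    [ContMDiffSMul 𝓘(ℝ, E') 𝓘(ℝ, F') ∞ H Y] (y : Y) {α : F →L[ℝ] ℝ}
    (hα : ∀ ξ : E, (∀ ζ, B.bf ξ (inclMap E E' H ζ) = 0) → α (actMap E G F (i y) ξ) = 0) :
    B.pl (i y) α =
      inclMap E E' H ((B.restrict hH).pl y (α.comp (md 𝓘(ℝ, F') 𝓘(ℝ, F) i y))) := by
  rw [← hc.pS_pl, eq_comm, ← sub_eq_zero, ← neg_eq_zero, neg_sub, ← B.pP_apply hH]
  apply B.eq_zero_of_bf_self
  rw [← B.bf_perp_left hH (B.bf_pP hH _), B.bf_symm, B.bf_pl, hα _ (B.bf_pP hH _), neg_zero]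

/-- The Schouten brackets of `P` and `Q` agree on functions that are constant to first order in the
directions of `𝔥^⊥`. -/
theorem schoutenSelf_eq (hc : IsCross B hH F F' i Φ ΦY) [ContMDiffSMul 𝓘(ℝ, E) 𝓘(ℝ, F) ∞ G M]
    [ContMDiffSMul 𝓘(ℝ, E') 𝓘(ℝ, F') ∞ H Y] {P : BivectorField F M} {Q : BivectorField F' Y}
    (hs : B.SplitsAlong P i Q (fun y => -B.rMatrix hH (ΦY y))) {f : Fin 3 → M → ℝ}
    (hf : ∀ a, SmoothFun F (f a)) {y : Y}
    (hperp : ∀ a, ∀ᶠ z in 𝓝 y, ∀ ξ : E, (∀ ζ, B.bf ξ (inclMap E E' H ζ) = 0) →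
      dR F (f a) (i z) (actMap E G F (i z) ξ) = 0) :
    P.schoutenSelf (f 0) (f 1) (f 2) (i y) =
      Q.schoutenSelf (fun z => f 0 (i z)) (fun z => f 1 (i z)) (fun z => f 2 (i z)) y := by
  have hcomp : ∀ {g : M → ℝ}, SmoothFun F g → ∀ z,
      (dR F g (i z)).comp (md 𝓘(ℝ, F') 𝓘(ℝ, F) i z) = dR F' (fun z => g (i z)) z := fun hg z =>
    (dR_comp (hg.mdiff _) (hc.smooth_incl.mdiff z) rfl).symm
  -- The differential of `f a` pulls back into `𝔥`, where the r-matrix vanishes, and only `Q`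
  -- remains. No condition on `g` is needed and the identity holds near `y`, so it can be applied to
  -- iterated brackets.
  have h1 : ∀ a {g : M → ℝ}, SmoothFun F g → ∀ᶠ z in 𝓝 y,
      P.bracket (f a) g (i z) = Q.bracket (fun z => f a (i z)) (fun z => g (i z)) z := by
    intro a g hg
    filter_upwards [hperp a] with z hz
    rw [P.bracket_apply, splits_apply hs, hcomp (hf a), hcomp hg, hc.pl_eq_inclMap z hz,
      B.bf_rM_skew hH (hc.regular z), B.rM_inclMap]
    simp [Q.bracket_apply]
  have h2 : ∀ a b c, P.bracket (f a) (P.bracket (f b) (f c)) (i y) =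
      Q.bracket (fun z => f a (i z)) (Q.bracket (fun z => f b (i z)) (fun z => f c (i z))) y := by
    intro a b c
    rw [(h1 a (P.smoothFun_bracket (hf b) (hf c))).self_of_nhds]
    exact Q.bracket_congr EventuallyEq.rfl (h1 b (hf c))
  rw [BivectorField.schoutenSelf, BivectorField.schoutenSelf, h2, h2, h2]

/-- All three covectors pull back into `𝔥`, where the inner product restricts and the bracket is
that of `𝔥` by `inclMap_lieBr`. -/
theorem cartan_eq (hc : IsCross B hH F F' i Φ ΦY) [T2Space G]
    [ContMDiffSMul 𝓘(ℝ, E) 𝓘(ℝ, F) ∞ G M]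
    [ContMDiffSMul 𝓘(ℝ, E') 𝓘(ℝ, F') ∞ H Y] (y : Y) {α : Fin 3 → F →L[ℝ] ℝ}
    (hα : ∀ a, ∀ ξ : E, (∀ ζ, B.bf ξ (inclMap E E' H ζ) = 0) → α a (actMap E G F (i y) ξ) = 0) :
    B.cartan (B.pl (i y) (α 0)) (B.pl (i y) (α 1)) (B.pl (i y) (α 2)) =
      (B.restrict hH).cartan
        ((B.restrict hH).pl y ((α 0).comp (md 𝓘(ℝ, F') 𝓘(ℝ, F) i y)))
        ((B.restrict hH).pl y ((α 1).comp (md 𝓘(ℝ, F') 𝓘(ℝ, F) i y)))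
        ((B.restrict hH).pl y ((α 2).comp (md 𝓘(ℝ, F') 𝓘(ℝ, F) i y))) := by
  rw [B.cartan_eq, InvariantInnerProduct.cartan_eq, B.bf_restrict, inclMap_lieBr hH,
    hc.pl_eq_inclMap y (hα 0), hc.pl_eq_inclMap y (hα 1), hc.pl_eq_inclMap y (hα 2)]

/-- A covector that vanishes on the cross-section comes from `G`. -/
theorem exists_dR_moment_eq (hc : IsCross B hH F F' i Φ ΦY) [T2Space G]
    [ContMDiffSMul 𝓘(ℝ, E) 𝓘(ℝ, F) ∞ G M] [ContMDiffSMul 𝓘(ℝ, E') 𝓘(ℝ, F') ∞ H Y] {y : Y}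
    (hspan : ∀ w : F, ∃ (v : F') (ξ : E), w = md 𝓘(ℝ, F') 𝓘(ℝ, F) i y v + actMap E G F (i y) ξ)
    {α : F →L[ℝ] ℝ} (hα : α.comp (md 𝓘(ℝ, F') 𝓘(ℝ, F) i y) = 0) :
    ∃ f : G → ℝ, SmoothFun E f ∧ dR F (fun x => f (Φ x)) (i y) = α ∧
      ∀ ζ, B.bf (B.sh ((dR E f (ΦY y : G)).comp (leftMap E (ΦY y : G)))) (inclMap E E' H ζ) =
          0 := by
  have := hH.lieGroup
  set u := ΦY y with hu
  have hp : B.pP hH (B.pl (i y) α) = B.pl (i y) α := B.pP_of_perp hH fun ζ => by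
    rw [B.bf_pl, ← hc.md_comp_actMap, ← ContinuousLinearMap.comp_apply, hα]
    simp
  -- `α` vanishes on the `H`-orbits, so `B.pl (i y) α` lies in `𝔥^⊥`. A function with gradient `l`,
  -- where `(1 - Ad_u) l` is this element, is the only possible choice in view of `pl_comp_moment`.
  obtain ⟨l, hl, hlα⟩ := B.exists_sub_adMap hH (hc.regular y) (B.pl (i y) α)
  rw [hp] at hlα
  let L : E ≃L[ℝ] E := (LinearEquiv.ofBijective (leftMap E (u : G)).toLinearMap
    (leftMap_bijective (u : G))).toContinuousLinearEquiv
  obtain ⟨f, hf, hfd⟩ := exists_smoothFun_md_eq (u : G)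
    ((B.bf l).toContinuousLinearMap.comp L.symm.toContinuousLinearMap)
  have hfl : ∀ ξ : E, dR E f (u : G) (leftMap E (u : G) ξ) = B.bf l ξ := fun ξ => by
    have : dR E f (u : G) = (B.bf l).toContinuousLinearMap.comp L.symm.toContinuousLinearMap := hfd
    rw [this]
    exact congrArg (B.bf l) (L.symm_apply_apply ξ)
  have hsh : B.sh ((dR E f (u : G)).comp (leftMap E (u : G))) = l := B.eq_of_bf fun ξ => by
    rw [B.bf_sh, ContinuousLinearMap.comp_apply, hfl]
  refine ⟨f, hf, ?_, fun ζ => by rw [hsh, hl]⟩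
  -- The two covectors agree on orbit directions by `h1`. Both vanish on the cross-section by `h2`
  -- and `hα`, since `l` is orthogonal to `𝔥`. By `hspan` these directions span.
  have h1 : B.pl (i y) (dR F (fun x => f (Φ x)) (i y)) = B.pl (i y) α := by
    rw [B.pl_comp_moment hc.smooth_moment hc.equivariant hf, ← hc.coe_moment, hsh, hlα]
  have h2 : (dR F (fun x => f (Φ x)) (i y)).comp (md 𝓘(ℝ, F') 𝓘(ℝ, F) i y) = 0 := by
    rw [hc.dR_comp_moment hf]
    have hv : ContMDiff 𝓘(ℝ, E') 𝓘(ℝ, E) ∞ (Subtype.val : H → G) := hH.embedding.contMDiff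
    have hfv : SmoothFun E' (fun x : H => f x) := ContMDiff.comp (g := f) hf hv
    ext w
    rw [dR_comp_apply (f := fun x : H => f x) (g := ΦY) (hfv.mdiff _) (hc.smooth_moment'.mdiff y)
      rfl, dR_comp_apply (g := (Subtype.val : H → G)) (hf.mdiff _) (hv.mdiff _) rfl]
    obtain ⟨ζ, hζ⟩ := (leftMap_bijective (E := E') (ΦY y)).2 (md 𝓘(ℝ, F') 𝓘(ℝ, E') ΦY y w)
    rw [← hζ, md_val_leftMap hH, hfl, hl]
    rfl
  ext w
  obtain ⟨v, ξ, rfl⟩ := hspan w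
  have h3 := DFunLike.congr_fun h2 v
  have h4 := DFunLike.congr_fun hα v
  have h5 := congrArg (fun η => B.bf η ξ) h1
  simp only [B.bf_pl, neg_inj] at h5
  simp only [ContinuousLinearMap.comp_apply, zero_apply] at h3 h4
  rw [map_add, map_add, h3, h4, h5]

end IsCross

end CrossSection

/-! ### Charts from local diffeomorphisms; criteria for submersions and immersions -/

section Charts

variable {E₁ : Type*} [NormedAddCommGroup E₁] [NormedSpace ℝ E₁]
  {H₁ : Type*} [TopologicalSpace H₁] {I₁ : ModelWithCorners ℝ E₁ H₁}
  {M₁ : Type*} [TopologicalSpace M₁] [ChartedSpace H₁ M₁]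
  {E₂ : Type*} [NormedAddCommGroup E₂] [NormedSpace ℝ E₂]
  {H₂ : Type*} [TopologicalSpace H₂] {I₂ : ModelWithCorners ℝ E₂ H₂}
  {M₂ : Type*} [TopologicalSpace M₂] [ChartedSpace H₂ M₂]
  {E₃ : Type*} [NormedAddCommGroup E₃] [NormedSpace ℝ E₃]
  {H₃ : Type*} [TopologicalSpace H₃] {I₃ : ModelWithCorners ℝ E₃ H₃}
  {M₃ : Type*} [TopologicalSpace M₃] [ChartedSpace H₃ M₃]

theorem mem_contDiffGroupoid_of_contMDiffOn {f : OpenPartialHomeomorph H₁ H₁}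
    (hf : ContMDiffOn I₁ I₁ ∞ f f.source) (hf' : ContMDiffOn I₁ I₁ ∞ f.symm f.target) :
    f ∈ contDiffGroupoid ∞ I₁ := by
  have key : ∀ {g : H₁ → H₁} {s : Set H₁}, ContMDiffOn I₁ I₁ ∞ g s →
      ContDiffOn ℝ ∞ (I₁ ∘ g ∘ I₁.symm) (I₁.symm ⁻¹' s ∩ range I₁) := fun hg => by
    rw [← contMDiffOn_iff_contDiffOn]
    exact I₁.contMDiff.comp_contMDiffOn (hg.comp
      (I₁.contMDiffOn_symm.mono inter_subset_right) fun x hx => hx.1)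
  rw [contDiffGroupoid, mem_groupoid_of_pregroupoid]
  exact ⟨key hf, key hf'⟩

theorem mem_maximalAtlas_of_contMDiffOn [IsManifold I₁ ∞ M₁] {e : OpenPartialHomeomorph M₁ H₁}
    (he : ContMDiffOn I₁ I₁ ∞ e e.source) (he' : ContMDiffOn I₁ I₁ ∞ e.symm e.target) :
    e ∈ IsManifold.maximalAtlas I₁ ∞ M₁ := by
  rw [IsManifold.mem_maximalAtlas_iff]
  have key : ∀ e' ∈ atlas H₁ M₁, e.symm ≫ₕ e' ∈ contDiffGroupoid ∞ I₁ := fun c hc => by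
    have hc' := IsManifold.subset_maximalAtlas (I := I₁) (n := ∞) hc
    have h1 := contMDiffOn_of_mem_maximalAtlas hc'
    have h2 := contMDiffOn_symm_of_mem_maximalAtlas hc'
    refine mem_contDiffGroupoid_of_contMDiffOn ?_ ?_
    · refine h1.comp (he'.mono ?_) ?_
      · rw [OpenPartialHomeomorph.trans_source]
        exact inter_subset_left
      · intro x hx
        rw [OpenPartialHomeomorph.trans_source] at hx
        exact hx.2
    · refine he.comp (h2.mono ?_) ?_
      · rw [OpenPartialHomeomorph.trans_target]
        exact inter_subset_left
      · intro x hx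
        rw [OpenPartialHomeomorph.trans_target] at hx
        exact hx.2
  exact fun c hc => ⟨key c hc, by
    have := (contDiffGroupoid ∞ I₁).symm (key c hc)
    rwa [OpenPartialHomeomorph.trans_symm_eq_symm_trans_symm,
      OpenPartialHomeomorph.symm_symm] at this⟩

/-- A local diffeomorphism to the model vector space gives a chart of the maximal atlas near a
point. -/
theorem exists_chart_of_isLocalDiffeomorphAt [I₁.Boundaryless] [IsManifold I₁ ∞ M₁] {ψ : M₁ → E₁}
    {x : M₁} (hψ : IsLocalDiffeomorphAt I₁ 𝓘(ℝ, E₁) ∞ ψ x) {s : Set M₁} (hs : s ∈ 𝓝 x) :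
    ∃ e ∈ IsManifold.maximalAtlas I₁ ∞ M₁, x ∈ e.source ∧ e.source ⊆ s ∧
      ∀ y ∈ e.source, I₁ (e y) = ψ y := by
  obtain ⟨Ψ, hx, hΨ⟩ := hψ
  obtain ⟨O, hO, hOo, hxO⟩ := mem_nhds_iff.1 hs
  let e₀ := Ψ.toOpenPartialHomeomorph.restrOpen O hOo
  let e := e₀.trans I₁.toHomeomorph.symm.toOpenPartialHomeomorph
  have hes : e.source = Ψ.source ∩ O := by
    simp only [e, e₀, OpenPartialHomeomorph.trans_source, OpenPartialHomeomorph.restrOpen_source]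
    simp
  have hsym : ContMDiff 𝓘(ℝ, E₁) I₁ ∞ I₁.symm := by
    rw [← contMDiffOn_univ, ← I₁.range_eq_univ]
    exact I₁.contMDiffOn_symm
  refine ⟨e, mem_maximalAtlas_of_contMDiffOn ?_ ?_, ?_, ?_, ?_⟩
  · rw [hes]
    exact hsym.comp_contMDiffOn (Ψ.contMDiffOn_toFun.mono inter_subset_left)
  · refine Ψ.contMDiffOn_invFun.comp I₁.contMDiff.contMDiffOn ?_
    intro z hz
    simp only [e, e₀, OpenPartialHomeomorph.trans_target] at hz
    exact hz.2.1
  · rw [hes]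
    exact ⟨hx, hxO⟩
  · rw [hes]
    exact inter_subset_right.trans hO
  · intro y hy
    rw [hes] at hy
    rw [hΨ hy.1]
    exact I₁.right_inv (by rw [I₁.range_eq_univ]; trivial)

theorem isLocalDiffeomorphAt_extChartAt [I₁.Boundaryless] [IsManifold I₁ ∞ M₁] (x : M₁) :
    IsLocalDiffeomorphAt I₁ 𝓘(ℝ, E₁) ∞ (extChartAt I₁ x) x :=
  ⟨chartDiffeo I₁ x, mem_extChartAt_source x, fun _ _ => rfl⟩

theorem isLocalDiffeomorphAt_continuousLinearEquiv (L : E₁ ≃L[ℝ] E₂) (x : E₁) :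
    IsLocalDiffeomorphAt 𝓘(ℝ, E₁) 𝓘(ℝ, E₂) ∞ L x :=
  L.toDiffeomorph.isLocalDiffeomorph x

/-- A local diffeomorphism restricts to partial diffeomorphisms with small domains. -/
theorem exists_partialDiffeomorph_subset {f : M₁ → M₂} {x : M₁}
    (hf : IsLocalDiffeomorphAt I₁ I₂ ∞ f x) {s : Set M₁} (hs : s ∈ 𝓝 x) :
    ∃ Ψ : PartialDiffeomorph I₁ I₂ M₁ M₂ ∞, x ∈ Ψ.source ∧ Ψ.source ⊆ s ∧ EqOn f Ψ Ψ.source := by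
  obtain ⟨Ψ, hx, hΨ⟩ := hf
  obtain ⟨O, hO, hOo, hxO⟩ := mem_nhds_iff.1 hs
  let e := Ψ.toOpenPartialHomeomorph.restrOpen O hOo
  have hes : e.source = Ψ.source ∩ O := OpenPartialHomeomorph.restrOpen_source _ _ _
  refine ⟨⟨e.toPartialEquiv, e.open_source, e.open_target, ?_, ?_⟩, ?_, ?_, ?_⟩
  · change ContMDiffOn I₁ I₂ ∞ Ψ e.source
    rw [hes]
    exact Ψ.contMDiffOn_toFun.mono inter_subset_left
  · exact Ψ.contMDiffOn_invFun.mono fun z hz => hz.1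
  · change x ∈ e.source
    rw [hes]
    exact ⟨hx, hxO⟩
  · change e.source ⊆ s
    rw [hes]
    exact inter_subset_right.trans hO
  · intro y hy
    have hy' : y ∈ e.source := hy
    rw [hes] at hy'
    exact hΨ hy'.1

theorem isLocalDiffeomorphAt_congr {f g : M₁ → M₂} {x : M₁} (hf : IsLocalDiffeomorphAt I₁ I₂ ∞ f x)
    (h : f =ᶠ[𝓝 x] g) : IsLocalDiffeomorphAt I₁ I₂ ∞ g x := by
  obtain ⟨Ψ, hx, hs, hΨ⟩ := exists_partialDiffeomorph_subset hf h
  exact ⟨Ψ, hx, fun y hy => (hs hy).symm.trans (hΨ hy)⟩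

/-- A map that is locally the projection of a product is a submersion. -/
theorem isSubmersionAtOfComplement_of_isLocalDiffeomorphAt [I₁.Boundaryless] [IsManifold I₁ ∞ M₁]
    [I₂.Boundaryless] [IsManifold I₂ ∞ M₂] [I₃.Boundaryless] [IsManifold I₃ ∞ M₃]
    {f : M₁ → M₂} {D : M₁ → M₂ × M₃} {x : M₁}
    (hD : IsLocalDiffeomorphAt I₁ (I₂.prod I₃) ∞ D x) (hf : ∀ᶠ y in 𝓝 x, f y = (D y).1) :
    Manifold.IsSubmersionAtOfComplement E₃ I₁ I₂ ∞ f x := by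
  let L : E₁ ≃L[ℝ] E₂ × E₃ := hD.mfderivToContinuousLinearEquiv (by simp)
  -- In the source chart `L⁻¹ ∘ (product chart) ∘ D` the map `f` is literally the first component of
  -- `L`, the normal form that a submersion requires.
  have hψ : IsLocalDiffeomorphAt I₁ 𝓘(ℝ, E₁) ∞
      (L.symm ∘ (extChartAt (I₂.prod I₃) (D x)) ∘ D) x :=
    (hD.comp _ _ (isLocalDiffeomorphAt_extChartAt (D x))).comp _ _
      (isLocalDiffeomorphAt_continuousLinearEquiv L.symm _)
  obtain ⟨e, he, hxe, hes, hee⟩ := exists_chart_of_isLocalDiffeomorphAt hψ hf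
  have hfx : f x = (D x).1 := hf.self_of_nhds
  have hcont : ContinuousAt f x := by
    have : ContinuousAt (fun y => (D y).1) x := continuousAt_fst.comp hD.contMDiffAt.continuousAt
    exact this.congr (hf.mono fun y hy => hy.symm)
  refine Manifold.IsSubmersionAtOfComplement.mk_of_continuousAt hcont L e (chartAt H₂ (D x).1) hxe
    (by rw [hfx]; exact mem_chart_source _ _) he (IsManifold.chart_mem_maximalAtlas _) ?_
  intro z hz
  have hy : (e.extend I₁).symm z ∈ e.source := by
    have := (e.extend I₁).map_target hz
    rwa [e.extend_source] at this
  have hz' : I₁ (e ((e.extend I₁).symm z)) = z := (e.extend I₁).right_inv hz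
  have h1 := hee _ hy
  rw [hz'] at h1
  have h2 : L z = extChartAt (I₂.prod I₃) (D x) (D ((e.extend I₁).symm z)) :=
    (congrArg L h1).trans (L.apply_symm_apply _)
  change extChartAt I₂ (D x).1 (f ((e.extend I₁).symm z)) = (L z).1
  rw [h2, hes hy, extChartAt_prod]
  rfl

/-- A map that is locally the inclusion of a factor of a product is an immersion. -/
theorem isImmersionAtOfComplement_of_isLocalDiffeomorphAt [I₁.Boundaryless] [IsManifold I₁ ∞ M₁]
    [I₂.Boundaryless] [IsManifold I₂ ∞ M₂] {V : Type*} [NormedAddCommGroup V] [NormedSpace ℝ V]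
    {f : M₁ → M₂} {D : M₁ × V → M₂} {x : M₁}
    (hD : IsLocalDiffeomorphAt (I₁.prod 𝓘(ℝ, V)) I₂ ∞ D (x, 0)) (hf : ∀ᶠ y in 𝓝 x, f y = D (y, 0)) :
    Manifold.IsImmersionAtOfComplement V I₁ I₂ ∞ f x := by
  let L : (E₁ × V) ≃L[ℝ] E₂ := hD.mfderivToContinuousLinearEquiv (by simp)
  have hfx : f x = D (x, 0) := hf.self_of_nhds
  have hcont : ContinuousAt f x := by
    have h1 : ContinuousAt (fun y : M₁ => (y, (0 : V))) x := by fun_prop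
    have : ContinuousAt (fun y => D (y, 0)) x :=
      ContinuousAt.comp (g := D) hD.contMDiffAt.continuousAt h1
    exact this.congr (hf.mono fun y hy => hy.symm)
  have hinv : hD.localInverse (D (x, 0)) = (x, 0) :=
    hD.localInverse_left_inv hD.localInverse_mem_target
  have h3 : IsLocalDiffeomorphAt (I₁.prod 𝓘(ℝ, V)) 𝓘(ℝ, E₁ × V) ∞
      (extChartAt (I₁.prod 𝓘(ℝ, V)) (x, (0 : V))) (hD.localInverse (D (x, 0))) := by
    rw [hinv]
    exact isLocalDiffeomorphAt_extChartAt (x, (0 : V))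
  -- In the target chart `L ∘ (product chart) ∘ D⁻¹` the map `f` is literally `z ↦ L (z, 0)`.
  have hψ : IsLocalDiffeomorphAt I₂ 𝓘(ℝ, E₂) ∞
      (L ∘ (extChartAt (I₁.prod 𝓘(ℝ, V)) (x, (0 : V))) ∘ hD.localInverse) (D (x, 0)) :=
    (hD.localInverse_isLocalDiffeomorphAt.comp _ _ h3).comp _ _
      (isLocalDiffeomorphAt_continuousLinearEquiv L _)
  obtain ⟨e, he, hxe, -, hee⟩ := exists_chart_of_isLocalDiffeomorphAt hψ univ_mem
  have hs : ∀ᶠ y in 𝓝 x, f y = D (y, 0) ∧ f y ∈ e.source ∧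
      hD.localInverse (D (y, 0)) = (y, 0) := by
    refine hf.and ((hcont.eventually (e.open_source.mem_nhds (by rwa [hfx]))).and ?_)
    have h1 : Tendsto (fun y : M₁ => (y, (0 : V))) (𝓝 x) (𝓝 (x, 0)) :=
      Continuous.tendsto (by fun_prop) x
    exact h1.eventually hD.localInverse_eventuallyEq_left
  obtain ⟨e₁, he₁, hxe₁, hes₁, hee₁⟩ := exists_chart_of_isLocalDiffeomorphAt
    (isLocalDiffeomorphAt_extChartAt (I₁ := I₁) x) hs
  refine Manifold.IsImmersionAtOfComplement.mk_of_continuousAt hcont L e₁ e hxe₁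
    (by rwa [hfx]) he₁ he ?_
  intro z hz
  have hy : (e₁.extend I₁).symm z ∈ e₁.source := by
    have := (e₁.extend I₁).map_target hz
    rwa [e₁.extend_source] at this
  have hz' : I₁ (e₁ ((e₁.extend I₁).symm z)) = z := (e₁.extend I₁).right_inv hz
  obtain ⟨h4, h5, h6⟩ := hes₁ hy
  have h7 := hee₁ _ hy
  rw [hz'] at h7
  change I₂ (e (f ((e₁.extend I₁).symm z))) = L (z, 0)
  rw [hee _ h5, h4]
  simp only [Function.comp_apply, h6, extChartAt_prod]
  exact congrArg (fun w => L (w, 0)) h7.symm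

end Charts

/-! ### Manifold structures from smooth transition maps -/

section Gluing

variable {E₁ : Type*} [NormedAddCommGroup E₁] [NormedSpace ℝ E₁]
  {H₁ : Type*} [TopologicalSpace H₁] {I₁ : ModelWithCorners ℝ E₁ H₁}
  {N : Type*} [TopologicalSpace N] [ChartedSpace H₁ N]
  {E₀ : Type*} [NormedAddCommGroup E₀] [NormedSpace ℝ E₀]

/-- A space with an atlas of local homeomorphisms to a manifold whose transition maps are smooth is
a manifold. -/
theorem exists_manifold_of_transitions [I₁.Boundaryless] [IsManifold I₁ ∞ N] {X : Type*}
    [TopologicalSpace X] (e : X → OpenPartialHomeomorph X N) (hx : ∀ x, x ∈ (e x).source)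
    (htrans : ∀ x x', ContMDiffOn I₁ I₁ ∞ (fun z => e x' ((e x).symm z))
      ((e x).target ∩ (e x).symm ⁻¹' (e x').source)) (L : E₁ ≃L[ℝ] E₀) :
    ∃ _ : ChartedSpace E₀ X, IsManifold 𝓘(ℝ, E₀) ∞ X ∧
      (∀ x, ContMDiffOn 𝓘(ℝ, E₀) I₁ ∞ (e x) (e x).source) ∧
      ∀ x, ContMDiffOn I₁ 𝓘(ℝ, E₀) ∞ (e x).symm (e x).target := by
  -- The local homeomorphisms take values in the manifold `N`; each is followed by a chart of `N`
  -- and the linear identification with `E₀`.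
  have hκ : ∀ x, ∃ κ : OpenPartialHomeomorph N E₀, e x x ∈ κ.source ∧
      ContMDiffOn I₁ 𝓘(ℝ, E₀) ∞ κ κ.source ∧ ContMDiffOn 𝓘(ℝ, E₀) I₁ ∞ κ.symm κ.target := fun x =>
    let k := (chartDiffeo I₁ (e x x)).trans L.toDiffeomorph.toPartialDiffeomorph
    ⟨k.toOpenPartialHomeomorph, ⟨mem_extChartAt_source _, trivial⟩, k.contMDiffOn_toFun,
      k.contMDiffOn_invFun⟩
  choose κ hκx hκs hκs' using hκ
  let c : X → OpenPartialHomeomorph X E₀ := fun x => (e x).trans (κ x)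
  have hcs : ∀ x, x ∈ (c x).source := fun x => by
    simp only [c, OpenPartialHomeomorph.trans_source]
    exact ⟨hx x, hκx x⟩
  let cs : ChartedSpace E₀ X :=
    { atlas := range c
      chartAt := c
      mem_chart_source := hcs
      chart_mem_atlas := fun x => ⟨x, rfl⟩ }
  have hM : IsManifold 𝓘(ℝ, E₀) ∞ X := by
    refine isManifold_of_contDiffOn _ _ _ ?_
    rintro _ _ ⟨x, rfl⟩ ⟨x', rfl⟩
    rw [← contMDiffOn_iff_contDiffOn]
    have h1 : ContMDiffOn 𝓘(ℝ, E₀) 𝓘(ℝ, E₀) ∞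
        (fun z => κ x' (e x' ((e x).symm ((κ x).symm z)))) ((c x).symm ≫ₕ c x').source := by
      have hsrc : ∀ z ∈ ((c x).symm ≫ₕ c x').source, z ∈ (κ x).target ∧
          (κ x).symm z ∈ (e x).target ∧ (e x).symm ((κ x).symm z) ∈ (e x').source ∧
          e x' ((e x).symm ((κ x).symm z)) ∈ (κ x').source := by
        intro z hz
        simp only [c, OpenPartialHomeomorph.trans_source, OpenPartialHomeomorph.symm_source,
          OpenPartialHomeomorph.trans_target] at hz
        exact ⟨hz.1.1, hz.1.2, hz.2.1, hz.2.2⟩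
      refine (hκs x').comp ((htrans x x').comp ((hκs' x).mono fun z hz => (hsrc z hz).1) ?_) ?_
      · exact fun z hz => ⟨(hsrc z hz).2.1, (hsrc z hz).2.2.1⟩
      · exact fun z hz => (hsrc z hz).2.2.2
    refine h1.mono ?_
    intro z hz
    exact hz.1
  have hcp : ∀ p, ContMDiffAt 𝓘(ℝ, E₀) 𝓘(ℝ, E₀) ∞ (c p) p := fun p =>
    contMDiffAt_of_mem_maximalAtlas (IsManifold.chart_mem_maximalAtlas p) (hcs p)
  have hcp' : ∀ p, ContMDiffAt 𝓘(ℝ, E₀) 𝓘(ℝ, E₀) ∞ (c p).symm (c p p) := fun p =>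
    contMDiffAt_symm_of_mem_maximalAtlas (IsManifold.chart_mem_maximalAtlas p)
      ((c p).map_source (hcs p))
  have hto : ∀ x p, p ∈ (e x).source →
      ContMDiffAt I₁ I₁ ∞ (fun z => e x ((e p).symm z)) (e p p) := fun x p hp => by
    refine (htrans p x).contMDiffAt (IsOpen.mem_nhds ?_ ?_)
    · exact (e p).symm.isOpen_inter_preimage (e x).open_source
    · refine ⟨(e p).map_source (hx p), ?_⟩
      rwa [mem_preimage, (e p).left_inv (hx p)]
  have hfrom : ∀ x p, p ∈ (e x).source →
      ContMDiffAt I₁ I₁ ∞ (fun z => e p ((e x).symm z)) (e x p) := fun x p hp => by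
    refine (htrans x p).contMDiffAt (IsOpen.mem_nhds ?_ ?_)
    · exact (e x).symm.isOpen_inter_preimage (e p).open_source
    · refine ⟨(e x).map_source hp, ?_⟩
      rw [mem_preimage, (e x).left_inv hp]
      exact hx p
  refine ⟨cs, hM, fun x p hp => ContMDiffAt.contMDiffWithinAt ?_, fun x q hq => ?_⟩
  · have h1 : ContMDiffAt 𝓘(ℝ, E₀) I₁ ∞ (fun z => e x ((e p).symm ((κ p).symm (c p z)))) p := by
      have h2 : ContMDiffAt 𝓘(ℝ, E₀) I₁ ∞ (κ p).symm (c p p) :=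
        (hκs' p).contMDiffAt ((κ p).open_target.mem_nhds ((κ p).map_source (hκx p)))
      refine ContMDiffAt.comp_of_eq (g := fun z => e x ((e p).symm z)) (hto x p hp)
        (h2.comp p (hcp p)) ?_
      exact (κ p).left_inv (hκx p)
    refine h1.congr_of_eventuallyEq ?_
    filter_upwards [(c p).open_source.mem_nhds (hcs p)] with z hz
    simp only [c, OpenPartialHomeomorph.trans_source] at hz
    change e x z = e x ((e p).symm ((κ p).symm (κ p (e p z))))
    rw [(κ p).left_inv hz.2, (e p).left_inv hz.1]
  · obtain ⟨p, hp, rfl⟩ : ∃ p ∈ (e x).source, e x p = q :=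
      ⟨(e x).symm q, (e x).map_target hq, (e x).right_inv hq⟩
    refine ContMDiffAt.contMDiffWithinAt ?_
    have h2 : ContMDiffAt I₁ 𝓘(ℝ, E₀) ∞ (κ p) (e p p) :=
      (hκs p).contMDiffAt ((κ p).open_source.mem_nhds (hκx p))
    have hpx : e p ((e x).symm (e x p)) = e p p := by rw [(e x).left_inv hp]
    have h1 : ContMDiffAt I₁ 𝓘(ℝ, E₀) ∞ (fun z => (c p).symm (κ p (e p ((e x).symm z))))
        (e x p) := by
      refine ContMDiffAt.comp_of_eq (g := (c p).symm) (hcp' p)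
        (ContMDiffAt.comp_of_eq (g := κ p) h2 (hfrom x p hp) hpx) ?_
      exact congrArg (κ p) hpx
    refine h1.congr_of_eventuallyEq ?_
    have h3 : ContinuousAt (e x).symm (e x p) := (e x).symm.continuousAt ((e x).map_source hp)
    have h4 : ∀ᶠ z in 𝓝 (e x p), (e x).symm z ∈ (c p).source :=
      h3.eventually ((c p).open_source.mem_nhds (by rw [(e x).left_inv hp]; exact hcs p))
    filter_upwards [h4] with z hz
    exact ((c p).left_inv hz).symm

end Gluing

/-! ### Submanifolds as zero sets of submersions -/

section Submanifold

variable {F : Type*} [NormedAddCommGroup F] [NormedSpace ℝ F] [FiniteDimensional ℝ F]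
  {M : Type*} [TopologicalSpace M] [ChartedSpace F M] [IsManifold 𝓘(ℝ, F) ∞ M]
  {V : Type*} [NormedAddCommGroup V] [NormedSpace ℝ V] [FiniteDimensional ℝ V]

/-- `κ` is a linear projection onto the kernel of `a`, identified with `W` by a dimension count. The
kernel of the pair is then trivial. -/
theorem exists_bijective_prod {W : Type*} [NormedAddCommGroup W] [NormedSpace ℝ W]
    [FiniteDimensional ℝ W] (a : F →L[ℝ] V) (ha : Function.Surjective a)
    (hn : Module.finrank ℝ F = Module.finrank ℝ V + Module.finrank ℝ W) :
    ∃ κ : F →L[ℝ] W, Function.Bijective (a.prod κ) := by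
  have hk : Module.finrank ℝ (LinearMap.ker a.toLinearMap) = Module.finrank ℝ W := by
    have h1 := LinearMap.finrank_range_add_finrank_ker a.toLinearMap
    rw [LinearMap.range_eq_top.2 ha, finrank_top] at h1
    omega
  obtain ⟨p, hp⟩ := (LinearMap.ker a.toLinearMap).exists_isCompl.elim fun q hq =>
    (⟨(LinearMap.ker a.toLinearMap).projectionOnto q hq, fun x =>
      Submodule.projectionOnto_apply_left hq x⟩ :
      ∃ p : F →ₗ[ℝ] LinearMap.ker a.toLinearMap, ∀ x : LinearMap.ker a.toLinearMap, p x = x)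
  let L := LinearEquiv.ofFinrankEq _ _ hk
  let κ : F →L[ℝ] W := (L.toLinearMap ∘ₗ p).toContinuousLinearMap
  have hinj : Function.Injective (a.prod κ) := by
    rw [injective_iff_map_eq_zero]
    intro w hw
    have h1 : a w = 0 := congrArg Prod.fst hw
    have h2 : L (p w) = 0 := congrArg Prod.snd hw
    have h3 := hp ⟨w, h1⟩
    rw [LinearEquiv.map_eq_zero_iff] at h2
    simpa [h2] using congrArg Subtype.val h3.symm
  refine ⟨κ, hinj, ?_⟩
  have := LinearMap.injective_iff_surjective_of_finrank_eq_finrank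
    (f := (a.prod κ).toLinearMap) (by rw [hn, Module.finrank_prod])
  exact this.1 hinj

/-- Near a point of a level set of a submersion, the manifold is a product. -/
theorem exists_adapted_chart {S : Set M} {n : ℕ}
    (hn : Module.finrank ℝ F = Module.finrank ℝ V + n) {y : M} {O : Set M} (hO : IsOpen O)
    (hy : y ∈ O) {q : M → V} (hq : ContMDiffOn 𝓘(ℝ, F) 𝓘(ℝ, V) ∞ q O)
    (hsurj : Function.Surjective (md 𝓘(ℝ, F) 𝓘(ℝ, V) q y)) (hS : ∀ m ∈ O, m ∈ S ↔ q m = 0) :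
    ∃ Ψ : PartialDiffeomorph 𝓘(ℝ, F) 𝓘(ℝ, V × EuclideanSpace ℝ (Fin n)) M
      (V × EuclideanSpace ℝ (Fin n)) ∞, y ∈ Ψ.source ∧ ∀ m ∈ Ψ.source, m ∈ S ↔ (Ψ m).1 = 0 := by
  have := FiniteDimensional.complete ℝ F
  have := FiniteDimensional.complete ℝ V
  obtain ⟨κ, hκ⟩ := exists_bijective_prod (W := EuclideanSpace ℝ (Fin n)) _ hsurj
    (by rw [hn, finrank_euclideanSpace_fin])
  let c := extChartAt 𝓘(ℝ, F) y
  have hc : ContMDiffOn 𝓘(ℝ, F) 𝓘(ℝ, F) ∞ c (chartAt F y).source := contMDiffOn_extChartAt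
  have hχ : ContMDiffOn 𝓘(ℝ, F) 𝓘(ℝ, V × EuclideanSpace ℝ (Fin n)) ∞ (fun m => (q m, κ (c m)))
      (O ∩ (chartAt F y).source) :=
    (hq.mono inter_subset_left).prodMk_space
      (κ.contMDiff.comp_contMDiffOn (hc.mono inter_subset_right))
  have hopen : IsOpen (O ∩ (chartAt F y).source) := hO.inter (chartAt F y).open_source
  have hmem : y ∈ O ∩ (chartAt F y).source := ⟨hy, mem_chart_source F y⟩
  have hmd : md 𝓘(ℝ, F) 𝓘(ℝ, V × EuclideanSpace ℝ (Fin n)) (fun m => (q m, κ (c m))) y =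
      (md 𝓘(ℝ, F) 𝓘(ℝ, V) q y).prod κ := by
    have hqd : MDifferentiableAt 𝓘(ℝ, F) 𝓘(ℝ, V) q y :=
      (hq.contMDiffAt (hO.mem_nhds hy)).mdifferentiableAt (by simp)
    have hcd : MDifferentiableAt 𝓘(ℝ, F) 𝓘(ℝ, F) c y :=
      (hc.contMDiffAt ((chartAt F y).open_source.mem_nhds hmem.2)).mdifferentiableAt (by simp)
    have hκc : md 𝓘(ℝ, F) 𝓘(ℝ, EuclideanSpace ℝ (Fin n)) (fun m => κ (c m)) y = κ := by
      rw [md_comp (g := κ) κ.differentiableAt.mdifferentiableAt hcd, md_extChartAt_self,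
        md_eq_fderiv]
      simp
    have hχd : MDifferentiableAt 𝓘(ℝ, F) 𝓘(ℝ, V × EuclideanSpace ℝ (Fin n))
        (fun m => (q m, κ (c m))) y :=
      (hχ.contMDiffAt (hopen.mem_nhds hmem)).mdifferentiableAt (by simp)
    have h1 := md_comp (g := (Prod.fst : V × EuclideanSpace ℝ (Fin n) → V)) (I₃ := 𝓘(ℝ, V))
      (differentiableAt_fst (𝕜 := ℝ)).mdifferentiableAt hχd
    have h2 := md_comp (g := (Prod.snd : V × EuclideanSpace ℝ (Fin n) → EuclideanSpace ℝ (Fin n)))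
      (I₃ := 𝓘(ℝ, EuclideanSpace ℝ (Fin n))) (differentiableAt_snd (𝕜 := ℝ)).mdifferentiableAt hχd
    rw [md_eq_fderiv, fderiv_fst] at h1
    rw [md_eq_fderiv, fderiv_snd] at h2
    ext w
    · exact congrArg (fun A : F →L[ℝ] V => A w) h1.symm
    · exact congrFun (congrArg (fun A : F →L[ℝ] EuclideanSpace ℝ (Fin n) => (A w).ofLp)
        (h2.symm.trans hκc)) _
  have hld := isLocalDiffeomorphAt_of_md hopen hmem hχ (by rw [hmd]; exact hκ)
  obtain ⟨Ψ, hyΨ, hΨs, hΨ⟩ := exists_partialDiffeomorph_subset hld (hO.mem_nhds hy)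
  refine ⟨Ψ, hyΨ, fun m hm => ?_⟩
  rw [hS m (hΨs hm), ← hΨ hm]

theorem injective_md_comp_prodMk {E₁ : Type*} [NormedAddCommGroup E₁] [NormedSpace ℝ E₁]
    {H₁ : Type*} [TopologicalSpace H₁] {I₁ : ModelWithCorners ℝ E₁ H₁}
    {M₁ : Type*} [TopologicalSpace M₁] [ChartedSpace H₁ M₁] {D : M₁ × V → M} {x : M₁}
    (hD : IsLocalDiffeomorphAt (I₁.prod 𝓘(ℝ, V)) 𝓘(ℝ, F) ∞ D (x, 0)) :
    Function.Injective (md I₁ 𝓘(ℝ, F) (fun z => D (z, 0)) x) := by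
  rw [injective_iff_map_eq_zero]
  intro w hw
  have h1 := md_prod_apply (hD.contMDiffAt.mdifferentiableAt (by simp)) w (0 : V)
  rw [hw, map_zero, zero_add] at h1
  have h2 := (md_bijective_of_isLocalDiffeomorphAt hD).1 (h1.trans (map_zero _).symm)
  exact congrArg Prod.fst h2

/-- A subset that is locally the zero set of a submersion is a submanifold. -/
theorem exists_submanifold {n : ℕ} (hn : Module.finrank ℝ F = Module.finrank ℝ V + n) {S : Set M}
    (hS : ∀ y ∈ S, ∃ O : Set M, IsOpen O ∧ y ∈ O ∧ ∃ q : M → V, ContMDiffOn 𝓘(ℝ, F) 𝓘(ℝ, V) ∞ q O ∧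
      Function.Surjective (md 𝓘(ℝ, F) 𝓘(ℝ, V) q y) ∧ ∀ m ∈ O, m ∈ S ↔ q m = 0) :
    ∃ _ : ChartedSpace (EuclideanSpace ℝ (Fin n)) S,
      IsManifold 𝓘(ℝ, EuclideanSpace ℝ (Fin n)) ∞ S ∧
      Manifold.IsSmoothEmbedding 𝓘(ℝ, EuclideanSpace ℝ (Fin n)) 𝓘(ℝ, F) ∞
        (Subtype.val : S → M) ∧
      ∀ y, Function.Injective
        (md 𝓘(ℝ, EuclideanSpace ℝ (Fin n)) 𝓘(ℝ, F) (Subtype.val : S → M) y) := by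
  have hΨ : ∀ y : S, ∃ Ψ : PartialDiffeomorph 𝓘(ℝ, F) 𝓘(ℝ, V × EuclideanSpace ℝ (Fin n)) M
      (V × EuclideanSpace ℝ (Fin n)) ∞, (y : M) ∈ Ψ.source ∧
        ∀ m ∈ Ψ.source, m ∈ S ↔ (Ψ m).1 = 0 := fun y => by
    obtain ⟨O, hO, hy, q, hq, hqs, hqS⟩ := hS y y.2
    exact exists_adapted_chart hn hO hy hq hqs hqS
  choose Ψ hyΨ hΨS using hΨ
  have hin : ∀ (y : S) (z : EuclideanSpace ℝ (Fin n)), ((0 : V), z) ∈ (Ψ y).target →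
      (Ψ y).symm (0, z) ∈ S := fun y z hz =>
    (hΨS y _ ((Ψ y).map_target hz)).2 (congrArg Prod.fst ((Ψ y).right_inv hz))
  classical
  let e : S → OpenPartialHomeomorph S (EuclideanSpace ℝ (Fin n)) := fun y =>
    { toFun := fun x => (Ψ y x).2
      invFun := fun z => if h : ((0 : V), z) ∈ (Ψ y).target then ⟨_, hin y z h⟩ else y
      source := Subtype.val ⁻¹' (Ψ y).source
      target := {z | ((0 : V), z) ∈ (Ψ y).target}
      map_source' := fun x hx => by
        have h1 := (Ψ y).map_source hx
        have h2 := (hΨS y x hx).1 x.2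
        change ((0 : V), (Ψ y x).2) ∈ (Ψ y).target
        rw [← h2]
        exact h1
      map_target' := fun z hz => by
        rw [dif_pos (show ((0 : V), z) ∈ (Ψ y).target from hz)]
        exact (Ψ y).map_target hz
      left_inv' := fun x hx => by
        have h1 := (Ψ y).map_source hx
        have h2 := (hΨS y x hx).1 x.2
        have h3 : ((0 : V), (Ψ y x).2) = Ψ y x := by rw [← h2]
        have h4 : ((0 : V), (Ψ y x).2) ∈ (Ψ y).target := by rw [h3]; exact h1
        rw [dif_pos h4]
        refine Subtype.ext ?_
        change (Ψ y).symm (0, (Ψ y x).2) = x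
        rw [h3]
        exact (Ψ y).left_inv hx
      right_inv' := fun z hz => by
        rw [dif_pos (show ((0 : V), z) ∈ (Ψ y).target from hz)]
        exact congrArg Prod.snd ((Ψ y).right_inv hz)
      open_source := (Ψ y).open_source.preimage continuous_subtype_val
      open_target := (Ψ y).open_target.preimage (by fun_prop)
      continuousOn_toFun := continuous_snd.comp_continuousOn
        ((Ψ y).contMDiffOn_toFun.continuousOn.comp continuous_subtype_val.continuousOn
          fun x hx => hx)
      continuousOn_invFun := by
        rw [Topology.IsInducing.subtypeVal.continuousOn_iff]
        have h : ContinuousOn (fun z : EuclideanSpace ℝ (Fin n) => (Ψ y).symm ((0 : V), z))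
            {z | ((0 : V), z) ∈ (Ψ y).target} :=
          (Ψ y).contMDiffOn_invFun.continuousOn.comp (by fun_prop) fun x hx => hx
        refine h.congr fun z hz => ?_
        simp only [Function.comp_apply]
        rw [dif_pos (show ((0 : V), z) ∈ (Ψ y).target from hz)] }
  have hsymm : ∀ y, ∀ z ∈ (e y).target, ((e y).symm z : M) = (Ψ y).symm (0, z) := fun y z hz => by
    change Subtype.val (if h : ((0 : V), z) ∈ (Ψ y).target then (⟨_, hin y z h⟩ : S) else y) = _
    rw [dif_pos (show ((0 : V), z) ∈ (Ψ y).target from hz)]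
  have hzero : ContMDiff 𝓘(ℝ, EuclideanSpace ℝ (Fin n)) 𝓘(ℝ, V × EuclideanSpace ℝ (Fin n)) ∞
      (fun z : EuclideanSpace ℝ (Fin n) => ((0 : V), z)) :=
    ContDiff.contMDiff (contDiff_const.prodMk contDiff_id)
  have hsnd : ContMDiff 𝓘(ℝ, V × EuclideanSpace ℝ (Fin n)) 𝓘(ℝ, EuclideanSpace ℝ (Fin n)) ∞
      (fun z : V × EuclideanSpace ℝ (Fin n) => z.2) := contDiff_snd.contMDiff
  obtain ⟨cs, hM, he, he'⟩ := exists_manifold_of_transitions e hyΨ (fun y y' => by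
    have h : ContMDiffOn 𝓘(ℝ, EuclideanSpace ℝ (Fin n)) 𝓘(ℝ, EuclideanSpace ℝ (Fin n)) ∞
        (fun z => (Ψ y' ((Ψ y).symm (0, z))).2)
        ((e y).target ∩ (e y).symm ⁻¹' (e y').source) := by
      refine hsnd.comp_contMDiffOn ((Ψ y').contMDiffOn_toFun.comp
        ((Ψ y).contMDiffOn_invFun.comp hzero.contMDiffOn fun z hz => hz.1) fun z hz => ?_)
      have h2 : ((e y).symm z : M) ∈ (Ψ y').source := hz.2
      rwa [hsymm y z hz.1] at h2
    refine h.congr fun z hz => ?_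
    change (Ψ y' ((e y).symm z : M)).2 = _
    rw [hsymm y z hz.1]) (ContinuousLinearEquiv.refl ℝ _)
  -- The immersion criterion needs the inclusion as the slice `v = 0` of a local diffeomorphism; the
  -- adapted chart provides `(x, v) ↦ (Ψ y)⁻¹ (v, e y x)`.
  suffices hD : ∀ y : S, ∃ D : S × V → M,
      IsLocalDiffeomorphAt (𝓘(ℝ, EuclideanSpace ℝ (Fin n)).prod 𝓘(ℝ, V)) 𝓘(ℝ, F) ∞ D (y, 0) ∧
        ∀ᶠ x : S in 𝓝 y, (x : M) = D (x, 0) by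
    choose D hD hDval using hD
    exact ⟨cs, hM, ⟨Manifold.IsImmersionOfComplement.isImmersion (F := V) fun y =>
      isImmersionAtOfComplement_of_isLocalDiffeomorphAt (hD y) (hDval y),
      Topology.IsEmbedding.subtypeVal⟩, fun y => by
        rw [md_congr (hDval y)]
        exact injective_md_comp_prodMk (hD y)⟩
  intro y
  let W := EuclideanSpace ℝ (Fin n)
  have hcont : ContinuousOn (fun p : S × V => ((p.2, e y p.1) : V × W)) {p | p.1 ∈ (e y).source} :=
    continuousOn_snd.prodMk ((e y).continuousOn.comp continuousOn_fst fun p hp => hp)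
  have hcont' : ContinuousOn (fun m : M => (Ψ y m).2) (Ψ y).source :=
    continuous_snd.comp_continuousOn (Ψ y).contMDiffOn_toFun.continuousOn
  let D : PartialDiffeomorph (𝓘(ℝ, W).prod 𝓘(ℝ, V)) 𝓘(ℝ, F) (S × V) M ∞ :=
    { toFun := fun p => (Ψ y).symm (p.2, e y p.1)
      invFun := fun m => ((e y).symm (Ψ y m).2, (Ψ y m).1)
      source := {p | p.1 ∈ (e y).source} ∩ (fun p : S × V => ((p.2, e y p.1) : V × W)) ⁻¹'
        (Ψ y).target
      target := (Ψ y).source ∩ (fun m : M => (Ψ y m).2) ⁻¹' (e y).target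
      map_source' := fun p hp => by
        refine ⟨(Ψ y).map_target hp.2, ?_⟩
        have := congrArg Prod.snd ((Ψ y).right_inv hp.2)
        exact (congrArg (· ∈ (e y).target) this).mpr ((e y).map_source hp.1)
      map_target' := fun m hm => by
        refine ⟨(e y).map_target hm.2, ?_⟩
        change ((Ψ y m).1, e y ((e y).symm (Ψ y m).2)) ∈ (Ψ y).target
        rw [(e y).right_inv hm.2]
        exact (Ψ y).map_source hm.1
      left_inv' := fun p hp => by
        have := (Ψ y).right_inv hp.2
        have h1 := congrArg Prod.fst this
        have h2 := congrArg Prod.snd this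
        refine Prod.ext ?_ h1
        exact (congrArg (e y).symm h2).trans ((e y).left_inv hp.1)
      right_inv' := fun m hm => by
        change (Ψ y).symm ((Ψ y m).1, e y ((e y).symm (Ψ y m).2)) = m
        rw [(e y).right_inv hm.2]
        exact (Ψ y).left_inv hm.1
      open_source := hcont.isOpen_inter_preimage ((e y).open_source.preimage continuous_fst)
        (Ψ y).open_target
      open_target := hcont'.isOpen_inter_preimage (Ψ y).open_source (e y).open_target
      contMDiffOn_toFun := by
        refine (Ψ y).contMDiffOn_invFun.comp (ContMDiffOn.prodMk_space contMDiffOn_snd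
          ((he y).comp contMDiffOn_fst fun p hp => hp.1)) fun p hp => hp.2
      contMDiffOn_invFun := by
        refine ContMDiffOn.prodMk ((he' y).comp (hsnd.comp_contMDiffOn
          ((Ψ y).contMDiffOn_toFun.mono inter_subset_left)) fun m hm => hm.2) ?_
        exact ContMDiff.comp_contMDiffOn (g := fun z : V × W => z.1)
          contDiff_fst.contMDiff ((Ψ y).contMDiffOn_toFun.mono inter_subset_left) }
  have hey : ∀ x ∈ (e y).source, ((0 : V), e y x) = Ψ y x := fun x hx => by
    have h2 := (hΨS y x hx).1 x.2
    rw [← h2]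
    rfl
  refine ⟨D, ⟨D, ⟨hyΨ y, ?_⟩, fun _ _ => rfl⟩, ?_⟩
  · change ((0 : V), e y y) ∈ (Ψ y).target
    rw [hey y (hyΨ y)]
    exact (Ψ y).map_source (hyΨ y)
  · filter_upwards [(e y).open_source.mem_nhds (hyΨ y)] with x hx
    change (x : M) = (Ψ y).symm (0, e y x)
    rw [hey x hx]
    exact ((Ψ y).left_inv hx).symm

end Submanifold

/-! ### A transversal to `H` in `G` -/

section Transversal

variable {E : Type*} [NormedAddCommGroup E] [NormedSpace ℝ E] [FiniteDimensional ℝ E]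
  {G : Type*} [TopologicalSpace G] [ChartedSpace E G] [Group G] [LieGroup 𝓘(ℝ, E) ∞ G]
  {E' : Type*} [NormedAddCommGroup E'] [NormedSpace ℝ E'] [FiniteDimensional ℝ E']
  {H : Subgroup G} [ChartedSpace E' H]
  {V : Type*} [NormedAddCommGroup V] [NormedSpace ℝ V] [FiniteDimensional ℝ V]

/-- `σ : V → G` is a transversal at `1` to `H`, tangent to `𝔥^⊥`: multiplication gives a
diffeomorphism of `S × H` onto an open subset of `G`. -/
structure IsTransversal (B : InvariantInnerProduct E G) (hH : IsLieSubgroup E E' H) (σ : V → G)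
    (S : Set V) (τ : PartialDiffeomorph (𝓘(ℝ, V).prod 𝓘(ℝ, E')) 𝓘(ℝ, E) (V × H) G ∞) : Prop where
  isOpen : IsOpen S
  zero_mem : (0 : V) ∈ S
  smooth : ContMDiffOn 𝓘(ℝ, V) 𝓘(ℝ, E) ∞ σ S
  map_zero : σ 0 = 1
  perp : ∀ v ζ, B.bf (md 𝓘(ℝ, V) 𝓘(ℝ, E) σ 0 v) (inclMap E E' H ζ) = 0
  injective : Function.Injective (md 𝓘(ℝ, V) 𝓘(ℝ, E) σ 0)
  exists_eq : ∀ ξ : E, (∀ ζ, B.bf ξ (inclMap E E' H ζ) = 0) → ∃ v, md 𝓘(ℝ, V) 𝓘(ℝ, E) σ 0 v = ξ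
  source : τ.source = S ×ˢ univ
  apply : ∀ p, τ p = σ p.1 * (p.2 : G)

theorem InvariantInnerProduct.eq_zero_of_perp_add (B : InvariantInnerProduct E G)
    (hH : IsLieSubgroup E E' H)
    {ξ : E} (hξ : ∀ ζ, B.bf ξ (inclMap E E' H ζ) = 0) {ζ : E'} (h : ξ + inclMap E E' H ζ = 0) :
    ξ = 0 ∧ ζ = 0 := by
  have h1 : inclMap E E' H ζ = 0 := by
    have := congrArg (B.pS hH) h
    rwa [map_add, B.pS_of_perp hH hξ, zero_add, B.pS_inclMap, _root_.map_zero] at this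
  rw [h1, add_zero] at h
  exact ⟨h, inclMap_injective hH (by rw [h1, _root_.map_zero])⟩

/-- Right translation as a diffeomorphism. -/
def mulRightDiffeo (E : Type*) [NormedAddCommGroup E] [NormedSpace ℝ E] {G : Type*}
    [TopologicalSpace G] [ChartedSpace E G] [Group G] [LieGroup 𝓘(ℝ, E) ∞ G] (k : G) :
    G ≃ₘ^∞⟮𝓘(ℝ, E), 𝓘(ℝ, E)⟯ G where
  toEquiv := Equiv.mulRight k
  contMDiff_toFun := contMDiff_mulRight k
  contMDiff_invFun := contMDiff_mulRight k⁻¹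

/-- The map is equivariant for right translation by `H`, which moves `(v, 1)` to `(v, h)`. -/
theorem isLocalDiffeomorphAt_mul_right [LieGroup 𝓘(ℝ, E') ∞ H] {σ : V → G} {v : V}
    (hσ : IsLocalDiffeomorphAt (𝓘(ℝ, V).prod 𝓘(ℝ, E')) 𝓘(ℝ, E) ∞
      (fun p : V × H => σ p.1 * (p.2 : G)) (v, 1)) (h : H) :
    IsLocalDiffeomorphAt (𝓘(ℝ, V).prod 𝓘(ℝ, E')) 𝓘(ℝ, E) ∞
      (fun p : V × H => σ p.1 * (p.2 : G)) (v, h) := by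
  let R : (V × H) ≃ₘ^∞⟮𝓘(ℝ, V).prod 𝓘(ℝ, E'), 𝓘(ℝ, V).prod 𝓘(ℝ, E')⟯ (V × H) :=
    (Diffeomorph.refl 𝓘(ℝ, V) V ∞).prodCongr (mulRightDiffeo E' h⁻¹)
  have hR : R (v, h) = (v, 1) := Prod.ext rfl (mul_inv_cancel h)
  have l1 : IsLocalDiffeomorphAt (𝓘(ℝ, V).prod 𝓘(ℝ, E')) (𝓘(ℝ, V).prod 𝓘(ℝ, E')) ∞ R (v, h) :=
    R.isLocalDiffeomorph _
  rw [← hR] at hσ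
  have l3 := (l1.comp _ _ hσ).comp _ _ ((mulRightDiffeo E (h : G)).isLocalDiffeomorph _)
  refine isLocalDiffeomorphAt_congr l3 (Eventually.of_forall fun p => ?_)
  change σ p.1 * ((p.2 * h⁻¹ : H) : G) * (h : G) = σ p.1 * (p.2 : G)
  simp [mul_assoc]

/-- Multiplication of a transversal with `H` is an open embedding. -/
theorem exists_partialDiffeomorph_mul (hH : IsLieSubgroup E E' H) {σ : V → G} (hσ0 : σ 0 = 1)
    (hσc : ContinuousAt σ 0)
    (hT : IsLocalDiffeomorphAt (𝓘(ℝ, V).prod 𝓘(ℝ, E')) 𝓘(ℝ, E) ∞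
      (fun p : V × H => σ p.1 * (p.2 : G)) (0, 1)) {S₁ : Set V} (hS₁ : S₁ ∈ 𝓝 0) :
    ∃ (S : Set V) (τ : PartialDiffeomorph (𝓘(ℝ, V).prod 𝓘(ℝ, E')) 𝓘(ℝ, E) (V × H) G ∞),
      IsOpen S ∧ 0 ∈ S ∧ S ⊆ S₁ ∧ τ.source = S ×ˢ univ ∧ ∀ p, τ p = σ p.1 * (p.2 : G) := by
  have := hH.lieGroup
  obtain ⟨Ψ, hΨ0, hΨ⟩ := hT
  obtain ⟨S₂, hS₂, W, hW, hSW⟩ := mem_nhds_prod_iff.1 (Ψ.open_source.mem_nhds hΨ0)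
  -- This uses the subspace topology on `H`: elements of `H` near `1` in `G` are near `1` in `H`.
  have hWn : ∃ W' ∈ 𝓝 (1 : G), (Subtype.val : H → G) ⁻¹' W' ⊆ W := by
    have h1 : W ∈ comap (Subtype.val : H → G) (𝓝 1) := by
      rwa [← Subgroup.coe_one H, ← nhds_subtype_eq_comap]
    exact h1
  obtain ⟨W', hW', hWW⟩ := hWn
  have hnear : ∀ᶠ p in 𝓝 ((0 : V), (0 : V)), (σ p.2)⁻¹ * σ p.1 ∈ W' := by
    have hc : ContinuousAt (fun p : V × V => (σ p.2)⁻¹ * σ p.1) ((0 : V), (0 : V)) := by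
      have : IsTopologicalGroup G := topologicalGroup_of_lieGroup 𝓘(ℝ, E) ∞
      exact (ContinuousAt.comp (x := ((0 : V), (0 : V))) (g := σ) hσc continuousAt_snd).inv.mul
        (ContinuousAt.comp (x := ((0 : V), (0 : V))) (g := σ) hσc continuousAt_fst)
    exact hc (by simpa [hσ0] using hW')
  rw [nhds_prod_eq, eventually_prod_self_iff'] at hnear
  obtain ⟨S₃, hS₃, hS₃W⟩ := hnear
  obtain ⟨S, hSs, hSo, hS0⟩ := mem_nhds_iff.1 (inter_mem (inter_mem hS₁ hS₂) hS₃)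
  -- If `σ(v) h = σ(v') h'`, then `h' h⁻¹ = σ(v')⁻¹ σ(v)` is close to `1` in `G`, hence in `H`. So
  -- injectivity near `(0, 1)` gives injectivity on all of `S × H`.
  have hinj : InjOn (fun p : V × H => σ p.1 * (p.2 : G)) (S ×ˢ univ) := by
    rintro ⟨v, h⟩ hp ⟨v', h'⟩ hp' heq
    have heq' : σ v * (h : G) = σ v' * (h' : G) := heq
    have h1 : (σ v')⁻¹ * σ v = ((h' * h⁻¹ : H) : G) := by
      rw [Subgroup.coe_mul, Subgroup.coe_inv, eq_mul_inv_iff_mul_eq, mul_assoc, heq',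
        inv_mul_cancel_left]
    have h2 : h' * h⁻¹ ∈ W := hWW (by
      rw [mem_preimage, ← h1]
      exact hS₃W v (hSs hp.1).2 v' (hSs hp'.1).2)
    have h3 : σ v * ((1 : H) : G) = σ v' * ((h' * h⁻¹ : H) : G) := by
      rw [← h1]
      simp
    have m1 : (v, (1 : H)) ∈ Ψ.source := hSW ⟨(hSs hp.1).1.2, mem_of_mem_nhds hW⟩
    have m2 : (v', h' * h⁻¹) ∈ Ψ.source := hSW ⟨(hSs hp'.1).1.2, h2⟩
    have h4 : (v, (1 : H)) = (v', h' * h⁻¹) :=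
      Ψ.injOn m1 m2 ((hΨ m1).symm.trans (h3.trans (hΨ m2)))
    have h5 := congrArg Prod.fst h4
    have h6 : (1 : H) = h' * h⁻¹ := congrArg Prod.snd h4
    exact Prod.ext h5 (by rw [eq_mul_inv_iff_mul_eq, one_mul] at h6; exact h6)
  have hloc : ∀ p ∈ S ×ˢ (univ : Set H),
      IsLocalDiffeomorphAt (𝓘(ℝ, V).prod 𝓘(ℝ, E')) 𝓘(ℝ, E) ∞
        (fun p : V × H => σ p.1 * (p.2 : G)) p := by
    rintro ⟨v, h⟩ hp
    exact isLocalDiffeomorphAt_mul_right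
      ⟨Ψ, hSW ⟨(hSs hp.1).1.2, mem_of_mem_nhds hW⟩, hΨ⟩ h
  obtain ⟨τ, hτs, hτ⟩ := exists_partialDiffeomorph_of_injOn (hSo.prod isOpen_univ) hloc hinj
  exact ⟨S, τ, hSo, hS0, fun v hv => (hSs hv).1.1, hτs, fun p => congrFun hτ p⟩

/-- `σ` is affine in the chart at `1`, with directions in `𝔥^⊥`, and takes the place of the
exponential map there. The derivative of `(v, h) ↦ σ(v) h` at `(0, 1)` is the isomorphism `𝔥^⊥ ⊕ 𝔥 →
𝔤`. -/
theorem exists_isTransversal (B : InvariantInnerProduct E G) (hH : IsLieSubgroup E E' H) :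
    ∃ (d : ℕ) (σ : EuclideanSpace ℝ (Fin d) → G) (S : Set (EuclideanSpace ℝ (Fin d))) (τ : _),
      Module.finrank ℝ E = d + Module.finrank ℝ E' ∧ IsTransversal B hH σ S τ := by
  have := hH.lieGroup
  have hmH : IsManifold 𝓘(ℝ, E') ∞ H := hH.lieGroup.toIsManifold
  have hmG : IsManifold 𝓘(ℝ, E) ∞ G := ‹LieGroup 𝓘(ℝ, E) ∞ G›.toIsManifold
  have hv : ContMDiff 𝓘(ℝ, E') 𝓘(ℝ, E) ∞ (Subtype.val : H → G) := hH.embedding.contMDiff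
  let K : Submodule ℝ E := LinearMap.ker (B.pS hH)
  let d := Module.finrank ℝ K
  let V := EuclideanSpace ℝ (Fin d)
  have hK : ∀ ξ : E, ξ ∈ K ↔ ∀ ζ, B.bf ξ (inclMap E E' H ζ) = 0 := fun ξ => by
    rw [LinearMap.mem_ker]
    refine ⟨fun h ζ => ?_, B.pS_of_perp hH⟩
    rw [← B.bf_pS hH, h]
    simp
  let L : V ≃ₗ[ℝ] K := LinearEquiv.ofFinrankEq _ _ (finrank_euclideanSpace_fin)
  let j : V →L[ℝ] E := (K.subtype ∘ₗ L.toLinearMap).toContinuousLinearMap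
  have hjp : ∀ v ζ, B.bf (j v) (inclMap E E' H ζ) = 0 := fun v => (hK _).1 (L v).2
  have hji : Function.Injective j := fun v w h => L.injective (Subtype.ext h)
  have hjs : ∀ ξ : E, (∀ ζ, B.bf ξ (inclMap E E' H ζ) = 0) → ∃ v, j v = ξ := fun ξ hξ =>
    ⟨L.symm ⟨ξ, (hK ξ).2 hξ⟩, congrArg Subtype.val (L.apply_symm_apply _)⟩
  let c := extChartAt 𝓘(ℝ, E) (1 : G)
  let σ : V → G := fun v => c.symm (c 1 + j v)
  let S₁ : Set V := (fun v => c 1 + j v) ⁻¹' c.target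
  have hlin : ContMDiff 𝓘(ℝ, V) 𝓘(ℝ, E) ∞ (fun v : V => c 1 + j v) :=
    ContDiff.contMDiff (contDiff_const.add j.contDiff)
  have hS₁ : IsOpen S₁ := (isOpen_extChartAt_target (I := 𝓘(ℝ, E)) (1 : G)).preimage hlin.continuous
  have h0 : (0 : V) ∈ S₁ := by
    change c 1 + j 0 ∈ c.target
    rw [_root_.map_zero, add_zero]
    exact mem_extChartAt_target (I := 𝓘(ℝ, E)) (1 : G)
  have hσ : ContMDiffOn 𝓘(ℝ, V) 𝓘(ℝ, E) ∞ σ S₁ :=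
    (contMDiffOn_extChartAt_symm (1 : G)).comp hlin.contMDiffOn fun v hv => hv
  have hσ0 : σ 0 = 1 := by
    change c.symm (c 1 + j 0) = 1
    rw [_root_.map_zero, add_zero]
    exact extChartAt_to_inv (I := 𝓘(ℝ, E)) (1 : G)
  have hσd : md 𝓘(ℝ, V) 𝓘(ℝ, E) σ 0 = j := by
    rw [md_comp_of_eq (g := c.symm) (f := fun v : V => c 1 + j v) (y := c 1) (I₂ := 𝓘(ℝ, E))
      ((contMDiffAt_extChartAt_symm (1 : G)).mdifferentiableAt (by simp)) (hlin.mdiff 0) (by simp),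
      md_extChartAt_symm_self, md_eq_fderiv]
    simp [fderiv_const_add]
  let T : V × H → G := fun p => σ p.1 * (p.2 : G)
  have hT : ContMDiffOn (𝓘(ℝ, V).prod 𝓘(ℝ, E')) 𝓘(ℝ, E) ∞ T (S₁ ×ˢ univ) :=
    (hσ.comp contMDiffOn_fst fun p hp => hp.1).mul (hv.comp contMDiff_snd).contMDiffOn
  have hTo : IsOpen (S₁ ×ˢ (univ : Set H)) := hS₁.prod isOpen_univ
  have hTd : ∀ v w, md (𝓘(ℝ, V).prod 𝓘(ℝ, E')) 𝓘(ℝ, E) T (0, 1) (v, w) = j v + inclMap E E' H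
      w := by
    intro v w
    rw [md_prod_apply ((hT.contMDiffAt (hTo.mem_nhds ⟨h0, trivial⟩)).mdifferentiableAt (by simp))]
    simp only [T, hσ0, one_mul, Subgroup.coe_one, mul_one]
    change md 𝓘(ℝ, V) 𝓘(ℝ, E) σ 0 v + _ = _
    rw [hσd]
    rfl
  have hb : Function.Bijective (md (𝓘(ℝ, V).prod 𝓘(ℝ, E')) 𝓘(ℝ, E) T (0, 1)) := by
    constructor
    · rw [injective_iff_map_eq_zero]
      rintro ⟨v, w⟩ h
      rw [hTd] at h
      obtain ⟨h1, h2⟩ := B.eq_zero_of_perp_add hH (hjp v) h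
      rw [h2, hji (h1.trans (_root_.map_zero j).symm)]
      rfl
    · intro ξ
      obtain ⟨v, hv⟩ := hjs _ (B.bf_pP hH ξ)
      obtain ⟨ζ, hζ⟩ := B.pS_mem hH ξ
      refine ⟨(v, ζ), ?_⟩
      rw [hTd, hv, ← hζ, add_comm, B.pS_add_pP]
  have := FiniteDimensional.complete ℝ E
  have := FiniteDimensional.complete ℝ E'
  have hdim : Module.finrank ℝ E = d + Module.finrank ℝ E' := by
    have := (LinearEquiv.ofBijective (md (𝓘(ℝ, V).prod 𝓘(ℝ, E')) 𝓘(ℝ, E) T (0, 1)).toLinearMap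
      hb).finrank_eq
    rw [Module.finrank_prod, finrank_euclideanSpace_fin] at this
    exact this.symm
  obtain ⟨S, τ, hSo, hS0, hSs, hτs, hτ⟩ := exists_partialDiffeomorph_mul hH hσ0
    (hσ.contMDiffAt (hS₁.mem_nhds h0)).continuousAt
    (isLocalDiffeomorphAt_of_md hTo (x := (0, 1)) ⟨h0, trivial⟩ hT hb) (hS₁.mem_nhds h0)
  refine ⟨d, σ, S, τ, hdim, ?_⟩
  exact
    { isOpen := hSo
      zero_mem := hS0
      smooth := hσ.mono fun v hv => hSs hv
      map_zero := hσ0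
      perp := by rw [hσd]; exact hjp
      injective := by rw [hσd]; exact hji
      exists_eq := by rw [hσd]; exact hjs
      source := hτs
      apply := hτ }

end Transversal

/-! ### Consequences of the slice property -/

section Slice

variable {E : Type*} [NormedAddCommGroup E] [NormedSpace ℝ E] [FiniteDimensional ℝ E]
  {G : Type*} [TopologicalSpace G] [ChartedSpace E G] [Group G] [LieGroup 𝓘(ℝ, E) ∞ G]
  {E' : Type*} [NormedAddCommGroup E'] [NormedSpace ℝ E'] [FiniteDimensional ℝ E']
  {H : Subgroup G} [ChartedSpace E' H]
  {F : Type*} [NormedAddCommGroup F] [NormedSpace ℝ F]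
  {M : Type*} [TopologicalSpace M] [ChartedSpace F M] [MulAction G M]
  {F' : Type*} [NormedAddCommGroup F'] [NormedSpace ℝ F']
  {Y : Type*} [TopologicalSpace Y] [ChartedSpace F' Y]
  {V : Type*} [NormedAddCommGroup V] [NormedSpace ℝ V] [FiniteDimensional ℝ V]
  {B : InvariantInnerProduct E G} {hH : IsLieSubgroup E E' H}

/-- Injectivity of the slice map gives `[k, u] = [1, u']`, which forces `k ∈ H`. -/
theorem IsSlice.mem_of_conj {g : G} {U : TopologicalSpace.Opens H} (hU : IsSlice E E' g U) {k : G}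
    {u u' : H} (hu : u ∈ U) (hu' : u' ∈ U) (h : k * u * k⁻¹ = u') : k ∈ H := by
  let := conjAction U hU.invariant
  obtain ⟨n, cs, -, -, hinj⟩ := hU.diffeo
  have h1 : (AssocBundle.mk (k, ⟨u, hu⟩) : AssocBundle H U) = AssocBundle.mk (1, ⟨u', hu'⟩) := by
    apply hinj
    change k * u * k⁻¹ = 1 * u' * 1⁻¹
    rw [h]
    simp
  obtain ⟨x, hx⟩ := Quotient.exact h1
  have h2 : (1 : G) = k * (x : G)⁻¹ := congrArg Prod.fst hx
  rw [eq_mul_inv_iff_mul_eq, one_mul] at h2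
  rw [← h2]
  exact x.2

/-- The map `(k, u) ↦ k u k⁻¹` has surjective derivative at `(1, u)`, so in left trivialization
`(Ad_u⁻¹ - 1)𝔤 + 𝔥 = 𝔤`. A vector of `𝔥^⊥` fixed by `Ad_u` is orthogonal to both summands. -/
theorem IsSlice.regular (B : InvariantInnerProduct E G) (hH : IsLieSubgroup E E' H) {g : G}
    {U : TopologicalSpace.Opens H} (hU : IsSlice E E' g U) {u : H} (hu : u ∈ U) :
    B.Regular hH u := by
  let := conjAction U hU.invariant
  have := hH.lieGroup
  have hmH : IsManifold 𝓘(ℝ, E') ∞ H := hH.lieGroup.toIsManifold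
  have hmG : IsManifold 𝓘(ℝ, E) ∞ G := ‹LieGroup 𝓘(ℝ, E) ∞ G›.toIsManifold
  have hv : ContMDiff 𝓘(ℝ, E') 𝓘(ℝ, E) ∞ (Subtype.val : H → G) := hH.embedding.contMDiff
  obtain ⟨n, cs, hq, hld, -⟩ := hU.diffeo
  have := hq.isManifold
  have hinv : ContMDiff 𝓘(ℝ, E) 𝓘(ℝ, E) ∞ (fun k : G => k⁻¹) := contMDiff_inv 𝓘(ℝ, E) ∞
  have hUv : ContMDiff 𝓘(ℝ, E') 𝓘(ℝ, E') ∞ (Subtype.val : U → H) := contMDiff_subtype_val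
  have hUG : ContMDiff 𝓘(ℝ, E') 𝓘(ℝ, E) ∞ (fun x : U => ((x : H) : G)) := hv.comp hUv
  have hc : ContMDiff (𝓘(ℝ, E).prod 𝓘(ℝ, E')) 𝓘(ℝ, E) ∞
      (fun p : G × U => p.1 * ((p.2 : H) : G) * p.1⁻¹) :=
    (contMDiff_fst.mul (hUG.comp contMDiff_snd)).mul (hinv.comp contMDiff_fst)
  let x : G × U := (1, ⟨u, hu⟩)
  have hsub : Manifold.IsSubmersionAt (𝓘(ℝ, E).prod 𝓘(ℝ, E')) 𝓘(ℝ, EuclideanSpace ℝ (Fin n)) ∞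
      (AssocBundle.mk : G × U → AssocBundle H U) x := hq.submersion.isSubmersionAt x
  have h1 := md_comp (I₁ := 𝓘(ℝ, E).prod 𝓘(ℝ, E')) (I₂ := 𝓘(ℝ, EuclideanSpace ℝ (Fin n)))
    (I₃ := 𝓘(ℝ, E)) (g := sliceMap U hU.invariant) (f := AssocBundle.mk) (x := x)
    ((hld _).contMDiffAt.mdifferentiableAt (by simp)) (hsub.contMDiffAt.mdifferentiableAt (by simp))
  have hsurj : Function.Surjective (md (𝓘(ℝ, E).prod 𝓘(ℝ, E')) 𝓘(ℝ, E)
      (fun p : G × U => p.1 * ((p.2 : H) : G) * p.1⁻¹) x) := by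
    have h2 : Function.Surjective (md (𝓘(ℝ, E).prod 𝓘(ℝ, E')) 𝓘(ℝ, E)
        (fun y => sliceMap U hU.invariant (AssocBundle.mk y)) x) := by
      rw [h1]
      exact (md_bijective_of_isLocalDiffeomorphAt (hld _)).2.comp
        (md_surjective_of_isSubmersionAt hsub)
    exact h2
  have hform : ∀ (ξ : E) (w : E'), ∃ ζ : E', md (𝓘(ℝ, E).prod 𝓘(ℝ, E')) 𝓘(ℝ, E)
      (fun p : G × U => p.1 * ((p.2 : H) : G) * p.1⁻¹) x (ξ, w) =
        leftMap E (u : G) (adMap E (u : G)⁻¹ ξ - ξ + inclMap E E' H ζ) := fun ξ w => by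
    rw [md_prod_apply ((hc _).mdifferentiableAt (by simp))]
    simp only [one_mul, inv_one, mul_one]
    rw [md_conj_orbit, md_comp (g := (Subtype.val : H → G)) (hv.mdiff _) (hUv.mdiff _)]
    obtain ⟨ζ, hζ⟩ := (leftMap_bijective (E := E') u).2
      (md 𝓘(ℝ, E') 𝓘(ℝ, E') (Subtype.val : U → H) ⟨u, hu⟩ w)
    refine ⟨ζ, ?_⟩
    rw [ContinuousLinearMap.comp_apply, ← hζ, md_val_leftMap hH, rightMap_eq, map_add, map_sub]
  intro ξ hξ hA
  apply B.eq_zero_of_bf_self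
  obtain ⟨⟨ξ', w⟩, hξw⟩ := hsurj (leftMap E (u : G) ξ)
  obtain ⟨ζ, hζ⟩ := hform ξ' w
  have h3 : ξ = adMap E (u : G)⁻¹ ξ' - ξ' + inclMap E E' H ζ :=
    (leftMap_bijective (u : G)).1 (hξw.symm.trans hζ)
  have h4 : B.bf ξ (adMap E (u : G)⁻¹ ξ') = B.bf ξ ξ' := by
    conv_lhs => rw [← B.bf_adMap (u : G), adMap_apply_inv, hA]
  refine (congrArg (B.bf ξ) h3).trans ?_
  rw [map_add, map_sub, hξ, h4, sub_self, add_zero]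

/-- `Ad_u⁻¹ - 1` preserves `𝔥^⊥`, so both parts of the sum vanish separately. -/
theorem InvariantInnerProduct.eq_zero_of_regular (B : InvariantInnerProduct E G) {u : H}
    (hu : B.Regular hH u) {ξ : E} (hξ : ∀ ζ, B.bf ξ (inclMap E E' H ζ) = 0) {ζ : E'}
    (h : adMap E (u : G)⁻¹ ξ - ξ + inclMap E E' H ζ = 0) : ξ = 0 ∧ ζ = 0 := by
  have hp : ∀ ζ, B.bf (adMap E (u : G)⁻¹ ξ - ξ) (inclMap E E' H ζ) = 0 := fun ζ => by
    have := B.perp_adMap hH hξ u⁻¹ ζ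
    rw [map_sub, LinearMap.sub_apply, hξ, sub_zero]
    exact this
  obtain ⟨h4, h5⟩ := B.eq_zero_of_perp_add hH hp h
  refine ⟨hu ξ hξ ?_, h5⟩
  conv_lhs => rw [← sub_eq_zero.1 h4]
  rw [adMap_apply_inv]

namespace IsTransversal

variable {σ : V → G} {S : Set V}
  {τ : PartialDiffeomorph (𝓘(ℝ, V).prod 𝓘(ℝ, E')) 𝓘(ℝ, E) (V × H) G ∞}

/-- `σ(v) · 1` and `σ(0) · σ(v)` are the same element, and `τ` is injective. -/
theorem eq_zero (hσ : IsTransversal B hH σ S τ) {v : V} (hv : v ∈ S) (h : σ v ∈ H) : v = 0 := by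
  have h1 : τ (v, 1) = τ (0, ⟨σ v, h⟩) := by
    rw [hσ.apply, hσ.apply, hσ.map_zero]
    simp
  have h2 : (v, (1 : H)) = (0, ⟨σ v, h⟩) := τ.injOn (by rw [hσ.source]; exact ⟨hv, trivial⟩)
    (by rw [hσ.source]; exact ⟨hσ.zero_mem, trivial⟩) h1
  exact congrArg Prod.fst h2

theorem smooth_at (hσ : IsTransversal B hH σ S τ) : ContMDiffAt 𝓘(ℝ, V) 𝓘(ℝ, E) ∞ σ 0 :=
  hσ.smooth.contMDiffAt (hσ.isOpen.mem_nhds hσ.zero_mem)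

/-- In left trivialization the derivative is `(Ad_u⁻¹ - 1) ξ + ζ` with `ξ = dσ(v) ∈ 𝔥^⊥` and `ζ ∈
𝔥`. It is injective by regularity, and `hdim` makes it bijective. -/
theorem isLocalDiffeomorphAt_conj (hσ : IsTransversal B hH σ S τ)
    (hdim : Module.finrank ℝ E = Module.finrank ℝ V + Module.finrank ℝ E') {u : H}
    (hu : B.Regular hH u) :
    IsLocalDiffeomorphAt (𝓘(ℝ, V).prod 𝓘(ℝ, E')) 𝓘(ℝ, E) ∞
      (fun p : V × H => σ p.1 * (p.2 : G) * (σ p.1)⁻¹) (0, u) := by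
  have := hH.lieGroup
  have hmH : IsManifold 𝓘(ℝ, E') ∞ H := hH.lieGroup.toIsManifold
  have hmG : IsManifold 𝓘(ℝ, E) ∞ G := ‹LieGroup 𝓘(ℝ, E) ∞ G›.toIsManifold
  have := FiniteDimensional.complete ℝ E
  have := FiniteDimensional.complete ℝ E'
  have := FiniteDimensional.complete ℝ V
  have hv : ContMDiff 𝓘(ℝ, E') 𝓘(ℝ, E) ∞ (Subtype.val : H → G) := hH.embedding.contMDiff
  have hinv : ContMDiff 𝓘(ℝ, E) 𝓘(ℝ, E) ∞ (fun k : G => k⁻¹) := contMDiff_inv 𝓘(ℝ, E) ∞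
  have h1 : ContMDiffOn (𝓘(ℝ, V).prod 𝓘(ℝ, E')) 𝓘(ℝ, E) ∞ (fun p : V × H => σ p.1) (S ×ˢ univ) :=
    hσ.smooth.comp contMDiffOn_fst fun p hp => hp.1
  have h2 : ContMDiffOn (𝓘(ℝ, V).prod 𝓘(ℝ, E')) 𝓘(ℝ, E) ∞
      (fun p : V × H => σ p.1 * (p.2 : G) * (σ p.1)⁻¹) (S ×ˢ univ) :=
    (h1.mul (hv.comp contMDiff_snd).contMDiffOn).mul (hinv.comp_contMDiffOn h1)
  have ho : IsOpen (S ×ˢ (univ : Set H)) := hσ.isOpen.prod isOpen_univ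
  have hm : ((0 : V), u) ∈ S ×ˢ (univ : Set H) := ⟨hσ.zero_mem, trivial⟩
  refine isLocalDiffeomorphAt_of_md ho hm h2 ?_
  have hconj : ContMDiff 𝓘(ℝ, E) 𝓘(ℝ, E) ∞ (fun k : G => k * u * k⁻¹) :=
    (contMDiff_mulRight (u : G)).mul hinv
  have hinj : Function.Injective (md (𝓘(ℝ, V).prod 𝓘(ℝ, E')) 𝓘(ℝ, E)
      (fun p : V × H => σ p.1 * (p.2 : G) * (σ p.1)⁻¹) (0, u)) := by
    rw [injective_iff_map_eq_zero]
    rintro ⟨v, w⟩ h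
    obtain ⟨ζ, rfl⟩ := (leftMap_bijective (E := E') u).2 w
    rw [md_prod_apply ((h2.contMDiffAt (ho.mem_nhds hm)).mdifferentiableAt (by simp)),
      md_comp_of_eq (g := fun k : G => k * u * k⁻¹) (f := σ) (hconj.mdiff 1)
      (hσ.smooth_at.mdifferentiableAt (by simp)) hσ.map_zero] at h
    simp only [hσ.map_zero, one_mul, inv_one, mul_one] at h
    change _ + md 𝓘(ℝ, E') 𝓘(ℝ, E) (Subtype.val : H → G) u _ = 0 at h
    set ξ := md 𝓘(ℝ, V) 𝓘(ℝ, E) σ 0 v with hξ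
    rw [ContinuousLinearMap.comp_apply, md_conj_orbit, md_val_leftMap hH, rightMap_eq, ← map_sub,
      ← map_add] at h
    have h3 := (leftMap_bijective (u : G)).1 (h.trans (_root_.map_zero (leftMap E (u : G))).symm)
    obtain ⟨h6, h5⟩ := B.eq_zero_of_regular hu (hσ.perp v) h3
    rw [h5, hσ.injective (h6.trans (_root_.map_zero _).symm), _root_.map_zero]
    rfl
  refine ⟨hinj, ?_⟩
  have hf : Module.finrank ℝ (V × E') = Module.finrank ℝ E := by
    rw [Module.finrank_prod, hdim]
  exact (LinearMap.injective_iff_surjective_of_finrank_eq_finrank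
    (f := (md (𝓘(ℝ, V).prod 𝓘(ℝ, E')) 𝓘(ℝ, E)
      (fun p : V × H => σ p.1 * (p.2 : G) * (σ p.1)⁻¹) (0, u)).toLinearMap) hf).1 hinj

variable [ContMDiffSMul 𝓘(ℝ, E) 𝓘(ℝ, F) ∞ G M]

theorem contMDiffOn_smul (hσ : IsTransversal B hH σ S τ) {i : Y → M}
    (hi : ContMDiff 𝓘(ℝ, F') 𝓘(ℝ, F) ∞ i) :
    ContMDiffOn (𝓘(ℝ, V).prod 𝓘(ℝ, F')) 𝓘(ℝ, F) ∞ (fun p : V × Y => σ p.1 • i p.2) (S ×ˢ univ) :=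
  ContMDiffOn.smul (hσ.smooth.comp contMDiffOn_fst fun _ hp => hp.1)
    (hi.comp contMDiff_snd).contMDiffOn

theorem md_smul (hσ : IsTransversal B hH σ S τ) {i : Y → M} (hi : ContMDiff 𝓘(ℝ, F') 𝓘(ℝ, F) ∞ i)
    (y : Y) (v : V) (w : F') :
    md (𝓘(ℝ, V).prod 𝓘(ℝ, F')) 𝓘(ℝ, F) (fun p : V × Y => σ p.1 • i p.2) (0, y) (v, w) =
      actMap E G F (i y) (md 𝓘(ℝ, V) 𝓘(ℝ, E) σ 0 v) + md 𝓘(ℝ, F') 𝓘(ℝ, F) i y w := by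
  have hact : ContMDiff 𝓘(ℝ, E) 𝓘(ℝ, F) ∞ (fun k : G => k • i y) := contMDiff_id.smul
      contMDiff_const
  have ho : IsOpen (S ×ˢ (univ : Set Y)) := hσ.isOpen.prod isOpen_univ
  rw [md_prod_apply (((hσ.contMDiffOn_smul hi).contMDiffAt
    (ho.mem_nhds ⟨hσ.zero_mem, trivial⟩)).mdifferentiableAt (by simp)),
    md_comp_of_eq (g := fun k : G => k • i y) (f := σ) (hact.mdiff 1)
      (hσ.smooth_at.mdifferentiableAt (by simp)) hσ.map_zero]
  simp only [hσ.map_zero, one_smul]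
  rfl

end IsTransversal

end Slice

/-! ### Splitting of `P` along the cross-section -/

section Splitting

variable {E : Type*} [NormedAddCommGroup E] [NormedSpace ℝ E] [FiniteDimensional ℝ E]
  {G : Type*} [TopologicalSpace G] [ChartedSpace E G] [Group G] [LieGroup 𝓘(ℝ, E) ∞ G]
  {E' : Type*} [NormedAddCommGroup E'] [NormedSpace ℝ E'] [FiniteDimensional ℝ E']
  {H : Subgroup G} [ChartedSpace E' H]
  {F : Type*} [NormedAddCommGroup F] [NormedSpace ℝ F] [FiniteDimensional ℝ F]
  {M : Type*} [TopologicalSpace M] [ChartedSpace F M] [MulAction G M]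
  {F' : Type*} [NormedAddCommGroup F'] [NormedSpace ℝ F']
  {Y : Type*} [TopologicalSpace Y] [ChartedSpace F' Y]
  {V : Type*} [NormedAddCommGroup V] [NormedSpace ℝ V] [FiniteDimensional ℝ V]
  {B : InvariantInnerProduct E G} {hH : IsLieSubgroup E E' H}
  {σ : V → G} {S : Set V}
  {τ : PartialDiffeomorph (𝓘(ℝ, V).prod 𝓘(ℝ, E')) 𝓘(ℝ, E) (V × H) G ∞}
  [ContMDiffSMul 𝓘(ℝ, E) 𝓘(ℝ, F) ∞ G M]

namespace IsTransversal

/-- The projection onto the tangent space of the cross-section along `𝔥^⊥`. -/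
theorem exists_projection (hσ : IsTransversal B hH σ S τ) {i : Y → M}
    (hi : ContMDiff 𝓘(ℝ, F') 𝓘(ℝ, F) ∞ i) {y : Y}
    (hΘ : IsLocalDiffeomorphAt (𝓘(ℝ, V).prod 𝓘(ℝ, F')) 𝓘(ℝ, F) ∞
      (fun p : V × Y => σ p.1 • i p.2) (0, y)) :
    ∃ π : F →L[ℝ] F', (∀ w, π (md 𝓘(ℝ, F') 𝓘(ℝ, F) i y w) = w) ∧
      (∀ ξ : E, (∀ ζ, B.bf ξ (inclMap E E' H ζ) = 0) → π (actMap E G F (i y) ξ) = 0) ∧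
      ∀ w : F, ∃ ξ : E, (∀ ζ, B.bf ξ (inclMap E E' H ζ) = 0) ∧
        w = md 𝓘(ℝ, F') 𝓘(ℝ, F) i y (π w) + actMap E G F (i y) ξ := by
  let L : (V × F') ≃ₗ[ℝ] F := LinearEquiv.ofBijective
    (md (𝓘(ℝ, V).prod 𝓘(ℝ, F')) 𝓘(ℝ, F) (fun p : V × Y => σ p.1 • i p.2) (0, y)).toLinearMap
    (md_bijective_of_isLocalDiffeomorphAt hΘ)
  have hL : ∀ v w, L (v, w) = actMap E G F (i y) (md 𝓘(ℝ, V) 𝓘(ℝ, E) σ 0 v) +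
      md 𝓘(ℝ, F') 𝓘(ℝ, F) i y w := fun v w => hσ.md_smul hi y v w
  refine ⟨(LinearMap.snd ℝ V F' ∘ₗ L.symm.toLinearMap).toContinuousLinearMap, fun w => ?_,
    fun ξ hξ => ?_, fun w => ?_⟩
  · have := hL 0 w
    rw [_root_.map_zero, _root_.map_zero, zero_add] at this
    change (L.symm _).2 = w
    rw [← this, L.symm_apply_apply]
  · obtain ⟨v, rfl⟩ := hσ.exists_eq ξ hξ
    have := hL v 0
    rw [_root_.map_zero, add_zero] at this
    change (L.symm _).2 = 0
    rw [← this, L.symm_apply_apply]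
  · refine ⟨md 𝓘(ℝ, V) 𝓘(ℝ, E) σ 0 (L.symm w).1, hσ.perp _, ?_⟩
    rw [add_comm]
    exact (L.apply_symm_apply w).symm.trans (hL _ _)

/-- Smooth functions on the cross-section extend to functions on `M` that are constant to first
order in the directions of `𝔥^⊥`. -/
theorem exists_extension (hσ : IsTransversal B hH σ S τ) [IsManifold 𝓘(ℝ, F) ∞ M] [T2Space M]
    {i : Y → M} {y : Y}
    (hΘ : IsLocalDiffeomorphAt (𝓘(ℝ, V).prod 𝓘(ℝ, F')) 𝓘(ℝ, F) ∞
      (fun p : V × Y => σ p.1 • i p.2) (0, y)) {f : Y → ℝ} (hf : SmoothFun F' f) :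
    ∃ f₁ : M → ℝ, SmoothFun F f₁ ∧ (∀ᶠ z in 𝓝 y, f₁ (i z) = f z) ∧
      ∀ᶠ z in 𝓝 y, ∀ ξ : E, (∀ ζ, B.bf ξ (inclMap E E' H ζ) = 0) →
        dR F f₁ (i z) (actMap E G F (i z) ξ) = 0 := by
  obtain ⟨Ψ, hy, hΨ⟩ := hΘ
  have hΨy : Ψ (0, y) = i y := by
    rw [← hΨ hy]
    simp [hσ.map_zero]
  -- Locally `M` is `V × Y`, and `f` is extended as a constant in `V`. Differentiating along `v ↦
  -- σ(v) • i z` at every `z` near `y` gives the last claim on a neighbourhood, as needed for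
  -- iterated brackets.
  have hf₀ : ContMDiffOn 𝓘(ℝ, F) 𝓘(ℝ, ℝ) ∞ (fun m => f (Ψ.symm m).2) Ψ.target :=
    ContMDiff.comp_contMDiffOn (g := f) hf
      (contMDiff_snd.comp_contMDiffOn Ψ.contMDiffOn_invFun)
  obtain ⟨f₁, hf₁, hf₁e⟩ := exists_smoothFun_eventuallyEq Ψ.open_target
    (x := i y) (by rw [← hΨy]; exact Ψ.map_source hy) hf₀
  have hev : ∀ᶠ p in 𝓝 ((0 : V), y), f₁ (σ p.1 • i p.2) = f p.2 := by
    have h1 : ContinuousAt Ψ ((0 : V), y) :=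
      Ψ.contMDiffOn_toFun.continuousOn.continuousAt (Ψ.open_source.mem_nhds hy)
    rw [← hΨy] at hf₁e
    filter_upwards [h1.eventually hf₁e, Ψ.open_source.mem_nhds hy] with p hp hps
    have h2 := hΨ hps
    simp only at h2
    rw [h2, hp]
    exact congrArg (fun q : V × Y => f q.2) (Ψ.left_inv hps)
  have hz : Tendsto (fun z : Y => ((0 : V), z)) (𝓝 y) (𝓝 (0, y)) :=
    Continuous.tendsto (by fun_prop) y
  have hev' := hz.eventually hev.eventually_nhds
  refine ⟨f₁, hf₁, ?_, ?_⟩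
  · filter_upwards [hev'] with z hz
    have := hz.self_of_nhds
    simpa [hσ.map_zero] using this
  · filter_upwards [hev'] with z hz ξ hξ
    obtain ⟨v, rfl⟩ := hσ.exists_eq ξ hξ
    have hv : Tendsto (fun v : V => (v, z)) (𝓝 0) (𝓝 (0, z)) := Continuous.tendsto (by fun_prop) 0
    have h1 : (fun v : V => f₁ (σ v • i z)) =ᶠ[𝓝 0] fun _ => f z := hv.eventually hz
    have hact : ContMDiff 𝓘(ℝ, E) 𝓘(ℝ, F) ∞ (fun k : G => k • i z) :=
      contMDiff_id.smul contMDiff_const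
    have h2 := dR_comp_apply (f := fun k : G => f₁ (k • i z)) (g := σ) (x := 0) (y := 1)
      ((ContMDiff.comp (g := f₁) hf₁ hact).mdiff 1)
      (hσ.smooth_at.mdifferentiableAt (by simp)) hσ.map_zero v
    rw [dR_congr h1, ← dR_actMap hf₁] at h2
    rw [← h2, dR, md_const]
    rfl

end IsTransversal

variable [MulAction H Y] {i : Y → M} {Φ : M → G} {ΦY : Y → H}

namespace IsCross

theorem splitsAlong_of {P : BivectorField F M} {Q : BivectorField F' Y}
    (h : ∀ (y : Y) (α β : F →L[ℝ] ℝ), P.pv (i y) α β =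
      Q.pv y (α.comp (md 𝓘(ℝ, F') 𝓘(ℝ, F) i y)) (β.comp (md 𝓘(ℝ, F') 𝓘(ℝ, F) i y))
        - B.bf (B.pl (i y) α) (B.rM hH (ΦY y) (B.pl (i y) β))) :
    B.SplitsAlong P i Q (fun y => -B.rMatrix hH (ΦY y)) := fun y α β => by
  have e : ∀ α β : F →L[ℝ] ℝ, B.generated (-B.rMatrix hH (ΦY y)) (i y) α β =
      -(B.bf (B.pl (i y) α) (B.rM hH (ΦY y) (B.pl (i y) β))) := fun α β =>
    congrArg₂ (fun ξ η : E => -(B.bf ξ (B.rM hH (ΦY y) η))) (B.pull_eq_pl (i y) α)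
      (B.pull_eq_pl (i y) β)
  exact (h y α β).trans ((sub_eq_add_neg _ _).trans (congrArg _ (e α β).symm))

theorem pv_of_perp (hc : IsCross B hH F F' i Φ ΦY) [ContMDiffSMul 𝓘(ℝ, E') 𝓘(ℝ, F') ∞ H Y]
    {P : BivectorField F M} {Q : BivectorField F' Y}
    (hs : B.SplitsAlong P i Q (fun y => -B.rMatrix hH (ΦY y))) (y : Y) {α : F →L[ℝ] ℝ}
    (hα : ∀ ξ : E, (∀ ζ, B.bf ξ (inclMap E E' H ζ) = 0) → α (actMap E G F (i y) ξ) = 0)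
    (β : F →L[ℝ] ℝ) :
    P.pv (i y) α β = Q.pv y (α.comp (md 𝓘(ℝ, F') 𝓘(ℝ, F) i y))
        (β.comp (md 𝓘(ℝ, F') 𝓘(ℝ, F) i y)) := by
  rw [splits_apply hs, B.bf_rM_skew hH (hc.regular y), hc.pl_eq_inclMap y hα, B.rM_inclMap]
  simp

/-- On a covector that vanishes on the cross-section, `P` is given by the r-matrix. -/
theorem pv_of_comp_eq_zero (hc : IsCross B hH F F' i Φ ΦY) [T2Space G]
    [ContMDiffSMul 𝓘(ℝ, E') 𝓘(ℝ, F') ∞ H Y] {P : BivectorField F M}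
    (hmom : ∀ f : G → ℝ, SmoothFun E f → ∀ (m : M) (β : F →L[ℝ] ℝ),
      P.pv m (dR F (fun x => f (Φ x)) m) β = -β (actMap E G F m (B.dop f (Φ m)))) {y : Y}
    (hspan : ∀ w : F, ∃ (v : F') (ξ : E), w = md 𝓘(ℝ, F') 𝓘(ℝ, F) i y v + actMap E G F (i y) ξ)
    {α : F →L[ℝ] ℝ} (hα : α.comp (md 𝓘(ℝ, F') 𝓘(ℝ, F) i y) = 0) (β : F →L[ℝ] ℝ) :
    P.pv (i y) α β = -B.bf (B.pl (i y) α) (B.rM hH (ΦY y) (B.pl (i y) β)) := by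
  obtain ⟨f, hf, rfl, hl⟩ := hc.exists_dR_moment_eq hspan hα
  set l := B.sh ((dR E f (ΦY y : G)).comp (leftMap E (ΦY y : G))) with hldef
  have hpl : B.pl (i y) (dR F (fun x => f (Φ x)) (i y)) = l - adMap E (ΦY y : G) l := by
    rw [B.pl_comp_moment hc.smooth_moment hc.equivariant hf, ← hc.coe_moment]
  have hrM : B.rM hH (ΦY y) (l - adMap E (ΦY y : G) l) =
      (1 / 2 : ℝ) • (adMap E (ΦY y : G) l + l) :=
    B.rM_eq_of hH (hc.regular y) hl (by
      rw [map_sub, B.pP_adMap, B.pP_of_perp hH hl])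
  rw [B.bf_rM_skew hH (hc.regular y), hpl, hrM, hmom f hf, neg_neg, B.bf_symm, B.bf_pl,
    ← hc.coe_moment, B.dop_eq, add_comm]

/-- The splitting of `P` along the cross-section. -/
theorem exists_splitting (hc : IsCross B hH F F' i Φ ΦY) [T2Space G] [IsManifold 𝓘(ℝ, F) ∞ M]
    [T2Space M] [ContMDiffSMul 𝓘(ℝ, E') 𝓘(ℝ, F') ∞ H Y] {P : BivectorField F M}
    (hmom : ∀ f : G → ℝ, SmoothFun E f → ∀ (m : M) (β : F →L[ℝ] ℝ),
      P.pv m (dR F (fun x => f (Φ x)) m) β = -β (actMap E G F m (B.dop f (Φ m))))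
    (hσ : IsTransversal B hH σ S τ)
    (hΘ : ∀ y, IsLocalDiffeomorphAt (𝓘(ℝ, V).prod 𝓘(ℝ, F')) 𝓘(ℝ, F) ∞
      (fun p : V × Y => σ p.1 • i p.2) (0, y)) :
    ∃ Q : BivectorField F' Y, B.SplitsAlong P i Q (fun y => -B.rMatrix hH (ΦY y)) := by
  choose π hπ hπ0 hπs using fun y => hσ.exists_projection hc.smooth_incl (hΘ y)
  -- `T` extends a covector on `Y` by zero on the directions of `𝔥^⊥`; `Q` is `P` evaluated on such
  -- extensions.
  let T : Y → (F' →L[ℝ] ℝ) →ₗ[ℝ] (F →L[ℝ] ℝ) := fun y =>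
    { toFun := fun α => α.comp (π y)
      map_add' := fun α β => ContinuousLinearMap.add_comp α β (π y)
      map_smul' := fun c α => ContinuousLinearMap.smul_comp c α (π y) }
  have hT : ∀ y α w, T y α w = α (π y w) := fun _ _ _ => rfl
  have hTperp : ∀ y α (ξ : E), (∀ ζ, B.bf ξ (inclMap E E' H ζ) = 0) →
      T y α (actMap E G F (i y) ξ) = 0 := fun y α ξ hξ => by
    rw [hT, hπ0 y ξ hξ, map_zero]
  have hTeq : ∀ y (α : F →L[ℝ] ℝ), (∀ ξ : E, (∀ ζ, B.bf ξ (inclMap E E' H ζ) = 0) →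
      α (actMap E G F (i y) ξ) = 0) → T y (α.comp (md 𝓘(ℝ, F') 𝓘(ℝ, F) i y)) = α := by
    intro y α hα
    ext w
    obtain ⟨ξ, hξ, hw⟩ := hπs y w
    rw [hT, ContinuousLinearMap.comp_apply]
    conv_rhs => rw [hw, map_add, hα ξ hξ, add_zero]
  let Q : BivectorField F' Y :=
    { val := fun y => (P.pv (i y)).compl₁₂ (T y) (T y)
      alt := fun y α => P.pv_self (i y) (T y α)
      smooth := fun f h hf hh y => by
        obtain ⟨f₁, hf₁, hff, hfp⟩ := hσ.exists_extension (hΘ y) hf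
        obtain ⟨h₁, hh₁, hhh, hhp⟩ := hσ.exists_extension (hΘ y) hh
        have h1 : SmoothFun F' (fun z => P.bracket f₁ h₁ (i z)) :=
          ContMDiff.comp (g := P.bracket f₁ h₁) (P.smoothFun_bracket hf₁ hh₁) hc.smooth_incl
        refine (h1 y).congr_of_eventuallyEq ?_
        -- At every nearby point the differential of the extended function is `T` of the
        -- differential on `Y`, so `Q(df, dh)` is the restriction of a smooth bracket on `M`.
        filter_upwards [hff.eventually_nhds, hfp, hhh.eventually_nhds, hhp] with z z1 z2 z3 z4
        have key : ∀ {f : Y → ℝ} {f₁ : M → ℝ}, SmoothFun F f₁ → (∀ᶠ z in 𝓝 z, f₁ (i z) = f z) →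
            (∀ ξ : E, (∀ ζ, B.bf ξ (inclMap E E' H ζ) = 0) →
              dR F f₁ (i z) (actMap E G F (i z) ξ) = 0) → T z (dR F' f z) = dR F f₁ (i z) := by
          intro f f₁ hf₁ hff hfp
          rw [← hTeq z _ hfp, ← dR_comp (hf₁.mdiff _) (hc.smooth_incl.mdiff z) rfl,
            dR_congr (g := f) hff]
        change P.pv (i z) (T z (dR F' f z)) (T z (dR F' h z)) = _
        rw [key hf₁ z1 z2, key hh₁ z3 z4]
        rfl }
  refine ⟨Q, splitsAlong_of fun y α β => ?_⟩
  change P.pv (i y) α β = P.pv (i y) (T y (α.comp (md 𝓘(ℝ, F') 𝓘(ℝ, F) i y)))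
    (T y (β.comp (md 𝓘(ℝ, F') 𝓘(ℝ, F) i y))) - _
  have hr := hc.regular y
  have hz : ∀ α : F' →L[ℝ] ℝ, B.rM hH (ΦY y) (B.pl (i y) (T y α)) = 0 := fun α => by
    rw [hc.pl_eq_inclMap y (hTperp y α), B.rM_inclMap]
  have hspan : ∀ w : F, ∃ (v : F') (ξ : E),
      w = md 𝓘(ℝ, F') 𝓘(ℝ, F) i y v + actMap E G F (i y) ξ := fun w =>
    let ⟨ξ, _, hw⟩ := hπs y w
    ⟨_, ξ, hw⟩
  -- A covector is the sum of one that vanishes on `T_y Y` and one that vanishes on the directions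
  -- of `𝔥^⊥`. If either argument is of the first kind, `P` is given by `-r`; if both are of the
  -- second kind, it is `Q`. The r-matrix kills the second kind, so no mixed terms arise.
  have hdec : ∀ α : F →L[ℝ] ℝ, ∃ α₀ : F →L[ℝ] ℝ, α₀.comp (md 𝓘(ℝ, F') 𝓘(ℝ, F) i y) = 0 ∧
      α = α₀ + T y (α.comp (md 𝓘(ℝ, F') 𝓘(ℝ, F) i y)) := fun α => by
    refine ⟨α - T y (α.comp (md 𝓘(ℝ, F') 𝓘(ℝ, F) i y)), ?_, by simp⟩
    ext w
    simp [hT, hπ]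
  obtain ⟨α₀, hα₀, hα⟩ := hdec α
  obtain ⟨β₀, hβ₀, hβ⟩ := hdec β
  set α₁ := T y (α.comp (md 𝓘(ℝ, F') 𝓘(ℝ, F) i y))
  set β₁ := T y (β.comp (md 𝓘(ℝ, F') 𝓘(ℝ, F) i y))
  have h1 := hc.pv_of_comp_eq_zero hmom hspan hα₀ (β₀ + β₁)
  have h2 := hc.pv_of_comp_eq_zero hmom hspan hβ₀ α₁
  have h3 : B.bf (B.pl (i y) α₁) (B.rM hH (ΦY y) (B.pl (i y) (β₀ + β₁))) = 0 := by
    rw [B.bf_rM_skew hH hr, hz]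
    simp
  rw [hz, map_zero, neg_zero] at h2
  rw [hα, hβ, map_add (P.pv (i y)) α₀ α₁, LinearMap.add_apply, h1, map_add (P.pv (i y) α₁),
      P.pv_swap _ α₁ β₀, h2,
    B.pl_add _ α₀ α₁, map_add B.bf, LinearMap.add_apply, h3]
  ring

end IsCross

end Splitting

/-! ### The quasi-Poisson structure on the cross-section -/

section Restriction

variable {E : Type*} [NormedAddCommGroup E] [NormedSpace ℝ E] [FiniteDimensional ℝ E]
  {G : Type*} [TopologicalSpace G] [ChartedSpace E G] [Group G] [LieGroup 𝓘(ℝ, E) ∞ G]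
  {E' : Type*} [NormedAddCommGroup E'] [NormedSpace ℝ E'] [FiniteDimensional ℝ E']
  {H : Subgroup G} [ChartedSpace E' H]
  {F : Type*} [NormedAddCommGroup F] [NormedSpace ℝ F] [FiniteDimensional ℝ F]
  {M : Type*} [TopologicalSpace M] [ChartedSpace F M] [MulAction G M]
  {F' : Type*} [NormedAddCommGroup F'] [NormedSpace ℝ F']
  {Y : Type*} [TopologicalSpace Y] [ChartedSpace F' Y] [MulAction H Y]
  {V : Type*} [NormedAddCommGroup V] [NormedSpace ℝ V] [FiniteDimensional ℝ V]
  {B : InvariantInnerProduct E G} {hH : IsLieSubgroup E E' H}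
  {σ : V → G} {S : Set V}
  {τ : PartialDiffeomorph (𝓘(ℝ, V).prod 𝓘(ℝ, E')) 𝓘(ℝ, E) (V × H) G ∞}
  {i : Y → M} {Φ : M → G} {ΦY : Y → H}

theorem InvariantInnerProduct.IsHamiltonian.moment_plain {P : BivectorField F M}
    (hP : B.IsHamiltonian P Φ) {f : G → ℝ} (hf : SmoothFun E f) (m : M) (β : F →L[ℝ] ℝ) :
    P.pv m (dR F (fun x => f (Φ x)) m) β = -β (actMap E G F m (B.dop f (Φ m))) := by
  have h : P.pv m (dR F (fun x => f (Φ x)) m) β = β (-actMap E G F m (B.dop f (Φ m))) :=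
    hP.moment f hf m β
  rw [h, map_neg]

theorem cartan_pull (f₁ f₂ f₃ : M → ℝ) (m : M) :
    B.cartan (B.pull (F := F) m (dAt f₁ m)) (B.pull (F := F) m (dAt f₂ m))
      (B.pull (F := F) m (dAt f₃ m)) =
    B.cartan (B.pl m (dR F f₁ m)) (B.pl m (dR F f₂ m)) (B.pl m (dR F f₃ m)) := by
  have h : ∀ f : M → ℝ, B.pull (F := F) m (dAt f m) = B.pl m (dR F f m) := fun f =>
    B.pull_eq_pl m (dR F f m)
  rw [h, h, h]

theorem BivectorField.IsInvariant.pv_smul {P : BivectorField F M} (hP : P.IsInvariant G) (k : G)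
    (m : M) (α β : F →L[ℝ] ℝ) : P.pv (k • m) α β =
      P.pv m (α.comp (md 𝓘(ℝ, F) 𝓘(ℝ, F) (fun x : M => k • x) m))
        (β.comp (md 𝓘(ℝ, F) 𝓘(ℝ, F) (fun x : M => k • x) m)) := hP k m α β

theorem md_val_injective (hH : IsLieSubgroup E E' H) (u : H) :
    Function.Injective (md 𝓘(ℝ, E') 𝓘(ℝ, E) (Subtype.val : H → G) u) := by
  have := hH.lieGroup
  intro v w h
  obtain ⟨v, rfl⟩ := (leftMap_bijective (E := E') u).2 v
  obtain ⟨w, rfl⟩ := (leftMap_bijective (E := E') u).2 w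
  rw [md_val_leftMap hH, md_val_leftMap hH] at h
  rw [inclMap_injective hH ((leftMap_bijective (u : G)).1 h)]

/-- Every differential on `H` is the restriction of one on `G`. -/
theorem exists_smoothFun_dR_val_eq [T2Space G] (hH : IsLieSubgroup E E' H) (u : H)
    (α : E' →L[ℝ] ℝ) : ∃ f : G → ℝ, SmoothFun E f ∧ dR E' (fun x : H => f x) u = α := by
  have hmG : IsManifold 𝓘(ℝ, E) ∞ G := ‹LieGroup 𝓘(ℝ, E) ∞ G›.toIsManifold
  have hv : ContMDiff 𝓘(ℝ, E') 𝓘(ℝ, E) ∞ (Subtype.val : H → G) := hH.embedding.contMDiff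
  obtain ⟨p, hp⟩ := LinearMap.exists_leftInverse_of_injective
    (md 𝓘(ℝ, E') 𝓘(ℝ, E) (Subtype.val : H → G) u).toLinearMap
    (LinearMap.ker_eq_bot.2 (md_val_injective hH u))
  obtain ⟨f, hf, hfd⟩ := exists_smoothFun_md_eq (u : G) (α.comp p.toContinuousLinearMap)
  refine ⟨f, hf, ?_⟩
  ext w
  rw [dR_comp_apply (g := (Subtype.val : H → G)) (hf.mdiff _) (hv.mdiff _) rfl]
  have h1 : dR E f (u : G) = α.comp p.toContinuousLinearMap := hfd
  rw [h1]
  exact congrArg α (DFunLike.congr_fun hp w)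

variable [ContMDiffSMul 𝓘(ℝ, E) 𝓘(ℝ, F) ∞ G M]

/-- The cross-section of a Hamiltonian quasi-Poisson manifold is Hamiltonian quasi-Poisson. -/
theorem IsCross.isHamiltonian_restrict (hc : IsCross B hH F F' i Φ ΦY) [T2Space G]
    [FiniteDimensional ℝ F'] [IsManifold 𝓘(ℝ, F') ∞ Y] [T2Space Y] [SecondCountableTopology Y]
    [ContMDiffSMul 𝓘(ℝ, E') 𝓘(ℝ, F') ∞ H Y] {P : BivectorField F M} (hP : B.IsHamiltonian P Φ)
    (hσ : IsTransversal B hH σ S τ)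
    (hΘ : ∀ y, IsLocalDiffeomorphAt (𝓘(ℝ, V).prod 𝓘(ℝ, F')) 𝓘(ℝ, F) ∞
      (fun p : V × Y => σ p.1 • i p.2) (0, y)) {Q : BivectorField F' Y}
    (hs : B.SplitsAlong P i Q (fun y => -B.rMatrix hH (ΦY y)))
    (heq : ∀ (h : H) (y : Y), ΦY (h • y) = h * ΦY y * h⁻¹) :
    (B.restrict hH).IsHamiltonian Q ΦY := by
  have := hP.isManifold
  have := hP.t2
  have := hH.lieGroup
  -- Covectors on `Y` lift to covectors on `M` that see no r-matrix; statements about `Q` become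
  -- statements about `P` on lifts.
  have hlift : ∀ (y : Y) (α' : F' →L[ℝ] ℝ), ∃ α : F →L[ℝ] ℝ,
      α.comp (md 𝓘(ℝ, F') 𝓘(ℝ, F) i y) = α' ∧ ∀ ξ : E, (∀ ζ, B.bf ξ (inclMap E E' H ζ) = 0) →
        α (actMap E G F (i y) ξ) = 0 := fun y α' => by
    obtain ⟨π, h1, h2, -⟩ := hσ.exists_projection hc.smooth_incl (hΘ y)
    refine ⟨α'.comp π, ?_, fun ξ hξ => ?_⟩
    · ext w
      simp [h1]
    · rw [ContinuousLinearMap.comp_apply, h2 ξ hξ, map_zero]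
  refine ⟨‹_›, ‹_›, ‹_›, ‹_›, fun h y α' β' => ?_, fun f₁ f₂ f₃ h₁ h₂ h₃ y => ?_,
    hc.smooth_moment', heq, fun f' hf' y β' => ?_⟩
  · obtain ⟨α, hα, hα0⟩ := hlift (h • y) α'
    obtain ⟨β, hβ, -⟩ := hlift (h • y) β'
    have hk : ContMDiff 𝓘(ℝ, F) 𝓘(ℝ, F) ∞ (fun x : M => (h : G) • x) :=
      ContMDiffSMul.contMDiff_const_smul (I := 𝓘(ℝ, E)) (h : G)
    have hk' : ContMDiff 𝓘(ℝ, F') 𝓘(ℝ, F') ∞ (fun x : Y => h • x) :=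
      ContMDiffSMul.contMDiff_const_smul (I := 𝓘(ℝ, E')) h
    have hcomm : (md 𝓘(ℝ, F) 𝓘(ℝ, F) (fun x : M => (h : G) • x) (i y)).comp
        (md 𝓘(ℝ, F') 𝓘(ℝ, F) i y) = (md 𝓘(ℝ, F') 𝓘(ℝ, F) i (h • y)).comp
        (md 𝓘(ℝ, F') 𝓘(ℝ, F') (fun x : Y => h • x) y) := by
      rw [← md_comp (hk.mdiff _) (hc.smooth_incl.mdiff y),
        ← md_comp (g := i) (hc.smooth_incl.mdiff _) (hk'.mdiff y)]
      simp only [hc.smul]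
    -- The pullback of `α` by `h` again kills the directions of `𝔥^⊥`, because `Ad_h` preserves
    -- `𝔥^⊥`. Hence `P` reduces to `Q` both at `h • y` and at `y`.
    have h1 := hc.pv_of_perp hs (h • y) hα0 β
    rw [hα, hβ, hc.smul, hP.invariant.pv_smul, hc.pv_of_perp hs y, ContinuousLinearMap.comp_assoc,
      hcomm, ContinuousLinearMap.comp_assoc, hcomm, ← ContinuousLinearMap.comp_assoc,
      ← ContinuousLinearMap.comp_assoc, hα, hβ] at h1
    · exact h1.symm
    · intro ξ hξ
      rw [ContinuousLinearMap.comp_apply, md_smul_actMap, ← hc.smul]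
      exact hα0 _ (B.perp_adMap hH hξ h)
  · have hext := fun f (hf : SmoothFun F' f) => hσ.exists_extension (hΘ y) hf
    obtain ⟨g₁, hg₁, e₁, p₁⟩ := hext f₁ h₁
    obtain ⟨g₂, hg₂, e₂, p₂⟩ := hext f₂ h₂
    obtain ⟨g₃, hg₃, e₃, p₃⟩ := hext f₃ h₃
    have hd : ∀ {f : Y → ℝ} {g : M → ℝ}, SmoothFun F g → (∀ᶠ z in 𝓝 y, g (i z) = f z) →
        (dR F g (i y)).comp (md 𝓘(ℝ, F') 𝓘(ℝ, F) i y) = dR F' f y := fun hg he => by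
      rw [← dR_comp (hg.mdiff _) (hc.smooth_incl.mdiff y) rfl, dR_congr he]
    have hsch := hP.schouten g₁ g₂ g₃ hg₁ hg₂ hg₃ (i y)
    rw [cartan_pull] at hsch
    rw [cartan_pull, ← Q.schoutenSelf_congr e₁ e₂ e₃, ← hd hg₁ e₁, ← hd hg₂ e₂, ← hd hg₃ e₃]
    have hs1 := hc.schoutenSelf_eq hs (f := ![g₁, g₂, g₃]) (y := y)
      (by intro a; fin_cases a <;> assumption) (by intro a; fin_cases a <;> assumption)
    have hs2 := hc.cartan_eq y (α := ![dR F g₁ (i y), dR F g₂ (i y), dR F g₃ (i y)])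
      (by intro a; fin_cases a; exacts [p₁.self_of_nhds, p₂.self_of_nhds, p₃.self_of_nhds])
    exact hs1.symm.trans (hsch.trans hs2)
  -- `f'` itself is not extended to `G`. Both sides of the moment condition depend only on its
  -- differential at `ΦY y`, which is realized by a function on `G`.
  · obtain ⟨f, hf, hfd⟩ := exists_smoothFun_dR_val_eq hH (ΦY y) (dR E' f' (ΦY y))
    obtain ⟨β, hβ, -⟩ := hlift y β'
    have h1 := hc.moment_defect hs hf y β
    rw [hP.moment_plain hf, neg_add_cancel, hβ, InvariantInnerProduct.dop_eq, hfd,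
      ← InvariantInnerProduct.dop_eq] at h1
    have hv : ContMDiff 𝓘(ℝ, E') 𝓘(ℝ, E) ∞ (Subtype.val : H → G) := hH.embedding.contMDiff
    have hfv : SmoothFun E' (fun x : H => f x) := ContMDiff.comp (g := f) hf hv
    rw [dR_comp (f := fun x : H => f x) (g := ΦY) (hfv.mdiff _) (hc.smooth_moment'.mdiff y) rfl,
      hfd, ← dR_comp (f := f') (hf'.mdiff _) (hc.smooth_moment'.mdiff y) rfl] at h1
    have h2 : β' (-actMap E' H F' y ((B.restrict hH).dop f' (ΦY y))) =
        Q.pv y (dR F' (fun x => f' (ΦY x)) y) β' := by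
      rw [eq_neg_of_add_eq_zero_left h1.symm]
      exact map_neg (β' : F' →L[ℝ] ℝ) _
    exact h2.symm

end Restriction

/-! ### The cross-section theorem -/

section CrossSectionTheorem

variable {E : Type*} [NormedAddCommGroup E] [NormedSpace ℝ E] [FiniteDimensional ℝ E]
  {G : Type*} [TopologicalSpace G] [ChartedSpace E G] [Group G] [LieGroup 𝓘(ℝ, E) ∞ G]
  {E' : Type*} [NormedAddCommGroup E'] [NormedSpace ℝ E'] [FiniteDimensional ℝ E']
  {H : Subgroup G} [ChartedSpace E' H]
  {F : Type*} [NormedAddCommGroup F] [NormedSpace ℝ F] [FiniteDimensional ℝ F]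
  {M : Type*} [TopologicalSpace M] [ChartedSpace F M] [MulAction G M]
  {V : Type*} [NormedAddCommGroup V] [NormedSpace ℝ V] [FiniteDimensional ℝ V]
  {B : InvariantInnerProduct E G} {hH : IsLieSubgroup E E' H}
  {σ : V → G} {S : Set V}
  {τ : PartialDiffeomorph (𝓘(ℝ, V).prod 𝓘(ℝ, E')) 𝓘(ℝ, E) (V × H) G ∞}
  {Φ : M → G}

theorem contMDiff_of_comp_isSmoothEmbedding
    {E₁ : Type*} [NormedAddCommGroup E₁] [NormedSpace ℝ E₁]
    {H₁ : Type*} [TopologicalSpace H₁] {I₁ : ModelWithCorners ℝ E₁ H₁}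
    {M₁ : Type*} [TopologicalSpace M₁] [ChartedSpace H₁ M₁] [IsManifold I₁ ∞ M₁]
    {E₂ : Type*} [NormedAddCommGroup E₂] [NormedSpace ℝ E₂]
    {M₂ : Type*} [TopologicalSpace M₂] [ChartedSpace E₂ M₂] [IsManifold 𝓘(ℝ, E₂) ∞ M₂]
    {E₃ : Type*} [NormedAddCommGroup E₃] [NormedSpace ℝ E₃]
    {M₃ : Type*} [TopologicalSpace M₃] [ChartedSpace E₃ M₃] [IsManifold 𝓘(ℝ, E₃) ∞ M₃]
    {ι : M₂ → M₃} (hι : Manifold.IsSmoothEmbedding 𝓘(ℝ, E₂) 𝓘(ℝ, E₃) ∞ ι) {f : M₁ → M₂}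
    (hf : ContMDiff I₁ 𝓘(ℝ, E₃) ∞ (fun x => ι (f x))) : ContMDiff I₁ 𝓘(ℝ, E₂) ∞ f :=
  (ContMDiff.iff_comp_isImmersion hι.isImmersion).2
    ⟨hι.isEmbedding.isInducing.continuous_iff.2 hf.continuous, hf⟩

/-- Near a point of the cross-section, the cross-section is the zero set of a submersion. -/
theorem IsSlice.exists_submersion {g : G} {U : TopologicalSpace.Opens H} (hU : IsSlice E E' g U)
    [ContMDiffSMul 𝓘(ℝ, E) 𝓘(ℝ, F) ∞ G M]
    (hΦ : ContMDiff 𝓘(ℝ, F) 𝓘(ℝ, E) ∞ Φ) (heq : ∀ (k : G) (m : M), Φ (k • m) = k * Φ m * k⁻¹)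
    (hσ : IsTransversal B hH σ S τ)
    (hdim : Module.finrank ℝ E = Module.finrank ℝ V + Module.finrank ℝ E') {y : M}
    (hy : y ∈ crossSection Φ U) :
    ∃ O : Set M, IsOpen O ∧ y ∈ O ∧ ∃ q : M → V, ContMDiffOn 𝓘(ℝ, F) 𝓘(ℝ, V) ∞ q O ∧
      Function.Surjective (md 𝓘(ℝ, F) 𝓘(ℝ, V) q y) ∧ ∀ m ∈ O, m ∈ crossSection Φ U ↔ q m = 0 := by
  obtain ⟨u, hu, huy⟩ := hy
  have hnhd : S ×ˢ (U : Set H) ∈ 𝓝 ((0 : V), u) :=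
    prod_mem_nhds (hσ.isOpen.mem_nhds hσ.zero_mem) (U.isOpen.mem_nhds hu)
  obtain ⟨Ψ, hΨu, hΨs, hΨ⟩ := exists_partialDiffeomorph_subset
    (hσ.isLocalDiffeomorphAt_conj hdim (hU.regular B hH hu)) hnhd
  have hΨ0 : Ψ (0, u) = Φ y := by
    rw [← hΨ hΨu, ← huy]
    simp [hσ.map_zero]
  have hyt : Φ y ∈ Ψ.target := by rw [← hΨ0]; exact Ψ.map_source hΨu
  have hq : ContMDiffOn 𝓘(ℝ, F) 𝓘(ℝ, V) ∞ (fun m => (Ψ.symm (Φ m)).1) (Φ ⁻¹' Ψ.target) :=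
    contMDiff_fst.comp_contMDiffOn (Ψ.contMDiffOn_invFun.comp hΦ.contMDiffOn fun m hm => hm)
  have ho : IsOpen (Φ ⁻¹' Ψ.target) := Ψ.open_target.preimage hΦ.continuous
  refine ⟨Φ ⁻¹' Ψ.target, ho, hyt, fun m => (Ψ.symm (Φ m)).1, hq, ?_, fun m hm => ?_⟩
  · have hact : ContMDiff 𝓘(ℝ, E) 𝓘(ℝ, F) ∞ (fun k : G => k • y) :=
      contMDiff_id.smul contMDiff_const
    have hc : ContMDiffAt 𝓘(ℝ, V) 𝓘(ℝ, F) ∞ (fun v => σ v • y) 0 :=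
      ContMDiffAt.comp (g := fun k : G => k • y) 0 (hact _) hσ.smooth_at
    have h1 := md_comp_of_eq (g := fun m => (Ψ.symm (Φ m)).1) (f := fun v => σ v • y) (x := 0)
      (y := y) ((hq.contMDiffAt (ho.mem_nhds hyt)).mdifferentiableAt (by simp))
      (hc.mdifferentiableAt (by simp)) (by simp [hσ.map_zero])
    -- By equivariance `Φ(σ(v) • y) = σ(v) u σ(v)⁻¹`, so `v ↦ σ(v) • y` is a section of `q`, which
    -- is therefore submersive at `y`.
    have h2 : (fun v => (Ψ.symm (Φ (σ v • y))).1) =ᶠ[𝓝 0] fun v => v := by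
      have hv : Tendsto (fun v : V => (v, u)) (𝓝 0) (𝓝 (0, u)) := Continuous.tendsto (by fun_prop) 0
      filter_upwards [hv.eventually (Ψ.open_source.mem_nhds hΨu)] with v hv
      have h3 : Φ (σ v • y) = Ψ (v, u) := by
        rw [← hΨ hv, heq, ← huy]
      rw [h3]
      exact congrArg Prod.fst (Ψ.left_inv hv)
    rw [md_congr h2, md_id] at h1
    intro v
    exact ⟨_, (DFunLike.congr_fun h1 v).symm⟩
  · have hm' : Ψ.symm (Φ m) ∈ Ψ.source := Ψ.map_target hm
    have hmS := hΨs hm'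
    have h1 : Φ m = Ψ (Ψ.symm (Φ m)) := (Ψ.right_inv hm).symm
    have h2 := h1.trans (hΨ hm').symm
    simp only at h2
    constructor
    -- If `Φ m ∈ U`, then `σ(v)` conjugates one element of `U` to another, hence lies in `H`; the
    -- transversal meets `H` only at `v = 0`.
    · rintro ⟨u', hu', hum⟩
      refine hσ.eq_zero hmS.1 (hU.mem_of_conj hmS.2 hu' ?_)
      rw [← h2, hum]
    · intro h0
      beta_reduce at h0
      rw [h0, hσ.map_zero, one_mul, inv_one, mul_one] at h2
      exact ⟨_, hmS.2, h2.symm⟩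

/-- If an orbit direction `ξ ∈ 𝔥^⊥` were tangent to `Y`, applying `dΦ` would put `(Ad_u⁻¹ - 1) ξ`
into `𝔥`, so `ξ = 0` by regularity. The rest is a dimension count. -/
theorem IsCross.isLocalDiffeomorphAt {F' : Type*} [NormedAddCommGroup F'] [NormedSpace ℝ F']
    [FiniteDimensional ℝ F'] {Y : Type*} [TopologicalSpace Y] [ChartedSpace F' Y] [MulAction H Y]
    [IsManifold 𝓘(ℝ, F') ∞ Y] [IsManifold 𝓘(ℝ, F) ∞ M] [ContMDiffSMul 𝓘(ℝ, E) 𝓘(ℝ, F) ∞ G M]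
    {i : Y → M} {ΦY : Y → H} (hc : IsCross B hH F F' i Φ ΦY) (hσ : IsTransversal B hH σ S τ)
    (hdim : Module.finrank ℝ F = Module.finrank ℝ V + Module.finrank ℝ F') {y : Y}
    (hi : Function.Injective (md 𝓘(ℝ, F') 𝓘(ℝ, F) i y)) :
    IsLocalDiffeomorphAt (𝓘(ℝ, V).prod 𝓘(ℝ, F')) 𝓘(ℝ, F) ∞
      (fun p : V × Y => σ p.1 • i p.2) (0, y) := by
  have := hH.lieGroup
  have := FiniteDimensional.complete ℝ F
  have := FiniteDimensional.complete ℝ F'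
  have := FiniteDimensional.complete ℝ V
  have ho : IsOpen (S ×ˢ (univ : Set Y)) := hσ.isOpen.prod isOpen_univ
  refine isLocalDiffeomorphAt_of_md ho ⟨hσ.zero_mem, trivial⟩ (hσ.contMDiffOn_smul hc.smooth_incl)
      ?_
  have hinj : Function.Injective (md (𝓘(ℝ, V).prod 𝓘(ℝ, F')) 𝓘(ℝ, F)
      (fun p : V × Y => σ p.1 • i p.2) (0, y)) := by
    rw [injective_iff_map_eq_zero]
    rintro ⟨v, w⟩ h
    rw [hσ.md_smul hc.smooth_incl] at h
    have hv : ContMDiff 𝓘(ℝ, E') 𝓘(ℝ, E) ∞ (Subtype.val : H → G) := hH.embedding.contMDiff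
    obtain ⟨ζ, hζ⟩ := (leftMap_bijective (E := E') (ΦY y)).2 (md 𝓘(ℝ, F') 𝓘(ℝ, E') ΦY y w)
    have h1 : md 𝓘(ℝ, F) 𝓘(ℝ, E) Φ (i y) (md 𝓘(ℝ, F') 𝓘(ℝ, F) i y w) =
        leftMap E (ΦY y : G) (inclMap E E' H ζ) := by
      have e1 := md_comp (hc.smooth_moment.mdiff (i y)) (hc.smooth_incl.mdiff y)
      have e2 := md_comp (g := (Subtype.val : H → G)) (hv.mdiff (ΦY y)) (hc.smooth_moment'.mdiff y)
      simp only [hc.coe_moment] at e2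
      have e3 := DFunLike.congr_fun (e1.symm.trans e2) w
      rw [ContinuousLinearMap.comp_apply, ContinuousLinearMap.comp_apply, ← hζ] at e3
      rw [e3, md_val_leftMap hH]
    have h2 := congrArg (md 𝓘(ℝ, F) 𝓘(ℝ, E) Φ (i y)) h
    rw [map_add, h1, md_equivariant_actMap hc.smooth_moment hc.equivariant, ← hc.coe_moment,
      rightMap_eq, ← map_sub, ← map_add, _root_.map_zero] at h2
    have h3 := (leftMap_bijective (ΦY y : G)).1
      (h2.trans (_root_.map_zero (leftMap E (ΦY y : G))).symm)
    obtain ⟨h4, -⟩ := B.eq_zero_of_regular (hc.regular y) (hσ.perp v) h3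
    rw [h4, _root_.map_zero, zero_add] at h
    rw [hi (h.trans (_root_.map_zero _).symm), hσ.injective (h4.trans (_root_.map_zero _).symm)]
    rfl
  refine ⟨hinj, ?_⟩
  have hf : Module.finrank ℝ (V × F') = Module.finrank ℝ F := by
    rw [Module.finrank_prod, hdim]
  exact (LinearMap.injective_iff_surjective_of_finrank_eq_finrank
    (f := (md (𝓘(ℝ, V).prod 𝓘(ℝ, F')) 𝓘(ℝ, F)
      (fun p : V × Y => σ p.1 • i p.2) (0, y)).toLinearMap) hf).1 hinj

theorem IsSlice.exists_chartedSpace_crossSection {g : G} {U : TopologicalSpace.Opens H}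
    (hU : IsSlice E E' g U) [IsManifold 𝓘(ℝ, F) ∞ M] [ContMDiffSMul 𝓘(ℝ, E) 𝓘(ℝ, F) ∞ G M]
    (hΦ : ContMDiff 𝓘(ℝ, F) 𝓘(ℝ, E) ∞ Φ) (heq : ∀ (k : G) (m : M), Φ (k • m) = k * Φ m * k⁻¹)
    (hσ : IsTransversal B hH σ S τ)
    (hdim : Module.finrank ℝ E = Module.finrank ℝ V + Module.finrank ℝ E') :
    ∃ (n : ℕ) (_ : ChartedSpace (EuclideanSpace ℝ (Fin n)) (crossSection Φ U)),
      (∀ _ : crossSection Φ U, Module.finrank ℝ F = Module.finrank ℝ V + n) ∧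
      IsManifold 𝓘(ℝ, EuclideanSpace ℝ (Fin n)) ∞ (crossSection Φ U) ∧
      Manifold.IsSmoothEmbedding 𝓘(ℝ, EuclideanSpace ℝ (Fin n)) 𝓘(ℝ, F) ∞
        (Subtype.val : crossSection Φ U → M) ∧
      ∀ y, Function.Injective (md 𝓘(ℝ, EuclideanSpace ℝ (Fin n)) 𝓘(ℝ, F)
        (Subtype.val : crossSection Φ U → M) y) := by
  have hsub := fun y hy => hU.exists_submersion (y := y) hΦ heq hσ hdim hy
  rcases (crossSection Φ U).eq_empty_or_nonempty with he | ⟨y, hy⟩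
  -- Without a point on the cross-section nothing ensures `dim V ≤ dim M`. For the empty set any
  -- codimension will do, and the dimension formula is stated only in the presence of a point.
  · obtain ⟨cs, h⟩ := exists_submanifold (n := 0) (V := F) (add_zero _).symm
      (S := crossSection Φ U) (fun y hy => by rw [he] at hy; exact hy.elim)
    exact ⟨0, cs, fun y => (eq_empty_iff_forall_notMem.1 he y y.2).elim, h⟩
  · obtain ⟨O, -, -, q, -, hq, -⟩ := hsub y hy
    have hle : Module.finrank ℝ V ≤ Module.finrank ℝ F :=
      LinearMap.finrank_le_finrank_of_surjective (f := (md 𝓘(ℝ, F) 𝓘(ℝ, V) q y).toLinearMap) hq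
    obtain ⟨n, hn⟩ := Nat.exists_eq_add_of_le hle
    obtain ⟨cs, h⟩ := exists_submanifold (n := n) hn hsub
    exact ⟨n, cs, fun _ => hn, h⟩

/-- Alternation and vanishing on `𝔥` follow from skewness and `rM_inclMap`; smoothness is that of
the Cayley transform along `ΦY`. -/
theorem InvariantInnerProduct.isPerpSection_rMatrix {F' : Type*} [NormedAddCommGroup F']
    [NormedSpace ℝ F'] {Y : Type*} [TopologicalSpace Y] [ChartedSpace F' Y] {ΦY : Y → H}
    (hΦY : ContMDiff 𝓘(ℝ, F') 𝓘(ℝ, E') ∞ ΦY) (hr : ∀ y, B.Regular hH (ΦY y)) :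
    IsPerpSection E' H F' (fun y => -B.rMatrix hH (ΦY y)) where
  alt y ξ := by
    have h : ∀ ξ : E, B.bf ξ (B.rM hH (ΦY y) ξ) = 0 := fun ξ => by
      have := B.bf_rM_skew hH (hr y) ξ ξ
      rw [B.bf_symm (B.rM hH (ΦY y) ξ)] at this
      linarith
    exact neg_eq_zero.2 (h ξ)
  perp y ζ η := by
    have h : ∀ (ζ : E') (η : E), B.bf (inclMap E E' H ζ) (B.rM hH (ΦY y) η) = 0 := fun ζ η => by
      rw [B.bf_rM_skew hH (hr y), B.rM_inclMap]
      simp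
    exact neg_eq_zero.2 (h ζ η)
  smooth ξ η := by
    have h : ∀ ξ η : E, SmoothFun F' (fun y => -(B.bf ξ (B.rM hH (ΦY y) η))) := fun ξ η y => by
      have h1 : ContMDiffAt 𝓘(ℝ, F') 𝓘(ℝ, E) ∞ (fun y => B.rM hH (ΦY y) η) y :=
        ContMDiffAt.comp (g := fun u : H => B.rM hH u η) y (B.contMDiffAt_rM hH (hr y) η) (hΦY y)
      exact (ContMDiffAt.comp (g := fun w : E => (B.bf ξ).toContinuousLinearMap w) y
        (ContinuousLinearMap.contMDiff _ _) h1).neg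
    exact h ξ η

/-- The cross-section theorem. -/
theorem InvariantInnerProduct.IsHamiltonian.exists_crossSection [T2Space G] {g : G}
    {U : TopologicalSpace.Opens H} (hU : IsSlice E E' g U) {P : BivectorField F M}
    (hP : B.IsHamiltonian P Φ) (hH : IsLieSubgroup E E' H) :
    ∃ (n : ℕ) (_ : ChartedSpace (EuclideanSpace ℝ (Fin n)) (crossSection Φ U))
      (_ : MulAction H (crossSection Φ U))
      (PY : BivectorField (EuclideanSpace ℝ (Fin n)) (crossSection Φ U))
      (Pperp : crossSection Φ U → LinearMap.BilinForm ℝ (GroupLieAlgebra 𝓘(ℝ, E) G))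
      (ΦY : crossSection Φ U → H),
      Manifold.IsSmoothEmbedding 𝓘(ℝ, EuclideanSpace ℝ (Fin n)) 𝓘(ℝ, F) ∞
        (Subtype.val : crossSection Φ U → M) ∧
      (∀ (h : H) (y : crossSection Φ U), ((h • y : crossSection Φ U) : M) = (h : G) • (y : M)) ∧
      (∀ y : crossSection Φ U, (ΦY y : G) = Φ y) ∧
      InvariantInnerProduct.IsPerpSection E' H (EuclideanSpace ℝ (Fin n)) Pperp ∧
      B.SplitsAlong P (Subtype.val : crossSection Φ U → M) PY Pperp ∧
      (∀ y, Pperp y = -B.rMatrix hH (ΦY y)) ∧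
      (B.restrict hH).IsHamiltonian PY ΦY := by
  have := hP.isManifold
  have := hP.t2
  have := hP.secondCountable
  have := hP.smooth_action
  have := hH.lieGroup
  have hmH : IsManifold 𝓘(ℝ, E') ∞ H := hH.lieGroup.toIsManifold
  have hmG : IsManifold 𝓘(ℝ, E) ∞ G := ‹LieGroup 𝓘(ℝ, E) ∞ G›.toIsManifold
  have hv : ContMDiff 𝓘(ℝ, E') 𝓘(ℝ, E) ∞ (Subtype.val : H → G) := hH.embedding.contMDiff
  obtain ⟨d, σ, S, τ, hdim, hσ⟩ := exists_isTransversal B hH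
  rw [← finrank_euclideanSpace_fin (𝕜 := ℝ) (n := d)] at hdim
  obtain ⟨n, cs, hn, hM, hemb, hinj⟩ :=
    hU.exists_chartedSpace_crossSection hP.smooth_moment hP.equivariant hσ hdim
  have hmem : ∀ y : crossSection Φ U, ∃ h : Φ y ∈ H, (⟨Φ y, h⟩ : H) ∈ U := fun y => by
    obtain ⟨u, hu, huy⟩ := y.2
    rw [← huy]
    exact ⟨u.2, hu⟩
  choose hmem hmemU using hmem
  have hinv : ∀ (h : H) (y : crossSection Φ U), (h : G) • (y : M) ∈ crossSection Φ U := fun h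
      y => by
    refine ⟨h * ⟨Φ y, hmem y⟩ * h⁻¹, hU.invariant h _ (hmemU y), ?_⟩
    rw [hP.equivariant]
    rfl
  let act : MulAction H (crossSection Φ U) :=
    { smul := fun h y => ⟨(h : G) • (y : M), hinv h y⟩
      one_smul := fun y => Subtype.ext (one_smul G (y : M))
      mul_smul := fun h k y => Subtype.ext (mul_smul (h : G) (k : G) (y : M)) }
  let ΦY : crossSection Φ U → H := fun y => ⟨Φ y, hmem y⟩
  have hval : ContMDiff 𝓘(ℝ, EuclideanSpace ℝ (Fin n)) 𝓘(ℝ, F) ∞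
      (Subtype.val : crossSection Φ U → M) := hemb.contMDiff
  have hΦY : ContMDiff 𝓘(ℝ, EuclideanSpace ℝ (Fin n)) 𝓘(ℝ, E') ∞ ΦY :=
    contMDiff_of_comp_isSmoothEmbedding hH.embedding (hP.smooth_moment.comp hval)
  have hact : ContMDiffSMul 𝓘(ℝ, E') 𝓘(ℝ, EuclideanSpace ℝ (Fin n)) ∞ H (crossSection Φ U) :=
    ⟨contMDiff_of_comp_isSmoothEmbedding hemb
      ((hv.comp contMDiff_fst).smul (hval.comp contMDiff_snd))⟩
  have hc : IsCross B hH F (EuclideanSpace ℝ (Fin n)) (Subtype.val : crossSection Φ U → M) Φ ΦY :=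
    { smooth_incl := hval
      smul := fun _ _ => rfl
      coe_moment := fun _ => rfl
      regular := fun y => hU.regular B hH (hmemU y)
      smooth_moment := hP.smooth_moment
      smooth_moment' := hΦY
      equivariant := hP.equivariant }
  have hΘ := fun y => hc.isLocalDiffeomorphAt hσ
    (by rw [finrank_euclideanSpace_fin (n := n)]; exact hn y) (hinj y)
  obtain ⟨Q, hs⟩ := hc.exists_splitting (fun f hf m β => hP.moment_plain hf m β) hσ hΘ
  refine ⟨n, cs, act, Q, fun y => -B.rMatrix hH (ΦY y), ΦY, hemb, fun _ _ => rfl, fun _ => rfl,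
    isPerpSection_rMatrix hΦY hc.regular, hs, fun _ => rfl, ?_⟩
  exact hc.isHamiltonian_restrict hP hσ hΘ hs fun h y => Subtype.ext (hP.equivariant h y)

end CrossSectionTheorem

/-! ### Topology of the associated bundle -/

namespace AssocBundle

section Topology

variable {G : Type*} [Group G] {H : Subgroup G} {Y : Type*} [MulAction H Y]

theorem mk_eq_mk {p q : G × Y} :
    (mk p : AssocBundle H Y) = mk q ↔ ∃ h : H, q = (p.1 * (h : G)⁻¹, h • p.2) := Quotient.eq

theorem mk_mul_smul (a : G) (h : H) (y : Y) :
    (mk (a * (h : G), y) : AssocBundle H Y) = mk (a, h • y) :=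
  mk_eq_mk.2 ⟨h, by simp⟩

theorem mk_surjective : Function.Surjective (mk : G × Y → AssocBundle H Y) := Quotient.mk_surjective

theorem smul_mk (k : G) (p : G × Y) : k • (mk p : AssocBundle H Y) = mk (k * p.1, p.2) := rfl

variable [TopologicalSpace G] [IsTopologicalGroup G] [TopologicalSpace Y] [ContinuousSMul H Y]

/-- The saturation of an open set is the union of its translates under `H`. -/
theorem isOpenQuotientMap_mk : IsOpenQuotientMap (mk : G × Y → AssocBundle H Y) := by
  have hq : Topology.IsQuotientMap (mk : G × Y → AssocBundle H Y) := isQuotientMap_quot_mk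
  refine ⟨mk_surjective, hq.continuous, fun O hO => hq.isOpen_preimage.1 ?_⟩
  have h1 : (mk : G × Y → AssocBundle H Y) ⁻¹' (mk '' O) =
      ⋃ h : H, (fun p : G × Y => (p.1 * (h : G)⁻¹, h • p.2)) ⁻¹' O := by
    ext p
    simp only [mem_preimage, mem_image, mem_iUnion]
    constructor
    · rintro ⟨q, hq, hqp⟩
      obtain ⟨h, rfl⟩ := mk_eq_mk.1 hqp.symm
      exact ⟨h, hq⟩
    · rintro ⟨h, hh⟩
      exact ⟨_, hh, (mk_eq_mk.2 ⟨h, rfl⟩).symm⟩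
  rw [h1]
  exact isOpen_iUnion fun h => hO.preimage (by fun_prop)

/-- The quotient map is open, so it suffices that the relation is closed. For closed `H` the
condition `q.1⁻¹ p.1 ∈ H` is closed, and on this set `h = q.1⁻¹ p.1` is continuous, which makes `h •
p.2 = q.2` a closed condition. -/
theorem t2Space [T2Space Y] (hH : IsClosed (H : Set G)) : T2Space (AssocBundle H Y) := by
  rw [t2Space_iff_of_isOpenQuotientMap (isOpenQuotientMap_mk (G := G) (H := H) (Y := Y))]
  let C : Set ((G × Y) × (G × Y)) := {q | q.2.1⁻¹ * q.1.1 ∈ H}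
  have hC : IsClosed C := hH.preimage (f := fun q : (G × Y) × (G × Y) => q.2.1⁻¹ * q.1.1)
    (by fun_prop)
  let h : C → H := fun q => ⟨_, q.2⟩
  have hh : Continuous h := Continuous.subtype_mk (by fun_prop) _
  have hcl : IsClosed {q : C | h q • (q : (G × Y) × (G × Y)).1.2 = (q : (G × Y) × (G × Y)).2.2} :=
    isClosed_eq (hh.smul (by fun_prop)) (by fun_prop)
  have := hC.isClosedEmbedding_subtypeVal.isClosedMap _ hcl
  convert this
  ext ⟨p, q⟩
  simp only [mem_ofPred_eq, mem_image, Subtype.exists]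
  constructor
  · intro hpq
    obtain ⟨x, rfl⟩ := mk_eq_mk.1 hpq
    have hx : (p.1 * (x : G)⁻¹)⁻¹ * p.1 = x := by simp
    refine ⟨(p, (p.1 * (x : G)⁻¹, x • p.2)), ?_, ?_, rfl⟩
    · change (p.1 * (x : G)⁻¹)⁻¹ * p.1 ∈ H
      rw [hx]
      exact x.2
    · exact congrArg (· • p.2) (Subtype.ext hx : h ⟨_, _⟩ = x)
  · rintro ⟨z, hz, hzh, rfl⟩
    refine mk_eq_mk.2 ⟨h ⟨_, hz⟩, ?_⟩
    refine Prod.ext ?_ hzh.symm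
    change q.1 = p.1 * (q.1⁻¹ * p.1)⁻¹
    simp

theorem secondCountableTopology [SecondCountableTopology G] [SecondCountableTopology Y] :
    SecondCountableTopology (AssocBundle H Y) :=
  isOpenQuotientMap_mk.isQuotientMap.secondCountableTopology isOpenQuotientMap_mk.isOpenMap

end Topology

/-! ### Local trivializations and smooth structure of the associated bundle -/

section Charts

variable {E : Type*} [NormedAddCommGroup E] [NormedSpace ℝ E] [FiniteDimensional ℝ E]
  {G : Type*} [TopologicalSpace G] [ChartedSpace E G] [Group G] [LieGroup 𝓘(ℝ, E) ∞ G]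
  {E' : Type*} [NormedAddCommGroup E'] [NormedSpace ℝ E'] [FiniteDimensional ℝ E']
  {H : Subgroup G} [ChartedSpace E' H]
  {F : Type*} [NormedAddCommGroup F] [NormedSpace ℝ F] [FiniteDimensional ℝ F]
  {Y : Type*} [TopologicalSpace Y] [ChartedSpace F Y] [MulAction H Y]
  {V : Type*} [NormedAddCommGroup V] [NormedSpace ℝ V] [FiniteDimensional ℝ V]
  {B : InvariantInnerProduct E G} {hH : IsLieSubgroup E E' H}
  {σ : V → G} {S : Set V}
  {τ : PartialDiffeomorph (𝓘(ℝ, V).prod 𝓘(ℝ, E')) 𝓘(ℝ, E) (V × H) G ∞}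

/-- Right multiplication by `H` acts only on the second of the product coordinates `a = σ(v) h'`,
and it preserves their domain because `τ.source = S × H`. -/
theorem symm_mul (hσ : IsTransversal B hH σ S τ) {a : G} (ha : a ∈ τ.target) (h : H) :
    a * (h : G) ∈ τ.target ∧ τ.symm (a * (h : G)) = ((τ.symm a).1, (τ.symm a).2 * h) := by
  have h1 : τ.symm a ∈ τ.source := τ.map_target ha
  have h2 : τ (τ.symm a) = a := τ.right_inv ha
  have h3 : ((τ.symm a).1, (τ.symm a).2 * h) ∈ τ.source := by
    rw [hσ.source] at h1 ⊢
    exact ⟨h1.1, trivial⟩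
  have h4 : τ ((τ.symm a).1, (τ.symm a).2 * h) = a * (h : G) := by
    rw [hσ.apply] at h2 ⊢
    conv_rhs => rw [← h2]
    simp [mul_assoc]
  rw [← h4]
  exact ⟨τ.map_source h3, τ.left_inv h3⟩

theorem coe_mem_target (hσ : IsTransversal B hH σ S τ) (h : H) : (h : G) ∈ τ.target := by
  have h1 : ((0 : V), h) ∈ τ.source := by rw [hσ.source]; exact ⟨hσ.zero_mem, trivial⟩
  have h2 := τ.map_source h1
  have h3 : τ ((0 : V), h) = h := by rw [hσ.apply, hσ.map_zero, one_mul]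
  exact h3 ▸ h2

theorem contMDiffOn_chart (k : G) [ContMDiffSMul 𝓘(ℝ, E') 𝓘(ℝ, F) ∞ H Y] :
    ContMDiffOn (𝓘(ℝ, E).prod 𝓘(ℝ, F)) (𝓘(ℝ, V).prod 𝓘(ℝ, F)) ∞
      (fun p : G × Y => ((τ.symm (k * p.1)).1, (τ.symm (k * p.1)).2 • p.2))
      {p | k * p.1 ∈ τ.target} := by
  have h1 : ContMDiffOn (𝓘(ℝ, E).prod 𝓘(ℝ, F)) (𝓘(ℝ, V).prod 𝓘(ℝ, E')) ∞
      (fun p : G × Y => τ.symm (k * p.1)) {p | k * p.1 ∈ τ.target} :=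
    τ.contMDiffOn_invFun.comp ((contMDiff_mulLeft k).comp contMDiff_fst).contMDiffOn fun p hp => hp
  exact (contMDiff_fst.comp_contMDiffOn h1).prodMk
    ((contMDiff_snd.comp_contMDiffOn h1).smul contMDiffOn_snd)

/-- Local trivializations of the associated bundle. -/
theorem exists_chart (hσ : IsTransversal B hH σ S τ) [ContMDiffSMul 𝓘(ℝ, E') 𝓘(ℝ, F) ∞ H Y]
    (k : G) :
    ∃ e : OpenPartialHomeomorph (AssocBundle H Y) (V × Y),
      (∀ p : G × Y, mk p ∈ e.source ↔ k⁻¹ * p.1 ∈ τ.target) ∧ e.target = S ×ˢ univ ∧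
      (∀ p : G × Y, k⁻¹ * p.1 ∈ τ.target →
        e (mk p) = ((τ.symm (k⁻¹ * p.1)).1, (τ.symm (k⁻¹ * p.1)).2 • p.2)) ∧
      ∀ q, e.symm q = mk (k * σ q.1, q.2) := by
  have : IsTopologicalGroup G := topologicalGroup_of_lieGroup 𝓘(ℝ, E) ∞
  have : ContinuousSMul H Y :=
    ⟨(ContMDiffSMul.contMDiff_smul (I := 𝓘(ℝ, E')) (I' := 𝓘(ℝ, F)) (n := ∞)).continuous⟩
  have hmk := isOpenQuotientMap_mk (G := G) (H := H) (Y := Y)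
  -- With `k⁻¹ a = σ(v) h` one has `[a, y] = [k σ(v), h • y]`, so `(v, h • y)` depends only on the
  -- class; this is the trivialization near the fibre of `k`.
  let f : G × Y → V × Y := fun p => ((τ.symm (k⁻¹ * p.1)).1, (τ.symm (k⁻¹ * p.1)).2 • p.2)
  let T : Set (G × Y) := {p | k⁻¹ * p.1 ∈ τ.target}
  have hT : IsOpen T := τ.open_target.preimage (by fun_prop)
  have hTf : ∀ p ∈ T, ∀ q, (mk p : AssocBundle H Y) = mk q → q ∈ T ∧ f q = f p := by
    rintro p hp q hpq
    obtain ⟨h, rfl⟩ := mk_eq_mk.1 hpq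
    obtain ⟨h1, h2⟩ := symm_mul hσ hp h⁻¹
    have e1 : k⁻¹ * (p.1 * (h : G)⁻¹) = k⁻¹ * p.1 * ((h⁻¹ : H) : G) := by
      simp [mul_assoc]
    refine ⟨?_, ?_⟩
    · change k⁻¹ * (p.1 * (h : G)⁻¹) ∈ τ.target
      rw [e1]
      exact h1
    · simp only [f, e1]
      rw [h2]
      simp [mul_smul]
  let g : AssocBundle H Y → V × Y := fun x => f x.out
  have hout : ∀ p : G × Y, (mk p : AssocBundle H Y) = mk (mk p : AssocBundle H Y).out := fun p =>
    (Quotient.out_eq (mk p : AssocBundle H Y)).symm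
  have hg : ∀ p ∈ T, g (mk p) = f p := fun p hp => (hTf p hp _ (hout p)).2
  have hsrc : ∀ p, (mk p : AssocBundle H Y) ∈ mk '' T ↔ p ∈ T :=
    fun p => ⟨fun ⟨q, hq, hqp⟩ => (hTf q hq p hqp).1, fun hp => ⟨p, hp, rfl⟩⟩
  have hkσ : ∀ q : V × Y, q.1 ∈ S → (k * σ q.1, q.2) ∈ T ∧ f (k * σ q.1, q.2) = q := by
    rintro ⟨v, y⟩ hv
    have h1 : (v, (1 : H)) ∈ τ.source := by rw [hσ.source]; exact ⟨hv, trivial⟩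
    have h2 : τ (v, 1) = σ v := by rw [hσ.apply]; simp
    have h3 : τ.symm (σ v) = (v, 1) := by rw [← h2]; exact τ.left_inv h1
    refine ⟨?_, ?_⟩
    · change k⁻¹ * (k * σ v) ∈ τ.target
      rw [inv_mul_cancel_left, ← h2]
      exact τ.map_source h1
    · simp only [f, inv_mul_cancel_left]
      rw [h3, one_smul]
  have hleft : ∀ p ∈ T, (f p).1 ∈ S ∧ (mk (k * σ (f p).1, (f p).2) : AssocBundle H Y) = mk p := by
    intro p hp
    have h1 : τ.symm (k⁻¹ * p.1) ∈ τ.source := τ.map_target hp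
    have h2 : τ (τ.symm (k⁻¹ * p.1)) = k⁻¹ * p.1 := τ.right_inv hp
    rw [hσ.apply] at h2
    rw [hσ.source] at h1
    refine ⟨h1.1, ?_⟩
    rw [← mk_mul_smul]
    congr 1
    refine Prod.ext ?_ rfl
    change k * σ (τ.symm (k⁻¹ * p.1)).1 * ((τ.symm (k⁻¹ * p.1)).2 : G) = p.1
    rw [mul_assoc, h2, mul_inv_cancel_left]
  let e : OpenPartialHomeomorph (AssocBundle H Y) (V × Y) :=
    { toFun := g
      invFun := fun q => mk (k * σ q.1, q.2)
      source := mk '' T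
      target := S ×ˢ univ
      map_source' := by
        rintro _ ⟨p, hp, rfl⟩
        rw [hg p hp]
        exact ⟨(hleft p hp).1, trivial⟩
      map_target' := fun q hq => (hsrc _).2 (hkσ q hq.1).1
      left_inv' := by
        rintro _ ⟨p, hp, rfl⟩
        rw [hg p hp]
        exact (hleft p hp).2
      right_inv' := fun q hq => by
        rw [hg _ (hkσ q hq.1).1]
        exact (hkσ q hq.1).2
      open_source := hmk.isOpenMap T hT
      open_target := hσ.isOpen.prod isOpen_univ
      continuousOn_toFun := by
        rw [hmk.isQuotientMap.continuousOn_isOpen_iff (hmk.isOpenMap T hT)]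
        have h1 : ContinuousOn f T := (contMDiffOn_chart (E := E) (F := F) (τ := τ)
            k⁻¹).continuousOn
        refine (h1.mono fun p hp => (hsrc p).1 hp).congr fun p hp => hg p ((hsrc p).1 hp)
      continuousOn_invFun := hmk.continuous.comp_continuousOn
        ((continuousOn_const.mul (hσ.smooth.continuousOn.comp continuousOn_fst
          fun q hq => hq.1)).prodMk continuousOn_snd) }
  exact ⟨e, hsrc, rfl, hg, fun _ => rfl⟩

/-- Compose with a local section of the submersion. -/
theorem contMDiffAt_of_comp_isSubmersionAt
    {E₁ : Type*} [NormedAddCommGroup E₁] [NormedSpace ℝ E₁]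
    {H₁ : Type*} [TopologicalSpace H₁] {I₁ : ModelWithCorners ℝ E₁ H₁} [I₁.Boundaryless]
    {M₁ : Type*} [TopologicalSpace M₁] [ChartedSpace H₁ M₁] [IsManifold I₁ ∞ M₁]
    {E₂ : Type*} [NormedAddCommGroup E₂] [NormedSpace ℝ E₂]
    {H₂ : Type*} [TopologicalSpace H₂] {I₂ : ModelWithCorners ℝ E₂ H₂} [I₂.Boundaryless]
    {M₂ : Type*} [TopologicalSpace M₂] [ChartedSpace H₂ M₂] [IsManifold I₂ ∞ M₂]
    {E₃ : Type*} [NormedAddCommGroup E₃] [NormedSpace ℝ E₃]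
    {H₃ : Type*} [TopologicalSpace H₃] {I₃ : ModelWithCorners ℝ E₃ H₃}
    {M₃ : Type*} [TopologicalSpace M₃] [ChartedSpace H₃ M₃]
    {f : M₁ → M₂} {x : M₁} (hf : Manifold.IsSubmersionAt I₁ I₂ ∞ f x) {g : M₂ → M₃}
    (hg : ContMDiffAt I₁ I₃ ∞ (fun y => g (f y)) x) : ContMDiffAt I₂ I₃ ∞ g (f x) := by
  obtain ⟨s, hs, hsx, hfs⟩ := exists_section_of_isSubmersionAt hf
  have h1 : ContMDiffAt I₂ I₃ ∞ (fun z => g (f (s z))) (f x) :=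
    ContMDiffAt.comp_of_eq (g := fun y => g (f y)) hg hs hsx
  refine h1.congr_of_eventuallyEq ?_
  filter_upwards [hfs] with z hz
  rw [hz]

/-- The associated bundle is a manifold. -/
theorem exists_isQuotientManifold (hσ : IsTransversal B hH σ S τ) [IsManifold 𝓘(ℝ, F) ∞ Y]
    [ContMDiffSMul 𝓘(ℝ, E') 𝓘(ℝ, F) ∞ H Y] :
    ∃ (n : ℕ) (_ : ChartedSpace (EuclideanSpace ℝ (Fin n)) (AssocBundle H Y)),
      IsQuotientManifold (H := H) (Y := Y) E F (EuclideanSpace ℝ (Fin n)) := by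
  have := hH.lieGroup
  have hmH : IsManifold 𝓘(ℝ, E') ∞ H := hH.lieGroup.toIsManifold
  have hmG : IsManifold 𝓘(ℝ, E) ∞ G := ‹LieGroup 𝓘(ℝ, E) ∞ G›.toIsManifold
  have hv : ContMDiff 𝓘(ℝ, E') 𝓘(ℝ, E) ∞ (Subtype.val : H → G) := hH.embedding.contMDiff
  have hinvH : ContMDiff 𝓘(ℝ, E') 𝓘(ℝ, E') ∞ (fun k : H => k⁻¹) := contMDiff_inv 𝓘(ℝ, E') ∞
  choose c hcs hct hcf hcg using fun k : G => exists_chart (F := F) (Y := Y) hσ k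
  let n := Module.finrank ℝ (V × F)
  let L : (V × F) ≃L[ℝ] EuclideanSpace ℝ (Fin n) :=
    ContinuousLinearEquiv.ofFinrankEq finrank_euclideanSpace_fin.symm
  -- The trivialization is translated to the group component of a representative, where it is
  -- defined because `1 ∈ τ.target`.
  let e : AssocBundle H Y → OpenPartialHomeomorph (AssocBundle H Y) (V × Y) := fun x => c x.out.1
  have hmem : ∀ x, x ∈ (e x).source := fun x => by
    have h1 : (mk x.out : AssocBundle H Y) = x := Quotient.out_eq x
    have h2 := (hcs x.out.1 x.out).2 (by
      rw [inv_mul_cancel]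
      exact coe_mem_target hσ 1)
    rwa [h1] at h2
  have hσk : ∀ k : G, ContMDiffOn (𝓘(ℝ, V).prod 𝓘(ℝ, F)) (𝓘(ℝ, E).prod 𝓘(ℝ, F)) ∞
      (fun q : V × Y => (k * σ q.1, q.2)) (S ×ˢ univ) := fun k =>
    ((contMDiff_mulLeft k).comp_contMDiffOn (hσ.smooth.comp contMDiffOn_fst
      fun q hq => hq.1)).prodMk contMDiffOn_snd
  obtain ⟨cs, hM, he, he'⟩ := exists_manifold_of_transitions (I₁ := 𝓘(ℝ, V).prod 𝓘(ℝ, F)) e hmem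
    (fun x x' => by
      have h1 : ∀ q ∈ (e x).target ∩ (e x).symm ⁻¹' (e x').source, q ∈ S ×ˢ (univ : Set Y) ∧
          x'.out.1⁻¹ * (x.out.1 * σ q.1) ∈ τ.target := fun q hq => by
        have h2 := hq.1
        rw [hct] at h2
        refine ⟨h2, ?_⟩
        have h3 := hq.2
        rw [mem_preimage, hcg] at h3
        exact (hcs _ _).1 h3
      refine ((contMDiffOn_chart (E := E) (F := F) (τ := τ) x'.out.1⁻¹).comp
        ((hσk x.out.1).mono fun q hq => (h1 q hq).1) fun q hq => (h1 q hq).2).congr fun q hq => ?_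
      rw [hcg, hcf _ _ (h1 q hq).2]
      rfl) L
  refine ⟨n, cs, hM, Manifold.IsSubmersionOfComplement.isSubmersion (F := E') fun p₀ => ?_⟩
  set k := (mk p₀ : AssocBundle H Y).out.1 with hk
  have hek : e (mk p₀) = c k := rfl
  have hc : ContMDiffOn 𝓘(ℝ, EuclideanSpace ℝ (Fin n)) (𝓘(ℝ, V).prod 𝓘(ℝ, F)) ∞ (c k)
    (c k).source := he (mk p₀)
  have hc' : ContMDiffOn (𝓘(ℝ, V).prod 𝓘(ℝ, F)) 𝓘(ℝ, EuclideanSpace ℝ (Fin n)) ∞ (c k).symm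
    (c k).target := he' (mk p₀)
  have hp₀ : k⁻¹ * p₀.1 ∈ τ.target := (hcs k p₀).1 (hmem (mk p₀))
  have hτ : ContMDiffOn (𝓘(ℝ, E).prod 𝓘(ℝ, F)) (𝓘(ℝ, V).prod 𝓘(ℝ, E')) ∞
      (fun p : G × Y => τ.symm (k⁻¹ * p.1)) {p | k⁻¹ * p.1 ∈ τ.target} :=
    τ.contMDiffOn_invFun.comp ((contMDiff_mulLeft k⁻¹).comp contMDiff_fst).contMDiffOn
      fun p hp => hp
  let W := EuclideanSpace ℝ (Fin n)
  have hτS : ∀ p : G × Y, k⁻¹ * p.1 ∈ τ.target → (τ.symm (k⁻¹ * p.1)).1 ∈ S := fun p hp => by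
    have h1 : τ.symm (k⁻¹ * p.1) ∈ τ.source := τ.map_target hp
    rw [hσ.source] at h1
    exact h1.1
  have hτr : ∀ p : G × Y, k⁻¹ * p.1 ∈ τ.target →
      k * (σ (τ.symm (k⁻¹ * p.1)).1 * ((τ.symm (k⁻¹ * p.1)).2 : G)) = p.1 := fun p hp => by
    have h1 : τ (τ.symm (k⁻¹ * p.1)) = k⁻¹ * p.1 := τ.right_inv hp
    rw [hσ.apply] at h1
    rw [h1, mul_inv_cancel_left]
  have hτl : ∀ (v : V) (h : H), v ∈ S → σ v * (h : G) ∈ τ.target ∧ τ.symm (σ v * (h : G)) =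
      (v, h) :=
    fun v h hv => by
      have h1 : (v, h) ∈ τ.source := by rw [hσ.source]; exact ⟨hv, trivial⟩
      have h2 : τ (v, h) = σ v * (h : G) := hσ.apply _
      rw [← h2]
      exact ⟨τ.map_source h1, τ.left_inv h1⟩
  have hcS : ∀ x ∈ (c k).source, (c k x).1 ∈ S := fun x hx => by
    have := (c k).map_source hx
    rw [hct] at this
    exact this.1
  have hmkc : ∀ p : G × Y, k⁻¹ * p.1 ∈ τ.target → (mk p : AssocBundle H Y) = (c k).symm
      ((τ.symm (k⁻¹ * p.1)).1, (τ.symm (k⁻¹ * p.1)).2 • p.2) := fun p hp => by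
    rw [← hcf k p hp, (c k).left_inv ((hcs k p).2 hp)]
  -- Locally `G × Y` is the product of the bundle with `H`: the second component of `D` is the
  -- `H`-coordinate of `k⁻¹ p.1`. This exhibits `mk` as a projection with complement `E'`.
  let D : PartialDiffeomorph (𝓘(ℝ, E).prod 𝓘(ℝ, F)) (𝓘(ℝ, W).prod 𝓘(ℝ, E')) (G × Y)
      (AssocBundle H Y × H) ∞ :=
    { toFun := fun p => (mk p, (τ.symm (k⁻¹ * p.1)).2)
      invFun := fun q => (k * (σ (c k q.1).1 * (q.2 : G)), q.2⁻¹ • (c k q.1).2)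
      source := {p | k⁻¹ * p.1 ∈ τ.target}
      target := (c k).source ×ˢ univ
      map_source' := fun p hp => ⟨(hcs k p).2 hp, trivial⟩
      map_target' := fun q hq => by
        change k⁻¹ * (k * (σ (c k q.1).1 * (q.2 : G))) ∈ τ.target
        rw [inv_mul_cancel_left]
        exact (hτl _ _ (hcS _ hq.1)).1
      left_inv' := fun p hp => by
        simp only
        rw [hcf k p hp]
        refine Prod.ext (hτr p hp) ?_
        simp
      right_inv' := fun q hq => by
        have h1 := hτl (c k q.1).1 q.2 (hcS _ hq.1)
        simp only [inv_mul_cancel_left]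
        rw [h1.2]
        refine Prod.ext ?_ rfl
        change (mk (k * (σ (c k q.1).1 * (q.2 : G)), q.2⁻¹ • (c k q.1).2) : AssocBundle H Y) = q.1
        rw [← mul_assoc, mk_mul_smul, smul_inv_smul, ← hcg k (c k q.1), (c k).left_inv hq.1]
      open_source := τ.open_target.preimage
        (((contMDiff_mulLeft (E := E) k⁻¹).continuous).comp continuous_fst)
      open_target := (c k).open_source.prod isOpen_univ
      contMDiffOn_toFun := by
        refine ContMDiffOn.prodMk ?_ (contMDiff_snd.comp_contMDiffOn hτ)
        refine (hc'.comp (contMDiffOn_chart (E := E) (F := F) (τ := τ) k⁻¹) fun p hp => ?_).congr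
          hmkc
        rw [hct]
        exact ⟨hτS p hp, trivial⟩
      contMDiffOn_invFun := by
        have h1 : ContMDiffOn (𝓘(ℝ, W).prod 𝓘(ℝ, E')) (𝓘(ℝ, V).prod 𝓘(ℝ, F)) ∞
            (fun q : AssocBundle H Y × H => c k q.1) ((c k).source ×ˢ univ) :=
          hc.comp contMDiffOn_fst fun q hq => hq.1
        have h2 : ContMDiffOn (𝓘(ℝ, W).prod 𝓘(ℝ, E')) 𝓘(ℝ, E) ∞
            (fun q : AssocBundle H Y × H => σ (c k q.1).1) ((c k).source ×ˢ univ) :=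
          hσ.smooth.comp (contMDiff_fst.comp_contMDiffOn h1) fun q hq => hcS _ hq.1
        refine ContMDiffOn.prodMk ((contMDiff_mulLeft k).comp_contMDiffOn
          (h2.mul (hv.comp contMDiff_snd).contMDiffOn)) ?_
        exact ContMDiffOn.smul (hinvH.comp contMDiff_snd).contMDiffOn
          (contMDiff_snd.comp_contMDiffOn h1) }
  exact isSubmersionAtOfComplement_of_isLocalDiffeomorphAt (D := D) ⟨D, hp₀, fun _ _ => rfl⟩
    (Eventually.of_forall fun _ => rfl)

end Charts

end AssocBundle

/-! ### Invariance of the bracket and of the Cartan tensor -/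

section AdInvariance

variable {E : Type*} [NormedAddCommGroup E] [NormedSpace ℝ E] [FiniteDimensional ℝ E]
  {G : Type*} [TopologicalSpace G] [ChartedSpace E G] [Group G] [LieGroup 𝓘(ℝ, E) ∞ G]

theorem md_clm_apply {W : Type*} [NormedAddCommGroup W] [NormedSpace ℝ W] {A : G → W →L[ℝ] ℝ}
    {c : G → W} {k : G} (hA : MDifferentiableAt 𝓘(ℝ, E) 𝓘(ℝ, W →L[ℝ] ℝ) A k)
    (hc : MDifferentiableAt 𝓘(ℝ, E) 𝓘(ℝ, W) c k) (v : E) :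
    dR E (fun k => A k (c k)) k v =
      md 𝓘(ℝ, E) 𝓘(ℝ, W →L[ℝ] ℝ) A k v (c k) + A k (md 𝓘(ℝ, E) 𝓘(ℝ, W) c k v) := by
  have hb : ∀ p : (W →L[ℝ] ℝ) × W, HasFDerivAt (fun q : (W →L[ℝ] ℝ) × W => q.1 q.2)
      ((isBoundedBilinearMap_apply (𝕜 := ℝ) (E := W) (F := ℝ)).deriv p) p := fun p =>
    isBoundedBilinearMap_apply.hasFDerivAt p
  have hp : MDifferentiableAt 𝓘(ℝ, E) 𝓘(ℝ, (W →L[ℝ] ℝ) × W) (fun k => (A k, c k)) k :=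
    hA.prodMk_space hc
  have h := md_comp (I₃ := 𝓘(ℝ, ℝ)) (g := fun q : (W →L[ℝ] ℝ) × W => q.1 q.2)
    (hb _).differentiableAt.mdifferentiableAt hp
  have h1 := md_comp (I₃ := 𝓘(ℝ, W →L[ℝ] ℝ)) (g := (Prod.fst : (W →L[ℝ] ℝ) × W → W →L[ℝ] ℝ))
    (differentiableAt_fst (𝕜 := ℝ)).mdifferentiableAt hp
  have h2 := md_comp (I₃ := 𝓘(ℝ, W)) (g := (Prod.snd : (W →L[ℝ] ℝ) × W → W))
    (differentiableAt_snd (𝕜 := ℝ)).mdifferentiableAt hp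
  rw [md_eq_fderiv, fderiv_fst] at h1
  rw [md_eq_fderiv, fderiv_snd] at h2
  rw [md_eq_fderiv, (hb _).fderiv] at h
  have e1 := DFunLike.congr_fun h1 v
  have e2 := DFunLike.congr_fun h2 v
  refine (DFunLike.congr_fun h v).trans ?_
  rw [ContinuousLinearMap.comp_apply, IsBoundedBilinearMap.deriv_apply, add_comm]
  exact congrArg₂ (fun (a : W →L[ℝ] ℝ) (b : W) => a (c k) + A k b) e1.symm e2.symm

/-- The derivative of the adjoint action is the Lie bracket. -/
theorem md_adMap [T2Space G] (a ξ : E) :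
    md 𝓘(ℝ, E) 𝓘(ℝ, E) (fun k : G => adMap E k ξ) 1 a = lieBr E G a ξ := by
  have := FiniteDimensional.complete ℝ E
  have hmG : IsManifold 𝓘(ℝ, E) ∞ G := ‹LieGroup 𝓘(ℝ, E) ∞ G›.toIsManifold
  have hc : ContMDiff 𝓘(ℝ, E) 𝓘(ℝ, E) ∞ (fun k : G => adMap E k ξ) :=
    contMDiff_adMap.clm_apply contMDiff_const
  by_contra hne
  obtain ⟨φ, hφ⟩ := SeparatingDual.exists_ne_zero (R := ℝ) (sub_ne_zero.2 hne)
  obtain ⟨f, hf, hfd⟩ := exists_smoothFun_md_eq (1 : G) φ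
  have hfφ : dR E f 1 = φ := hfd
  apply hφ
  rw [map_sub, ← hfφ, dR_lieBr hf]
  have hA : ContMDiff 𝓘(ℝ, E) 𝓘(ℝ, E →L[ℝ] ℝ) ∞ (fun k : G => dR E (fun x => f (x * k)) 1) := fun
      k => by
    have h1 : ContMDiff (𝓘(ℝ, E).prod 𝓘(ℝ, E)) 𝓘(ℝ, ℝ) ∞ (fun p : G × G => f (p.2 * p.1)) :=
      ContMDiff.comp (g := f) hf (contMDiff_snd.mul contMDiff_fst)
    exact contMDiffAt_md (f := fun (k x : G) => f (x * k)) (b := (1 : G)) h1.contMDiffAt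
  -- The derivative of `f` along `ξ^L` at `k` is the derivative of `x ↦ f(x k)` at `1` along `Ad_k
  -- ξ`. By the product rule in `k`, one term is a mixed derivative equal to the second term of the
  -- commutator in `dR_lieBr`; the other contains the derivative of `Ad_k ξ`.
  have h1 : (fun k : G => dR E f k (leftMap E k ξ)) =
      fun k : G => dR E (fun x => f (x * k)) 1 (adMap E k ξ) := funext fun k => by
    rw [← dR_rightMap hf, rightMap_eq, adMap_inv_apply]
  have h2 := md_clm_apply (hA.mdiff 1) (hc.mdiff 1) a
  rw [← h1, adMap_one] at h2
  have h3 : md 𝓘(ℝ, E) 𝓘(ℝ, E →L[ℝ] ℝ) (fun k : G => dR E (fun x => f (x * k)) 1) 1 a ξ =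
      dR E (fun x => dR E f x (leftMap E x a)) 1 ξ := by
    have h4 := md_clm_apply (c := fun _ : G => ξ) (hA.mdiff 1) (contMDiff_const.mdiff 1) a
    rw [md_const, zero_apply, map_zero, add_zero] at h4
    rw [← h4]
    simp only [dR_leftMap hf]
    have h5 : ContMDiff (𝓘(ℝ, E).prod 𝓘(ℝ, E)) 𝓘(ℝ, ℝ) ∞ (fun p : G × G => f (p.2 * p.1)) :=
      ContMDiff.comp (g := f) hf (contMDiff_snd.mul contMDiff_fst)
    exact md_md_comm (a := (1 : G)) (b := (1 : G)) h5.contMDiffAt a ξ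
  have h4 : dR E (fun k : G => dR E f k (leftMap E k ξ)) 1 a =
      dR E (fun x => dR E f x (leftMap E x a)) 1 ξ +
        dR E f 1 (md 𝓘(ℝ, E) 𝓘(ℝ, E) (fun k : G => adMap E k ξ) 1 a) := by
    rw [← h3]
    simp only [mul_one] at h2
    exact h2
  rw [h4]
  ring

/-- `Ad_k` is an automorphism of the Lie algebra. -/
theorem adMap_lieBr [T2Space G] (k : G) (a ξ : E) :
    adMap E k (lieBr E G a ξ) = lieBr E G (adMap E k a) (adMap E k ξ) := by
  have hc : ∀ ξ : E, ContMDiff 𝓘(ℝ, E) 𝓘(ℝ, E) ∞ (fun k : G => adMap E k ξ) := fun ξ =>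
    contMDiff_adMap.clm_apply contMDiff_const
  have h1 := md_comp (g := adMap E k) ((adMap E k).contMDiff.mdiff _) ((hc ξ).mdiff 1)
  have h2 := md_comp_of_eq (f := fun x : G => k * x * k⁻¹)
      (g := fun x : G => adMap E x (adMap E k ξ))
    (x := (1 : G)) (y := 1) ((hc _).mdiff 1) ((contMDiff_conj k).mdiff 1) (by simp)
  have h3 : (fun x : G => adMap E (k * x * k⁻¹) (adMap E k ξ)) =
      fun x : G => adMap E k (adMap E x ξ) := funext fun x => by
    rw [adMap_mul, adMap_mul, ContinuousLinearMap.comp_apply, ContinuousLinearMap.comp_apply,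
      adMap_inv_apply]
  rw [h3, h1, md_eq_fderiv, (adMap E k).fderiv] at h2
  have h4 := DFunLike.congr_fun h2 a
  rw [ContinuousLinearMap.comp_apply, ContinuousLinearMap.comp_apply, md_adMap] at h4
  exact h4.trans (md_adMap _ _)

namespace InvariantInnerProduct

/-- The derivative at `k = 1` of the invariance of the inner product under `Ad_k`. -/
theorem bf_lieBr [T2Space G] (B : InvariantInnerProduct E G) (a ξ η : E) :
    B.bf (lieBr E G a ξ) η = -B.bf ξ (lieBr E G a η) := by
  have hc : ∀ ξ : E, ContMDiff 𝓘(ℝ, E) 𝓘(ℝ, E) ∞ (fun k : G => adMap E k ξ) := fun ξ =>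
    contMDiff_adMap.clm_apply contMDiff_const
  let b : E →L[ℝ] E →L[ℝ] ℝ :=
    (LinearMap.toContinuousLinearMap.toLinearMap ∘ₗ B.bf).toContinuousLinearMap
  have hb : ∀ ξ η, b ξ η = B.bf ξ η := fun _ _ => rfl
  have hA : ContMDiff 𝓘(ℝ, E) 𝓘(ℝ, E →L[ℝ] ℝ) ∞ (fun k : G => b (adMap E k ξ)) :=
    b.contMDiff.comp (hc ξ)
  have h1 := md_clm_apply (hA.mdiff 1) ((hc η).mdiff 1) a
  have h2 : (fun k : G => b (adMap E k ξ) (adMap E k η)) = fun _ => B.bf ξ η := funext fun k => by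
    rw [hb, B.bf_adMap]
  rw [h2, md_comp (g := b) (b.contMDiff.mdiff _) ((hc ξ).mdiff 1), md_eq_fderiv, b.fderiv,
    ContinuousLinearMap.comp_apply, md_adMap, md_adMap, adMap_one, dR, md_const, hb] at h1
  have h3 : (0 : ℝ) = B.bf (lieBr E G a ξ) η + B.bf ξ (lieBr E G a η) := h1
  linarith

theorem cartan_cyclic [T2Space G] (B : InvariantInnerProduct E G) (ξ η ζ : E) :
    B.cartan ξ η ζ = B.cartan η ζ ξ := by
  have hskew : ∀ a b : E, lieBr E G a b = -lieBr E G b a := fun a b => by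
    have := FiniteDimensional.complete ℝ E
    have : LieGroup 𝓘(ℝ, E) (minSmoothness ℝ 3) G :=
      .of_le (n := ∞) (by simpa using ENat.LEInfty.out)
    exact (lie_skew (L := GroupLieAlgebra 𝓘(ℝ, E) G) a b).symm
  rw [B.cartan_eq, B.cartan_eq, ← neg_neg (B.bf η _), ← B.bf_lieBr, hskew ζ η, map_neg,
    LinearMap.neg_apply, neg_neg, B.bf_symm]

theorem cartan_adMap [T2Space G] (B : InvariantInnerProduct E G) (k : G) (ξ η ζ : E) :
    B.cartan (adMap E k ξ) (adMap E k η) (adMap E k ζ) = B.cartan ξ η ζ := by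
  rw [B.cartan_eq, B.cartan_eq, ← adMap_lieBr, B.bf_adMap]

end InvariantInnerProduct

end AdInvariance

/-! ### Propagation of the axioms from the cross-section to all orbits -/

section Induction

variable {E : Type*} [NormedAddCommGroup E] [NormedSpace ℝ E] [FiniteDimensional ℝ E]
  {G : Type*} [TopologicalSpace G] [ChartedSpace E G] [Group G] [LieGroup 𝓘(ℝ, E) ∞ G]
  {F : Type*} [NormedAddCommGroup F] [NormedSpace ℝ F] [FiniteDimensional ℝ F]
  {M : Type*} [TopologicalSpace M] [ChartedSpace F M] [MulAction G M]
  {B : InvariantInnerProduct E G} {Φ : M → G}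

/-- The operator `𝒟` is equivariant. -/
theorem InvariantInnerProduct.adMap_dop (B : InvariantInnerProduct E G) {f : G → ℝ}
    (hf : SmoothFun E f) (k u : G) :
    adMap E k (B.dop (fun x => f (k * x * k⁻¹)) u) = B.dop f (k * u * k⁻¹) := by
  refine B.eq_of_bf fun ζ => ?_
  obtain ⟨ξ, rfl⟩ : ∃ ξ, adMap E k ξ = ζ := ⟨adMap E k⁻¹ ζ, adMap_apply_inv k ζ⟩
  have hfk : SmoothFun E (fun x => f (k * x * k⁻¹)) := ContMDiff.comp (g := f) hf (contMDiff_conj k)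
  have hc : ∀ g : G → ℝ, SmoothFun E g → dR E g 1 (adMap E k ξ) =
      dR E (fun x => g (k * x * k⁻¹)) 1 ξ := fun g hg =>
    (dR_comp_apply (g := fun x : G => k * x * k⁻¹) (hg.mdiff _) ((contMDiff_conj k).mdiff 1)
      (by simp) ξ).symm
  rw [B.bf_adMap, B.bf_dop, B.bf_dop, symDeriv, symDeriv, dR_leftMap hf, dR_rightMap hf,
    dR_leftMap hfk, dR_rightMap hfk,
    hc (fun x => f (k * u * k⁻¹ * x)) (ContMDiff.comp (g := f) hf (contMDiff_mulLeft _)),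
    hc (fun x => f (x * (k * u * k⁻¹))) (ContMDiff.comp (g := f) hf (contMDiff_mulRight _))]
  simp [mul_assoc]

theorem dR_smul {f : M → ℝ} (hf : SmoothFun F f) {k : G}
    (hk : ContMDiff 𝓘(ℝ, F) 𝓘(ℝ, F) ∞ (fun x : M => k • x)) (m : M) :
    (dR F f (k • m)).comp (md 𝓘(ℝ, F) 𝓘(ℝ, F) (fun x : M => k • x) m) =
      dR F (fun x => f (k • x)) m :=
  (dR_comp (hf.mdiff _) (hk.mdiff m) rfl).symm

theorem SmoothFun.comp_smul {f : M → ℝ} (hf : SmoothFun F f) {k : G}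
    (hk : ContMDiff 𝓘(ℝ, F) 𝓘(ℝ, F) ∞ (fun x : M => k • x)) :
    SmoothFun F (fun x => f (k • x)) := ContMDiff.comp (g := f) hf hk

variable [ContMDiffSMul 𝓘(ℝ, E) 𝓘(ℝ, F) ∞ G M]

/-- The moment map condition propagates along orbits. -/
theorem BivectorField.IsInvariant.moment_smul {P : BivectorField F M} (hP : P.IsInvariant G)
    (hΦ : ContMDiff 𝓘(ℝ, F) 𝓘(ℝ, E) ∞ Φ) (heq : ∀ (k : G) (m : M), Φ (k • m) = k * Φ m * k⁻¹)
    {m : M} (hm : ∀ f : G → ℝ, SmoothFun E f → ∀ β : F →L[ℝ] ℝ,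
      P.pv m (dR F (fun x => f (Φ x)) m) β = -β (actMap E G F m (B.dop f (Φ m))))
    (k : G) {f : G → ℝ} (hf : SmoothFun E f) (β : F →L[ℝ] ℝ) :
    P.pv (k • m) (dR F (fun x => f (Φ x)) (k • m)) β =
      -β (actMap E G F (k • m) (B.dop f (Φ (k • m)))) := by
  have hfΦ : SmoothFun F (fun x => f (Φ x)) := ContMDiff.comp (g := f) hf hΦ
  have hk : ContMDiff 𝓘(ℝ, F) 𝓘(ℝ, F) ∞ (fun x : M => k • x) :=
    ContMDiffSMul.contMDiff_const_smul (I := 𝓘(ℝ, E)) k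
  rw [hP.pv_smul, dR_smul hfΦ hk]
  simp only [heq]
  rw [hm (fun x => f (k * x * k⁻¹)) (ContMDiff.comp (g := f) hf (contMDiff_conj k)),
    ContinuousLinearMap.comp_apply, md_smul_actMap, B.adMap_dop hf]

/-- The Schouten bracket of an invariant bivector field is invariant. -/
theorem BivectorField.IsInvariant.schoutenSelf_smul {P : BivectorField F M} (hP : P.IsInvariant G)
    {f₁ f₂ f₃ : M → ℝ} (h₁ : SmoothFun F f₁) (h₂ : SmoothFun F f₂) (h₃ : SmoothFun F f₃)
    {k : G} (hk : ContMDiff 𝓘(ℝ, F) 𝓘(ℝ, F) ∞ (fun x : M => k • x)) (m : M) :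
    P.schoutenSelf f₁ f₂ f₃ (k • m) = P.schoutenSelf (fun x => f₁ (k • x)) (fun x => f₂ (k • x))
      (fun x => f₃ (k • x)) m := by
  have hb : ∀ {f h : M → ℝ}, SmoothFun F f → SmoothFun F h → ∀ m, P.bracket f h (k • m) =
      P.bracket (fun x => f (k • x)) (fun x => h (k • x)) m := fun hf hh m =>
    P.bracket_smul hP hf hh hk m
  have hbb : ∀ {f h l : M → ℝ}, SmoothFun F f → SmoothFun F h → SmoothFun F l →
      P.bracket f (P.bracket h l) (k • m) = P.bracket (fun x => f (k • x))
        (P.bracket (fun x => h (k • x)) (fun x => l (k • x))) m := fun hf hh hl => by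
    rw [hb hf (P.smoothFun_bracket hh hl)]
    simp only [hb hh hl]
  simp only [schoutenSelf]
  rw [hbb h₁ h₂ h₃, hbb h₂ h₃ h₁, hbb h₃ h₁ h₂]

theorem InvariantInnerProduct.cartan_smul [T2Space G] (B : InvariantInnerProduct E G)
    {f₁ f₂ f₃ : M → ℝ} (h₁ : SmoothFun F f₁) (h₂ : SmoothFun F f₂) (h₃ : SmoothFun F f₃)
    (k : G) (m : M) :
    B.cartan (B.pl (k • m) (dR F f₁ (k • m))) (B.pl (k • m) (dR F f₂ (k • m)))
      (B.pl (k • m) (dR F f₃ (k • m))) =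
    B.cartan (B.pl m (dR F (fun x => f₁ (k • x)) m)) (B.pl m (dR F (fun x => f₂ (k • x)) m))
      (B.pl m (dR F (fun x => f₃ (k • x)) m)) := by
  have hk : ContMDiff 𝓘(ℝ, F) 𝓘(ℝ, F) ∞ (fun x : M => k • x) :=
    ContMDiffSMul.contMDiff_const_smul (I := 𝓘(ℝ, E)) k
  rw [B.pl_smul_point, B.pl_smul_point, B.pl_smul_point, B.cartan_adMap, dR_smul h₁ hk,
    dR_smul h₂ hk, dR_smul h₃ hk]

variable {E' : Type*} [NormedAddCommGroup E'] [NormedSpace ℝ E'] [FiniteDimensional ℝ E']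
  {H : Subgroup G} [ChartedSpace E' H]
  {F' : Type*} [NormedAddCommGroup F'] [NormedSpace ℝ F'] [FiniteDimensional ℝ F']
  {Y : Type*} [TopologicalSpace Y] [ChartedSpace F' Y] [MulAction H Y]
  {V : Type*} [NormedAddCommGroup V] [NormedSpace ℝ V] [FiniteDimensional ℝ V]
  {hH : IsLieSubgroup E E' H} {σ : V → G} {S : Set V}
  {τ : PartialDiffeomorph (𝓘(ℝ, V).prod 𝓘(ℝ, E')) 𝓘(ℝ, E) (V × H) G ∞}
  {i : Y → M} {ΦY : Y → H}

namespace IsCross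

/-- The moment condition has the same defect on `M` along `Y` as on `Y`, where it vanishes. -/
theorem moment_incl (hc : IsCross B hH F F' i Φ ΦY) [ContMDiffSMul 𝓘(ℝ, E') 𝓘(ℝ, F') ∞ H Y]
    {P : BivectorField F M} {Q : BivectorField F' Y}
    (hs : B.SplitsAlong P i Q (fun y => -B.rMatrix hH (ΦY y)))
    (hQ : (B.restrict hH).IsHamiltonian Q ΦY) (y : Y) {f : G → ℝ} (hf : SmoothFun E f)
    (β : F →L[ℝ] ℝ) :
    P.pv (i y) (dR F (fun x => f (Φ x)) (i y)) β =
      -β (actMap E G F (i y) (B.dop f (Φ (i y)))) := by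
  have hv : ContMDiff 𝓘(ℝ, E') 𝓘(ℝ, E) ∞ (Subtype.val : H → G) := hH.embedding.contMDiff
  have hfv : SmoothFun E' (fun x : H => f x) := ContMDiff.comp (g := f) hf hv
  have := hH.lieGroup
  have h := hc.moment_defect hs hf y β
  rw [hQ.moment_plain (f := fun x : H => f x) hfv, neg_add_cancel] at h
  exact eq_neg_of_add_eq_zero_left h

/-- If two functions agree to first order along the cross-section, then the defect in
`[P, P] = φ_M` is the same for both of them. -/
theorem schouten_defect_congr (hc : IsCross B hH F F' i Φ ΦY) [T2Space G] [T2Space M]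
    [IsManifold 𝓘(ℝ, F) ∞ M] [ContMDiffSMul 𝓘(ℝ, E') 𝓘(ℝ, F') ∞ H Y] {P : BivectorField F M}
    (hP : P.IsInvariant G)
    (hmom : ∀ f : G → ℝ, SmoothFun E f → ∀ (m : M) (β : F →L[ℝ] ℝ),
      P.pv m (dR F (fun x => f (Φ x)) m) β = -β (actMap E G F m (B.dop f (Φ m)))) {y : Y}
    (hspan : ∀ w : F, ∃ (v : F') (ξ : E), w = md 𝓘(ℝ, F') 𝓘(ℝ, F) i y v + actMap E G F (i y) ξ)
    {f g f₂ f₃ : M → ℝ} (hf : SmoothFun F f) (hg : SmoothFun F g) (h₂ : SmoothFun F f₂)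
    (h₃ : SmoothFun F f₃) (hfg : (dR F f (i y)).comp (md 𝓘(ℝ, F') 𝓘(ℝ, F) i y) =
      (dR F g (i y)).comp (md 𝓘(ℝ, F') 𝓘(ℝ, F) i y)) :
    P.schoutenSelf f f₂ f₃ (i y) - B.cartan (B.pl (i y) (dR F f (i y)))
        (B.pl (i y) (dR F f₂ (i y))) (B.pl (i y) (dR F f₃ (i y))) =
      P.schoutenSelf g f₂ f₃ (i y) - B.cartan (B.pl (i y) (dR F g (i y)))
        (B.pl (i y) (dR F f₂ (i y))) (B.pl (i y) (dR F f₃ (i y))) := by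
  -- The differential of `f - g` vanishes on the cross-section, so it is that of some `Φ^*h`. For
  -- `Φ^*h` the defect is zero by `schoutenSelf_moment`, and tensoriality transfers this to `f - g`.
  obtain ⟨h, hh, hd, -⟩ := hc.exists_dR_moment_eq hspan
    (α := dR F f (i y) - dR F g (i y)) (by rw [ContinuousLinearMap.sub_comp, hfg, sub_self])
  have hhΦ : SmoothFun F (fun x => h (Φ x)) := ContMDiff.comp (g := h) hh hc.smooth_moment
  have hfs : SmoothFun F (fun x => f x - g x) := ContMDiff.sub hf hg
  have h1 := B.schoutenSelf_moment hP hc.smooth_moment hc.equivariant hmom hh h₂ h₃ (i y)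
  rw [← P.schoutenSelf_eq_of_dR hfs hhΦ h₂ h₃ (by rw [dR_sub (hf.mdiff _) (hg.mdiff _), hd]),
    P.schoutenSelf_sub hf hg h₂ h₃, hd, sub_eq_add_neg (dR F f (i y)), ← neg_one_smul ℝ (dR F g _),
    B.pl_add, B.pl_smul, B.cartan_eq] at h1
  rw [B.cartan_eq, B.cartan_eq]
  simp only [map_add, map_smul, LinearMap.add_apply, LinearMap.smul_apply, smul_eq_mul] at h1
  linarith

/-- The condition `[P, P] = φ_M` along the cross-section. -/
theorem schouten_incl (hc : IsCross B hH F F' i Φ ΦY) [T2Space G] [T2Space M]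
    [IsManifold 𝓘(ℝ, F) ∞ M] [ContMDiffSMul 𝓘(ℝ, E') 𝓘(ℝ, F') ∞ H Y] {P : BivectorField F M}
    (hP : P.IsInvariant G)
    (hmom : ∀ f : G → ℝ, SmoothFun E f → ∀ (m : M) (β : F →L[ℝ] ℝ),
      P.pv m (dR F (fun x => f (Φ x)) m) β = -β (actMap E G F m (B.dop f (Φ m))))
    {Q : BivectorField F' Y} (hs : B.SplitsAlong P i Q (fun y => -B.rMatrix hH (ΦY y)))
    (hQ : (B.restrict hH).IsHamiltonian Q ΦY) (hσ : IsTransversal B hH σ S τ) {y : Y}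
    (hΘ : IsLocalDiffeomorphAt (𝓘(ℝ, V).prod 𝓘(ℝ, F')) 𝓘(ℝ, F) ∞
      (fun p : V × Y => σ p.1 • i p.2) (0, y))
    {f₁ f₂ f₃ : M → ℝ} (h₁ : SmoothFun F f₁) (h₂ : SmoothFun F f₂) (h₃ : SmoothFun F f₃) :
    P.schoutenSelf f₁ f₂ f₃ (i y) = B.cartan (B.pl (i y) (dR F f₁ (i y)))
      (B.pl (i y) (dR F f₂ (i y))) (B.pl (i y) (dR F f₃ (i y))) := by
  have := hH.lieGroup
  have hspan : ∀ w : F, ∃ (v : F') (ξ : E),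
      w = md 𝓘(ℝ, F') 𝓘(ℝ, F) i y v + actMap E G F (i y) ξ := fun w => by
    obtain ⟨π, -, -, h⟩ := hσ.exists_projection hc.smooth_incl hΘ
    obtain ⟨ξ, -, h⟩ := h w
    exact ⟨_, _, h⟩
  have hcomp : ∀ {f : M → ℝ}, SmoothFun F f → SmoothFun F' (fun z => f (i z)) := fun hf =>
    ContMDiff.comp (g := _) hf hc.smooth_incl
  have hd : ∀ {f : Y → ℝ} {g : M → ℝ}, SmoothFun F g → (∀ᶠ z in 𝓝 y, g (i z) = f z) →
      (dR F g (i y)).comp (md 𝓘(ℝ, F') 𝓘(ℝ, F) i y) = dR F' f y := fun hg he => by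
    rw [← dR_comp (hg.mdiff _) (hc.smooth_incl.mdiff y) rfl, dR_congr he]
  -- Each `f_a` is compared with the extension of its restriction to `Y` that is constant along the
  -- transversal; for these the identity reduces to the one on `Y`.
  obtain ⟨g₁, hg₁, e₁, p₁⟩ := hσ.exists_extension hΘ (hcomp h₁)
  obtain ⟨g₂, hg₂, e₂, p₂⟩ := hσ.exists_extension hΘ (hcomp h₂)
  obtain ⟨g₃, hg₃, e₃, p₃⟩ := hσ.exists_extension hΘ (hcomp h₃)
  have hdf : ∀ {f g : M → ℝ}, SmoothFun F f → SmoothFun F g → (∀ᶠ z in 𝓝 y, g (i z) = f (i z)) →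
      (dR F f (i y)).comp (md 𝓘(ℝ, F') 𝓘(ℝ, F) i y) =
        (dR F g (i y)).comp (md 𝓘(ℝ, F') 𝓘(ℝ, F) i y) := fun hf hg he => by
    rw [hd hg he, hd (f := fun z => _) hf (Eventually.of_forall fun _ => rfl)]
  have hg : P.schoutenSelf g₁ g₂ g₃ (i y) = B.cartan (B.pl (i y) (dR F g₁ (i y)))
      (B.pl (i y) (dR F g₂ (i y))) (B.pl (i y) (dR F g₃ (i y))) := by
    have hs1 := hc.schoutenSelf_eq hs (f := ![g₁, g₂, g₃]) (y := y)
      (by intro a; fin_cases a <;> assumption) (by intro a; fin_cases a <;> assumption)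
    have hs2 := hc.cartan_eq y (α := ![dR F g₁ (i y), dR F g₂ (i y), dR F g₃ (i y)])
      (by intro a; fin_cases a; exacts [p₁.self_of_nhds, p₂.self_of_nhds, p₃.self_of_nhds])
    have hs3 := hQ.schouten _ _ _ (hcomp hg₁) (hcomp hg₂) (hcomp hg₃) y
    rw [cartan_pull, dR_congr e₁, dR_congr e₂, dR_congr e₃, ← hd hg₁ e₁, ← hd hg₂ e₂,
      ← hd hg₃ e₃] at hs3
    exact hs1.trans (hs3.trans hs2.symm)
  -- The arguments are exchanged one at a time in the first slot; cyclic symmetry of both sides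
  -- brings the next argument there.
  have a1 := hc.schouten_defect_congr hP hmom hspan h₁ hg₁ h₂ h₃ (hdf h₁ hg₁ e₁)
  have a2 := hc.schouten_defect_congr hP hmom hspan h₂ hg₂ h₃ hg₁ (hdf h₂ hg₂ e₂)
  have a3 := hc.schouten_defect_congr hP hmom hspan h₃ hg₃ hg₁ hg₂ (hdf h₃ hg₃ e₃)
  rw [P.schoutenSelf_cyclic g₁ f₂ f₃, B.cartan_cyclic (B.pl (i y) (dR F g₁ (i y))) _ _, a2,
    P.schoutenSelf_cyclic g₂ f₃ g₁, B.cartan_cyclic (B.pl (i y) (dR F g₂ (i y))) _ _, a3,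
    P.schoutenSelf_cyclic g₃ g₁ g₂, B.cartan_cyclic (B.pl (i y) (dR F g₃ (i y))) _ _, hg,
    sub_self] at a1
  exact sub_eq_zero.1 a1

/-- An invariant bivector field that is obtained by induction from a Hamiltonian quasi-Poisson
structure on a cross-section through all orbits is Hamiltonian quasi-Poisson. -/
theorem isHamiltonian_of_restrict (hc : IsCross B hH F F' i Φ ΦY) [T2Space G] [T2Space M]
    [SecondCountableTopology M] [IsManifold 𝓘(ℝ, F) ∞ M] {P : BivectorField F M}
    (hP : P.IsInvariant G) {Q : BivectorField F' Y}
    (hs : B.SplitsAlong P i Q (fun y => -B.rMatrix hH (ΦY y)))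
    (hQ : (B.restrict hH).IsHamiltonian Q ΦY) (hσ : IsTransversal B hH σ S τ)
    (hΘ : ∀ y, IsLocalDiffeomorphAt (𝓘(ℝ, V).prod 𝓘(ℝ, F')) 𝓘(ℝ, F) ∞
      (fun p : V × Y => σ p.1 • i p.2) (0, y)) (hsurj : ∀ m : M, ∃ (k : G) (y : Y), k • i y = m) :
    B.IsHamiltonian P Φ := by
  have := hQ.smooth_action
  have hmom : ∀ f : G → ℝ, SmoothFun E f → ∀ (m : M) (β : F →L[ℝ] ℝ),
      P.pv m (dR F (fun x => f (Φ x)) m) β = -β (actMap E G F m (B.dop f (Φ m))) :=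
    fun f hf m β => by
      obtain ⟨k, y, rfl⟩ := hsurj m
      exact hP.moment_smul hc.smooth_moment hc.equivariant
        (fun f hf β => hc.moment_incl hs hQ y hf β) k hf β
  refine ⟨‹_›, ‹_›, ‹_›, ‹_›, hP, fun f₁ f₂ f₃ h₁ h₂ h₃ m => ?_, hc.smooth_moment, hc.equivariant,
    fun f hf m β => ?_⟩
  · obtain ⟨k, y, rfl⟩ := hsurj m
    have hk : ContMDiff 𝓘(ℝ, F) 𝓘(ℝ, F) ∞ (fun x : M => k • x) :=
      ContMDiffSMul.contMDiff_const_smul (I := 𝓘(ℝ, E)) k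
    rw [cartan_pull, hP.schoutenSelf_smul h₁ h₂ h₃ hk, B.cartan_smul h₁ h₂ h₃]
    exact hc.schouten_incl hP hmom hs hQ hσ (hΘ y) (h₁.comp_smul hk) (h₂.comp_smul hk)
      (h₃.comp_smul hk)
  · have h : ∀ β : F →L[ℝ] ℝ, P.pv m (dR F (fun x => f (Φ x)) m) β =
        β (-actMap E G F m (B.dop f (Φ m))) := fun β => by rw [hmom f hf, map_neg]
    exact h β

end IsCross

end Induction

/-! ### Induction of bivector fields -/

section InducedBivector

/-- Expanding in a basis reduces joint smoothness to fixed vectors, the form in which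
`contMDiffAt_rM` gives smoothness of the r-matrix. -/
theorem contMDiffAt_linearMap_apply {E₁ : Type*} [NormedAddCommGroup E₁] [NormedSpace ℝ E₁]
    {H₁ : Type*} [TopologicalSpace H₁] {I₁ : ModelWithCorners ℝ E₁ H₁}
    {N : Type*} [TopologicalSpace N] [ChartedSpace H₁ N]
    {E : Type*} [NormedAddCommGroup E] [NormedSpace ℝ E] [FiniteDimensional ℝ E]
    {W : Type*} [NormedAddCommGroup W] [NormedSpace ℝ W] {L : N → E →ₗ[ℝ] W} {v : N → E} {x : N}
    (hL : ∀ ξ, ContMDiffAt I₁ 𝓘(ℝ, W) ∞ (fun x => L x ξ) x) (hv : ContMDiffAt I₁ 𝓘(ℝ, E) ∞ v x) :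
    ContMDiffAt I₁ 𝓘(ℝ, W) ∞ (fun x => L x (v x)) x := by
  let b := Module.finBasis ℝ E
  have h1 : (fun x => L x (v x)) = fun x => ∑ j, (b.coord j (v x)) • L x (b j) := funext fun x => by
    conv_lhs => rw [← b.sum_repr (v x), map_sum]
    simp
  rw [h1]
  have h2 : ∀ j, ContMDiffAt I₁ 𝓘(ℝ, ℝ) ∞ (fun x => b.coord j (v x)) x := fun j =>
    ((b.coord j).toContinuousLinearMap.contMDiff.contMDiffAt).comp x hv
  exact ContMDiffAt.sum fun j _ => (h2 j).smul (hL _)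

variable {E : Type*} [NormedAddCommGroup E] [NormedSpace ℝ E] [FiniteDimensional ℝ E]
  {G : Type*} [TopologicalSpace G] [ChartedSpace E G] [Group G] [LieGroup 𝓘(ℝ, E) ∞ G]
  {F : Type*} [NormedAddCommGroup F] [NormedSpace ℝ F] [FiniteDimensional ℝ F]
  {M : Type*} [TopologicalSpace M] [ChartedSpace F M] [MulAction G M]
  {E' : Type*} [NormedAddCommGroup E'] [NormedSpace ℝ E'] [FiniteDimensional ℝ E']
  {H : Subgroup G} [ChartedSpace E' H]
  {F' : Type*} [NormedAddCommGroup F'] [NormedSpace ℝ F'] [FiniteDimensional ℝ F']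
  {Y : Type*} [TopologicalSpace Y] [ChartedSpace F' Y] [MulAction H Y]
  {B : InvariantInnerProduct E G} {hH : IsLieSubgroup E E' H}
  {i : Y → M} {Φ : M → G} {ΦY : Y → H}

namespace InvariantInnerProduct

variable (B hH) in
/-- The bivector `P_Y - (Φ_Y^* r)_M` along the cross-section. -/
def crossBivector (i : Y → M) (ΦY : Y → H) (Q : BivectorField F' Y) (y : Y) :
    (F →L[ℝ] ℝ) →ₗ[ℝ] (F →L[ℝ] ℝ) →ₗ[ℝ] ℝ :=
  LinearMap.mk₂ ℝ (fun α β => Q.pv y (α.comp (md 𝓘(ℝ, F') 𝓘(ℝ, F) i y))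
      (β.comp (md 𝓘(ℝ, F') 𝓘(ℝ, F) i y)) - B.bf (B.pl (i y) α) (B.rM hH (ΦY y) (B.pl (i y) β)))
    (fun α α' β => by
      rw [ContinuousLinearMap.add_comp, B.pl_add]
      simp only [map_add, LinearMap.add_apply]
      ring)
    (fun c α β => by
      rw [ContinuousLinearMap.smul_comp, B.pl_smul]
      simp only [map_smul, LinearMap.smul_apply, smul_eq_mul]
      ring)
    (fun α β β' => by
      rw [ContinuousLinearMap.add_comp, B.pl_add]
      simp only [map_add]
      ring)
    (fun c α β => by
      rw [ContinuousLinearMap.smul_comp, B.pl_smul]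
      simp only [map_smul, smul_eq_mul]
      ring)

theorem crossBivector_apply (Q : BivectorField F' Y) (y : Y) (α β : F →L[ℝ] ℝ) :
    B.crossBivector hH i ΦY Q y α β = Q.pv y (α.comp (md 𝓘(ℝ, F') 𝓘(ℝ, F) i y))
      (β.comp (md 𝓘(ℝ, F') 𝓘(ℝ, F) i y)) -
        B.bf (B.pl (i y) α) (B.rM hH (ΦY y) (B.pl (i y) β)) := rfl

/-- The vector is dual to the derivative at `1` of `l ↦ f(k l • i y)`, a jointly smooth function of
`k`, `y` and `l`. -/
theorem contMDiff_pl [IsManifold 𝓘(ℝ, F') ∞ Y] [ContMDiffSMul 𝓘(ℝ, E) 𝓘(ℝ, F) ∞ G M]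
    (B : InvariantInnerProduct E G) (hi : ContMDiff 𝓘(ℝ, F') 𝓘(ℝ, F) ∞ i) {f : M → ℝ}
    (hf : SmoothFun F f) : ContMDiff (𝓘(ℝ, E).prod 𝓘(ℝ, F')) 𝓘(ℝ, E) ∞
      (fun p : G × Y => B.pl (i p.2) (dR F (fun x => f (p.1 • x)) (i p.2))) := by
  have hmG : IsManifold 𝓘(ℝ, E) ∞ G := ‹LieGroup 𝓘(ℝ, E) ∞ G›.toIsManifold
  let s : (E →L[ℝ] ℝ) →L[ℝ] E :=
    { toFun := B.sh, map_add' := B.sh_add, map_smul' := B.sh_smul : (E →L[ℝ] ℝ) →ₗ[ℝ] E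
        }.toContinuousLinearMap
  have hA : ContMDiff (𝓘(ℝ, E).prod 𝓘(ℝ, F')) 𝓘(ℝ, E →L[ℝ] ℝ) ∞
      (fun p : G × Y => dR E (fun k : G => f (p.1 • k • i p.2)) 1) := fun p => by
    have h1 : ContMDiff ((𝓘(ℝ, E).prod 𝓘(ℝ, F')).prod 𝓘(ℝ, E)) 𝓘(ℝ, ℝ) ∞
        (fun q : (G × Y) × G => f (q.1.1 • q.2 • i q.1.2)) :=
      ContMDiff.comp (g := f) hf ((contMDiff_fst.comp contMDiff_fst).smul
        (contMDiff_snd.smul (hi.comp (contMDiff_snd.comp contMDiff_fst))))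
    exact contMDiffAt_md (f := fun (p : G × Y) (k : G) => f (p.1 • k • i p.2)) (b := (1 : G))
      h1.contMDiffAt
  have h2 : (fun p : G × Y => B.pl (i p.2) (dR F (fun x => f (p.1 • x)) (i p.2))) =
      fun p : G × Y => s (-dR E (fun k : G => f (p.1 • k • i p.2)) 1) := funext fun p => by
    have hk := hf.comp_smul (ContMDiffSMul.contMDiff_const_smul (I := 𝓘(ℝ, E)) p.1)
    refine congrArg B.sh ?_
    ext ξ
    exact congrArg Neg.neg (dR_actMap hk (i p.2) ξ)
  rw [h2]
  exact s.contMDiff.comp hA.neg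

end InvariantInnerProduct

namespace IsCross

theorem moment_smul (hc : IsCross B hH F F' i Φ ΦY) (h : H) (y : Y) :
    ΦY (h • y) = h * ΦY y * h⁻¹ := Subtype.ext (by
  rw [hc.coe_moment, hc.smul, hc.equivariant, ← hc.coe_moment]
  rfl)

theorem crossBivector_self (hc : IsCross B hH F F' i Φ ΦY) (Q : BivectorField F' Y) (y : Y)
    (α : F →L[ℝ] ℝ) : B.crossBivector hH i ΦY Q y α α = 0 := by
  rw [InvariantInnerProduct.crossBivector_apply, Q.pv_self, zero_sub, neg_eq_zero]
  have := B.bf_rM_skew hH (hc.regular y) (B.pl (i y) α) (B.pl (i y) α)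
  rw [B.bf_symm (B.rM hH (ΦY y) _)] at this
  linarith

variable [ContMDiffSMul 𝓘(ℝ, E) 𝓘(ℝ, F) ∞ G M]

/-- Invariance of `Q` handles the first term, conjugation equivariance of the r-matrix (`rM_adMap`)
the second. This is what makes the induced bivector independent of the representative of a point. -/
theorem crossBivector_smul (hc : IsCross B hH F F' i Φ ΦY)
    [ContMDiffSMul 𝓘(ℝ, E') 𝓘(ℝ, F') ∞ H Y] {Q : BivectorField F' Y} (hQ : Q.IsInvariant H)
    (h : H) (y : Y) (α β : F →L[ℝ] ℝ) :
    B.crossBivector hH i ΦY Q (h • y) α β = B.crossBivector hH i ΦY Q y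
      (α.comp (md 𝓘(ℝ, F) 𝓘(ℝ, F) (fun x : M => (h : G) • x) (i y)))
      (β.comp (md 𝓘(ℝ, F) 𝓘(ℝ, F) (fun x : M => (h : G) • x) (i y))) := by
  have hk : ContMDiff 𝓘(ℝ, F) 𝓘(ℝ, F) ∞ (fun x : M => (h : G) • x) :=
    ContMDiffSMul.contMDiff_const_smul (I := 𝓘(ℝ, E)) (h : G)
  have hk' : ContMDiff 𝓘(ℝ, F') 𝓘(ℝ, F') ∞ (fun x : Y => h • x) :=
    ContMDiffSMul.contMDiff_const_smul (I := 𝓘(ℝ, E')) h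
  have hcomm : (md 𝓘(ℝ, F) 𝓘(ℝ, F) (fun x : M => (h : G) • x) (i y)).comp
      (md 𝓘(ℝ, F') 𝓘(ℝ, F) i y) = (md 𝓘(ℝ, F') 𝓘(ℝ, F) i (h • y)).comp
      (md 𝓘(ℝ, F') 𝓘(ℝ, F') (fun x : Y => h • x) y) := by
    rw [← md_comp (hk.mdiff _) (hc.smooth_incl.mdiff y),
      ← md_comp (g := i) (hc.smooth_incl.mdiff _) (hk'.mdiff y)]
    simp only [hc.smul]
  have hr := hc.regular (h • y)
  rw [hc.moment_smul] at hr
  rw [InvariantInnerProduct.crossBivector_apply, InvariantInnerProduct.crossBivector_apply,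
    hQ.pv_smul, ContinuousLinearMap.comp_assoc, ContinuousLinearMap.comp_assoc, ← hcomm,
    hc.smul, B.pl_smul_point, B.pl_smul_point, hc.moment_smul,
    B.rM_adMap hH (hc.regular y) h hr, B.bf_adMap, ContinuousLinearMap.comp_assoc,
    ContinuousLinearMap.comp_assoc]

/-- Smoothness upstairs on `G × Y`: translating the functions by `k` replaces moving the bivector,
and each ingredient is smooth in `(k, y)`. -/
theorem contMDiff_crossBivector (hc : IsCross B hH F F' i Φ ΦY) [IsManifold 𝓘(ℝ, F') ∞ Y]
    [T2Space Y] (Q : BivectorField F' Y) {f h : M → ℝ} (hf : SmoothFun F f) (hh : SmoothFun F h) :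
    ContMDiff (𝓘(ℝ, E).prod 𝓘(ℝ, F')) 𝓘(ℝ, ℝ) ∞ (fun p : G × Y =>
      B.crossBivector hH i ΦY Q p.2 (dR F (fun x => f (p.1 • x)) (i p.2))
        (dR F (fun x => h (p.1 • x)) (i p.2))) := by
  have hmG : IsManifold 𝓘(ℝ, E) ∞ G := ‹LieGroup 𝓘(ℝ, E) ∞ G›.toIsManifold
  have hk : ∀ k : G, ContMDiff 𝓘(ℝ, F) 𝓘(ℝ, F) ∞ (fun x : M => k • x) := fun k =>
    ContMDiffSMul.contMDiff_const_smul (I := 𝓘(ℝ, E)) k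
  have hd : ∀ {f : M → ℝ}, SmoothFun F f → ∀ (k : G) (y : Y),
      (dR F (fun x => f (k • x)) (i y)).comp (md 𝓘(ℝ, F') 𝓘(ℝ, F) i y) =
        dR F' (fun z => f (k • i z)) y := fun hf k y =>
    (dR_comp (f := fun x => _) ((hf.comp_smul (hk k)).mdiff _) (hc.smooth_incl.mdiff y) rfl).symm
  have hs : ∀ {f : M → ℝ}, SmoothFun F f → ContMDiff (𝓘(ℝ, E).prod 𝓘(ℝ, F')) 𝓘(ℝ, ℝ) ∞
      (fun p : G × Y => f (p.1 • i p.2)) := fun hf =>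
    ContMDiff.comp (g := _) hf (contMDiff_fst.smul (hc.smooth_incl.comp contMDiff_snd))
  have h1 := Q.contMDiff_pv (f := fun (k : G) y => f (k • i y)) (h := fun (k : G) y => h (k • i y))
    (hs hf) (hs hh)
  simp only [InvariantInnerProduct.crossBivector_apply, hd hf, hd hh]
  let b : E →L[ℝ] E →L[ℝ] ℝ :=
    (LinearMap.toContinuousLinearMap.toLinearMap ∘ₗ B.bf).toContinuousLinearMap
  have h2 : ContMDiff (𝓘(ℝ, E).prod 𝓘(ℝ, F')) 𝓘(ℝ, E →L[ℝ] ℝ) ∞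
      (fun p : G × Y => b (B.pl (i p.2) (dR F (fun x => f (p.1 • x)) (i p.2)))) :=
    b.contMDiff.comp (B.contMDiff_pl hc.smooth_incl hf)
  have h3 : ContMDiff (𝓘(ℝ, E).prod 𝓘(ℝ, F')) 𝓘(ℝ, E) ∞ (fun p : G × Y =>
      B.rM hH (ΦY p.2) (B.pl (i p.2) (dR F (fun x => h (p.1 • x)) (i p.2)))) := fun p =>
    contMDiffAt_linearMap_apply (L := fun p : G × Y => B.rM hH (ΦY p.2))
      (fun ξ => ContMDiffAt.comp (g := fun u : H => B.rM hH u ξ) p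
        (B.contMDiffAt_rM hH (hc.regular p.2) ξ) ((hc.smooth_moment'.comp contMDiff_snd) p))
      (B.contMDiff_pl hc.smooth_incl hh p)
  exact h1.sub (h2.clm_apply h3)

/-- Induction of bivector fields from a cross-section. -/
theorem exists_bivectorField (hc : IsCross B hH F F' i Φ ΦY) [IsManifold 𝓘(ℝ, F) ∞ M]
    [IsManifold 𝓘(ℝ, F') ∞ Y] [T2Space Y] [ContMDiffSMul 𝓘(ℝ, E') 𝓘(ℝ, F') ∞ H Y]
    {Q : BivectorField F' Y} (hQ : Q.IsInvariant H)
    (hsub : ∀ p : G × Y, Manifold.IsSubmersionAt (𝓘(ℝ, E).prod 𝓘(ℝ, F')) 𝓘(ℝ, F) ∞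
      (fun p : G × Y => p.1 • i p.2) p)
    (hsurj : ∀ m : M, ∃ p : G × Y, p.1 • i p.2 = m)
    (hfib : ∀ p q : G × Y, p.1 • i p.2 = q.1 • i q.2 → ∃ h : H, q = (p.1 * (h : G)⁻¹, h • p.2)) :
    ∃ P : BivectorField F M, P.IsInvariant G ∧
      B.SplitsAlong P i Q (fun y => -B.rMatrix hH (ΦY y)) := by
  have hmG : IsManifold 𝓘(ℝ, E) ∞ G := ‹LieGroup 𝓘(ℝ, E) ∞ G›.toIsManifold
  have hk : ∀ k : G, ContMDiff 𝓘(ℝ, F) 𝓘(ℝ, F) ∞ (fun x : M => k • x) := fun k =>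
    ContMDiffSMul.contMDiff_const_smul (I := 𝓘(ℝ, E)) k
  have hmul : ∀ (k l : G) (m : M), md 𝓘(ℝ, F) 𝓘(ℝ, F) (fun x : M => (k * l) • x) m =
      (md 𝓘(ℝ, F) 𝓘(ℝ, F) (fun x : M => k • x) (l • m)).comp
        (md 𝓘(ℝ, F) 𝓘(ℝ, F) (fun x : M => l • x) m) := fun k l m => by
    rw [← md_comp ((hk k).mdiff _) ((hk l).mdiff m)]
    simp only [mul_smul]
  choose c hcm using hsurj
  -- The push-forward by `p.1` of the bivector at `p.2`. `hT` shows that it is constant on the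
  -- fibres of the submersion, so any choice `c` of representatives gives the same field.
  let T : G × Y → (F →L[ℝ] ℝ) → (F →L[ℝ] ℝ) → ℝ := fun p α β =>
    B.crossBivector hH i ΦY Q p.2
      (α.comp (md 𝓘(ℝ, F) 𝓘(ℝ, F) (fun x : M => p.1 • x) (i p.2)))
      (β.comp (md 𝓘(ℝ, F) 𝓘(ℝ, F) (fun x : M => p.1 • x) (i p.2)))
  have hT : ∀ p q : G × Y, p.1 • i p.2 = q.1 • i q.2 → T p = T q := fun p q hpq => by
    obtain ⟨h, rfl⟩ := hfib p q hpq
    funext α β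
    have h1 := hmul (p.1 * (h : G)⁻¹) h (i p.2)
    rw [inv_mul_cancel_right] at h1
    simp only [T]
    rw [hc.crossBivector_smul hQ, ContinuousLinearMap.comp_assoc, ContinuousLinearMap.comp_assoc,
      hc.smul, ← h1]
  let val : M → (F →L[ℝ] ℝ) →ₗ[ℝ] (F →L[ℝ] ℝ) →ₗ[ℝ] ℝ := fun m =>
    LinearMap.mk₂ ℝ (T (c m)) (fun α α' β => by simp [T, ContinuousLinearMap.add_comp])
      (fun a α β => by simp [T, ContinuousLinearMap.smul_comp])
      (fun α β β' => by simp [T, ContinuousLinearMap.add_comp])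
      (fun a α β => by simp [T, ContinuousLinearMap.smul_comp])
  have hval : ∀ (p : G × Y) α β, val (p.1 • i p.2) α β = T p α β := fun p α β =>
    congrFun (congrFun (hT _ _ (hcm _)) α) β
  have halt : ∀ m α, val m α α = 0 := fun m α => hc.crossBivector_self Q (c m).2 _
  have hsm : ∀ f h : M → ℝ, SmoothFun F f → SmoothFun F h →
      SmoothFun F (fun m => val m (dR F f m) (dR F h m)) := fun f h hf hh m => by
    rw [← hcm m]
    refine AssocBundle.contMDiffAt_of_comp_isSubmersionAt
      (g := fun m => val m (dR F f m) (dR F h m)) (hsub (c m)) ?_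
    -- Pulled back to `G × Y`, the bracket of `f` and `h` is this smooth function, and smoothness
    -- descends along the submersion.
    have h1 := hc.contMDiff_crossBivector Q hf hh (c m)
    simp only [hval, T, dR_smul hf (hk _), dR_smul hh (hk _)]
    exact h1
  let P : BivectorField F M := ⟨val, halt, hsm⟩
  have hPv : ∀ (p : G × Y) α β, P.pv (p.1 • i p.2) α β = T p α β := hval
  refine ⟨P, fun k m => ?_, IsCross.splitsAlong_of fun y α β => ?_⟩
  · have h1 : ∀ α β : F →L[ℝ] ℝ, P.pv (k • m) α β =
        P.pv m (α.comp (md 𝓘(ℝ, F) 𝓘(ℝ, F) (fun x : M => k • x) m))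
          (β.comp (md 𝓘(ℝ, F) 𝓘(ℝ, F) (fun x : M => k • x) m)) := fun α β => by
      rw [← hcm m, hPv, ← mul_smul, hPv (k * (c m).1, (c m).2)]
      simp only [T, hmul]
      rfl
    exact h1
  · have h1 := hPv (1, y) α β
    have h2 : md 𝓘(ℝ, F) 𝓘(ℝ, F) (fun x : M => (1 : G) • x) (i y) = ContinuousLinearMap.id ℝ F := by
      simp only [one_smul]
      exact md_id _
    simp only [one_smul] at h1
    rw [h1]
    simp only [T]
    rw [h2]
    rfl

/-- An invariant bivector field is determined by its restriction to a cross-section through all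
orbits. -/
theorem bivectorField_ext (hsurj : ∀ m : M, ∃ p : G × Y, p.1 • i p.2 = m) {P P' : BivectorField F M}
    (hP : P.IsInvariant G) (hP' : P'.IsInvariant G) (h : ∀ y, P.pv (i y) = P'.pv (i y)) : P =
        P' := by
  refine BivectorField.ext (funext fun m => ?_)
  obtain ⟨⟨k, y⟩, rfl⟩ := hsurj m
  refine LinearMap.ext₂ fun α β => (hP.pv_smul k (i y) α β).trans ?_
  rw [h]
  exact (hP'.pv_smul k (i y) α β).symm

end IsCross

end InducedBivector

/-! ### The induction theorem -/

section Induced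

variable {E : Type*} [NormedAddCommGroup E] [NormedSpace ℝ E] [FiniteDimensional ℝ E]
  {G : Type*} [TopologicalSpace G] [ChartedSpace E G] [Group G] [LieGroup 𝓘(ℝ, E) ∞ G]
  {E' : Type*} [NormedAddCommGroup E'] [NormedSpace ℝ E'] [FiniteDimensional ℝ E']
  {H : Subgroup G} [ChartedSpace E' H]
  {F : Type*} [NormedAddCommGroup F] [NormedSpace ℝ F] [FiniteDimensional ℝ F]
  {Y : Type*} [TopologicalSpace Y] [ChartedSpace F Y] [MulAction H Y]
  {B : InvariantInnerProduct E G} {hH : IsLieSubgroup E E' H} {ΦY : Y → H}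

namespace AssocBundle

theorem smul_mk_one (p : G × Y) : p.1 • (mk (1, p.2) : AssocBundle H Y) = mk p := by
  rw [smul_mk, mul_one]

/-- The equivariant extension `[k, y] ↦ k Φ_Y(y) k⁻¹` of `Φ_Y`. -/
def extend (ΦY : Y → H) (heq : ∀ (h : H) (y : Y), ΦY (h • y) = h * ΦY y * h⁻¹) :
    AssocBundle H Y → G :=
  Quotient.lift (fun p : G × Y => p.1 * (ΦY p.2 : G) * p.1⁻¹) (by
    rintro p q ⟨h, rfl⟩
    simp [heq, mul_assoc])

theorem extend_mk (heq : ∀ (h : H) (y : Y), ΦY (h • y) = h * ΦY y * h⁻¹) (p : G × Y) :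
    extend ΦY heq (mk p) = p.1 * (ΦY p.2 : G) * p.1⁻¹ := rfl

theorem extend_smul (heq : ∀ (h : H) (y : Y), ΦY (h • y) = h * ΦY y * h⁻¹) (k : G)
    (x : AssocBundle H Y) : extend ΦY heq (k • x) = k * extend ΦY heq x * k⁻¹ := by
  obtain ⟨p, rfl⟩ := mk_surjective x
  rw [smul_mk, extend_mk, extend_mk]
  simp [mul_assoc]

variable {F₁ : Type*} [NormedAddCommGroup F₁] [NormedSpace ℝ F₁] [FiniteDimensional ℝ F₁]
  [ChartedSpace F₁ (AssocBundle H Y)] [IsManifold 𝓘(ℝ, F) ∞ Y]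

theorem IsQuotientManifold.contMDiff_mk (hq : IsQuotientManifold (H := H) (Y := Y) E F F₁) :
    ContMDiff (𝓘(ℝ, E).prod 𝓘(ℝ, F)) 𝓘(ℝ, F₁) ∞ (AssocBundle.mk : G × Y → AssocBundle H Y) :=
  hq.submersion.contMDiff

theorem IsQuotientManifold.contMDiff_incl (hq : IsQuotientManifold (H := H) (Y := Y) E F F₁) :
    ContMDiff 𝓘(ℝ, F) 𝓘(ℝ, F₁) ∞ (fun y : Y => (AssocBundle.mk (1, y) : AssocBundle H Y)) :=
  hq.contMDiff_mk.comp (contMDiff_const.prodMk contMDiff_id)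

theorem IsQuotientManifold.contMDiffAt_of_comp_mk (hq : IsQuotientManifold (H := H) (Y := Y) E F F₁)
    {E₃ : Type*} [NormedAddCommGroup E₃] [NormedSpace ℝ E₃]
    {H₃ : Type*} [TopologicalSpace H₃] {I₃ : ModelWithCorners ℝ E₃ H₃}
    {M₃ : Type*} [TopologicalSpace M₃] [ChartedSpace H₃ M₃] {f : AssocBundle H Y → M₃} {p : G × Y}
    (hf : ContMDiffAt (𝓘(ℝ, E).prod 𝓘(ℝ, F)) I₃ ∞ (fun q => f (AssocBundle.mk q)) p) :
    ContMDiffAt 𝓘(ℝ, F₁) I₃ ∞ f (AssocBundle.mk p) := by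
  have := hq.isManifold
  have hmG : IsManifold 𝓘(ℝ, E) ∞ G := ‹LieGroup 𝓘(ℝ, E) ∞ G›.toIsManifold
  exact contMDiffAt_of_comp_isSubmersionAt (hq.submersion.isSubmersionAt p) hf

/-- With a local section `s` of the projection the action is `(k, x) ↦ [k s(x).1, s(x).2]`. -/
theorem IsQuotientManifold.contMDiffSMul (hq : IsQuotientManifold (H := H) (Y := Y) E F F₁) :
    ContMDiffSMul 𝓘(ℝ, E) 𝓘(ℝ, F₁) ∞ G (AssocBundle H Y) := by
  have := hq.isManifold
  have hmG : IsManifold 𝓘(ℝ, E) ∞ G := ‹LieGroup 𝓘(ℝ, E) ∞ G›.toIsManifold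
  refine ⟨fun ⟨k, x⟩ => ?_⟩
  obtain ⟨p, rfl⟩ := mk_surjective x
  obtain ⟨s, hs, -, hss⟩ := exists_section_of_isSubmersionAt (hq.submersion.isSubmersionAt p)
  have h1 : ContMDiffAt (𝓘(ℝ, E).prod 𝓘(ℝ, F₁)) (𝓘(ℝ, E).prod 𝓘(ℝ, F)) ∞
      (fun q : G × AssocBundle H Y => s q.2) (k, AssocBundle.mk p) :=
    ContMDiffAt.comp (g := s) (k, AssocBundle.mk p) hs contMDiffAt_snd
  have h2 : ContMDiffAt (𝓘(ℝ, E).prod 𝓘(ℝ, F₁)) (𝓘(ℝ, E).prod 𝓘(ℝ, F)) ∞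
      (fun q : G × AssocBundle H Y => (q.1 * (s q.2).1, (s q.2).2)) (k, AssocBundle.mk p) :=
    (contMDiffAt_fst.mul (contMDiffAt_fst.comp _ h1)).prodMk (contMDiffAt_snd.comp _ h1)
  have h3 := (hq.contMDiff_mk.contMDiffAt).comp _ h2
  refine h3.congr_of_eventuallyEq ?_
  filter_upwards [continuousAt_snd.eventually hss] with q hq
  change q.1 • q.2 = AssocBundle.mk (q.1 * (s q.2).1, (s q.2).2)
  rw [← smul_mk, hq]

theorem IsQuotientManifold.contMDiff_extend (hq : IsQuotientManifold (H := H) (Y := Y) E F F₁)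
    (hH : IsLieSubgroup E E' H) (hΦY : ContMDiff 𝓘(ℝ, F) 𝓘(ℝ, E') ∞ ΦY)
    (heq : ∀ (h : H) (y : Y), ΦY (h • y) = h * ΦY y * h⁻¹) :
    ContMDiff 𝓘(ℝ, F₁) 𝓘(ℝ, E) ∞ (extend ΦY heq) := fun x => by
  obtain ⟨p, rfl⟩ := mk_surjective x
  have hv : ContMDiff 𝓘(ℝ, E') 𝓘(ℝ, E) ∞ (Subtype.val : H → G) := hH.embedding.contMDiff
  refine hq.contMDiffAt_of_comp_mk ?_
  have h1 : ContMDiff (𝓘(ℝ, E).prod 𝓘(ℝ, F)) 𝓘(ℝ, E) ∞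
      (fun p : G × Y => p.1 * (ΦY p.2 : G) * p.1⁻¹) :=
    (contMDiff_fst.mul (hv.comp (hΦY.comp contMDiff_snd))).mul contMDiff_fst.inv
  exact h1 p

variable {V : Type*} [NormedAddCommGroup V] [NormedSpace ℝ V] [FiniteDimensional ℝ V]
  {σ : V → G} {S : Set V}
  {τ : PartialDiffeomorph (𝓘(ℝ, V).prod 𝓘(ℝ, E')) 𝓘(ℝ, E) (V × H) G ∞}

/-- The map is the inverse of the trivialization at `k = 1`. Smoothness of the trivialization itself
is checked after composition with the projection, so it holds for any quotient structure. -/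
theorem IsQuotientManifold.isLocalDiffeomorphAt (hq : IsQuotientManifold (H := H) (Y := Y) E F F₁)
    [ContMDiffSMul 𝓘(ℝ, E') 𝓘(ℝ, F) ∞ H Y] (hσ : IsTransversal B hH σ S τ) (y : Y) :
    IsLocalDiffeomorphAt (𝓘(ℝ, V).prod 𝓘(ℝ, F)) 𝓘(ℝ, F₁) ∞
      (fun p : V × Y => σ p.1 • (AssocBundle.mk (1, p.2) : AssocBundle H Y)) (0, y) := by
  have := hq.contMDiffSMul
  obtain ⟨e, hes, het, hef, heg⟩ := exists_chart (F := F) (Y := Y) hσ 1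
  let D : PartialDiffeomorph (𝓘(ℝ, V).prod 𝓘(ℝ, F)) 𝓘(ℝ, F₁) (V × Y) (AssocBundle H Y) ∞ :=
    { toPartialEquiv := e.symm.toPartialEquiv
      open_source := e.open_target
      open_target := e.open_source
      contMDiffOn_toFun := by
        refine ((hσ.contMDiffOn_smul hq.contMDiff_incl).congr fun q _ => ?_).mono
          (show e.target ⊆ _ from het.le)
        change e.symm q = _
        rw [heg, one_mul, smul_mk, mul_one]
      contMDiffOn_invFun := fun x hx => by
        obtain ⟨p, rfl⟩ := mk_surjective x
        have hx' : (AssocBundle.mk p : AssocBundle H Y) ∈ e.source := hx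
        have hp := (hes p).1 hx'
        have ho : IsOpen {p : G × Y | 1⁻¹ * p.1 ∈ τ.target} := τ.open_target.preimage
          (((contMDiff_mulLeft (E := E) 1⁻¹).continuous).comp continuous_fst)
        have h1 := ((contMDiffOn_chart (E := E) (F := F) (τ := τ) 1⁻¹).contMDiffAt
          (ho.mem_nhds hp)).congr_of_eventuallyEq (f₁ := fun q => e (AssocBundle.mk q))
          (by filter_upwards [ho.mem_nhds hp] with q hq using hef q hq)
        exact (hq.contMDiffAt_of_comp_mk h1).contMDiffWithinAt }
  refine ⟨D, ?_, fun q _ => ?_⟩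
  · change ((0 : V), y) ∈ e.target
    rw [het]
    exact ⟨hσ.zero_mem, trivial⟩
  · change σ q.1 • AssocBundle.mk (1, q.2) = e.symm q
    rw [heg, one_mul, smul_mk, mul_one]

end AssocBundle

/-- The induction theorem. -/
theorem InvariantInnerProduct.IsHamiltonian.exists_induced [T2Space G] [CompactSpace G] {g : G}
    {U : TopologicalSpace.Opens H} (hU : IsSlice E E' g U) (hHg : H = Subgroup.centralizer {g})
    {PY : BivectorField F Y} (hQ : (B.restrict hH).IsHamiltonian PY ΦY) (hmem : ∀ y, ΦY y ∈ U) :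
    ∃ (n : ℕ) (_ : ChartedSpace (EuclideanSpace ℝ (Fin n)) (AssocBundle H Y)),
      AssocBundle.IsQuotientManifold (H := H) (Y := Y) E F (EuclideanSpace ℝ (Fin n)) ∧
      ∃ (P : BivectorField (EuclideanSpace ℝ (Fin n)) (AssocBundle H Y))
        (Φ : AssocBundle H Y → G),
        ((∀ (k : G) (x : AssocBundle H Y), Φ (k • x) = k * Φ x * k⁻¹) ∧
          ∀ y : Y, Φ (AssocBundle.mk (1, y)) = ΦY y) ∧
        (∀ Φ' : AssocBundle H Y → G,
          (∀ (k : G) (x : AssocBundle H Y), Φ' (k • x) = k * Φ' x * k⁻¹) →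
          (∀ y : Y, Φ' (AssocBundle.mk (1, y)) = ΦY y) → Φ' = Φ) ∧
        (P.IsInvariant G ∧
          B.SplitsAlong P (fun y : Y => (AssocBundle.mk (1, y) : AssocBundle H Y)) PY
            (fun y => -B.rMatrix hH (ΦY y))) ∧
        (∀ P' : BivectorField (EuclideanSpace ℝ (Fin n)) (AssocBundle H Y), P'.IsInvariant G →
          B.SplitsAlong P' (fun y : Y => (AssocBundle.mk (1, y) : AssocBundle H Y)) PY
            (fun y => -B.rMatrix hH (ΦY y)) → P' = P) ∧
        B.IsHamiltonian P Φ := by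
  have := hQ.isManifold
  have := hQ.t2
  have := hQ.secondCountable
  have := hQ.smooth_action
  have : IsTopologicalGroup G := topologicalGroup_of_lieGroup 𝓘(ℝ, E) ∞
  -- Compactness of `G` gives second countability of `G`, which then passes to the quotient of `G ×
  -- Y`.
  have : SecondCountableTopology G := ChartedSpace.secondCountable_of_sigmaCompact E G
  have : ContinuousSMul H Y :=
    ⟨(ContMDiffSMul.contMDiff_smul (I := 𝓘(ℝ, E')) (I' := 𝓘(ℝ, F)) (n := ∞)).continuous⟩
  -- A centralizer in a Hausdorff group is closed; this is what makes the associated bundle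
  -- Hausdorff.
  have hcl : IsClosed (H : Set G) := by
    rw [hHg]
    exact Set.isClosed_centralizer {g}
  have : T2Space (AssocBundle H Y) := AssocBundle.t2Space hcl
  have : SecondCountableTopology (AssocBundle H Y) := AssocBundle.secondCountableTopology
  obtain ⟨d, σ, S, τ, -, hσ⟩ := exists_isTransversal B hH
  obtain ⟨n, cs, hq⟩ := AssocBundle.exists_isQuotientManifold (F := F) (Y := Y) hσ
  have := hq.isManifold
  have := hq.contMDiffSMul
  let Φ := AssocBundle.extend ΦY hQ.equivariant
  have hΦ1 : ∀ y : Y, Φ (AssocBundle.mk (1, y)) = ΦY y := fun y => by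
    change 1 * (ΦY y : G) * 1⁻¹ = ΦY y
    simp
  have hc : IsCross B hH (EuclideanSpace ℝ (Fin n)) F
      (fun y : Y => (AssocBundle.mk (1, y) : AssocBundle H Y)) Φ ΦY :=
    { smooth_incl := hq.contMDiff_incl
      smul := fun h y => by
        rw [← AssocBundle.mk_mul_smul, one_mul, AssocBundle.smul_mk, mul_one]
      coe_moment := fun y => (hΦ1 y).symm
      regular := fun y => hU.regular B hH (hmem y)
      smooth_moment := hq.contMDiff_extend hH hQ.smooth_moment hQ.equivariant
      smooth_moment' := hQ.smooth_moment
      equivariant := AssocBundle.extend_smul hQ.equivariant }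
  have hsurj : ∀ x : AssocBundle H Y, ∃ p : G × Y, p.1 • AssocBundle.mk (1, p.2) = x := fun x => by
    obtain ⟨p, rfl⟩ := AssocBundle.mk_surjective x
    exact ⟨p, AssocBundle.smul_mk_one p⟩
  obtain ⟨P, hP, hs⟩ := hc.exists_bivectorField hQ.invariant
    (by simpa only [AssocBundle.smul_mk_one] using fun p => hq.submersion.isSubmersionAt p)
    hsurj (by simpa only [AssocBundle.smul_mk_one] using fun p q => AssocBundle.mk_eq_mk.1)
  refine ⟨n, cs, hq, P, Φ, ⟨hc.equivariant, hΦ1⟩, fun Φ' h1 h2 => funext fun x => ?_, ⟨hP, hs⟩,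
    fun P' h1 h2 => IsCross.bivectorField_ext (i := fun y : Y => AssocBundle.mk (1, y))
      hsurj h1 hP fun y => LinearMap.ext₂ fun α β => ?_,
    hc.isHamiltonian_of_restrict hP hs hQ hσ (hq.isLocalDiffeomorphAt hσ) fun x => ?_⟩
  · obtain ⟨p, rfl⟩ := hsurj x
    rw [h1, h2, hc.equivariant, hΦ1]
  · rw [IsCross.splits_apply h2, IsCross.splits_apply hs]
  · obtain ⟨p, hp⟩ := hsurj x
    exact ⟨p.1, p.2, hp⟩

end Induced

end QuasiPoisson

end

open QuasiPoisson in
theorem mainTheorem3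
    {E : Type*} [NormedAddCommGroup E] [NormedSpace ℝ E] [FiniteDimensional ℝ E]
    {G : Type*} [TopologicalSpace G] [ChartedSpace E G] [Group G] [LieGroup 𝓘(ℝ, E) ∞ G]
    [T2Space G] [CompactSpace G]
    (B : InvariantInnerProduct E G) (g : G)
    {E' : Type*} [NormedAddCommGroup E'] [NormedSpace ℝ E'] [FiniteDimensional ℝ E']
    (H : Subgroup G) (hHg : H = Subgroup.centralizer {g})
    [ChartedSpace E' H] (hH : IsLieSubgroup E E' H)
    (U : TopologicalSpace.Opens H) (hU : IsSlice E E' g U) :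
    (∀ {F : Type*} [NormedAddCommGroup F] [NormedSpace ℝ F] [FiniteDimensional ℝ F]
      {M : Type*} [TopologicalSpace M] [ChartedSpace F M] [MulAction G M]
      (P : BivectorField F M) (Φ : M → G), B.IsHamiltonian P Φ →
      ∃ (n : ℕ) (_ : ChartedSpace (EuclideanSpace ℝ (Fin n)) (crossSection Φ U))
        (_ : MulAction H (crossSection Φ U))
        (PY : BivectorField (EuclideanSpace ℝ (Fin n)) (crossSection Φ U))
        (Pperp : crossSection Φ U → LinearMap.BilinForm ℝ (GroupLieAlgebra 𝓘(ℝ, E) G))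
        (ΦY : crossSection Φ U → H),
        Manifold.IsSmoothEmbedding 𝓘(ℝ, EuclideanSpace ℝ (Fin n)) 𝓘(ℝ, F) ∞
          (Subtype.val : crossSection Φ U → M) ∧
        (∀ (h : H) (y : crossSection Φ U), ((h • y : crossSection Φ U) : M) = (h : G) • (y : M)) ∧
        (∀ y : crossSection Φ U, (ΦY y : G) = Φ y) ∧
        InvariantInnerProduct.IsPerpSection E' H (EuclideanSpace ℝ (Fin n)) Pperp ∧
        B.SplitsAlong P (Subtype.val : crossSection Φ U → M) PY Pperp ∧
        (∀ y, Pperp y = -B.rMatrix hH (ΦY y)) ∧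
        (B.restrict hH).IsHamiltonian PY ΦY) ∧
    (∀ {F : Type*} [NormedAddCommGroup F] [NormedSpace ℝ F] [FiniteDimensional ℝ F]
      {Y : Type*} [TopologicalSpace Y] [ChartedSpace F Y] [MulAction H Y]
      (PY : BivectorField F Y) (ΦY : Y → H), (B.restrict hH).IsHamiltonian PY ΦY →
      (∀ y, ΦY y ∈ U) →
      ∃ (n : ℕ) (_ : ChartedSpace (EuclideanSpace ℝ (Fin n)) (AssocBundle H Y)),
        AssocBundle.IsQuotientManifold (H := H) (Y := Y) E F (EuclideanSpace ℝ (Fin n)) ∧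
        ∃ (P : BivectorField (EuclideanSpace ℝ (Fin n)) (AssocBundle H Y))
          (Φ : AssocBundle H Y → G),
          ((∀ (k : G) (x : AssocBundle H Y), Φ (k • x) = k * Φ x * k⁻¹) ∧
            ∀ y : Y, Φ (AssocBundle.mk (1, y)) = ΦY y) ∧
          (∀ Φ' : AssocBundle H Y → G,
            (∀ (k : G) (x : AssocBundle H Y), Φ' (k • x) = k * Φ' x * k⁻¹) →
            (∀ y : Y, Φ' (AssocBundle.mk (1, y)) = ΦY y) → Φ' = Φ) ∧
          (P.IsInvariant G ∧
            B.SplitsAlong P (fun y : Y => (AssocBundle.mk (1, y) : AssocBundle H Y)) PY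
              (fun y => -B.rMatrix hH (ΦY y))) ∧
          (∀ P' : BivectorField (EuclideanSpace ℝ (Fin n)) (AssocBundle H Y), P'.IsInvariant G →
            B.SplitsAlong P' (fun y : Y => (AssocBundle.mk (1, y) : AssocBundle H Y)) PY
              (fun y => -B.rMatrix hH (ΦY y)) → P' = P) ∧
          B.IsHamiltonian P Φ) := by
  exact ⟨fun P Φ hP => hP.exists_crossSection hU hH,
    fun PY ΦY hPY hmem => hPY.exists_induced hU hHg hmem⟩
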